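/- **Setting.** Let $d\in\mathbb N$ and let $\Omega$ be either a bounded open subset of $\mathbb R^d$ (with the Euclidean distance and Lebesgue measure $dx$) or a connected $d$-dimensional smooth Riemannian manifold, possibly with boundary (with the intrinsic distance and the Riemannian volume $dx$). Write $|x-y|$ for the distance. Let $\mathbf X$ be a log-correlated field on $\Omega$: a centred Gaussian random generalized function such that for $f\in C_c^\infty(\Omega)$ the variable $\langle\mathbf X,f\rangle$ has variance $\iint C_{\mathbf X}(x,y)f(x)f(y)\,dx\,dy$, where $C_{\mathbf X}(x,y)=\log|x-y|^{-1}+h(x,y)$ with $h:\Omega\times\Omega\to\mathbb R$ continuous and symmetric. For $N\in\mathbb N$ let $\mathbf X_N:\Omega\to\mathbb R$ be a (jointly measurable, a.s. locally integrable) random function, with law $\mathbb P_N$ and expectation $\mathbb E_N$, such that $\langle\mathbf X_N,f\rangle\to\langle\mathbf X,f\rangle$ in distribution for all $f\in C_c^\infty(\Omega)$. Let $(\delta,x,y)\in(0,1]\times\Omega\times\Omega\mapsto\rho_{\delta,x}(y)\ge 0$ be continuous with $\rho_{\delta,x}(y)dy\to\boldsymbol\delta_x$ vaguely as $\delta\to0$,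 and such that $\mathbf X_N\,\rho_{\delta,x}$ is a.s. integrable; put $\mathbf X_{N,\delta}(x)=\int \mathbf X_N(y)\rho_{\delta,x}(y)\,dy$. Set $$C_{\mathbf X,\delta}(x,z)=\int C_{\mathbf X}(u,z)\rho_{\delta,x}(u)\,du,\qquad C_{\mathbf X,\delta,\epsilon}(x,z)=\iint C_{\mathbf X}(u,v)\rho_{\delta,x}(u)\rho_{\epsilon,z}(v)\,du\,dv .$$ Let $\mathcal D_R=\{\zeta\in\mathbb C:\Re\zeta\in[0,\sqrt{2d}],\ |\Im\zeta|\le R\}$ and $\mathcal D_\infty=\{\Re\zeta\in[0,\sqrt{2d}]\}$. For $q\in\mathbb N_0$, $\xi\in\mathbb R^q$, $\delta\in(0,1]^q$, $z\in\Omega^q$ let $\mathrm f=\mathrm f_{\delta,z}=\sum_{j=1}^q\xi_j\rho_{\delta_j,z_j}$, $\mathbb E\langle\mathbf X,\mathrm f\rangle^2=\iint C_{\mathbf X}(u,v)\mathrm f(u)\mathrm f(v)\,du\,dv$, and, for $\zeta_1,\zeta_2\in\mathcal D_\infty$ and $x_1\ne x_2$, define $\Psi_{N,\delta}^{(\zeta_1,\zeta_2,\xi)}(x_1,x_2;z)$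 by $$\mathbb E_N\Big[e^{\zeta_1\mathbf X_N(x_1)+\zeta_2\mathbf X_N(x_2)+\sum_j\xi_j\mathbf X_{N,\delta_j}(z_j)}\Big]=\Psi_{N,\delta}^{(\zeta_1,\zeta_2,\xi)}(x_1,x_2;z)\;e^{\frac{\zeta_1^2+\zeta_2^2}{2}\log N}\,e^{\zeta_1\zeta_2C_{\mathbf X}(x_1,x_2)+\zeta_1\int C_{\mathbf X}(x_1,u)\mathrm f(u)du+\zeta_2\int C_{\mathbf X}(x_2,u)\mathrm f(u)du+\frac12\mathbb E\langle\mathbf X,\mathrm f\rangle^2}.$$ **Assumption 1 (covariance).** The integrals defining $C_{\mathbf X,\delta}(x,z)$ and $C_{\mathbf X,\delta,\epsilon}(x,z)$ converge absolutely for all $x,z\in\Omega$ and $\delta,\epsilon\in(0,1]$, and for every compact $K\subset\Omega$ there is $c_K>0$ such that both $C_{\mathbf X,\delta}(x,z)$ and $C_{\mathbf X,\delta,\epsilon}(x,z)$ equal $-\log(|x-z|\vee\delta)+O(1)$, uniformly for $x,z\in K$ and $0<\epsilon\le\delta\le c_K$. **Assumption 2 (mesoscopic exponential moments).** For every $q\in\mathbb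 N_0$: all the exponential moments above exist (absolutely); $(\zeta_1,\zeta_2)\mapsto\Psi_{N,\delta}^{(\zeta_1,\zeta_2,\xi)}(x_1,x_2;z)$ is analytic in $\mathcal D_\infty^2$ (analytic in the interior and continuous up to the boundary); and there is a continuous $\Psi:\mathcal D_\infty\times\Omega\to\mathbb C$, not depending on $q$, with $\Psi(0,x)=1$ and $\Psi(t,x)>0$ for $t\in[0,\sqrt{2d}]$, $x\in\Omega$, such that for all compact $K\subset\Omega$, $\eta>0$, $R>0$ and fixed $\xi\in\mathbb R^q$, $$\Psi_{N,\delta}^{(\zeta_1,\zeta_2,\xi)}(x_1,x_2;z)=\Psi(\zeta_1,x_1)\Psi(\zeta_2,x_2)\,(1+o(1))\qquad(N\to\infty)$$ uniformly for $\zeta_1,\zeta_2\in\mathcal D_R$, $x_1,x_2\in K$ with $|x_1-x_2|\ge N^{\eta-1}$, $z\in K^q$ and $\delta_1,\dots,\delta_q\in[N^{\eta-1},1]$. **Assumption 3 (macroscopic exponential moments).** With the same $\Psi$, for every $q\in\mathbb N_0$, compact $K\subset\Omega$, $c>0$, and fixed $\xi\in\mathbb R^q$, $\delta\in(0,1]^q$,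 $z\in\Omega^q$, the same asymptotics hold for all sufficiently small $\eta>0$, uniformly for $\zeta_1,\zeta_2\in\mathcal D_{(\log N)^\eta}$ and $x_1,x_2\in K$ with $|x_1-x_2|\ge c$. Moreover, for every compact $K\subset\Omega$ there are constants $C,\varkappa$ with $|\Psi(\zeta,x)|\le Ce^{|\zeta|^\varkappa}$ for $\zeta\in\mathcal D_\infty$, $x\in K$. **Theorem 1.3.** Fix $\gamma\in(0,\sqrt{2d})$ and a continuous function $g:\Omega\to\mathbb R$, and define the random measures on $\Omega$ $$\mu_N(dx)=\frac{e^{\gamma\mathbf X_N(x)}}{\mathbb E_N e^{\gamma\mathbf X_N(x)}}\,dx,\qquad \nu_N(dx)=\frac{\mathbf 1\{\mathbf X_N(x)\ge\gamma\log N+g(x)\}}{\mathbb P_N(\mathbf X_N(x)\ge\gamma\log N)}\,dx .$$ Under Assumptions 1, 2 and 3, for every $f\in C_c^\infty(\Omega)$, the integrals $\nu_N(f)$ and $\mu_N(e^{-\gamma g}f)$ are almost surely well defined for all large $N$, and $$\lim_{N\to\infty}\mathbb E_N\big[\,|\nu_N(f)-\mu_N(e^{-\gamma g}f)|\,\big]=0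 .$$ -/

import Mathlib

open MeasureTheory ProbabilityTheory Filter Set
open scoped Bundle Topology ENNReal NNReal Manifold ContDiff

universe u v w t

noncomputable section

/-! ## The space

`Ω` is a metric space carrying a reference measure `vol` and a set `T` of test functions.  In the
theorem, `(Ω, vol, T)` is either a bounded open subset of `ℝ^d` with Lebesgue measure, or a
`d`-dimensional smooth Riemannian manifold with its intrinsic distance and its volume, and `T` is
`C_c^∞(Ω)`. -/

/-- `C_c^∞(U)` for `U ⊆ ℝ^d` open: the functions on `U` whose extension by zero is smooth with
compact support contained in `U`. -/
def testFunctionsOpen {d : ℕ} (U : Set (EuclideanSpace ℝ (Fin d))) : Set (U → ℝ) :=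
  {f | ∃ F : EuclideanSpace ℝ (Fin d) → ℝ,
    ContDiff ℝ ∞ F ∧ HasCompactSupport F ∧ tsupport F ⊆ U ∧ ∀ x : U, f x = F x}

/-- `C_c^∞(M)` for a manifold `M` (possibly with boundary). -/
def testFunctionsManifold {E H : Type*} [NormedAddCommGroup E] [NormedSpace ℝ E]
    [TopologicalSpace H] (I : ModelWithCorners ℝ E H) (M : Type*) [TopologicalSpace M]
    [ChartedSpace H M] : Set (M → ℝ) :=
  {f | ContMDiff I 𝓘(ℝ, ℝ) ∞ f ∧ HasCompactSupport f}

/-! ## Log-correlated fields -/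

/-- The kernel `C(x, y) = log dist(x, y)⁻¹ + h(x, y)`.  (On the diagonal, where the kernel is
infinite, the Lean value is irrelevant: the kernel is only evaluated at distinct points, or
integrated against diffuse measures.) -/
def logKernel {Ω : Type u} [MetricSpace Ω] (h : Ω → Ω → ℝ) (x y : Ω) : ℝ :=
  -Real.log (dist x y) + h x y

/-- A log-correlated field on `Ω`: a centred Gaussian random generalized function `f ↦ ⟨𝕏, f⟩`,
`f ∈ T`, whose covariance kernel is `log dist(x, y)⁻¹ + h(x, y)` with `h` continuous. -/
structure LogCorrelatedField (Ω : Type u) [MetricSpace Ω] [MeasurableSpace Ω] (vol : Measure Ω)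
    (T : Set (Ω → ℝ)) where
  /-- the continuous part of the covariance -/
  h : Ω → Ω → ℝ
  continuous_h : Continuous (Function.uncurry h)
  symm_h : ∀ x y, h x y = h y x
  /-- the probability space of the field -/
  Sample : Type w
  [measurableSpace : MeasurableSpace Sample]
  /-- its probability measure -/
  P : Measure Sample
  [isProbabilityMeasure : IsProbabilityMeasure P]
  /-- the pairing `⟨𝕏, f⟩` of the field with a test function -/
  pairing : (Ω → ℝ) → Sample → ℝ
  pairing_linear : ∀ f ∈ T, ∀ g ∈ T, ∀ a b : ℝ,
    pairing (a • f + b • g) =ᵐ[P] a • pairing f + b • pairing g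
  pairing_gaussian : ∀ f ∈ T, ∃ σsq : ℝ≥0,
    (σsq : ℝ) = ∫ x, ∫ y, logKernel h x y * f x * f y ∂vol ∂vol ∧
    HasLaw (pairing f) (gaussianReal 0 σsq) P

attribute [instance] LogCorrelatedField.measurableSpace LogCorrelatedField.isProbabilityMeasure

/-- The covariance kernel `C_𝕏` of a log-correlated field. -/
def LogCorrelatedField.cov {Ω : Type u} [MetricSpace Ω] [MeasurableSpace Ω] {vol : Measure Ω}
    {T : Set (Ω → ℝ)} (𝕏 : LogCorrelatedField.{u, w} Ω vol T) : Ω → Ω → ℝ :=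
  logKernel 𝕏.h

/-- The two layers of approximation of a log-correlated field `𝕏`: random functions `X N` on `Ω`
(each one defined on a probability space of its own) which converge to `𝕏` in distribution when
tested against test functions, and a continuous approximation of the identity `ρ δ x`, `0 < δ ≤ 1`,
against which `X N` can be integrated. -/
structure FieldApproximation {Ω : Type u} [MetricSpace Ω] [MeasurableSpace Ω] {vol : Measure Ω}
    {T : Set (Ω → ℝ)} (𝕏 : LogCorrelatedField.{u, w} Ω vol T) where
  /-- the probability space on which the `N`-th approximation lives -/
  Sample : ℕ → Type v
  [measurableSpace : ∀ N, MeasurableSpace (Sample N)]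
  /-- the law `ℙ_N` -/
  P : ∀ N, Measure (Sample N)
  [isProbabilityMeasure : ∀ N, IsProbabilityMeasure (P N)]
  /-- the random function `x ↦ 𝕏_N(x)` -/
  X : ∀ N, Sample N → Ω → ℝ
  measurable_X : ∀ N, Measurable (Function.uncurry (X N))
  locallyIntegrable_X : ∀ N, ∀ᵐ s ∂P N, LocallyIntegrable (X N s) vol
  tendsto_X : ∀ f ∈ T,
    TendstoInDistribution (fun N s => ∫ x, X N s x * f x ∂vol) atTop (𝕏.pairing f) P 𝕏.P
  /-- the smoothing kernel `ρ_{δ,x}(y)` at scale `δ` around `x` -/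
  ρ : ℝ → Ω → Ω → ℝ
  continuousOn_ρ :
    ContinuousOn (fun p : ℝ × Ω × Ω => ρ p.1 p.2.1 p.2.2) (Ioc 0 1 ×ˢ univ)
  ρ_nonneg : ∀ δ ∈ Ioc (0 : ℝ) 1, ∀ x y, 0 ≤ ρ δ x y
  tendsto_ρ : ∀ (x : Ω) (φ : Ω → ℝ), Continuous φ → HasCompactSupport φ →
    Tendsto (fun δ => ∫ y, φ y * ρ δ x y ∂vol) (𝓝[>] 0) (𝓝 (φ x))
  integrable_X_mul_ρ : ∀ N, ∀ δ ∈ Ioc (0 : ℝ) 1, ∀ x, ∀ᵐ s ∂P N,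
    Integrable (fun y => X N s y * ρ δ x y) vol

attribute [instance] FieldApproximation.measurableSpace FieldApproximation.isProbabilityMeasure

/-- The strip `𝒟_R = {ζ : 0 ≤ Re ζ ≤ √(2d), |Im ζ| ≤ R}`. -/
def stripR (d : ℕ) (R : ℝ) : Set ℂ := {ζ | 0 ≤ ζ.re ∧ ζ.re ≤ √(2 * d) ∧ |ζ.im| ≤ R}

/-- The infinite strip `𝒟_∞ = {ζ : 0 ≤ Re ζ ≤ √(2d)}`. -/
def stripInf (d : ℕ) : Set ℂ := {ζ | 0 ≤ ζ.re ∧ ζ.re ≤ √(2 * d)}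

namespace FieldApproximation

variable {Ω : Type u} [MetricSpace Ω] [MeasurableSpace Ω] {vol : Measure Ω} {T : Set (Ω → ℝ)}
  {𝕏 : LogCorrelatedField.{u, w} Ω vol T} (A : FieldApproximation.{u, v, w} 𝕏)

/-- The smoothed field `𝕏_{N,δ}(x) = ⟨𝕏_N, ρ_{δ,x}⟩`. -/
def smoothed (N : ℕ) (δ : ℝ) (s : A.Sample N) (x : Ω) : ℝ :=
  ∫ y, A.X N s y * A.ρ δ x y ∂vol

/-- `C_{𝕏,δ}(x, z) = ∫ C_𝕏(u, z) ρ_{δ,x}(u) du`. -/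
def cov₁ (δ : ℝ) (x z : Ω) : ℝ := ∫ y, 𝕏.cov y z * A.ρ δ x y ∂vol

/-- `C_{𝕏,δ,ε}(x, z) = ∫∫ C_𝕏(u, v) ρ_{δ,x}(u) ρ_{ε,z}(v) du dv`. -/
def cov₂ (δ ε : ℝ) (x z : Ω) : ℝ :=
  ∫ p : Ω × Ω, 𝕏.cov p.1 p.2 * A.ρ δ x p.1 * A.ρ ε z p.2 ∂(vol.prod vol)

/-- Covariance assumption: the kernels `C_{𝕏,δ}` and `C_{𝕏,δ,ε}` are well defined, and both equal
`-log (dist(x, z) ∨ δ) + O(1)`, locally uniformly in `x, z` and uniformly in small `ε ≤ δ`. -/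
structure CovarianceAssumption : Prop where
  integrable₁ : ∀ δ ∈ Ioc (0 : ℝ) 1, ∀ x z, Integrable (fun y => 𝕏.cov y z * A.ρ δ x y) vol
  integrable₂ : ∀ δ ∈ Ioc (0 : ℝ) 1, ∀ ε ∈ Ioc (0 : ℝ) 1, ∀ x z,
    Integrable (fun p : Ω × Ω => 𝕏.cov p.1 p.2 * A.ρ δ x p.1 * A.ρ ε z p.2) (vol.prod vol)
  bound : ∀ K : Set Ω, IsCompact K → ∃ c ∈ Ioc (0 : ℝ) 1, ∃ B : ℝ,
    ∀ x ∈ K, ∀ z ∈ K, ∀ δ ∈ Ioc 0 c, ∀ ε ∈ Ioc 0 c, ε ≤ δ →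
      |A.cov₁ δ x z + Real.log (max (dist x z) δ)| ≤ B ∧
      |A.cov₂ δ ε x z + Real.log (max (dist x z) δ)| ≤ B

/-- `f_{δ,z} = ∑_j ξ_j ρ_{δ_j,z_j}`. -/
def comb {q : ℕ} (ξ δ : Fin q → ℝ) (z : Fin q → Ω) (y : Ω) : ℝ :=
  ∑ j, ξ j * A.ρ (δ j) (z j) y

/-- The random variable `exp(ζ₁ 𝕏_N(x₁) + ζ₂ 𝕏_N(x₂) + ∑_j ξ_j 𝕏_{N,δ_j}(z_j))`. -/
def expVar (N : ℕ) (ζ₁ ζ₂ : ℂ) (x₁ x₂ : Ω) {q : ℕ} (ξ δ : Fin q → ℝ) (z : Fin q → Ω)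
    (s : A.Sample N) : ℂ :=
  Complex.exp (ζ₁ * (A.X N s x₁ : ℂ) + ζ₂ * (A.X N s x₂ : ℂ)
    + ((∑ j, ξ j * A.smoothed N (δ j) s (z j) : ℝ) : ℂ))

/-- The Gaussian prediction for the expectation of `expVar`:
`exp((ζ₁² + ζ₂²)/2 log N) exp(ζ₁ζ₂ C(x₁, x₂) + ζ₁ ∫ C(x₁, u) f(u) du + ζ₂ ∫ C(x₂, u) f(u) du
+ ½ 𝔼⟨𝕏, f⟩²)` with `f = f_{δ,z}` and `𝔼⟨𝕏, f⟩² = ∫∫ C(u, v) f(u) f(v) du dv`. -/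
def gaussianFactor (N : ℕ) (ζ₁ ζ₂ : ℂ) (x₁ x₂ : Ω) {q : ℕ} (ξ δ : Fin q → ℝ)
    (z : Fin q → Ω) : ℂ :=
  Complex.exp ((ζ₁ ^ 2 + ζ₂ ^ 2) / 2 * (Real.log N : ℂ)) *
  Complex.exp (ζ₁ * ζ₂ * (𝕏.cov x₁ x₂ : ℂ)
    + ζ₁ * ((∫ y, 𝕏.cov x₁ y * A.comb ξ δ z y ∂vol : ℝ) : ℂ)
    + ζ₂ * ((∫ y, 𝕏.cov x₂ y * A.comb ξ δ z y ∂vol : ℝ) : ℂ)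
    + 1 / 2 * ((∫ p : Ω × Ω, 𝕏.cov p.1 p.2 * A.comb ξ δ z p.1 * A.comb ξ δ z p.2
        ∂(vol.prod vol) : ℝ) : ℂ))

/-- `Ψ_{N,δ}^{(ζ₁,ζ₂,ξ)}(x₁, x₂; z)`: the ratio of the joint exponential moment of the field
to its Gaussian prediction. -/
def Psi (N : ℕ) (ζ₁ ζ₂ : ℂ) (x₁ x₂ : Ω) {q : ℕ} (ξ δ : Fin q → ℝ) (z : Fin q → Ω) : ℂ :=
  (∫ s, A.expVar N ζ₁ ζ₂ x₁ x₂ ξ δ z s ∂A.P N) / A.gaussianFactor N ζ₁ ζ₂ x₁ x₂ ξ δ z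

/-- Mesoscopic exponential-moment assumption with limit function `Ψ(ζ, x)`. -/
structure MesoscopicAssumption (d : ℕ) (Ψ : ℂ → Ω → ℂ) : Prop where
  /-- the exponential moments exist -/
  integrable : ∀ N : ℕ, 1 ≤ N → ∀ x₁ x₂ : Ω, x₁ ≠ x₂ → ∀ ζ₁ ∈ stripInf d, ∀ ζ₂ ∈ stripInf d,
    ∀ (q : ℕ) (ξ δ : Fin q → ℝ) (z : Fin q → Ω), (∀ j, δ j ∈ Ioc (0 : ℝ) 1) →
      Integrable (A.expVar N ζ₁ ζ₂ x₁ x₂ ξ δ z) (A.P N)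
  /-- `Ψ_N` is analytic in `(ζ₁, ζ₂) ∈ 𝒟_∞²` (analytic inside and continuous up to the edges) -/
  analytic : ∀ N : ℕ, 1 ≤ N → ∀ x₁ x₂ : Ω, x₁ ≠ x₂ →
    ∀ (q : ℕ) (ξ δ : Fin q → ℝ) (z : Fin q → Ω), (∀ j, δ j ∈ Ioc (0 : ℝ) 1) →
      AnalyticOnNhd ℂ (fun ζ : ℂ × ℂ => A.Psi N ζ.1 ζ.2 x₁ x₂ ξ δ z)
        (interior (stripInf d ×ˢ stripInf d)) ∧
      ContinuousOn (fun ζ : ℂ × ℂ => A.Psi N ζ.1 ζ.2 x₁ x₂ ξ δ z) (stripInf d ×ˢ stripInf d)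
  continuous_limit : ContinuousOn (Function.uncurry Ψ) (stripInf d ×ˢ univ)
  limit_zero : ∀ x, Ψ 0 x = 1
  limit_pos : ∀ t : ℝ, 0 ≤ t → t ≤ √(2 * d) → ∀ x, 0 < (Ψ t x).re ∧ (Ψ t x).im = 0
  /-- `Ψ_N = Ψ(ζ₁, x₁) Ψ(ζ₂, x₂) (1 + o(1))` uniformly down to any mesoscopic scale -/
  limit : ∀ K : Set Ω, IsCompact K → ∀ η > (0 : ℝ), ∀ R > (0 : ℝ), ∀ (q : ℕ) (ξ : Fin q → ℝ),
    ∀ e > (0 : ℝ), ∀ᶠ N : ℕ in atTop,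
      ∀ ζ₁ ∈ stripR d R, ∀ ζ₂ ∈ stripR d R, ∀ x₁ ∈ K, ∀ x₂ ∈ K, (N : ℝ) ^ (η - 1) ≤ dist x₁ x₂ →
      ∀ (z : Fin q → Ω) (δ : Fin q → ℝ), (∀ j, z j ∈ K) →
      (∀ j, (N : ℝ) ^ (η - 1) ≤ δ j ∧ δ j ≤ 1) →
        ‖A.Psi N ζ₁ ζ₂ x₁ x₂ ξ δ z - Ψ ζ₁ x₁ * Ψ ζ₂ x₂‖ ≤ e * ‖Ψ ζ₁ x₁ * Ψ ζ₂ x₂‖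

/-- Macroscopic exponential-moment assumption with limit function `Ψ(ζ, x)`. -/
structure MacroscopicAssumption (d : ℕ) (Ψ : ℂ → Ω → ℂ) : Prop where
  /-- at macroscopically separated points, `Ψ_N = Ψ(ζ₁, x₁) Ψ(ζ₂, x₂) (1 + o(1))` even when the
  imaginary parts of `ζ₁, ζ₂` grow like a small power of `log N` -/
  limit : ∀ K : Set Ω, IsCompact K → ∀ c > (0 : ℝ),
    ∀ (q : ℕ) (ξ δ : Fin q → ℝ) (z : Fin q → Ω), (∀ j, δ j ∈ Ioc (0 : ℝ) 1) →
    ∃ η₀ > (0 : ℝ), ∀ η : ℝ, 0 < η → η < η₀ → ∀ e > (0 : ℝ), ∀ᶠ N : ℕ in atTop,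
      ∀ ζ₁ ∈ stripR d (Real.log N ^ η), ∀ ζ₂ ∈ stripR d (Real.log N ^ η),
      ∀ x₁ ∈ K, ∀ x₂ ∈ K, c ≤ dist x₁ x₂ →
        ‖A.Psi N ζ₁ ζ₂ x₁ x₂ ξ δ z - Ψ ζ₁ x₁ * Ψ ζ₂ x₂‖ ≤ e * ‖Ψ ζ₁ x₁ * Ψ ζ₂ x₂‖
  growth : ∀ K : Set Ω, IsCompact K → ∃ C ϰ : ℝ, ∀ ζ ∈ stripInf d, ∀ x ∈ K,
    ‖Ψ ζ x‖ ≤ C * Real.exp (‖ζ‖ ^ ϰ)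

/-- The random measure
`μ_N(dx) = e^{γ 𝕏_N(x)} / 𝔼_N e^{γ 𝕏_N(x)} dx`. -/
def expMeasure (γ : ℝ) (N : ℕ) (s : A.Sample N) : Measure Ω :=
  vol.withDensity fun x => ENNReal.ofReal
    (Real.exp (γ * A.X N s x) / ∫ s', Real.exp (γ * A.X N s' x) ∂A.P N)

/-- The random measure
`ν_N(dx) = 1{𝕏_N(x) ≥ γ log N + g(x)} / ℙ_N(𝕏_N(x) ≥ γ log N) dx`. -/
def thickMeasure (γ : ℝ) (g : Ω → ℝ) (N : ℕ) (s : A.Sample N) : Measure Ω :=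
  vol.withDensity fun x =>
    {y | γ * Real.log N + g y ≤ A.X N s y}.indicator 1 x /
      A.P N {s' | γ * Real.log N ≤ A.X N s' x}

/-- `ν_N(f) - μ_N(e^{-γ g} f)` tends to zero in `L¹(ℙ_N)`, where the two integrals are well defined
almost surely, once `N` is large. -/
def ThickPointsMatch (γ : ℝ) (g f : Ω → ℝ) : Prop :=
  (∀ᶠ N : ℕ in atTop, ∀ᵐ s ∂A.P N,
    Integrable f (A.thickMeasure γ g N s) ∧
    Integrable (fun x => Real.exp (-γ * g x) * f x) (A.expMeasure γ N s)) ∧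
  Tendsto (fun N : ℕ => ∫⁻ s, ENNReal.ofReal
      |∫ x, f x ∂A.thickMeasure γ g N s
        - ∫ x, Real.exp (-γ * g x) * f x ∂A.expMeasure γ N s| ∂A.P N)
    atTop (𝓝 0)

end FieldApproximation

end

/-! Put `L = log N` and `v = 𝕏_N(x) - γ L`. Since `1{𝕏_N(x) ≥ γ L + g} = e^{-γ² L} e^{γ 𝕏_N(x)}
e^{-γ v} 1{v ≥ g}`, both densities are `e^{γ 𝕏_N(x)}` times a function of `v`: a constant for `μ_N`,
an exponential tail for `ν_N`. Under the law tilted by `e^{γ 𝕏_N(x)}`, `v` is nearly a centred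
Gaussian variable of variance `L`, which on bounded windows looks like `(2πL)^{-1/2}` times Lebesgue
measure. The tail integrates to `e^{-γ g}/γ`, that is, to `e^{-γ g}` times its value for `g = 0`.
After normalization the density of `ν_N` and `e^{-γ g}` times that of `μ_N` therefore have the same
asymptotics, also under tilts at two points and by finitely many smoothed fields: the four mixed
moments share one limit (`tendsto_integral_density`), and the differences of the densities at two
points decorrelate.

The local limit theorem is `GaussianFrequencies.tendsto_modeFun`. The characteristic functions of
the tilted laws are used at bounded frequencies only, so the first test functions are `sinc²`
kernels, whose Fourier transforms have compact support. The sum `bandKernel` of two of them is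
positive and decays only quadratically. The law is multiplied by it, Lévy's theorem is applied, and
dividing by it again gives access to the exponential tail on a half-line.

The plain second moment has a singularity `|x₁ - x₂|^{-γ²}` on the diagonal, which is not integrable
once `γ² ≥ d`. The densities are therefore truncated to the event that the field is at most `(γ + κ)
L` and that its smoothed versions at the scales `e^{-k}` are at most about `(γ + κ) k`. Under the
tilt the typical size is `γ k`, so a violation at scale `k` costs `e^{-κ² k / 2}`
(`lintegral_excess_le`), while the truncated second moment is `O(|x₁ - x₂|^{-β})` for some `β < d`
(`lintegral_truncation_le`).

The truncated correlations tend to zero pointwise off the diagonal. A Vitali argument passes from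
real exponential moments of the smoothed fields to characteristic functions, Fourier inversion
passes to smooth cutoffs at finitely many scales (`tendsto_integral_mul_of_tendsto_exp`), and the
finer scales contribute a uniformly small error. Dominated convergence and the second-moment method
(`tendsto_lintegral_abs_integral_of_correlation`) conclude.

The geometry enters mainly through `LocallyBoundedGrowth`, a local bound `O(r^d)` on volumes of
balls, which makes the kernel `|x₁ - x₂|^{-β}` integrable. On a manifold it holds because charts are
locally bi-Lipschitz for the intrinsic distance. -/

noncomputable section

/-! ## A band-limited positive kernel -/

/-- Lebesgue measure on `[-1, 1]²`. -/
def squareMeasure : Measure (ℝ × ℝ) :=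
  (volume.restrict (Icc (-1 : ℝ) 1)).prod (volume.restrict (Icc (-1 : ℝ) 1))

instance : IsFiniteMeasure squareMeasure := by unfold squareMeasure; infer_instance

lemma integral_exp_mul_I_Icc (u : ℝ) :
    ∫ a in Icc (-1 : ℝ) 1, Complex.exp ((a * u : ℝ) * Complex.I) = 2 * (Real.sinc u : ℂ) := by
  rw [integral_Icc_eq_integral_Ioc, ← intervalIntegral.integral_of_le (by norm_num)]
  by_cases hu : u = 0
  · subst hu
    simp
    norm_num
  have h := intervalIntegral.integral_comp_mul_right
    (fun t : ℝ => Complex.exp (t * Complex.I)) (a := -1) (b := 1) hu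
  rw [h, neg_one_mul, one_mul, integral_exp_mul_I_eq_sinc]
  have : (u : ℂ) ≠ 0 := by exact_mod_cast hu
  rw [Complex.real_smul]
  push_cast
  field_simp

/-- `sinc` is the characteristic function of the uniform law on `[-1, 1]`, so its square is that of
the sum of two independent such variables. All frequencies lie in `[-2, 2]`. -/
lemma sinc_sq_eq_integral (u : ℝ) :
    ((Real.sinc u ^ 2 : ℝ) : ℂ) =
      1 / 4 * ∫ p, Complex.exp (((p.1 + p.2) * u : ℝ) * Complex.I) ∂squareMeasure := by
  have h : ∀ p : ℝ × ℝ, Complex.exp (((p.1 + p.2) * u : ℝ) * Complex.I)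
      = Complex.exp ((p.1 * u : ℝ) * Complex.I) * Complex.exp ((p.2 * u : ℝ) * Complex.I) := by
    intro p
    rw [← Complex.exp_add]
    push_cast
    ring_nf
  simp_rw [h]
  unfold squareMeasure
  rw [integral_prod_mul (fun a : ℝ => Complex.exp ((a * u : ℝ) * Complex.I))
    (fun a : ℝ => Complex.exp ((a * u : ℝ) * Complex.I)), integral_exp_mul_I_Icc]
  push_cast
  ring

/-- The modulated kernel `sinc(θ(v - b))² e^{i s θ v}`. -/
def waveKernel (θ : ℕ) (b s v : ℝ) : ℂ :=
  ((Real.sinc (θ * (v - b)) ^ 2 : ℝ) : ℂ) * Complex.exp ((θ * s * v : ℝ) * Complex.I)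

/-- Modulation by `s` only shifts the band: the frequency of `v` is `θ (p₁ + p₂ + s)`, which
vanishes in the trivial mode `θ = 0`. -/
lemma waveKernel_eq_integral (θ : ℕ) (b s v : ℝ) :
    waveKernel θ b s v = ∫ p, 1 / 4 * Complex.exp ((-(θ * (p.1 + p.2) * b) : ℝ) * Complex.I) *
      Complex.exp ((θ * (p.1 + p.2 + s) * v : ℝ) * Complex.I) ∂squareMeasure := by
  unfold waveKernel
  rw [sinc_sq_eq_integral, mul_assoc, ← integral_mul_const, ← integral_const_mul]
  refine integral_congr_ae (ae_of_all _ fun p => ?_)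
  simp only
  rw [mul_assoc, mul_assoc, ← Complex.exp_add, ← Complex.exp_add]
  congr 2
  push_cast
  ring

lemma norm_waveKernel_le (θ : ℕ) (b s v : ℝ) : ‖waveKernel θ b s v‖ ≤ 1 := by
  unfold waveKernel
  rw [norm_mul, Complex.norm_exp_ofReal_mul_I, mul_one, Complex.norm_real, Real.norm_eq_abs,
    abs_pow]
  exact pow_le_one₀ (abs_nonneg _) (Real.abs_sinc_le_one _)

lemma continuous_waveKernel (θ : ℕ) (b s : ℝ) : Continuous (waveKernel θ b s) := by
  unfold waveKernel
  have := Real.continuous_sinc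
  fun_prop

lemma waveKernel_zero (b s v : ℝ) : waveKernel 0 b s v = 1 := by
  simp [waveKernel]

/-- The characteristic function of a weighted pair of random variables. -/
def weightedCharFun {S : Type*} [MeasurableSpace S] (P : Measure S) (W : S → ℝ)
    (v₁ v₂ : S → ℝ) (t₁ t₂ : ℝ) : ℂ :=
  ∫ x, (W x : ℂ) * Complex.exp ((t₁ * v₁ x + t₂ * v₂ x : ℝ) * Complex.I) ∂P

lemma norm_weightedCharFun_le {S : Type*} [MeasurableSpace S] {P : Measure S} {W : S → ℝ}
    {v₁ v₂ : S → ℝ} (t₁ t₂ : ℝ) :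
    ‖weightedCharFun P W v₁ v₂ t₁ t₂‖ ≤ ∫ x, |W x| ∂P := by
  unfold weightedCharFun
  refine (norm_integral_le_integral_norm _).trans (le_of_eq ?_)
  refine integral_congr_ae (ae_of_all _ fun x => ?_)
  simp only
  rw [norm_mul, Complex.norm_exp_ofReal_mul_I, mul_one, Complex.norm_real, Real.norm_eq_abs]

/-- The phase that appears when a product of two wave kernels is expanded. -/
def wavePhase (θ₁ θ₂ : ℕ) (b₁ b₂ : ℝ) (p : (ℝ × ℝ) × (ℝ × ℝ)) : ℂ :=
  (1 / 4 * Complex.exp ((-(θ₁ * (p.1.1 + p.1.2) * b₁) : ℝ) * Complex.I)) *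
    (1 / 4 * Complex.exp ((-(θ₂ * (p.2.1 + p.2.2) * b₂) : ℝ) * Complex.I))

lemma norm_wavePhase (θ₁ θ₂ : ℕ) (b₁ b₂ : ℝ) (p : (ℝ × ℝ) × (ℝ × ℝ)) :
    ‖wavePhase θ₁ θ₂ b₁ b₂ p‖ = 1 / 16 := by
  unfold wavePhase
  rw [norm_mul, norm_mul, norm_mul, Complex.norm_exp_ofReal_mul_I, Complex.norm_exp_ofReal_mul_I]
  norm_num

lemma continuous_wavePhase (θ₁ θ₂ : ℕ) (b₁ b₂ : ℝ) : Continuous (wavePhase θ₁ θ₂ b₁ b₂) := by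
  unfold wavePhase
  fun_prop

/-- Expansion of the expectation of a product of two wave kernels in terms of the characteristic
function. -/
lemma integral_waveKernel_mul_waveKernel {S : Type*} [MeasurableSpace S] {P : Measure S}
    [SFinite P] {W : S → ℝ} (hW : Integrable W P) {v₁ v₂ : S → ℝ} (hv₁ : Measurable v₁)
    (hv₂ : Measurable v₂) (θ₁ θ₂ : ℕ) (b₁ b₂ s₁ s₂ : ℝ) :
    ∫ x, (W x : ℂ) * (waveKernel θ₁ b₁ s₁ (v₁ x) * waveKernel θ₂ b₂ s₂ (v₂ x)) ∂P =
      ∫ p, wavePhase θ₁ θ₂ b₁ b₂ p *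
        weightedCharFun P W v₁ v₂ (θ₁ * (p.1.1 + p.1.2 + s₁)) (θ₂ * (p.2.1 + p.2.2 + s₂))
        ∂(squareMeasure.prod squareMeasure) := by
  have h1 : ∀ x, (W x : ℂ) * (waveKernel θ₁ b₁ s₁ (v₁ x) * waveKernel θ₂ b₂ s₂ (v₂ x)) =
      ∫ p, wavePhase θ₁ θ₂ b₁ b₂ p * ((W x : ℂ) *
        Complex.exp (((θ₁ * (p.1.1 + p.1.2 + s₁)) * v₁ x + (θ₂ * (p.2.1 + p.2.2 + s₂)) * v₂ x : ℝ)
          * Complex.I)) ∂(squareMeasure.prod squareMeasure) := by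
    intro x
    rw [waveKernel_eq_integral, waveKernel_eq_integral, ← integral_prod_mul, ← integral_const_mul]
    refine integral_congr_ae (ae_of_all _ fun p => ?_)
    simp only [wavePhase]
    rw [Complex.ofReal_add, add_mul, Complex.exp_add]
    ring
  simp_rw [h1, weightedCharFun, ← integral_const_mul]
  refine integral_integral_swap ?_
  have hm : Measurable (Function.uncurry fun (x : S) (p : (ℝ × ℝ) × (ℝ × ℝ)) =>
      wavePhase θ₁ θ₂ b₁ b₂ p *
        Complex.exp (((θ₁ * (p.1.1 + p.1.2 + s₁)) * v₁ x + (θ₂ * (p.2.1 + p.2.2 + s₂)) * v₂ x : ℝ)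
          * Complex.I)) := by
    have := (continuous_wavePhase θ₁ θ₂ b₁ b₂).measurable
    unfold Function.uncurry
    fun_prop
  have hW' : Integrable (fun z : S × ((ℝ × ℝ) × (ℝ × ℝ)) => (W z.1 : ℂ))
      (P.prod (squareMeasure.prod squareMeasure)) := (hW.ofReal (𝕜 := ℂ)).comp_fst _
  refine (hW'.bdd_mul hm.aestronglyMeasurable (c := 1 / 16) (ae_of_all _ fun z => ?_)).congr
    (ae_of_all _ fun z => ?_)
  · simp only [Function.uncurry]
    rw [norm_mul, norm_wavePhase, Complex.norm_exp_ofReal_mul_I, mul_one]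
  · simp only [Function.uncurry]
    ring

lemma integral_gaussian_shift_le {c : ℝ} (hc : 0 < c) (y : ℝ) :
    ∫ a in Icc (-1 : ℝ) 1, Real.exp (-c * (a + y) ^ 2) ≤ √(Real.pi / c) := by
  rw [← integral_gaussian c, ← integral_add_right_eq_self (fun x => Real.exp (-c * x ^ 2)) y]
  refine setIntegral_le_integral ((integrable_exp_neg_mul_sq hc).comp_add_right y) ?_
  exact ae_of_all _ fun a => (Real.exp_pos _).le

/-- Gaussian decay in the Fourier variable gains a factor `L^{-1/2}` per mode. -/
lemma sqrt_mul_integral_gaussian_square_le {θ : ℕ} (hθ : θ = 0 ∨ θ = 1) {c L : ℝ} (hc : 0 < c)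
    (hL : 0 < L) (s : ℝ) :
    √L ^ θ * ∫ p, Real.exp (-(c * L * (θ * (p.1 + p.2 + s)) ^ 2)) ∂squareMeasure
      ≤ 4 + 2 * √(Real.pi / c) := by
  have hpos : 0 ≤ √(Real.pi / c) := Real.sqrt_nonneg _
  rcases hθ with rfl | rfl
  -- In the trivial mode the integral is the area `4` of the square.
  · simp [squareMeasure, Measure.real, Measure.prod_apply]
    norm_num
  · have hint : Integrable (fun p : ℝ × ℝ => Real.exp (-(c * L * ((1 : ℕ) * (p.1 + p.2 + s)) ^ 2)))
        squareMeasure := by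
      refine Integrable.of_bound (by fun_prop) 1 (ae_of_all _ fun p => ?_)
      rw [Real.norm_eq_abs, Real.abs_exp]
      exact Real.exp_le_one_iff.2 (by have := mul_pos hc hL; simp; positivity)
    unfold squareMeasure at hint ⊢
    rw [integral_prod_symm _ hint]
    -- One coordinate is integrated as a Gaussian, which produces the factor `L^{-1/2}`; the other
    -- one only contributes the length `2`.
    have hb : ∀ y : ℝ, ∫ a in Icc (-1 : ℝ) 1,
        Real.exp (-(c * L * ((1 : ℕ) * (a + y + s)) ^ 2)) ≤ √(Real.pi / (c * L)) := by
      intro y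
      refine le_trans (le_of_eq ?_) (integral_gaussian_shift_le (mul_pos hc hL) (y + s))
      congr 1 with a
      congr 1
      push_cast
      ring
    have h2 : ∫ y in Icc (-1 : ℝ) 1, ∫ a in Icc (-1 : ℝ) 1,
        Real.exp (-(c * L * ((1 : ℕ) * (a + y + s)) ^ 2)) ≤
        ∫ y in Icc (-1 : ℝ) 1, √(Real.pi / (c * L)) := by
      refine integral_mono (hint.swap.integral_prod_left) (integrable_const _) hb
    have h3 : ∫ y in Icc (-1 : ℝ) 1, √(Real.pi / (c * L)) = 2 * √(Real.pi / (c * L)) := by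
      simp
      norm_num
    have h4 : √L * √(Real.pi / (c * L)) = √(Real.pi / c) := by
      rw [← Real.sqrt_mul hL.le]
      congr 1
      field_simp
    rw [h3] at h2
    calc _ ≤ √L ^ 1 * (2 * √(Real.pi / (c * L))) := by gcongr
      _ = 2 * √(Real.pi / c) := by rw [← h4]; ring
      _ ≤ _ := by linarith

/-- The mass of a product of two wave kernels under the standard Gaussian law with
variance `L`. -/
def waveGauss (θ : ℕ) (b s L : ℝ) : ℂ :=
  (√L ^ θ : ℝ) * ∫ p, 1 / 4 * Complex.exp ((-(θ * (p.1 + p.2) * b) : ℝ) * Complex.I) *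
    (Real.exp (-(L / 2 * (θ * (p.1 + p.2 + s)) ^ 2)) : ℂ) ∂squareMeasure

lemma waveGauss_zero (b s L : ℝ) : waveGauss 0 b s L = 1 := by
  simp [waveGauss, squareMeasure, Measure.real, Measure.prod_apply]
  norm_num

/-- The limiting mass of a wave kernel: its integral against a `1/√(2π)` multiple of Lebesgue
measure in the oscillating mode `θ = 1`, and `1` in the trivial mode. -/
def waveMass (θ : ℕ) (b s : ℝ) : ℂ :=
  if θ = 0 then 1 else ((√(2 * Real.pi))⁻¹ : ℝ) * ∫ v, waveKernel 1 b s v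

lemma sinc_sq_le (v : ℝ) : Real.sinc v ^ 2 ≤ 2 * (1 + v ^ 2)⁻¹ := by
  have h1 : Real.sinc v ^ 2 ≤ 1 := by
    rw [← sq_abs]; exact pow_le_one₀ (abs_nonneg _) (Real.abs_sinc_le_one v)
  have h2 : v ^ 2 * Real.sinc v ^ 2 ≤ 1 := by
    by_cases hv : v = 0
    · simp [hv]
    rw [Real.sinc_of_ne_zero hv, div_pow, mul_div_cancel₀ _ (pow_ne_zero 2 hv)]
    exact Real.sin_sq_le_one v
  rw [← div_eq_mul_inv, le_div_iff₀ (by positivity)]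
  nlinarith

lemma integrable_sinc_sq (b : ℝ) : Integrable fun v => Real.sinc (v - b) ^ 2 := by
  have h : Integrable fun v => Real.sinc v ^ 2 := by
    refine (integrable_inv_one_add_sq.const_mul 2).mono' ?_ (ae_of_all _ fun v => ?_)
    · exact (Real.continuous_sinc.pow 2).aestronglyMeasurable
    · rw [Real.norm_eq_abs, abs_of_nonneg (sq_nonneg _)]
      exact sinc_sq_le v
  exact h.comp_sub_right b

lemma integrable_waveKernel (b s : ℝ) : Integrable (waveKernel 1 b s) := by
  refine (integrable_sinc_sq b).mono' (continuous_waveKernel 1 b s).aestronglyMeasurable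
    (ae_of_all _ fun v => ?_)
  unfold waveKernel
  rw [norm_mul, Complex.norm_exp_ofReal_mul_I, mul_one, Complex.norm_real, Real.norm_eq_abs]
  simp

/-- Parseval: the integral over frequencies is the mean of the kernel under the Gaussian law of
variance `L`. The factor `√L` cancels the one in the normalization `1/√(2πL)` of its density. -/
lemma waveGauss_eq_integral {L : ℝ} (hL : 0 < L) (b s : ℝ) :
    waveGauss 1 b s L = ((√(2 * Real.pi))⁻¹ : ℝ) *
      ∫ v, (Real.exp (-(v ^ 2 / (2 * L))) : ℂ) * waveKernel 1 b s v := by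
  set Lq : ℝ≥0 := ⟨L, hL.le⟩
  have hL0 : Lq ≠ 0 := by
    intro h
    have := congrArg NNReal.toReal h
    simp [Lq] at this
    exact hL.ne' this
  -- The two-variable expansion is used with the second variable in the trivial mode, whose kernel
  -- is `1`.
  have h := integral_waveKernel_mul_waveKernel (P := gaussianReal 0 Lq) (W := fun _ => 1)
    (integrable_const _) measurable_id measurable_id 1 0 b 0 s 0
  have hc : ∀ t : ℝ, weightedCharFun (gaussianReal 0 Lq) (fun _ => 1) id id t 0 =
      (Real.exp (-(L / 2 * t ^ 2)) : ℂ) := by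
    intro t
    have := charFun_gaussianReal (μ := 0) (v := Lq) t
    rw [charFun_apply_real] at this
    unfold weightedCharFun
    simp only [id, zero_mul, add_zero, Complex.ofReal_one, one_mul]
    push_cast
    rw [this]
    congr 1
    rw [show ((Lq : ℝ) : ℂ) = (L : ℂ) from rfl, Complex.ofReal_zero]
    ring
  simp only [id, waveKernel_zero, mul_one, Complex.ofReal_one, one_mul, Nat.cast_zero, zero_mul,
    hc] at h
  have h3 : (∫ p, wavePhase 1 0 b 0 p *
      (Real.exp (-(L / 2 * (((1 : ℕ) : ℝ) * (p.1.1 + p.1.2 + s)) ^ 2)) : ℂ)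
        ∂(squareMeasure.prod squareMeasure)) =
      (∫ p, 1 / 4 * Complex.exp ((-((1 : ℕ) * (p.1 + p.2) * b) : ℝ) * Complex.I) *
        (Real.exp (-(L / 2 * (((1 : ℕ) : ℝ) * (p.1 + p.2 + s)) ^ 2)) : ℂ) ∂squareMeasure) *
        ∫ p : ℝ × ℝ, (1 / 4 : ℂ) ∂squareMeasure := by
    rw [← integral_prod_mul]
    refine integral_congr_ae (ae_of_all _ fun p => ?_)
    simp [wavePhase]
    ring
  have h4 : ∫ p : ℝ × ℝ, (1 / 4 : ℂ) ∂squareMeasure = 1 := by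
    simp [squareMeasure, Measure.real, Measure.prod_apply]
    norm_num
  rw [h4, mul_one] at h3
  unfold waveGauss
  rw [← h3, ← h, integral_gaussianReal_eq_integral_smul hL0, ← integral_const_mul,
    ← integral_const_mul]
  refine integral_congr_ae (ae_of_all _ fun v => ?_)
  simp only [gaussianPDFReal, Complex.real_smul, sub_zero, pow_one]
  have h5 : (√(2 * Real.pi * (Lq : ℝ)))⁻¹ = (√(2 * Real.pi))⁻¹ * (√L)⁻¹ := by
    rw [Real.sqrt_mul (by positivity), mul_inv]; rfl
  have h6 : (√L : ℂ) ≠ 0 := by exact_mod_cast (Real.sqrt_pos.2 hL).ne'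
  have h7 : -(v ^ 2 / (2 * L)) = -v ^ 2 / (2 * (Lq : ℝ)) := by
    change _ = -v ^ 2 / (2 * L)
    ring
  rw [h5, h7]
  push_cast
  field_simp

/-- As the variance grows, the rescaled Gaussian density flattens to the constant `1/√(2π)`;
integrability of `sinc²` provides the domination. -/
lemma tendsto_waveGauss {θ : ℕ} (hθ : θ = 0 ∨ θ = 1) (b s : ℝ) :
    Tendsto (waveGauss θ b s) atTop (𝓝 (waveMass θ b s)) := by
  rcases hθ with rfl | rfl
  · simp only [waveMass, if_true]
    exact tendsto_const_nhds.congr fun L => (waveGauss_zero b s L).symm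
  simp only [waveMass, one_ne_zero, if_false]
  have h : Tendsto (fun L : ℝ => ((√(2 * Real.pi))⁻¹ : ℝ) *
      ∫ v, (Real.exp (-(v ^ 2 / (2 * L))) : ℂ) * waveKernel 1 b s v) atTop
      (𝓝 (((√(2 * Real.pi))⁻¹ : ℝ) * ∫ v, waveKernel 1 b s v)) := by
    refine Tendsto.const_mul _ ?_
    refine tendsto_integral_filter_of_dominated_convergence (fun v => ‖waveKernel 1 b s v‖) ?_ ?_
      (integrable_waveKernel b s).norm ?_
    · refine Eventually.of_forall fun L => ?_
      have := continuous_waveKernel 1 b s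
      exact Continuous.aestronglyMeasurable (by fun_prop)
    · filter_upwards [eventually_gt_atTop 0] with L hL
      refine ae_of_all _ fun v => ?_
      rw [norm_mul]
      refine mul_le_of_le_one_left (norm_nonneg _) ?_
      rw [Complex.norm_real, Real.norm_eq_abs, Real.abs_exp]
      exact Real.exp_le_one_iff.2 (by simp; positivity)
    · refine ae_of_all _ fun v => ?_
      have h1 : Tendsto (fun L : ℝ => -(v ^ 2 / (2 * L))) atTop (𝓝 0) := by
        have : Tendsto (fun L : ℝ => 2 * L) atTop atTop :=
          tendsto_id.const_mul_atTop (by norm_num)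
        simpa using (this.const_div_atTop (v ^ 2)).neg
      have h2 := (Complex.continuous_ofReal.tendsto _).comp
        ((Real.continuous_exp.tendsto _).comp h1)
      simpa using h2.mul_const (waveKernel 1 b s v)
  refine h.congr' ?_
  filter_upwards [eventually_gt_atTop 0] with L hL
  exact (waveGauss_eq_integral hL b s).symm

/-- The positive band-limited kernel `sinc(v)² + sinc(v - 1)²`. -/
def bandKernel (v : ℝ) : ℝ := Real.sinc (v - 0) ^ 2 + Real.sinc (v - 1) ^ 2

lemma continuous_bandKernel : Continuous bandKernel := by
  unfold bandKernel
  have := Real.continuous_sinc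
  fun_prop

lemma bandKernel_le_two (v : ℝ) : bandKernel v ≤ 2 := by
  have h : ∀ u, Real.sinc u ^ 2 ≤ 1 := fun u => by
    rw [← sq_abs]; exact pow_le_one₀ (abs_nonneg _) (Real.abs_sinc_le_one u)
  unfold bandKernel
  linarith [h (v - 0), h (v - 1)]

lemma integrable_bandKernel : Integrable bandKernel :=
  (integrable_sinc_sq 0).add (integrable_sinc_sq 1)

/-- Lower bound for the band-limited kernel. -/
lemma exists_le_bandKernel : ∃ c > 0, ∀ v, c / (1 + v ^ 2) ≤ bandKernel v := by
  have hc1 : Real.cos 1 < 1 := by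
    have := Real.cos_one_le
    linarith
  refine ⟨(1 - Real.cos 1) / 3, by linarith, fun v => ?_⟩
  have hsc : ∀ u : ℝ, Real.sin u ^ 2 = u ^ 2 * Real.sinc u ^ 2 := by
    intro u
    by_cases hu : u = 0
    · simp [hu]
    rw [Real.sinc_of_ne_zero hu, div_pow, mul_div_cancel₀ _ (pow_ne_zero 2 hu)]
  -- The sum of squares equals `1 - cos 1 · cos (2v - 1)`, so the two kernels have no common zero.
  have h1 : 1 - Real.cos 1 ≤ Real.sin v ^ 2 + Real.sin (v - 1) ^ 2 := by
    have ha : Real.cos (2 * v - 1 + 1) = _ := Real.cos_add (2 * v - 1) 1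
    have hb : Real.cos (2 * v - 1 - 1) = _ := Real.cos_sub (2 * v - 1) 1
    have hc := Real.cos_sq' v
    have hd := Real.cos_sq' (v - 1)
    have he := Real.cos_two_mul v
    have hf := Real.cos_two_mul (v - 1)
    rw [show 2 * v - 1 + 1 = 2 * v by ring] at ha
    rw [show 2 * v - 1 - 1 = 2 * (v - 1) by ring] at hb
    have hg : Real.cos (2 * v - 1) * Real.cos 1 ≤ Real.cos 1 :=
      mul_le_of_le_one_left Real.cos_one_pos.le (Real.cos_le_one _)
    nlinarith
  rw [hsc, hsc] at h1
  unfold bandKernel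
  rw [sub_zero, div_le_iff₀ (by positivity)]
  have h2 := sq_nonneg (Real.sinc v)
  have h3 := sq_nonneg (Real.sinc (v - 1))
  have h4 : v ^ 2 ≤ 3 * (1 + v ^ 2) := by nlinarith
  have h5 : (v - 1) ^ 2 ≤ 3 * (1 + v ^ 2) := by nlinarith [sq_nonneg (v + 1), sq_nonneg v]
  nlinarith [mul_le_mul_of_nonneg_right h4 h2, mul_le_mul_of_nonneg_right h5 h3]

lemma bandKernel_pos (v : ℝ) : 0 < bandKernel v := by
  obtain ⟨c, hc, h⟩ := exists_le_bandKernel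
  exact lt_of_lt_of_le (by positivity) (h v)

/-- The function `v ↦ e^{-γ v} 1{v ≥ b}`. -/
def expTail (γ b v : ℝ) : ℝ := (Ici b).indicator (fun v => Real.exp (-γ * v)) v

lemma expTail_nonneg (γ b v : ℝ) : 0 ≤ expTail γ b v :=
  indicator_nonneg (fun _ _ => (Real.exp_pos _).le) _

lemma measurable_expTail (γ b : ℝ) : Measurable (expTail γ b) :=
  (by fun_prop : Measurable fun v : ℝ => Real.exp (-γ * v)).indicator measurableSet_Ici

/-- The kernel decays at most quadratically, so it beats the exponential at infinity; on the
remaining compact interval continuity suffices. -/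
lemma exists_expTail_le_bandKernel {γ : ℝ} (hγ : 0 < γ) (b₀ : ℝ) :
    ∃ C > 0, ∀ v, b₀ ≤ v → Real.exp (-γ * v) ≤ C * bandKernel v := by
  obtain ⟨c, hc, hck⟩ := exists_le_bandKernel
  have h1 : Tendsto (fun v : ℝ => (1 + v ^ 2) * Real.exp (-γ * v)) atTop (𝓝 0) := by
    have ha := (Real.tendsto_pow_mul_exp_neg_atTop_nhds_zero 0).comp
      (tendsto_id.const_mul_atTop hγ)
    have hb := ((Real.tendsto_pow_mul_exp_neg_atTop_nhds_zero 2).comp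
      (tendsto_id.const_mul_atTop hγ)).const_mul (γ⁻¹ ^ 2)
    refine ((ha.add hb).congr fun v => ?_).trans (by simp)
    simp only [Function.comp, id]
    field_simp
  obtain ⟨V, hV⟩ := eventually_atTop.1 (h1.eventually_le_const one_pos)
  obtain ⟨D, hD⟩ := (isCompact_Icc (a := b₀) (b := max V b₀)).bddAbove_image
    (f := fun v : ℝ => (1 + v ^ 2) * Real.exp (-γ * v)) (by fun_prop)
  refine ⟨(max D 1) / c, by positivity, fun v hv => ?_⟩
  have h2 : (1 + v ^ 2) * Real.exp (-γ * v) ≤ max D 1 := by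
    rcases le_total v (max V b₀) with h | h
    · exact (hD ⟨v, ⟨hv, h⟩, rfl⟩).trans (le_max_left _ _)
    · exact (hV v ((le_max_left _ _).trans h)).trans (le_max_right _ _)
  calc Real.exp (-γ * v) ≤ max D 1 / (1 + v ^ 2) := by
        rw [le_div_iff₀ (by positivity)]; linarith
    _ = max D 1 / c * (c / (1 + v ^ 2)) := by field_simp
    _ ≤ _ := by gcongr; exact hck v

/-- The constant is uniform over thresholds `b ≥ b₀`, so that the threshold may be `g(x)` with `x`
in a compact set. -/
lemma exists_expTail_le {γ : ℝ} (hγ : 0 < γ) (b₀ : ℝ) :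
    ∃ C > 0, ∀ b, b₀ ≤ b → ∀ v, expTail γ b v ≤ C * bandKernel v := by
  obtain ⟨C, hC, h⟩ := exists_expTail_le_bandKernel hγ b₀
  refine ⟨C, hC, fun b hb v => ?_⟩
  unfold expTail
  by_cases hv : v ∈ Ici b
  · rw [indicator_of_mem hv]
    exact h v (hb.trans hv)
  · rw [indicator_of_notMem hv]
    exact mul_nonneg hC.le (bandKernel_pos v).le

lemma integral_expTail {γ : ℝ} (hγ : 0 < γ) (b : ℝ) :
    ∫ v, expTail γ b v = Real.exp (-γ * b) / γ := by
  unfold expTail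
  rw [integral_indicator measurableSet_Ici, integral_Ici_eq_integral_Ioi,
    integral_exp_mul_Ioi (by linarith)]
  field_simp

/-! ## From characteristic functions to half-line functionals -/

/-- A portmanteau argument: steep continuous ramps bound the indicator from below and above, and in
the limit they differ from it at most at `b`, which is not an atom of `M₀`. -/
lemma tendsto_integral_indicator_Ici_of_tendsto {M : ℕ → Measure ℝ} {M₀ : Measure ℝ}
    [∀ n, IsFiniteMeasure (M n)] [IsFiniteMeasure M₀] {b : ℝ} (hb : M₀ {b} = 0)
    (h : ∀ ψ : ℝ → ℝ, Continuous ψ → (∃ C, ∀ x, |ψ x| ≤ C) →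
      Tendsto (fun n => ∫ x, ψ x ∂M n) atTop (𝓝 (∫ x, ψ x ∂M₀)))
    {ψ : ℝ → ℝ} (hψ : Continuous ψ) (hψ0 : ∀ x, 0 ≤ ψ x) {C : ℝ} (hC : ∀ x, ψ x ≤ C) :
    Tendsto (fun n => ∫ x, (Ici b).indicator ψ x ∂M n) atTop
      (𝓝 (∫ x, (Ici b).indicator ψ x ∂M₀)) := by
  have hint : ∀ (M : Measure ℝ) [IsFiniteMeasure M] (φ : ℝ → ℝ), Measurable φ →
      (∀ x, 0 ≤ φ x ∧ φ x ≤ C) → Integrable φ M := fun M _ φ hm hφ =>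
    Integrable.of_bound hm.aestronglyMeasurable C (ae_of_all _ fun x => by
      rw [Real.norm_eq_abs, abs_of_nonneg (hφ x).1]; exact (hφ x).2)
  -- continuous approximations of the indicator from both sides
  set r : ℕ → ℝ → ℝ := fun k x => max 0 (min 1 ((k + 1) * (x - b))) with hr
  set r' : ℕ → ℝ → ℝ := fun k x => max 0 (min 1 (1 + (k + 1) * (x - b))) with hr'
  have hrc : ∀ k, Continuous (r k) := fun k => by fun_prop
  have hrc' : ∀ k, Continuous (r' k) := fun k => by fun_prop
  have hr01 : ∀ k x, 0 ≤ r k x ∧ r k x ≤ 1 := fun k x =>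
    ⟨le_max_left _ _, max_le zero_le_one (min_le_left _ _)⟩
  have hr01' : ∀ k x, 0 ≤ r' k x ∧ r' k x ≤ 1 := fun k x =>
    ⟨le_max_left _ _, max_le zero_le_one (min_le_left _ _)⟩
  have hrle : ∀ k x, ψ x * r k x ≤ (Ici b).indicator ψ x := by
    intro k x
    by_cases hx : x ∈ Ici b
    · rw [indicator_of_mem hx]
      exact mul_le_of_le_one_right (hψ0 x) (hr01 k x).2
    · rw [indicator_of_notMem hx]
      have hx' : x - b < 0 := by simpa using hx
      have : r k x = 0 := by
        refine max_eq_left ((min_le_right _ _).trans ?_)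
        exact mul_nonpos_of_nonneg_of_nonpos (by positivity) hx'.le
      rw [this, mul_zero]
  have hrle' : ∀ k x, (Ici b).indicator ψ x ≤ ψ x * r' k x := by
    intro k x
    by_cases hx : x ∈ Ici b
    · rw [indicator_of_mem hx]
      have hx' : 0 ≤ x - b := by simpa using hx
      have : r' k x = 1 := by
        have h1 : 1 ≤ 1 + (k + 1) * (x - b) := by
          have : 0 ≤ ((k : ℝ) + 1) * (x - b) := by positivity
          linarith
        simp only [hr', min_eq_left h1]
        exact max_eq_right zero_le_one
      rw [this, mul_one]
    · rw [indicator_of_notMem hx]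
      exact mul_nonneg (hψ0 x) (hr01' k x).1
  have hψr : ∀ φ : ℝ → ℝ, (∀ x, 0 ≤ φ x ∧ φ x ≤ 1) → ∀ x, 0 ≤ ψ x * φ x ∧ ψ x * φ x ≤ C :=
    fun φ hφ x => ⟨mul_nonneg (hψ0 x) (hφ x).1,
      (mul_le_of_le_one_right (hψ0 x) (hφ x).2).trans (hC x)⟩
  have hind : ∀ x, 0 ≤ (Ici b).indicator ψ x ∧ (Ici b).indicator ψ x ≤ C := fun x =>
    ⟨indicator_nonneg (fun x _ => hψ0 x) x,
      (hrle' 0 x).trans (hψr _ (hr01' 0) x).2⟩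
  have hindm : Measurable ((Ici b).indicator ψ) := hψ.measurable.indicator measurableSet_Ici
  have hbd : ∀ φ : ℝ → ℝ, (∀ x, 0 ≤ φ x ∧ φ x ≤ 1) → ∃ C, ∀ x, |ψ x * φ x| ≤ C :=
    fun φ hφ => ⟨C, fun x => by
      rw [abs_of_nonneg (hψr φ hφ x).1]; exact (hψr φ hφ x).2⟩
  have hlim : ∀ φ : ℕ → ℝ → ℝ, (∀ k, Continuous (φ k)) → (∀ k x, 0 ≤ φ k x ∧ φ k x ≤ 1) →
      (∀ x, x ≠ b → Tendsto (fun k => ψ x * φ k x) atTop (𝓝 ((Ici b).indicator ψ x))) →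
      Tendsto (fun k => ∫ x, ψ x * φ k x ∂M₀) atTop (𝓝 (∫ x, (Ici b).indicator ψ x ∂M₀)) := by
    intro φ hφc hφ hφl
    refine tendsto_integral_of_dominated_convergence (fun _ => C)
      (fun k => (hψ.mul (hφc k)).aestronglyMeasurable) (integrable_const _)
      (fun k => ae_of_all _ fun x => ?_) ?_
    · rw [Real.norm_eq_abs, abs_of_nonneg (hψr _ (hφ k) x).1]
      exact (hψr _ (hφ k) x).2
    · filter_upwards [compl_mem_ae_iff.2 hb] with x hx
      exact hφl x hx
  have hlin : ∀ x, b < x → Tendsto (fun k : ℕ => ((k : ℝ) + 1) * (x - b)) atTop atTop := fun x hx =>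
    (tendsto_natCast_atTop_atTop.atTop_add tendsto_const_nhds).atTop_mul_const (sub_pos.2 hx)
  have hlin' : ∀ x, x < b → Tendsto (fun k : ℕ => ((k : ℝ) + 1) * (x - b)) atTop atBot :=
    fun x hx => (tendsto_natCast_atTop_atTop.atTop_add tendsto_const_nhds).atTop_mul_const_of_neg
      (sub_neg.2 hx)
  have hl1 := hlim r hrc hr01 (fun x hx => by
    rcases lt_or_gt_of_ne hx with hx | hx
    · refine tendsto_const_nhds.congr fun k => ?_
      rw [indicator_of_notMem (by simpa using hx)]
      exact (le_antisymm ((hrle k x).trans_eq (indicator_of_notMem (by simpa using hx) _))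
        (hψr _ (hr01 k) x).1).symm
    · refine tendsto_const_nhds.congr' ?_
      filter_upwards [(hlin x hx).eventually_ge_atTop 1] with k hk
      rw [indicator_of_mem (by simpa using hx.le)]
      simp only [hr, min_eq_left hk, max_eq_right zero_le_one, mul_one])
  have hl2 := hlim r' hrc' hr01' (fun x hx => by
    rcases lt_or_gt_of_ne hx with hx | hx
    · refine tendsto_const_nhds.congr' ?_
      filter_upwards [(hlin' x hx).eventually_le_atBot (-1)] with k hk
      rw [indicator_of_notMem (by simpa using hx)]
      have : r' k x = 0 := max_eq_left ((min_le_right _ _).trans (by linarith))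
      rw [this, mul_zero]
    · refine tendsto_const_nhds.congr fun k => ?_
      rw [indicator_of_mem (by simpa using hx.le)]
      refine le_antisymm ?_ ((mul_le_of_le_one_right (hψ0 x) (hr01' k x).2))
      exact (hrle' k x).trans' (indicator_of_mem (by simpa using hx.le) _).ge)
  rw [Metric.tendsto_atTop]
  intro ε hε
  obtain ⟨k, hk⟩ := ((hl1.eventually_const_lt (sub_lt_self _ (half_pos hε))).and
    (hl2.eventually_lt_const (lt_add_of_pos_right _ (half_pos hε)))).exists
  obtain ⟨n₀, hn₀⟩ := eventually_atTop.1
    (((h _ (hψ.mul (hrc k)) (hbd _ (hr01 k))).eventually_const_lt hk.1).and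
    ((h _ (hψ.mul (hrc' k)) (hbd _ (hr01' k))).eventually_lt_const hk.2))
  refine ⟨n₀, fun n hn => ?_⟩
  have h1 := integral_mono (hint (M n) _ (hψ.mul (hrc k)).measurable (hψr _ (hr01 k)))
    (hint (M n) _ hindm hind) (hrle k)
  have h2 := integral_mono (hint (M n) _ hindm hind)
    (hint (M n) _ (hψ.mul (hrc' k)).measurable (hψr _ (hr01' k))) (hrle' k)
  obtain ⟨h3, h4⟩ := hn₀ n hn
  rw [Real.dist_eq, abs_lt]
  simp only [Pi.mul_apply] at h1 h2 h3 h4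
  constructor <;> linarith

/-- Lévy's continuity theorem for finite measures on the line, with an indicator of a half-line
as test function. -/
lemma tendsto_integral_indicator_Ici_of_charFun {M : ℕ → Measure ℝ} {M₀ : Measure ℝ}
    [∀ n, IsFiniteMeasure (M n)] [IsFiniteMeasure M₀] {b : ℝ} (hb : M₀ {b} = 0)
    (h : ∀ s, Tendsto (fun n => charFun (M n) s) atTop (𝓝 (charFun M₀ s)))
    {ψ : ℝ → ℝ} (hψ : Continuous ψ) (hψ0 : ∀ x, 0 ≤ ψ x) {C : ℝ} (hC : ∀ x, ψ x ≤ C) :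
    Tendsto (fun n => ∫ x, (Ici b).indicator ψ x ∂M n) atTop
      (𝓝 (∫ x, (Ici b).indicator ψ x ∂M₀)) := by
  have hmass : Tendsto (fun n => (M n).real univ) atTop (𝓝 (M₀.real univ)) := by
    have := h 0
    simp only [charFun_zero] at this
    exact Complex.continuous_re.continuousAt.tendsto.comp this |>.congr fun n => by simp
  have hind : ∀ x, 0 ≤ (Ici b).indicator ψ x ∧ (Ici b).indicator ψ x ≤ C := fun x => by
    refine ⟨indicator_nonneg (fun x _ => hψ0 x) x, ?_⟩
    exact (indicator_le_self' (fun x _ => hψ0 x) x).trans (hC x)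
  -- A zero limit cannot be normalized; then the total masses tend to zero and so do the integrals
  -- of a bounded function.
  rcases eq_or_ne (M₀ univ) 0 with h0 | h0
  · have hM0 : M₀ = 0 := Measure.measure_univ_eq_zero.1 h0
    subst hM0
    simp only [integral_zero_measure]
    have hC0 : Tendsto (fun n => C * (M n).real univ) atTop (𝓝 0) := by
      simpa using hmass.const_mul C
    refine squeeze_zero (fun n => integral_nonneg fun x => (hind x).1) (fun n => ?_) hC0
    have h2 : ∫ x, (Ici b).indicator ψ x ∂M n ≤ ∫ _, C ∂M n := by
      refine integral_mono_of_nonneg (ae_of_all _ fun x => (hind x).1) (integrable_const _)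
        (ae_of_all _ fun x => (hind x).2)
    rw [integral_const, smul_eq_mul] at h2
    linarith
  have hpos : 0 < M₀.real univ := by
    rw [measureReal_def]; exact ENNReal.toReal_pos h0 (measure_ne_top _ _)
  refine tendsto_integral_indicator_Ici_of_tendsto hb ?_ hψ hψ0 hC
  -- normalize
  classical
  set m : ℕ → ℝ := fun n => (M n).real univ with hm
  -- The Dirac mass is an arbitrary default where `M n` vanishes, which does not happen for large
  -- `n`.
  set Q : ℕ → Measure ℝ := fun n =>
    if M n univ = 0 then Measure.dirac 0 else (M n univ)⁻¹ • M n with hQ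
  have hQp : ∀ n, IsProbabilityMeasure (Q n) := by
    intro n
    simp only [hQ]
    split_ifs with h1
    · infer_instance
    · exact ⟨by simp [ENNReal.inv_mul_cancel h1 (measure_ne_top _ _)]⟩
  set Q₀ : Measure ℝ := (M₀ univ)⁻¹ • M₀ with hQ₀
  have hQ₀p : IsProbabilityMeasure Q₀ :=
    ⟨by simp [hQ₀, ENNReal.inv_mul_cancel h0 (measure_ne_top _ _)]⟩
  have hev : ∀ᶠ n in atTop, M n univ ≠ 0 := by
    filter_upwards [hmass.eventually_const_lt hpos] with n hn h1
    simp [hm, measureReal_def, h1] at hn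
  have hQev : ∀ᶠ n in atTop, Q n = (M n univ)⁻¹ • M n := by
    filter_upwards [hev] with n hn
    simp only [hQ]
    rw [if_neg hn]
  have hinv : Tendsto (fun n => ((m n)⁻¹ : ℝ)) atTop (𝓝 (M₀.real univ)⁻¹) :=
    hmass.inv₀ hpos.ne'
  have hcf : ∀ s, Tendsto (fun n => charFun (Q n) s) atTop (𝓝 (charFun Q₀ s)) := by
    intro s
    have h1 : Tendsto (fun n => ((m n)⁻¹ : ℝ) • charFun (M n) s) atTop
        (𝓝 ((M₀.real univ)⁻¹ • charFun M₀ s)) := hinv.smul (h s)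
    have h2 : charFun Q₀ s = (M₀.real univ)⁻¹ • charFun M₀ s := by
      simp only [hQ₀, charFun, integral_smul_measure, ENNReal.toReal_inv, measureReal_def]
    rw [h2]
    refine h1.congr' ?_
    filter_upwards [hQev] with n hn
    rw [hn]
    simp only [charFun, integral_smul_measure, ENNReal.toReal_inv, measureReal_def, hm]
  have hconv := ProbabilityMeasure.tendsto_of_tendsto_charFun
    (μ := fun n => (⟨Q n, hQp n⟩ : ProbabilityMeasure ℝ)) (μ₀ := ⟨Q₀, hQ₀p⟩) hcf
  have hconv := ProbabilityMeasure.tendsto_iff_forall_integral_tendsto.1 hconv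
  rintro φ hφ ⟨D, hD⟩
  have h3 := hconv (BoundedContinuousFunction.ofNormedAddCommGroup φ hφ D hD)
  simp only [BoundedContinuousFunction.coe_ofNormedAddCommGroup, ProbabilityMeasure.coe_mk] at h3
  have h4 := hmass.mul h3
  have h5 : M₀.real univ * ∫ x, φ x ∂Q₀ = ∫ x, φ x ∂M₀ := by
    simp only [hQ₀, integral_smul_measure, ENNReal.toReal_inv, smul_eq_mul]
    rw [← measureReal_def, mul_inv_cancel_left₀ hpos.ne']
  rw [h5] at h4
  refine h4.congr' ?_
  filter_upwards [hQev, hev] with n hn hn'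
  rw [hn]
  simp only [integral_smul_measure, ENNReal.toReal_inv, smul_eq_mul]
  rw [← measureReal_def, mul_inv_cancel_left₀]
  simp only [hm, measureReal_def]
  exact (ENNReal.toReal_pos hn' (measure_ne_top _ _)).ne'

/-- If the weighted law of `v`, multiplied by the band-limited kernel, converges in the sense of
characteristic functions to a multiple of Lebesgue measure times the kernel, then the weighted law
of `v` integrates `e^{-γ v} 1{v ≥ b}` as that multiple of Lebesgue measure does. -/
lemma tendsto_integral_expTail {S : ℕ → Type*} [∀ n, MeasurableSpace (S n)]
    {P : ∀ n, Measure (S n)} {w : ∀ n, S n → ℝ} {V : ∀ n, S n → ℝ}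
    (hw : ∀ n, Measurable (w n)) (hw0 : ∀ n x, 0 ≤ w n x) (hwi : ∀ n, Integrable (w n) (P n))
    (hV : ∀ n, Measurable (V n)) {G : ℝ}
    (h : ∀ s : ℝ, Tendsto (fun n => ∫ x, (w n x : ℂ) * ((bandKernel (V n x) : ℂ) *
      Complex.exp ((s * V n x : ℝ) * Complex.I)) ∂P n) atTop
      (𝓝 (G * ∫ y, (bandKernel y : ℂ) * Complex.exp ((s * y : ℝ) * Complex.I))))
    {γ : ℝ} (hγ : 0 < γ) (b : ℝ) :
    Tendsto (fun n => ∫ x, w n x * expTail γ b (V n x) ∂P n) atTop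
      (𝓝 (G * (Real.exp (-γ * b) / γ))) := by
  have hk0 : ∀ y, 0 ≤ bandKernel y := fun y => (bandKernel_pos y).le
  have hkm : Measurable bandKernel := continuous_bandKernel.measurable
  have hki : 0 < ∫ y, bandKernel y := by
    rw [integral_pos_iff_support_of_nonneg hk0 integrable_bandKernel]
    have : Function.support bandKernel = univ := by
      ext y; simp [(bandKernel_pos y).ne']
    rw [this]; simp
  have hwk : ∀ n, Integrable (fun x => w n x * bandKernel (V n x)) (P n) := fun n =>
    (hwi n).mul_bdd (c := 2) (hkm.comp (hV n)).aestronglyMeasurable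
      (ae_of_all _ fun x => by
        rw [Real.norm_eq_abs, abs_of_nonneg (hk0 _)]; exact bandKernel_le_two _)
  -- The case `s = 0` of the assumption: limits of nonnegative integrals. Without this sign the
  -- density `G · bandKernel` of `M₀` would be truncated at zero.
  have hG : 0 ≤ G := by
    have h1 := h 0
    simp only [zero_mul, Complex.ofReal_zero, Complex.exp_zero, mul_one] at h1
    simp only [integral_complex_ofReal] at h1
    have h2 := Complex.continuous_re.continuousAt.tendsto.comp h1
    have h3 : 0 ≤ G * ∫ y, bandKernel y := by
      refine ge_of_tendsto (x := atTop) (f := fun n => ∫ x, w n x * bandKernel (V n x) ∂P n) ?_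
        (Eventually.of_forall fun n => integral_nonneg fun x => mul_nonneg (hw0 n x) (hk0 _))
      refine (h2.congr fun n => ?_).trans_eq ?_
      · simp only [Function.comp]
        rw [show (fun x => (w n x : ℂ) * (bandKernel (V n x) : ℂ)) =
          fun x => ((w n x * bandKernel (V n x) : ℝ) : ℂ) by ext x; push_cast; rfl]
        rw [integral_complex_ofReal, Complex.ofReal_re]
      · rw [← Complex.ofReal_mul, Complex.ofReal_re]
    exact nonneg_of_mul_nonneg_left h3 hki
  set M : ℕ → Measure ℝ := fun n =>
    ((P n).withDensity fun x => ENNReal.ofReal (w n x * bandKernel (V n x))).map (V n) with hM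
  set M₀ : Measure ℝ := volume.withDensity fun y => ENNReal.ofReal (G * bandKernel y) with hM₀
  have hfinW : ∀ n, IsFiniteMeasure
      ((P n).withDensity fun x => ENNReal.ofReal (w n x * bandKernel (V n x))) := fun n =>
    isFiniteMeasure_withDensity_ofReal (hwk n).2
  have hfin : ∀ n, IsFiniteMeasure (M n) := fun n => by
    have := hfinW n
    simp only [hM]; infer_instance
  have hfin₀ : IsFiniteMeasure M₀ :=
    isFiniteMeasure_withDensity_ofReal (integrable_bandKernel.const_mul G).2
  have hdens : ∀ n, Measurable fun x => (w n x * bandKernel (V n x)).toNNReal := fun n =>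
    ((hw n).mul (hkm.comp (hV n))).real_toNNReal
  have hMint : ∀ (E : Type) [NormedAddCommGroup E] [NormedSpace ℝ E] (n : ℕ) (φ : ℝ → E),
      StronglyMeasurable φ →
      ∫ y, φ y ∂M n = ∫ x, (w n x * bandKernel (V n x)) • φ (V n x) ∂P n := by
    intro E _ _ n φ hφ
    simp only [hM]
    rw [integral_map (hV n).aemeasurable hφ.aestronglyMeasurable]
    have : (fun x => ENNReal.ofReal (w n x * bandKernel (V n x))) =
      fun x => (((w n x * bandKernel (V n x)).toNNReal : ℝ≥0) : ℝ≥0∞) := rfl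
    rw [this, integral_withDensity_eq_integral_smul (hdens n)]
    refine integral_congr_ae (ae_of_all _ fun x => ?_)
    simp only [NNReal.smul_def]
    rw [Real.coe_toNNReal _ (mul_nonneg (hw0 n x) (hk0 _))]
  have hMint₀ : ∀ (E : Type) [NormedAddCommGroup E] [NormedSpace ℝ E] (φ : ℝ → E),
      ∫ y, φ y ∂M₀ = ∫ y, (G * bandKernel y) • φ y := by
    intro E _ _ φ
    simp only [hM₀]
    have : (fun y => ENNReal.ofReal (G * bandKernel y)) =
      fun y => (((G * bandKernel y).toNNReal : ℝ≥0) : ℝ≥0∞) := rfl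
    rw [this, integral_withDensity_eq_integral_smul (hkm.const_mul G).real_toNNReal]
    refine integral_congr_ae (ae_of_all _ fun x => ?_)
    simp only [NNReal.smul_def]
    rw [Real.coe_toNNReal _ (mul_nonneg hG (hk0 _))]
  obtain ⟨C, hC, hCk⟩ := exists_expTail_le_bandKernel hγ b
  -- Dividing by the kernel undoes the multiplication in `M n`. Freezing the quotient to the left of
  -- `b` keeps it continuous and bounded on the line; only its values on `[b, ∞)` matter.
  set ψ : ℝ → ℝ := fun v => Real.exp (-γ * max v b) / bandKernel (max v b) with hψ
  have hψc : Continuous ψ := by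
    have := continuous_bandKernel
    exact Continuous.div (by fun_prop) (by fun_prop) fun v => (bandKernel_pos _).ne'
  have hkey := tendsto_integral_indicator_Ici_of_charFun (M := M) (M₀ := M₀) (b := b)
    ((withDensity_absolutelyContinuous _ _) (by simp)) (fun s => ?_) hψc
    (fun x => div_nonneg (Real.exp_pos _).le (hk0 _)) (C := C)
    (fun x => by
      simp only [hψ]
      rw [div_le_iff₀ (bandKernel_pos _)]
      exact hCk _ (le_max_right _ _))
  · have hsm : StronglyMeasurable ((Ici b).indicator ψ) :=
      (hψc.measurable.indicator measurableSet_Ici).stronglyMeasurable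
    have hpt : ∀ y, bandKernel y * (Ici b).indicator ψ y = expTail γ b y := by
      intro y
      unfold expTail
      by_cases hy : y ∈ Ici b
      · rw [indicator_of_mem hy, indicator_of_mem hy]
        simp only [hψ, max_eq_left (show b ≤ y from hy)]
        rw [mul_div_cancel₀ _ (bandKernel_pos _).ne']
      · rw [indicator_of_notMem hy, indicator_of_notMem hy, mul_zero]
    rw [hMint₀ ℝ _] at hkey
    simp only [smul_eq_mul, mul_assoc, hpt] at hkey
    rw [integral_const_mul, integral_expTail hγ] at hkey
    refine hkey.congr fun n => ?_
    rw [hMint ℝ n _ hsm]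
    simp only [smul_eq_mul, mul_assoc, hpt]
  · have h1 := h s
    rw [charFun_apply_real, hMint₀ ℂ _]
    have h2 : ∀ n, charFun (M n) s = ∫ x, (w n x : ℂ) * ((bandKernel (V n x) : ℂ) *
      Complex.exp ((s * V n x : ℝ) * Complex.I)) ∂P n := by
      intro n
      rw [charFun_apply_real, hMint ℂ n _ (Continuous.stronglyMeasurable (by fun_prop))]
      refine integral_congr_ae (ae_of_all _ fun x => ?_)
      simp only [Complex.real_smul]
      push_cast
      ring
    simp only [h2]
    convert h1 using 2
    rw [← integral_const_mul]
    refine integral_congr_ae (ae_of_all _ fun x => ?_)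
    simp only [Complex.real_smul]
    push_cast
    ring

/-! ## A local limit theorem for weighted pairs -/

/-- The integral factorizes over the two modes, and each factor compensates its own power of `√L`.
-/
lemma sq_sum_integral_square_le {θ₁ θ₂ : ℕ} (hθ₁ : θ₁ = 0 ∨ θ₁ = 1) (hθ₂ : θ₂ = 0 ∨ θ₂ = 1)
    {c L : ℝ} (hc : 0 < c) (hL : 0 < L) (s₁ s₂ : ℝ) :
    (√L ^ θ₁ * √L ^ θ₂) * ∫ p, Real.exp (-(c * L * (θ₁ * (p.1.1 + p.1.2 + s₁)) ^ 2
      + c * L * (θ₂ * (p.2.1 + p.2.2 + s₂)) ^ 2)) ∂(squareMeasure.prod squareMeasure)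
      ≤ (4 + 2 * √(Real.pi / c)) ^ 2 := by
  have h : ∫ p, Real.exp (-(c * L * (θ₁ * (p.1.1 + p.1.2 + s₁)) ^ 2
      + c * L * (θ₂ * (p.2.1 + p.2.2 + s₂)) ^ 2)) ∂(squareMeasure.prod squareMeasure) =
      (∫ p, Real.exp (-(c * L * (θ₁ * (p.1 + p.2 + s₁)) ^ 2)) ∂squareMeasure) *
      ∫ p, Real.exp (-(c * L * (θ₂ * (p.1 + p.2 + s₂)) ^ 2)) ∂squareMeasure := by
    rw [← integral_prod_mul]
    refine integral_congr_ae (ae_of_all _ fun p => ?_)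
    simp only
    rw [← Real.exp_add]
    ring_nf
  rw [h]
  have h1 := sqrt_mul_integral_gaussian_square_le hθ₁ hc hL s₁
  have h2 := sqrt_mul_integral_gaussian_square_le hθ₂ hc hL s₂
  have h3 : 0 ≤ √L ^ θ₂ * ∫ p, Real.exp (-(c * L * (θ₂ * (p.1 + p.2 + s₂)) ^ 2))
      ∂squareMeasure :=
    mul_nonneg (by positivity) (integral_nonneg fun _ => (Real.exp_pos _).le)
  have h4 : (0 : ℝ) ≤ 4 + 2 * √(Real.pi / c) := by positivity
  calc _ = (√L ^ θ₁ * ∫ p, Real.exp (-(c * L * (θ₁ * (p.1 + p.2 + s₁)) ^ 2)) ∂squareMeasure) *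
        (√L ^ θ₂ * ∫ p, Real.exp (-(c * L * (θ₂ * (p.1 + p.2 + s₂)) ^ 2)) ∂squareMeasure) := by
        ring
    _ ≤ (4 + 2 * √(Real.pi / c)) * (4 + 2 * √(Real.pi / c)) := mul_le_mul h1 h2 h3 h4
    _ = _ := by ring

lemma ae_squareMeasure_abs_le (s : ℝ) :
    ∀ᵐ p ∂squareMeasure, |p.1 + p.2 + s| ≤ 2 + |s| := by
  have h : ∀ᵐ a ∂(volume.restrict (Icc (-1 : ℝ) 1)), |a| ≤ 1 := by
    filter_upwards [ae_restrict_mem measurableSet_Icc] with a ha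
    exact abs_le.2 ha
  have h1 : ∀ᵐ p ∂squareMeasure, |p.1| ≤ 1 := Measure.quasiMeasurePreserving_fst.ae h
  have h2 : ∀ᵐ p ∂squareMeasure, |p.2| ≤ 1 := Measure.quasiMeasurePreserving_snd.ae h
  filter_upwards [h1, h2] with p hp1 hp2
  calc |p.1 + p.2 + s| ≤ |p.1| + |p.2| + |s| := abs_add_three _ _ _
    _ ≤ _ := by linarith

/-- Band limitation: for fixed modulations only bounded frequencies occur, so bounds on
characteristic functions at bounded frequencies are enough. -/
lemma ae_prod_squareMeasure_abs_le {θ₁ θ₂ : ℕ} (hθ₁ : θ₁ = 0 ∨ θ₁ = 1) (hθ₂ : θ₂ = 0 ∨ θ₂ = 1)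
    (s₁ s₂ : ℝ) : ∀ᵐ p ∂(squareMeasure.prod squareMeasure),
      |(θ₁ : ℝ) * (p.1.1 + p.1.2 + s₁)| ≤ 2 + |s₁| + |s₂| ∧
      |(θ₂ : ℝ) * (p.2.1 + p.2.2 + s₂)| ≤ 2 + |s₁| + |s₂| := by
  have key : ∀ {θ : ℕ}, (θ = 0 ∨ θ = 1) → ∀ {x y : ℝ}, |x| ≤ y → |(θ : ℝ) * x| ≤ y := by
    rintro θ (rfl | rfl) x y h
    · simpa using (abs_nonneg x).trans h
    · simpa using h
  filter_upwards [Measure.quasiMeasurePreserving_fst.ae (ae_squareMeasure_abs_le s₁),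
    Measure.quasiMeasurePreserving_snd.ae (ae_squareMeasure_abs_le s₂)] with p h1 h2
  exact ⟨key hθ₁ (h1.trans (by linarith [abs_nonneg s₂])),
    key hθ₂ (h2.trans (by linarith [abs_nonneg s₁]))⟩

lemma continuous_weightedCharFun {S : Type*} [MeasurableSpace S] {P : Measure S} {W : S → ℝ}
    (hW : Integrable W P) {v₁ v₂ : S → ℝ} (hv₁ : Measurable v₁) (hv₂ : Measurable v₂) :
    Continuous fun t : ℝ × ℝ => weightedCharFun P W v₁ v₂ t.1 t.2 := by
  unfold weightedCharFun
  refine continuous_of_dominated (bound := fun x => |W x|) ?_ ?_ hW.abs ?_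
  · intro t
    exact (hW.ofReal (𝕜 := ℂ)).aestronglyMeasurable.mul
      (Measurable.aestronglyMeasurable (by fun_prop))
  · intro t
    refine ae_of_all _ fun x => ?_
    rw [norm_mul, Complex.norm_exp_ofReal_mul_I, mul_one, Complex.norm_real, Real.norm_eq_abs]
  · refine ae_of_all _ fun x => ?_
    fun_prop

section LocalLimit

variable {S : ℕ → Type v} [∀ n, MeasurableSpace (S n)] {P : ∀ n, Measure (S n)}
  {W : ∀ n, S n → ℝ} {V₁ V₂ : ∀ n, S n → ℝ} {L : ℕ → ℝ}

/-- The weighted pairs `(V₁, V₂)` look, near frequency zero, like pairs of independent centred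
Gaussian variables with variance `L → ∞`, with a Gaussian bound at all bounded frequencies. -/
structure GaussianFrequencies (P : ∀ n, Measure (S n)) (W V₁ V₂ : ∀ n, S n → ℝ) (L : ℕ → ℝ) :
    Prop where
  tendsto_atTop : Tendsto L atTop atTop
  measurable_weight : ∀ n, Measurable (W n)
  weight_nonneg : ∀ n x, 0 ≤ W n x
  integrable_weight : ∀ n, Integrable (W n) (P n)
  measurable_fst : ∀ n, Measurable (V₁ n)
  measurable_snd : ∀ n, Measurable (V₂ n)
  bound : ∀ R : ℝ, ∃ B : ℝ, ∀ᶠ n in atTop, ∀ t₁ t₂ : ℝ, |t₁| ≤ R → |t₂| ≤ R →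
    ‖weightedCharFun (P n) (W n) (V₁ n) (V₂ n) t₁ t₂‖ ≤
      B * Real.exp (-(L n / 2 * t₁ ^ 2 + L n / 2 * t₂ ^ 2))
  limit : ∀ ε > (0 : ℝ), ∃ τ > (0 : ℝ), ∀ᶠ n in atTop, ∀ t₁ t₂ : ℝ, |t₁| ≤ τ → |t₂| ≤ τ →
    ‖weightedCharFun (P n) (W n) (V₁ n) (V₂ n) t₁ t₂ -
        (Real.exp (-(L n / 2 * t₁ ^ 2 + L n / 2 * t₂ ^ 2)) : ℂ)‖ ≤
      ε * Real.exp (-(L n / 2 * t₁ ^ 2 + L n / 2 * t₂ ^ 2))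


/-- Uniform approximation of the characteristic function at bounded frequencies, with a slightly
weaker Gaussian bound. -/
lemma GaussianFrequencies.approx (h : GaussianFrequencies P W V₁ V₂ L) (R : ℝ) {ε : ℝ}
    (hε : 0 < ε) : ∀ᶠ n in atTop, ∀ t₁ t₂ : ℝ, |t₁| ≤ R → |t₂| ≤ R →
    ‖weightedCharFun (P n) (W n) (V₁ n) (V₂ n) t₁ t₂ -
        (Real.exp (-(L n / 2 * t₁ ^ 2 + L n / 2 * t₂ ^ 2)) : ℂ)‖ ≤
      ε * Real.exp (-(1 / 4 * L n * t₁ ^ 2 + 1 / 4 * L n * t₂ ^ 2)) := by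
  obtain ⟨B, hB⟩ := h.bound R
  obtain ⟨τ, hτ, hlim⟩ := h.limit ε hε
  -- The Gaussian exponent is split in two halves. When a frequency exceeds `τ`, one half gives
  -- `e^{-τ² L / 4}` and beats the constant `B`; the other half is kept for integration over the
  -- band.
  have hdec : Tendsto (fun n => (|B| + 1) * Real.exp (-(τ ^ 2 / 4 * L n))) atTop (𝓝 0) := by
    have h1 : Tendsto (fun n => τ ^ 2 / 4 * L n) atTop atTop :=
      h.tendsto_atTop.const_mul_atTop (by positivity)
    simpa using (Real.tendsto_exp_neg_atTop_nhds_zero.comp h1).const_mul (|B| + 1)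
  filter_upwards [hB, hlim, hdec.eventually_le_const hε, h.tendsto_atTop.eventually_gt_atTop 0]
    with n hn1 hn2 hn3 hn4 t₁ t₂ ht₁ ht₂
  have hq1 : 0 ≤ L n * t₁ ^ 2 := by positivity
  have hq2 : 0 ≤ L n * t₂ ^ 2 := by positivity
  by_cases hsmall : |t₁| ≤ τ ∧ |t₂| ≤ τ
  · refine (hn2 t₁ t₂ hsmall.1 hsmall.2).trans ?_
    gcongr
    · linarith
    · linarith
  · have hbig : τ ^ 2 * L n ≤ L n * t₁ ^ 2 + L n * t₂ ^ 2 := by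
      have : τ ^ 2 ≤ t₁ ^ 2 + t₂ ^ 2 := by
        rw [not_and_or, not_le, not_le] at hsmall
        rcases hsmall with h' | h'
        · nlinarith [sq_abs t₁, sq_nonneg t₂, abs_nonneg t₁]
        · nlinarith [sq_abs t₂, sq_nonneg t₁, abs_nonneg t₂]
      nlinarith
    set E := Real.exp (-(L n / 2 * t₁ ^ 2 + L n / 2 * t₂ ^ 2)) with hE
    have hEle : E ≤ Real.exp (-(τ ^ 2 / 4 * L n)) *
        Real.exp (-(1 / 4 * L n * t₁ ^ 2 + 1 / 4 * L n * t₂ ^ 2)) := by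
      rw [← Real.exp_add]
      refine Real.exp_le_exp.2 ?_
      linarith
    calc _ ≤ ‖weightedCharFun (P n) (W n) (V₁ n) (V₂ n) t₁ t₂‖ + ‖(E : ℂ)‖ := norm_sub_le _ _
      _ ≤ |B| * E + E := by
        gcongr
        · exact (hn1 t₁ t₂ ht₁ ht₂).trans (by gcongr; exact le_abs_self B)
        · rw [Complex.norm_real, Real.norm_eq_abs, abs_of_pos (Real.exp_pos _)]
      _ = (|B| + 1) * E := by ring
      _ ≤ (|B| + 1) * (Real.exp (-(τ ^ 2 / 4 * L n)) *
        Real.exp (-(1 / 4 * L n * t₁ ^ 2 + 1 / 4 * L n * t₂ ^ 2))) := by gcongr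
      _ = ((|B| + 1) * Real.exp (-(τ ^ 2 / 4 * L n))) *
        Real.exp (-(1 / 4 * L n * t₁ ^ 2 + 1 / 4 * L n * t₂ ^ 2)) := by ring
      _ ≤ _ := by gcongr

lemma waveGauss_mul_waveGauss (θ₁ θ₂ : ℕ) (b₁ b₂ s₁ s₂ l : ℝ) :
    waveGauss θ₁ b₁ s₁ l * waveGauss θ₂ b₂ s₂ l = (√l ^ θ₁ * √l ^ θ₂ : ℝ) *
      ∫ p, wavePhase θ₁ θ₂ b₁ b₂ p *
        (Real.exp (-(l / 2 * (θ₁ * (p.1.1 + p.1.2 + s₁)) ^ 2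
          + l / 2 * (θ₂ * (p.2.1 + p.2.2 + s₂)) ^ 2)) : ℂ)
        ∂(squareMeasure.prod squareMeasure) := by
  have h : ∫ p, wavePhase θ₁ θ₂ b₁ b₂ p *
        (Real.exp (-(l / 2 * (θ₁ * (p.1.1 + p.1.2 + s₁)) ^ 2
          + l / 2 * (θ₂ * (p.2.1 + p.2.2 + s₂)) ^ 2)) : ℂ)
        ∂(squareMeasure.prod squareMeasure) =
      (∫ p, 1 / 4 * Complex.exp ((-(θ₁ * (p.1 + p.2) * b₁) : ℝ) * Complex.I) *
        (Real.exp (-(l / 2 * (θ₁ * (p.1 + p.2 + s₁)) ^ 2)) : ℂ) ∂squareMeasure) *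
      ∫ p, 1 / 4 * Complex.exp ((-(θ₂ * (p.1 + p.2) * b₂) : ℝ) * Complex.I) *
        (Real.exp (-(l / 2 * (θ₂ * (p.1 + p.2 + s₂)) ^ 2)) : ℂ) ∂squareMeasure := by
    rw [← integral_prod_mul]
    refine integral_congr_ae (ae_of_all _ fun p => ?_)
    simp only [wavePhase]
    rw [neg_add, Real.exp_add]
    push_cast
    ring
  rw [h]
  unfold waveGauss
  push_cast
  ring

/-- On the Fourier side the weighted law and the Gaussian one differ by `ε e^{-L t² / 4}`.
Integrated over the band, this gains `L^{-1/2}` per oscillating mode, exactly what the prefactor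
loses. -/
lemma GaussianFrequencies.tendsto_waveKernel [∀ n, SFinite (P n)] (h : GaussianFrequencies P W V₁ V₂ L)
    {θ₁ θ₂ : ℕ} (hθ₁ : θ₁ = 0 ∨ θ₁ = 1) (hθ₂ : θ₂ = 0 ∨ θ₂ = 1) (b₁ b₂ s₁ s₂ : ℝ) :
    Tendsto (fun n => (√(L n) ^ θ₁ * √(L n) ^ θ₂ : ℝ) *
      ∫ x, (W n x : ℂ) * (waveKernel θ₁ b₁ s₁ (V₁ n x) * waveKernel θ₂ b₂ s₂ (V₂ n x)) ∂P n)
      atTop (𝓝 (waveMass θ₁ b₁ s₁ * waveMass θ₂ b₂ s₂)) := by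
  have hG := ((tendsto_waveGauss hθ₁ b₁ s₁).mul (tendsto_waveGauss hθ₂ b₂ s₂)).comp
    h.tendsto_atTop
  have hdiff : Tendsto (fun n => (√(L n) ^ θ₁ * √(L n) ^ θ₂ : ℝ) *
      ∫ x, (W n x : ℂ) * (waveKernel θ₁ b₁ s₁ (V₁ n x) * waveKernel θ₂ b₂ s₂ (V₂ n x)) ∂P n
      - waveGauss θ₁ b₁ s₁ (L n) * waveGauss θ₂ b₂ s₂ (L n)) atTop (𝓝 0) := by
    rw [Metric.tendsto_atTop]
    intro ε hε
    -- The constant of `sq_sum_integral_square_le` for `c = 1 / 4`, the decay rate left by `approx`.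
    set K : ℝ := (4 + 2 * √(Real.pi / (1 / 4))) ^ 2 with hK
    have hKpos : 0 < K := by positivity
    refine eventually_atTop.1 ?_
    filter_upwards [h.approx (2 + |s₁| + |s₂|) (ε := ε / K) (by positivity),
      h.tendsto_atTop.eventually_gt_atTop 0] with n hn hLn
    rw [integral_waveKernel_mul_waveKernel (h.integrable_weight n) (h.measurable_fst n)
      (h.measurable_snd n), waveGauss_mul_waveGauss, ← mul_sub, dist_zero_right]
    have hc1 : Continuous fun p : (ℝ × ℝ) × (ℝ × ℝ) =>
        weightedCharFun (P n) (W n) (V₁ n) (V₂ n) (θ₁ * (p.1.1 + p.1.2 + s₁))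
          (θ₂ * (p.2.1 + p.2.2 + s₂)) :=
      (continuous_weightedCharFun (h.integrable_weight n) (h.measurable_fst n)
        (h.measurable_snd n)).comp (by fun_prop : Continuous fun p : (ℝ × ℝ) × (ℝ × ℝ) =>
          (((θ₁ : ℝ) * (p.1.1 + p.1.2 + s₁), (θ₂ : ℝ) * (p.2.1 + p.2.2 + s₂)) : ℝ × ℝ))
    have hph := continuous_wavePhase θ₁ θ₂ b₁ b₂
    have hi1 : Integrable (fun p : (ℝ × ℝ) × (ℝ × ℝ) => wavePhase θ₁ θ₂ b₁ b₂ p *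
        weightedCharFun (P n) (W n) (V₁ n) (V₂ n) (θ₁ * (p.1.1 + p.1.2 + s₁))
          (θ₂ * (p.2.1 + p.2.2 + s₂))) (squareMeasure.prod squareMeasure) := by
      refine Integrable.of_bound (hph.mul hc1).aestronglyMeasurable
        (1 / 16 * ∫ x, |W n x| ∂P n) (ae_of_all _ fun p => ?_)
      rw [norm_mul, norm_wavePhase]
      gcongr
      exact norm_weightedCharFun_le _ _
    have hi2 : Integrable (fun p : (ℝ × ℝ) × (ℝ × ℝ) => wavePhase θ₁ θ₂ b₁ b₂ p *
        (Real.exp (-(L n / 2 * (θ₁ * (p.1.1 + p.1.2 + s₁)) ^ 2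
          + L n / 2 * (θ₂ * (p.2.1 + p.2.2 + s₂)) ^ 2)) : ℂ))
          (squareMeasure.prod squareMeasure) := by
      refine Integrable.of_bound (Continuous.aestronglyMeasurable (by fun_prop))
        (1 / 16 * 1) (ae_of_all _ fun p => ?_)
      rw [norm_mul, norm_wavePhase, Complex.norm_real, Real.norm_eq_abs, Real.abs_exp]
      gcongr
      exact Real.exp_le_one_iff.2 (neg_nonpos.2 (by positivity))
    rw [← integral_sub hi1 hi2, norm_mul, Complex.norm_real, Real.norm_eq_abs,
      abs_of_nonneg (by positivity)]
    have hb : ‖∫ p, (wavePhase θ₁ θ₂ b₁ b₂ p *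
        weightedCharFun (P n) (W n) (V₁ n) (V₂ n) (θ₁ * (p.1.1 + p.1.2 + s₁))
          (θ₂ * (p.2.1 + p.2.2 + s₂)) - wavePhase θ₁ θ₂ b₁ b₂ p *
        (Real.exp (-(L n / 2 * (θ₁ * (p.1.1 + p.1.2 + s₁)) ^ 2
          + L n / 2 * (θ₂ * (p.2.1 + p.2.2 + s₂)) ^ 2)) : ℂ)) ∂(squareMeasure.prod squareMeasure)‖
        ≤ ∫ p, ε / K * (1 / 16) * Real.exp (-(1 / 4 * L n * (θ₁ * (p.1.1 + p.1.2 + s₁)) ^ 2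
          + 1 / 4 * L n * (θ₂ * (p.2.1 + p.2.2 + s₂)) ^ 2)) ∂(squareMeasure.prod squareMeasure) := by
      refine norm_integral_le_of_norm_le ?_ ?_
      · refine Integrable.const_mul ?_ _
        refine Integrable.of_bound (Continuous.aestronglyMeasurable (by fun_prop))
          1 (ae_of_all _ fun p => ?_)
        rw [Real.norm_eq_abs, Real.abs_exp]
        exact Real.exp_le_one_iff.2 (neg_nonpos.2 (by positivity))
      · filter_upwards [ae_prod_squareMeasure_abs_le hθ₁ hθ₂ s₁ s₂] with p hp
        rw [← mul_sub, norm_mul, norm_wavePhase]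
        have := hn _ _ hp.1 hp.2
        calc _ ≤ 1 / 16 * (ε / K * _) := by gcongr
          _ = _ := by ring
    rw [integral_const_mul] at hb
    have hJ := sq_sum_integral_square_le hθ₁ hθ₂ (c := 1 / 4) (by norm_num) hLn s₁ s₂
    set J := ∫ p, Real.exp (-(1 / 4 * L n * (θ₁ * (p.1.1 + p.1.2 + s₁)) ^ 2
          + 1 / 4 * L n * (θ₂ * (p.2.1 + p.2.2 + s₂)) ^ 2)) ∂(squareMeasure.prod squareMeasure)
    calc _ ≤ (√(L n) ^ θ₁ * √(L n) ^ θ₂) * (ε / K * (1 / 16) * J) := by gcongr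
      _ = ε / K * (1 / 16) * ((√(L n) ^ θ₁ * √(L n) ^ θ₂) * J) := by ring
      _ ≤ ε / K * (1 / 16) * K := by gcongr
      _ < ε := by
        rw [show ε / K * (1 / 16) * K = ε / 16 by field_simp]
        linarith
  have := hdiff.add hG
  rw [zero_add] at this
  refine this.congr fun n => ?_
  simp only [Function.comp]
  ring

/-- The kernel `h(v) e^{isv}`, where `h` is the band-limited kernel. -/
def bandWave (s v : ℝ) : ℂ := (bandKernel v : ℂ) * Complex.exp ((s * v : ℝ) * Complex.I)

/-- The limiting mass of `bandWave`. -/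
def bandMass (s : ℝ) : ℂ := ((√(2 * Real.pi))⁻¹ : ℝ) * ∫ v, bandWave s v

lemma bandWave_eq (s v : ℝ) : bandWave s v = waveKernel 1 0 s v + waveKernel 1 1 s v := by
  simp only [bandWave, bandKernel, waveKernel]
  push_cast
  ring_nf

lemma norm_bandWave_le (s v : ℝ) : ‖bandWave s v‖ ≤ 2 := by
  rw [bandWave_eq]
  refine (norm_add_le _ _).trans ?_
  linarith [norm_waveKernel_le 1 0 s v, norm_waveKernel_le 1 1 s v]

lemma continuous_bandWave (s : ℝ) : Continuous (bandWave s) := by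
  have := continuous_bandKernel
  unfold bandWave
  fun_prop

lemma bandMass_eq (s : ℝ) : bandMass s = waveMass 1 0 s + waveMass 1 1 s := by
  simp only [bandMass, waveMass, one_ne_zero, if_false, bandWave_eq]
  rw [integral_add (integrable_waveKernel 0 s) (integrable_waveKernel 1 s), mul_add]

/-- The kernel is real. This symmetry makes the limits of the cosine and sine twists real in
`tendsto_twisted_expTail`. -/
lemma bandMass_neg (s : ℝ) : bandMass (-s) = starRingEnd ℂ (bandMass s) := by
  unfold bandMass
  rw [map_mul, Complex.conj_ofReal, ← integral_conj]
  congr 2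
  ext v
  unfold bandWave
  rw [map_mul, Complex.conj_ofReal, ← Complex.exp_conj, map_mul, Complex.conj_I,
    Complex.conj_ofReal]
  push_cast
  ring_nf

lemma integral_linear_combination_three {X : Type*} [MeasurableSpace X] {μ : Measure X}
    {f₀ f₁ f₂ : X → ℂ} (h₀ : Integrable f₀ μ) (h₁ : Integrable f₁ μ) (h₂ : Integrable f₂ μ)
    (c₀ c₁ c₂ : ℂ) : c₀ * ∫ x, f₀ x ∂μ + c₁ * ∫ x, f₁ x ∂μ + c₂ * ∫ x, f₂ x ∂μ =
      ∫ x, (c₀ * f₀ x + c₁ * f₁ x + c₂ * f₂ x) ∂μ := by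
  rw [← integral_const_mul, ← integral_const_mul, ← integral_const_mul,
    ← integral_add (h₀.const_mul c₀) (h₁.const_mul c₁)]
  exact (integral_add ((h₀.const_mul c₀).add (h₁.const_mul c₁)) (h₂.const_mul c₂)).symm

lemma integral_add_four {X : Type*} [MeasurableSpace X] {μ : Measure X}
    {f₀ f₁ f₂ f₃ : X → ℂ} (h₀ : Integrable f₀ μ) (h₁ : Integrable f₁ μ) (h₂ : Integrable f₂ μ)
    (h₃ : Integrable f₃ μ) :
    (∫ x, f₀ x ∂μ + ∫ x, f₁ x ∂μ) + (∫ x, f₂ x ∂μ + ∫ x, f₃ x ∂μ) =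
      ∫ x, ((f₀ x + f₁ x) + (f₂ x + f₃ x)) ∂μ := by
  rw [← integral_add h₀ h₁, ← integral_add h₂ h₃]
  exact (integral_add (h₀.add h₁) (h₂.add h₃)).symm

/-- Twisting a weight by `1 + cos(s u)` or `1 + sin(s u)` keeps it nonnegative, and reduces
complex weights `e^{isu}` to nonnegative ones. -/
lemma tendsto_twisted_expTail {w U V : ∀ n, S n → ℝ} (hw : ∀ n, Measurable (w n))
    (hw0 : ∀ n x, 0 ≤ w n x) (hwi : ∀ n, Integrable (w n) (P n)) (hU : ∀ n, Measurable (U n))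
    (hV : ∀ n, Measurable (V n)) {A : ℝ → ℂ} (hA : ∀ s, A (-s) = starRingEnd ℂ (A s))
    (h : ∀ s₁ s₂ : ℝ, Tendsto (fun n => ∫ x, (w n x : ℂ) *
      Complex.exp ((s₂ * U n x : ℝ) * Complex.I) * bandWave s₁ (V n x) ∂P n) atTop
      (𝓝 (A s₂ * bandMass s₁)))
    {γ : ℝ} (hγ : 0 < γ) (b s : ℝ) :
    Tendsto (fun n => ∫ x, (w n x : ℂ) * Complex.exp ((s * U n x : ℝ) * Complex.I) *
      (expTail γ b (V n x) : ℂ) ∂P n) atTop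
      (𝓝 (A s * ((√(2 * Real.pi))⁻¹ * (Real.exp (-γ * b) / γ) : ℝ))) := by
  have hexp : ∀ (s₁ s₂ : ℝ) n, Integrable (fun x => (w n x : ℂ) *
      Complex.exp ((s₂ * U n x : ℝ) * Complex.I) * bandWave s₁ (V n x)) (P n) := by
    intro s₁ s₂ n
    have h1 : Integrable (fun x => (w n x : ℂ)) (P n) := (hwi n).ofReal
    have hU' := hU n
    have h2 := (h1.mul_bdd (c := 1) (g := fun x => Complex.exp ((s₂ * U n x : ℝ) * Complex.I))
      (Measurable.aestronglyMeasurable (by fun_prop)) (ae_of_all _ fun x => by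
        rw [Complex.norm_exp_ofReal_mul_I]))
    exact h2.mul_bdd (c := 2) ((continuous_bandWave s₁).measurable.comp (hV n)).aestronglyMeasurable
      (ae_of_all _ fun x => norm_bandWave_le _ _)
  have hA0 : (A 0).im = 0 := by
    have := hA 0
    rw [neg_zero] at this
    exact Complex.conj_eq_iff_im.1 this.symm
  -- a real trigonometric twist
  have key : ∀ (T : ℝ → ℝ) (c₀ c₁ c₂ : ℂ) (G : ℝ), Continuous T → (∀ u, 0 ≤ T u ∧ T u ≤ 2) →
      (∀ u, (T u : ℂ) = c₀ * Complex.exp ((0 * u : ℝ) * Complex.I) +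
        c₁ * Complex.exp ((s * u : ℝ) * Complex.I) + c₂ * Complex.exp (((-s) * u : ℝ) * Complex.I)) →
      (G : ℂ) = c₀ * A 0 + c₁ * A s + c₂ * A (-s) →
      Tendsto (fun n => ∫ x, w n x * T (U n x) * expTail γ b (V n x) ∂P n) atTop
        (𝓝 (G * ((√(2 * Real.pi))⁻¹ * (Real.exp (-γ * b) / γ)))) := by
    intro T c₀ c₁ c₂ G hT hT2 hTe hG
    rw [← mul_assoc]
    refine tendsto_integral_expTail (w := fun n x => w n x * T (U n x))
      (fun n => (hw n).mul (hT.measurable.comp (hU n)))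
      (fun n x => mul_nonneg (hw0 n x) (hT2 _).1)
      (fun n => (hwi n).mul_bdd (c := 2) (hT.measurable.comp (hU n)).aestronglyMeasurable
        (ae_of_all _ fun x => by
          rw [Real.norm_eq_abs, abs_of_nonneg (hT2 _).1]; exact (hT2 _).2))
      hV (fun s₁ => ?_) hγ b
    have hlim := (((h s₁ 0).const_mul c₀).add ((h s₁ s).const_mul c₁)).add
      ((h s₁ (-s)).const_mul c₂)
    have e2 : c₀ * (A 0 * bandMass s₁) + c₁ * (A s * bandMass s₁) + c₂ * (A (-s) * bandMass s₁) =
        ((G * (√(2 * Real.pi))⁻¹ : ℝ) : ℂ) *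
          ∫ y, (bandKernel y : ℂ) * Complex.exp ((s₁ * y : ℝ) * Complex.I) := by
      have : bandMass s₁ = ((√(2 * Real.pi))⁻¹ : ℝ) *
          ∫ y, (bandKernel y : ℂ) * Complex.exp ((s₁ * y : ℝ) * Complex.I) := rfl
      rw [Complex.ofReal_mul, hG, mul_assoc, ← this]
      ring
    rw [e2] at hlim
    refine hlim.congr fun n => ?_
    rw [integral_linear_combination_three (hexp s₁ 0 n) (hexp s₁ s n) (hexp s₁ (-s) n)]
    refine integral_congr_ae (ae_of_all _ fun x => ?_)
    simp only [Complex.ofReal_mul (w n x) (T (U n x)), hTe, bandWave]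
    ring
  have hI2 : Complex.I ^ 2 = -1 := Complex.I_sq
  -- Three nonnegative twists, recombined at the end through `e^{iu} = (1 + cos u) + i (1 + sin u) -
  -- (1 + i)`.
  have k0 := key (fun _ => 1) 1 0 0 (A 0).re continuous_const (fun u => by norm_num)
    (fun u => by simp) (by
      rw [zero_mul, zero_mul, add_zero, add_zero, one_mul]
      exact Complex.ext (by simp) (by simp [hA0]))
  have k1 := key (fun u => 1 + Real.cos (s * u)) 1 (1 / 2) (1 / 2) ((A 0).re + (A s).re)
    (by fun_prop) (fun u => by
      have h1 := Real.cos_le_one (s * u)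
      have h2 := Real.neg_one_le_cos (s * u)
      constructor <;> linarith)
    (fun u => by
      push_cast
      rw [zero_mul, zero_mul, Complex.exp_zero, Complex.cos]
      ring_nf)
    (by
      rw [hA s]
      refine Complex.ext ?_ ?_
      · simp; ring
      · simp [hA0])
  have k2 := key (fun u => 1 + Real.sin (s * u)) 1 (-Complex.I / 2) (Complex.I / 2)
    ((A 0).re + (A s).im)
    (by fun_prop) (fun u => by
      have h1 := Real.sin_le_one (s * u)
      have h2 := Real.neg_one_le_sin (s * u)
      constructor <;> linarith)
    (fun u => by
      push_cast
      rw [zero_mul, zero_mul, Complex.exp_zero, Complex.sin]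
      ring_nf)
    (by
      rw [hA s]
      refine Complex.ext ?_ ?_
      · simp; ring
      · simp [hA0]; ring)
  set D : ℝ := (√(2 * Real.pi))⁻¹ * (Real.exp (-γ * b) / γ)
  have hre : ∀ (x : ℝ), Tendsto (fun r : ℝ => (r : ℂ)) (𝓝 x) (𝓝 (x : ℂ)) := fun x =>
    Complex.continuous_ofReal.tendsto x
  have hfin := (((hre _).comp k1).add (((hre _).comp k2).const_mul Complex.I)).sub
    (((hre _).comp k0).const_mul (1 + Complex.I))
  have e1 : ((((A 0).re + (A s).re) * D : ℝ) : ℂ) + Complex.I * ((((A 0).re + (A s).im) * D : ℝ) : ℂ)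
      - (1 + Complex.I) * (((A 0).re * D : ℝ) : ℂ) = A s * (D : ℂ) := by
    conv_rhs => rw [← Complex.re_add_im (A s)]
    push_cast
    ring
  rw [e1] at hfin
  have htail : ∀ (T : ℝ → ℝ), Continuous T → (∀ u, |T u| ≤ 2) → ∀ n,
      Integrable (fun x => w n x * T (U n x) * expTail γ b (V n x)) (P n) := by
    intro T hT hT2 n
    have h1 := (hwi n).mul_bdd (c := 2) (hT.measurable.comp (hU n)).aestronglyMeasurable
      (ae_of_all _ fun x => hT2 (U n x))
    refine h1.mul_bdd (c := Real.exp (-γ * b))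
      ((measurable_expTail γ b).comp (hV n)).aestronglyMeasurable (ae_of_all _ fun x => ?_)
    rw [Real.norm_eq_abs, abs_of_nonneg (expTail_nonneg _ _ _)]
    unfold expTail
    refine indicator_le' (fun v hv => ?_) (fun v hv => (Real.exp_pos _).le) _
    exact Real.exp_le_exp.2 (by nlinarith [show b ≤ v from hv])
  refine hfin.congr fun n => ?_
  have i0 := (htail (fun _ => 1) continuous_const (fun u => by norm_num) n).ofReal (𝕜 := ℂ)
  have i1 := (htail (fun u => 1 + Real.cos (s * u)) (by fun_prop) (fun u => by
      have h1 := Real.cos_le_one (s * u)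
      have h2 := Real.neg_one_le_cos (s * u)
      rw [abs_le]; constructor <;> linarith) n).ofReal (𝕜 := ℂ)
  have i2 := (htail (fun u => 1 + Real.sin (s * u)) (by fun_prop) (fun u => by
      have h1 := Real.sin_le_one (s * u)
      have h2 := Real.neg_one_le_sin (s * u)
      rw [abs_le]; constructor <;> linarith) n).ofReal (𝕜 := ℂ)
  simp only [Function.comp]
  rw [← integral_complex_ofReal, ← integral_complex_ofReal, ← integral_complex_ofReal]
  have hcomb := integral_linear_combination_three i1 i2 i0 1 Complex.I (-(1 + Complex.I))
  rw [one_mul, neg_mul, ← sub_eq_add_neg] at hcomb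
  refine hcomb.trans (integral_congr_ae (ae_of_all _ fun x => ?_))
  simp only
  rw [Complex.exp_mul_I]
  simp only [Complex.coe_algebraMap, Complex.ofReal_mul, Complex.ofReal_add, Complex.ofReal_one,
    Complex.ofReal_cos, Complex.ofReal_sin]
  ring

/-- The test function attached to a mode: `1` in the trivial mode, a thick-point indicator in the
oscillating mode. -/
def modeFun (θ : ℕ) (γ b v : ℝ) : ℝ := if θ = 0 then 1 else expTail γ b v

/-- The limiting mass of `modeFun`. -/
def modeMass (θ : ℕ) (γ b : ℝ) : ℝ :=
  if θ = 0 then 1 else (√(2 * Real.pi))⁻¹ * (Real.exp (-γ * b) / γ)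

lemma modeFun_nonneg (θ : ℕ) (γ b v : ℝ) : 0 ≤ modeFun θ γ b v := by
  unfold modeFun
  split_ifs
  · exact zero_le_one
  · exact expTail_nonneg _ _ _

lemma measurable_modeFun (θ : ℕ) (γ b : ℝ) : Measurable (modeFun θ γ b) := by
  unfold modeFun
  split_ifs
  · exact measurable_const
  · exact measurable_expTail γ b

lemma expTail_le {γ : ℝ} (hγ : 0 < γ) (b v : ℝ) : expTail γ b v ≤ Real.exp (-γ * b) := by
  unfold expTail
  refine indicator_le' (fun v hv => ?_) (fun v hv => (Real.exp_pos _).le) _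
  exact Real.exp_le_exp.2 (by nlinarith [show b ≤ v from hv])

/-- Local limit theorem: the weighted pairs integrate `e^{-γ v} 1{v ≥ b}` in either variable as
`(2πL)^{-1/2}` times Lebesgue measure does. -/
lemma GaussianFrequencies.tendsto_modeFun [∀ n, SFinite (P n)]
    (h : GaussianFrequencies P W V₁ V₂ L) {θ₁ θ₂ : ℕ} (hθ₁ : θ₁ = 0 ∨ θ₁ = 1)
    (hθ₂ : θ₂ = 0 ∨ θ₂ = 1) {γ : ℝ} (hγ : 0 < γ) (b₁ b₂ : ℝ) :
    Tendsto (fun n => (√(L n) ^ θ₁ * √(L n) ^ θ₂) *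
      ∫ x, W n x * (modeFun θ₁ γ b₁ (V₁ n x) * modeFun θ₂ γ b₂ (V₂ n x)) ∂P n)
      atTop (𝓝 (modeMass θ₁ γ b₁ * modeMass θ₂ γ b₂)) := by
  have hwm : ∀ (c : ℕ → ℝ) n, Measurable fun x => c n * W n x := fun c n =>
    (h.measurable_weight n).const_mul _
  have hwi : ∀ (c : ℕ → ℝ) n, Integrable (fun x => c n * W n x) (P n) := fun c n =>
    (h.integrable_weight n).const_mul _
  rcases hθ₁ with rfl | rfl <;> rcases hθ₂ with rfl | rfl
  · have h1 := h.tendsto_waveKernel (Or.inl rfl) (Or.inl rfl) 0 0 0 0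
    simp only [waveKernel_zero, waveMass, if_true, mul_one, pow_zero, Complex.ofReal_one,
      one_mul] at h1
    simp only [modeFun, modeMass, if_true, mul_one, pow_zero, one_mul]
    have h2 := Complex.continuous_re.continuousAt.tendsto.comp h1
    refine (h2.congr fun n => ?_).trans_eq (by simp)
    simp only [Function.comp]
    rw [integral_complex_ofReal, Complex.ofReal_re]
  · simp only [modeFun, modeMass, if_true, one_ne_zero, if_false, pow_zero, pow_one, one_mul]
    have h1 := tendsto_integral_expTail (w := fun n x => √(L n) * W n x) (hwm _)
      (fun n x => mul_nonneg (Real.sqrt_nonneg _) (h.weight_nonneg n x)) (hwi _)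
      h.measurable_snd (G := (√(2 * Real.pi))⁻¹) (fun s => ?_) hγ b₂
    · refine h1.congr fun n => ?_
      rw [← integral_const_mul]
      simp only [mul_assoc]
    · have h2 := (h.tendsto_waveKernel (Or.inl rfl) (Or.inr rfl) 0 0 0 s).add
        (h.tendsto_waveKernel (Or.inl rfl) (Or.inr rfl) 0 1 0 s)
      simp only [waveKernel_zero, one_mul, pow_zero, pow_one] at h2
      have e : waveMass 0 0 0 = 1 := by simp [waveMass]
      rw [e, one_mul, one_mul, ← bandMass_eq] at h2
      refine h2.congr fun n => ?_
      rw [← mul_add, ← integral_add, ← integral_const_mul]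
      · refine integral_congr_ae (ae_of_all _ fun x => ?_)
        have := bandWave_eq s (V₂ n x)
        simp only [bandWave] at this
        simp only
        rw [this, Complex.ofReal_mul]
        ring
      · exact ((h.integrable_weight n).ofReal (𝕜 := ℂ)).mul_bdd (c := 1)
          ((continuous_waveKernel _ _ _).measurable.comp (h.measurable_snd n)).aestronglyMeasurable
          (ae_of_all _ fun x => norm_waveKernel_le _ _ _ _)
      · exact ((h.integrable_weight n).ofReal (𝕜 := ℂ)).mul_bdd (c := 1)
          ((continuous_waveKernel _ _ _).measurable.comp (h.measurable_snd n)).aestronglyMeasurable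
          (ae_of_all _ fun x => norm_waveKernel_le _ _ _ _)
  · simp only [modeFun, modeMass, if_true, one_ne_zero, if_false, pow_zero, pow_one, mul_one]
    have h1 := tendsto_integral_expTail (w := fun n x => √(L n) * W n x) (hwm _)
      (fun n x => mul_nonneg (Real.sqrt_nonneg _) (h.weight_nonneg n x)) (hwi _)
      h.measurable_fst (G := (√(2 * Real.pi))⁻¹) (fun s => ?_) hγ b₁
    · refine h1.congr fun n => ?_
      rw [← integral_const_mul]
      simp only [mul_assoc]
    · have h2 := (h.tendsto_waveKernel (Or.inr rfl) (Or.inl rfl) 0 0 s 0).add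
        (h.tendsto_waveKernel (Or.inr rfl) (Or.inl rfl) 1 0 s 0)
      simp only [waveKernel_zero, mul_one, pow_zero, pow_one] at h2
      have e : waveMass 0 0 0 = 1 := by simp [waveMass]
      rw [e, mul_one, mul_one, ← bandMass_eq] at h2
      refine h2.congr fun n => ?_
      rw [← mul_add, ← integral_add, ← integral_const_mul]
      · refine integral_congr_ae (ae_of_all _ fun x => ?_)
        have := bandWave_eq s (V₁ n x)
        simp only [bandWave] at this
        simp only
        rw [this, Complex.ofReal_mul]
        ring
      · exact ((h.integrable_weight n).ofReal (𝕜 := ℂ)).mul_bdd (c := 1)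
          ((continuous_waveKernel _ _ _).measurable.comp (h.measurable_fst n)).aestronglyMeasurable
          (ae_of_all _ fun x => norm_waveKernel_le _ _ _ _)
      · exact ((h.integrable_weight n).ofReal (𝕜 := ℂ)).mul_bdd (c := 1)
          ((continuous_waveKernel _ _ _).measurable.comp (h.measurable_fst n)).aestronglyMeasurable
          (ae_of_all _ fun x => norm_waveKernel_le _ _ _ _)
  -- Two passes. The tail is first inserted in `V₁`, with the weight multiplied by the kernel and a
  -- character of `V₂`; this gives the characteristic functions that a second pass in `V₂` needs,
  -- now with the tail of `V₁` in the weight.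
  · simp only [modeFun, modeMass, one_ne_zero, if_false, pow_one]
    have hband : ∀ s₁ s₂ : ℝ, Tendsto (fun n => ∫ x, ((√(L n) * √(L n) * W n x : ℝ) : ℂ) *
        (bandWave s₁ (V₁ n x) * bandWave s₂ (V₂ n x)) ∂P n) atTop
        (𝓝 (bandMass s₁ * bandMass s₂)) := by
      intro s₁ s₂
      have hint : ∀ b b' n, Integrable (fun x => (W n x : ℂ) *
          (waveKernel 1 b s₁ (V₁ n x) * waveKernel 1 b' s₂ (V₂ n x))) (P n) := by
        intro b b' n
        refine ((h.integrable_weight n).ofReal (𝕜 := ℂ)).mul_bdd (c := 1) ?_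
          (ae_of_all _ fun x => ?_)
        · exact (((continuous_waveKernel _ _ _).measurable.comp (h.measurable_fst n)).mul
            ((continuous_waveKernel _ _ _).measurable.comp
              (h.measurable_snd n))).aestronglyMeasurable
        · rw [norm_mul]
          exact mul_le_one₀ (norm_waveKernel_le _ _ _ _) (norm_nonneg _)
            (norm_waveKernel_le _ _ _ _)
      have h2 := ((h.tendsto_waveKernel (Or.inr rfl) (Or.inr rfl) 0 0 s₁ s₂).add
        (h.tendsto_waveKernel (Or.inr rfl) (Or.inr rfl) 0 1 s₁ s₂)).add
        ((h.tendsto_waveKernel (Or.inr rfl) (Or.inr rfl) 1 0 s₁ s₂).add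
        (h.tendsto_waveKernel (Or.inr rfl) (Or.inr rfl) 1 1 s₁ s₂))
      rw [bandMass_eq, bandMass_eq]
      rw [show (waveMass 1 0 s₁ + waveMass 1 1 s₁) * (waveMass 1 0 s₂ + waveMass 1 1 s₂) =
        waveMass 1 0 s₁ * waveMass 1 0 s₂ + waveMass 1 0 s₁ * waveMass 1 1 s₂ +
        (waveMass 1 1 s₁ * waveMass 1 0 s₂ + waveMass 1 1 s₁ * waveMass 1 1 s₂) by ring]
      refine h2.congr fun n => ?_
      rw [← mul_add, ← mul_add, ← mul_add, integral_add_four (hint _ _ n) (hint _ _ n) (hint _ _ n)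
        (hint _ _ n), ← integral_const_mul]
      refine integral_congr_ae (ae_of_all _ fun x => ?_)
      simp only [bandWave_eq, pow_one, Complex.ofReal_mul]
      ring
    -- first variable
    have hfst : ∀ s : ℝ, Tendsto (fun n => ∫ x, ((√(L n) * √(L n) * W n x *
        bandKernel (V₂ n x) : ℝ) : ℂ) * Complex.exp ((s * V₂ n x : ℝ) * Complex.I) *
        (expTail γ b₁ (V₁ n x) : ℂ) ∂P n) atTop
        (𝓝 (bandMass s * ((√(2 * Real.pi))⁻¹ * (Real.exp (-γ * b₁) / γ) : ℝ))) := by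
      intro s
      refine tendsto_twisted_expTail (w := fun n x => √(L n) * √(L n) * W n x *
        bandKernel (V₂ n x)) (fun n => ((hwm (fun n => √(L n) * √(L n)) n).mul
          (continuous_bandKernel.measurable.comp (h.measurable_snd n))))
        (fun n x => mul_nonneg (mul_nonneg (by positivity) (h.weight_nonneg n x))
          (bandKernel_pos _).le)
        (fun n => (hwi (fun n => √(L n) * √(L n)) n).mul_bdd (c := 2)
          (continuous_bandKernel.measurable.comp (h.measurable_snd n)).aestronglyMeasurable
          (ae_of_all _ fun x => by
            rw [Real.norm_eq_abs, abs_of_nonneg (bandKernel_pos _).le]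
            exact bandKernel_le_two _))
        h.measurable_snd h.measurable_fst bandMass_neg (fun s₁ s₂ => ?_) hγ b₁ s
      have h3 := hband s₁ s₂
      rw [mul_comm] at h3
      refine h3.congr fun n => integral_congr_ae (ae_of_all _ fun x => ?_)
      simp only [bandWave, Complex.ofReal_mul]
      ring
    have h4 := tendsto_integral_expTail
      (w := fun n x => √(L n) * √(L n) * W n x * expTail γ b₁ (V₁ n x))
      (fun n => (hwm (fun n => √(L n) * √(L n)) n).mul ((measurable_expTail γ b₁).comp (h.measurable_fst n)))
      (fun n x => mul_nonneg (mul_nonneg (by positivity) (h.weight_nonneg n x))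
        (expTail_nonneg _ _ _))
      (fun n => (hwi (fun n => √(L n) * √(L n)) n).mul_bdd (c := Real.exp (-γ * b₁))
        ((measurable_expTail γ b₁).comp (h.measurable_fst n)).aestronglyMeasurable
        (ae_of_all _ fun x => by
          rw [Real.norm_eq_abs, abs_of_nonneg (expTail_nonneg _ _ _)]
          exact expTail_le hγ _ _))
      h.measurable_snd
      (G := (√(2 * Real.pi))⁻¹ * (Real.exp (-γ * b₁) / γ) * (√(2 * Real.pi))⁻¹) (fun s => ?_) hγ b₂
    · rw [mul_assoc] at h4
      refine h4.congr fun n => ?_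
      rw [← integral_const_mul]
      simp only [mul_assoc]
    · have h5 := hfst s
      have e : bandMass s * ((√(2 * Real.pi))⁻¹ * (Real.exp (-γ * b₁) / γ) : ℝ) =
          (((√(2 * Real.pi))⁻¹ * (Real.exp (-γ * b₁) / γ) * (√(2 * Real.pi))⁻¹ : ℝ) : ℂ) *
          ∫ y, (bandKernel y : ℂ) * Complex.exp ((s * y : ℝ) * Complex.I) := by
        have : bandMass s = ((√(2 * Real.pi))⁻¹ : ℝ) *
          ∫ y, (bandKernel y : ℂ) * Complex.exp ((s * y : ℝ) * Complex.I) := rfl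
        rw [this]
        push_cast
        ring
      rw [e] at h5
      refine h5.congr fun n => integral_congr_ae (ae_of_all _ fun x => ?_)
      simp only [Complex.ofReal_mul]
      ring

end LocalLimit

/-! ## From real exponential moments to bounded test functions -/

/-- A small function with bounded second derivative has a small derivative. The bounds come from
Cauchy's estimate on unit circles, and the derivatives inherit the assumptions, so the statement can
be iterated. -/
lemma tendsto_deriv_zero_of_tendsto_real {F : ℕ → ℂ → ℂ} (hF : ∀ n, Differentiable ℂ (F n))
    (hb : ∀ R : ℝ, ∃ C : ℝ, ∀ᶠ n in atTop, ∀ z, ‖z‖ ≤ R → ‖F n z‖ ≤ C)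
    (h0 : ∀ t : ℝ, Tendsto (fun n => F n t) atTop (𝓝 0)) :
    (∀ R : ℝ, ∃ C : ℝ, ∀ᶠ n in atTop, ∀ z, ‖z‖ ≤ R → ‖deriv (F n) z‖ ≤ C) ∧
    ∀ t : ℝ, Tendsto (fun n => deriv (F n) t) atTop (𝓝 0) := by
  have hbd : ∀ G : ℕ → ℂ → ℂ, (∀ n, Differentiable ℂ (G n)) →
      (∀ R : ℝ, ∃ C : ℝ, ∀ᶠ n in atTop, ∀ z, ‖z‖ ≤ R → ‖G n z‖ ≤ C) →
      ∀ R : ℝ, ∃ C : ℝ, ∀ᶠ n in atTop, ∀ z, ‖z‖ ≤ R → ‖deriv (G n) z‖ ≤ C := by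
    intro G hG hGb R
    obtain ⟨C, hC⟩ := hGb (R + 1)
    refine ⟨C, ?_⟩
    filter_upwards [hC] with n hn z hz
    have := Complex.norm_deriv_le_of_forall_mem_sphere_norm_le (c := z) one_pos
      (hG n).diffContOnCl (C := C) (fun w hw => hn w ?_)
    · simpa using this
    · have h1 : ‖w - z‖ = 1 := by simpa [dist_eq_norm] using hw
      calc ‖w‖ = ‖(w - z) + z‖ := by ring_nf
        _ ≤ ‖w - z‖ + ‖z‖ := norm_add_le _ _
        _ ≤ R + 1 := by linarith
  have hb1 := hbd F hF hb
  have hF' : ∀ n, Differentiable ℂ (deriv (F n)) := fun n =>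
    ((hF n).contDiff (n := 2)).differentiable_deriv_two
  have hb2 := hbd (fun n => deriv (F n)) hF' hb1
  refine ⟨hb1, fun t => ?_⟩
  obtain ⟨C, hC⟩ := hb2 (|t| + 1)
  rw [Metric.tendsto_atTop]
  intro e he
  set C' : ℝ := |C| + 1
  have hC' : 0 < C' := by positivity
  -- Increment of the difference quotient: after division by `r`, the values at `t` and `t + r` and
  -- the second derivative contribute at most `e / 4` each.
  set r : ℝ := min 1 (e / (4 * C')) with hr
  have hr0 : 0 < r := lt_min one_pos (by positivity)
  have hr1 : r ≤ 1 := min_le_left _ _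
  have hre : r * C' ≤ e / 4 := by
    have : r ≤ e / (4 * C') := min_le_right _ _
    calc r * C' ≤ e / (4 * C') * C' := by gcongr
      _ = e / 4 := by field_simp
  have h1 := (tendsto_zero_iff_norm_tendsto_zero.1 (h0 (t + r))).eventually_lt_const
    (show (0 : ℝ) < r * e / 4 by positivity)
  have h2 := (tendsto_zero_iff_norm_tendsto_zero.1 (h0 t)).eventually_lt_const
    (show (0 : ℝ) < r * e / 4 by positivity)
  refine eventually_atTop.1 ?_
  filter_upwards [hC, h1, h2] with n hn hn1 hn2
  have hsecond : ∀ z ∈ Metric.closedBall (t : ℂ) r, ‖deriv (F n) z - deriv (F n) t‖ ≤ C' * r := by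
    intro z hz
    have hz' : ‖z - t‖ ≤ r := by simpa [dist_eq_norm] using hz
    have hm := (convex_closedBall (t : ℂ) r).norm_image_sub_le_of_norm_deriv_le (𝕜 := ℂ)
      (f := deriv (F n)) (C := C') (fun w _ => (hF' n).differentiableAt) (fun w hw => ?_)
      (Metric.mem_closedBall_self hr0.le) hz
    · exact hm.trans (by gcongr)
    · have hw' : ‖w - t‖ ≤ r := by simpa [dist_eq_norm] using hw
      refine (hn w ?_).trans ((le_abs_self C).trans (le_add_of_nonneg_right zero_le_one))
      calc ‖w‖ = ‖(w - t) + t‖ := by ring_nf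
        _ ≤ ‖w - t‖ + ‖(t : ℂ)‖ := norm_add_le _ _
        _ ≤ |t| + 1 := by rw [Complex.norm_real, Real.norm_eq_abs]; linarith
  have hmem : ((t + r : ℝ) : ℂ) ∈ Metric.closedBall (t : ℂ) r := by
    simp [dist_eq_norm, abs_of_pos hr0]
  have hd : ∀ z, HasDerivAt (fun z => F n z - z * deriv (F n) t)
      (deriv (F n) z - deriv (F n) t) z := fun z => by
    simpa using ((hF n).differentiableAt.hasDerivAt (x := z)).fun_sub
      ((hasDerivAt_id z).mul_const (deriv (F n) t))
  have hmv := (convex_closedBall (t : ℂ) r).norm_image_sub_le_of_norm_deriv_le (𝕜 := ℂ)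
      (f := fun z => F n z - z * deriv (F n) t) (C := C' * r)
      (fun w _ => (hd w).differentiableAt) (fun w hw => by
        rw [(hd w).deriv]; exact hsecond w hw) (Metric.mem_closedBall_self hr0.le) hmem
  have he1 : F n ((t + r : ℝ) : ℂ) - ((t + r : ℝ) : ℂ) * deriv (F n) t - (F n t - t * deriv (F n) t)
      = F n ((t + r : ℝ) : ℂ) - F n t - r * deriv (F n) t := by push_cast; ring
  rw [he1] at hmv
  have he2 : ‖((t + r : ℝ) : ℂ) - t‖ = r := by simp [abs_of_pos hr0]
  rw [he2] at hmv
  have he3 : r * ‖deriv (F n) t‖ ≤ r * e / 4 + r * e / 4 + C' * r * r := by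
    calc r * ‖deriv (F n) t‖ = ‖(r : ℂ) * deriv (F n) t‖ := by
          rw [norm_mul, Complex.norm_real, Real.norm_eq_abs, abs_of_pos hr0]
      _ = ‖F n ((t + r : ℝ) : ℂ) - F n t -
            (F n ((t + r : ℝ) : ℂ) - F n t - r * deriv (F n) t)‖ := by ring_nf
      _ ≤ ‖F n ((t + r : ℝ) : ℂ)‖ + ‖F n t‖ +
            ‖F n ((t + r : ℝ) : ℂ) - F n t - r * deriv (F n) t‖ :=
          (norm_sub_le _ _).trans (add_le_add_left (norm_sub_le _ _) _)
      _ ≤ _ := by linarith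
  rw [dist_zero_right]
  have he4 : r * ‖deriv (F n) t‖ ≤ r * (3 * e / 4) := by nlinarith
  have := le_of_mul_le_mul_left he4 hr0
  linarith

/-- A Vitali-type theorem: locally uniformly bounded entire functions that tend to zero on the real
line tend to zero on the complex plane. -/
lemma tendsto_zero_of_tendsto_real {F : ℕ → ℂ → ℂ} (hF : ∀ n, Differentiable ℂ (F n))
    (hb : ∀ R : ℝ, ∃ C : ℝ, ∀ᶠ n in atTop, ∀ z, ‖z‖ ≤ R → ‖F n z‖ ≤ C)
    (h0 : ∀ t : ℝ, Tendsto (fun n => F n t) atTop (𝓝 0)) (z : ℂ) :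
    Tendsto (fun n => F n z) atTop (𝓝 0) := by
  have hiter : ∀ k, (∀ n, Differentiable ℂ (iteratedDeriv k (F n))) ∧
      (∀ R : ℝ, ∃ C : ℝ, ∀ᶠ n in atTop, ∀ z, ‖z‖ ≤ R → ‖iteratedDeriv k (F n) z‖ ≤ C) ∧
      ∀ t : ℝ, Tendsto (fun n => iteratedDeriv k (F n) t) atTop (𝓝 0) := by
    intro k
    induction k with
    | zero =>
      simp only [iteratedDeriv_zero]
      exact ⟨hF, hb, h0⟩
    | succ k ih =>
      simp only [iteratedDeriv_succ]
      obtain ⟨h1, h2⟩ := tendsto_deriv_zero_of_tendsto_real ih.1 ih.2.1 ih.2.2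
      exact ⟨fun n => ((ih.1 n).contDiff (n := 2)).differentiable_deriv_two, h1, h2⟩
  -- The Taylor coefficients at the real point `0` tend to zero. Cauchy's estimate on a circle more
  -- than twice as large as `‖z‖` dominates the series by a geometric one.
  set R : ℝ := 2 * (‖z‖ + 1) with hR
  have hR0 : 0 < R := by positivity
  obtain ⟨C, hC⟩ := hb R
  have hser : ∀ n, HasSum (fun k : ℕ => (k.factorial : ℂ)⁻¹ • (z - 0) ^ k •
      iteratedDeriv k (F n) 0) (F n z) := fun n =>
    Complex.hasSum_taylorSeries_of_entire (hF n) 0 z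
  have hq : ‖z‖ / R < 1 := by
    rw [div_lt_one hR0]; linarith [norm_nonneg z]
  have hlim := tendsto_tsum_of_dominated_convergence (𝓕 := atTop)
    (f := fun n k => (k.factorial : ℂ)⁻¹ • (z - 0) ^ k • iteratedDeriv k (F n) 0)
    (g := fun _ => (0 : ℂ)) (bound := fun k => |C| * (‖z‖ / R) ^ k)
    ((summable_geometric_of_lt_one (by positivity) hq).mul_left _)
    (fun k => by
      have := (hiter k).2.2 0
      have h2 := (this.const_smul ((z - 0) ^ k)).const_smul ((k.factorial : ℂ)⁻¹)
      simpa using h2)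
    (by
      filter_upwards [hC] with n hn k
      have h1 := Complex.norm_iteratedDeriv_le_of_forall_mem_sphere_norm_le (c := 0) k hR0
        (hF n).diffContOnCl (C := C) (fun w hw => hn w (by simpa using hw.le))
      rw [sub_zero, norm_smul, norm_smul, norm_inv, norm_pow, Complex.norm_natCast]
      have hk : (0 : ℝ) < k.factorial := by exact_mod_cast k.factorial_pos
      calc (k.factorial : ℝ)⁻¹ * (‖z‖ ^ k * ‖iteratedDeriv k (F n) 0‖)
          ≤ (k.factorial : ℝ)⁻¹ * (‖z‖ ^ k * (k.factorial * C / R ^ k)) := by gcongr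
        _ = C * (‖z‖ / R) ^ k := by rw [div_pow]; field_simp
        _ ≤ |C| * (‖z‖ / R) ^ k := by gcongr; exact le_abs_self C)
  rw [tsum_zero] at hlim
  exact hlim.congr fun n => (hser n).tsum_eq

lemma exp_abs_le_add (u : ℝ) : Real.exp |u| ≤ Real.exp u + Real.exp (-u) := by
  rcases abs_cases u with ⟨h, _⟩ | ⟨h, _⟩ <;> rw [h] <;>
    linarith [Real.exp_pos u, Real.exp_pos (-u)]

/-- Differentiation under the integral: on the unit ball around `z` the derivative is at most `|D|
e^{(‖z‖ + 2)|U|}`, which the real moments of orders `±(‖z‖ + 2)` control. -/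
lemma differentiable_integral_mul_cexp {X : Type*} [MeasurableSpace X] {μ : Measure X}
    {D U : X → ℝ} (hD : AEStronglyMeasurable D μ) (hU : Measurable U)
    (hi : ∀ t : ℝ, Integrable (fun x => D x * Real.exp (t * U x)) μ) :
    Differentiable ℂ fun z : ℂ => ∫ x, (D x : ℂ) * Complex.exp (z * U x) ∂μ := by
  intro z
  have hDc : AEStronglyMeasurable (fun x => (D x : ℂ)) μ :=
    Complex.continuous_ofReal.comp_aestronglyMeasurable hD
  set b : X → ℝ := fun x => |D x| * Real.exp ((‖z‖ + 2) * U x) +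
    |D x| * Real.exp (-(‖z‖ + 2) * U x) with hbdef
  have hbi : Integrable b μ := by
    have h1 := (hi (‖z‖ + 2)).abs
    have h2 := (hi (-(‖z‖ + 2))).abs
    simp only [abs_mul, Real.abs_exp] at h1 h2
    exact h1.add h2
  have hbig : ∀ x, ∀ w ∈ Metric.ball z 1, ∀ c : ℝ, c ≤ Real.exp |U x| →
      |D x| * (c * ‖Complex.exp (w * U x)‖) ≤ b x := by
    intro x w hw c hc
    have hw' : ‖w‖ ≤ ‖z‖ + 1 := by
      have : ‖w - z‖ < 1 := by simpa [dist_eq_norm] using hw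
      calc ‖w‖ = ‖(w - z) + z‖ := by ring_nf
        _ ≤ ‖w - z‖ + ‖z‖ := norm_add_le _ _
        _ ≤ _ := by linarith
    have h1 : ‖Complex.exp (w * U x)‖ ≤ Real.exp ((‖z‖ + 1) * |U x|) := by
      rw [Complex.norm_exp]
      refine Real.exp_le_exp.2 ?_
      calc (w * (U x : ℂ)).re ≤ ‖w * (U x : ℂ)‖ := Complex.re_le_norm _
        _ = ‖w‖ * |U x| := by rw [norm_mul, Complex.norm_real, Real.norm_eq_abs]
        _ ≤ _ := by gcongr
    calc |D x| * (c * ‖Complex.exp (w * U x)‖)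
        ≤ |D x| * (Real.exp |U x| * Real.exp ((‖z‖ + 1) * |U x|)) := by gcongr
      _ = |D x| * Real.exp |(‖z‖ + 2) * U x| := by
          rw [← Real.exp_add, abs_mul, abs_of_pos (by positivity : 0 < ‖z‖ + 2)]
          ring_nf
      _ ≤ |D x| * (Real.exp ((‖z‖ + 2) * U x) + Real.exp (-((‖z‖ + 2) * U x))) := by
          gcongr; exact exp_abs_le_add _
      _ = b x := by simp only [hbdef]; ring_nf
  have hder := hasDerivAt_integral_of_dominated_loc_of_deriv_le (μ := μ) (𝕜 := ℂ)
    (F := fun (w : ℂ) x => (D x : ℂ) * Complex.exp (w * U x))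
    (F' := fun (w : ℂ) x => (D x : ℂ) * (Complex.exp (w * U x) * U x)) (x₀ := z)
    (bound := b) (Metric.ball_mem_nhds z one_pos) ?_ ?_ ?_ ?_ hbi ?_
  · exact hder.2.differentiableAt
  · refine Eventually.of_forall fun w => hDc.mul ?_
    exact Measurable.aestronglyMeasurable (by fun_prop)
  · refine hbi.mono' (hDc.mul (Measurable.aestronglyMeasurable (by fun_prop)))
      (ae_of_all _ fun x => ?_)
    rw [norm_mul, Complex.norm_real, Real.norm_eq_abs]
    simpa using hbig x z (Metric.mem_ball_self one_pos) 1 (Real.one_le_exp (abs_nonneg _))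
  · exact hDc.mul (Measurable.aestronglyMeasurable (by fun_prop))
  · refine ae_of_all _ fun x w hw => ?_
    rw [norm_mul, norm_mul, Complex.norm_real, Complex.norm_real, Real.norm_eq_abs,
      Real.norm_eq_abs, mul_comm ‖Complex.exp _‖]
    exact hbig x w hw _ ((Real.add_one_le_exp |U x|).trans' (by linarith))
  · refine ae_of_all _ fun x w hw => ?_
    have := ((hasDerivAt_id w).mul_const (U x : ℂ)).cexp
    simpa using this.const_mul (D x : ℂ)

section Laplace

variable {S : ℕ → Type v} [∀ n, MeasurableSpace (S n)] {P : ∀ n, Measure (S n)}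

/-- If the signed exponential moments tend to zero, then so do the signed characteristic
functions. -/
lemma tendsto_integral_mul_cexp_I {D U : ∀ n, S n → ℝ}
    (hD : ∀ n, AEStronglyMeasurable (D n) (P n)) (hU : ∀ n, Measurable (U n))
    (hi : ∀ n (t : ℝ), Integrable (fun x => D n x * Real.exp (t * U n x)) (P n))
    (hb : ∀ t : ℝ, ∃ C, ∀ᶠ n in atTop, ∫ x, |D n x| * Real.exp (t * U n x) ∂P n ≤ C)
    (h0 : ∀ t : ℝ, Tendsto (fun n => ∫ x, D n x * Real.exp (t * U n x) ∂P n) atTop (𝓝 0)) :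
    Tendsto (fun n => ∫ x, (D n x : ℂ) * Complex.exp (U n x * Complex.I) ∂P n) atTop (𝓝 0) := by
  -- Real exponential moments are the values of entire functions on the real line; the
  -- characteristic function is the value at `i`.
  have := tendsto_zero_of_tendsto_real
    (F := fun n z => ∫ x, (D n x : ℂ) * Complex.exp (z * U n x) ∂P n)
    (fun n => differentiable_integral_mul_cexp (hD n) (hU n) (hi n)) (fun R => ?_) (fun t => ?_)
    Complex.I
  · simpa [mul_comm] using this
  · obtain ⟨C₁, h1⟩ := hb R
    obtain ⟨C₂, h2⟩ := hb (-R)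
    refine ⟨C₁ + C₂, ?_⟩
    filter_upwards [h1, h2] with n hn1 hn2 z hz
    have ha : ∀ t, Integrable (fun x => |D n x| * Real.exp (t * U n x)) (P n) := fun t => by
      simpa [abs_mul] using (hi n t).abs
    refine (norm_integral_le_of_norm_le ((ha R).add (ha (-R))) (ae_of_all _ fun x => ?_)).trans ?_
    · rw [norm_mul, Complex.norm_real, Real.norm_eq_abs, Pi.add_apply, ← mul_add]
      gcongr
      rw [Complex.norm_exp]
      have h3 : (z * (U n x : ℂ)).re ≤ |R * U n x| := by
        calc (z * (U n x : ℂ)).re ≤ ‖z * (U n x : ℂ)‖ := Complex.re_le_norm _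
          _ = ‖z‖ * |U n x| := by rw [norm_mul, Complex.norm_real, Real.norm_eq_abs]
          _ ≤ R * |U n x| := by gcongr
          _ ≤ |R * U n x| := by rw [abs_mul]; gcongr; exact le_abs_self R
      refine (Real.exp_le_exp.2 h3).trans ((exp_abs_le_add _).trans_eq ?_)
      ring_nf
    · rw [integral_add' (ha R) (ha (-R))]
      exact add_le_add hn1 hn2
  · have h1 := (Complex.continuous_ofReal.tendsto _).comp (h0 t)
    refine (h1.congr fun n => ?_).trans_eq (by simp)
    simp only [Function.comp]
    rw [← integral_complex_ofReal]
    refine integral_congr_ae (ae_of_all _ fun x => ?_)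
    simp

/-- If the signed joint exponential moments of a random vector tend to zero, then so do its signed
expectations of smooth compactly supported functions. -/
lemma tendsto_integral_mul_of_tendsto_exp {q : ℕ} {D : ∀ n, S n → ℝ}
    {Y : ∀ n, S n → EuclideanSpace ℝ (Fin q)} [∀ n, SFinite (P n)]
    (hD : ∀ n, AEStronglyMeasurable (D n) (P n)) (hY : ∀ n, Measurable (Y n))
    (hi : ∀ n (ξ : EuclideanSpace ℝ (Fin q)),
      Integrable (fun x => D n x * Real.exp (inner ℝ ξ (Y n x))) (P n))
    (hb : ∀ ξ : EuclideanSpace ℝ (Fin q), ∃ C, ∀ᶠ n in atTop,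
      ∫ x, |D n x| * Real.exp (inner ℝ ξ (Y n x)) ∂P n ≤ C)
    (h0 : ∀ ξ : EuclideanSpace ℝ (Fin q),
      Tendsto (fun n => ∫ x, D n x * Real.exp (inner ℝ ξ (Y n x)) ∂P n) atTop (𝓝 0))
    {Φ : EuclideanSpace ℝ (Fin q) → ℝ} (hΦ : ContDiff ℝ ∞ Φ) (hΦc : HasCompactSupport Φ) :
    Tendsto (fun n => ∫ x, D n x * Φ (Y n x) ∂P n) atTop (𝓝 0) := by
  have hcf : ∀ ξ : EuclideanSpace ℝ (Fin q), Tendsto (fun n => ∫ x, (D n x : ℂ) *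
      Complex.exp (((inner ℝ ξ (Y n x) : ℝ) : ℂ) * Complex.I) ∂P n) atTop (𝓝 0) := by
    intro ξ
    refine tendsto_integral_mul_cexp_I hD (U := fun n x => inner ℝ ξ (Y n x))
      (fun n => (continuous_const.inner continuous_id).measurable.comp (hY n)) ?_ ?_ ?_
    · intro n t; simpa [inner_smul_left] using hi n (t • ξ)
    · intro t; simpa [inner_smul_left] using hb (t • ξ)
    · intro t; simpa [inner_smul_left] using h0 (t • ξ)
  have hDi : ∀ n, Integrable (D n) (P n) := fun n => by simpa using hi n 0
  have hΦC : ContDiff ℝ ∞ fun y => (Φ y : ℂ) := Complex.ofRealCLM.contDiff.comp hΦ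
  have hΦCc : HasCompactSupport fun y => (Φ y : ℂ) := hΦc.comp_left (g := fun r : ℝ => (r : ℂ))
    (by simp)
  set φ : SchwartzMap (EuclideanSpace ℝ (Fin q)) ℂ := hΦCc.toSchwartzMap hΦC with hφ
  set ψ : SchwartzMap (EuclideanSpace ℝ (Fin q)) ℂ := FourierTransform.fourier φ with hψ
  -- Fourier inversion writes `Φ` as a superposition of characters with an integrable weight, which
  -- reduces the claim to characteristic functions by dominated convergence.
  have hinv : ∀ y, (Φ y : ℂ) = ∫ w, Complex.exp ((inner ℝ ((2 * Real.pi) • w) y : ℝ) * Complex.I) *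
      ψ w := by
    intro y
    have h1 : FourierTransformInv.fourierInv ψ = φ := by
      simp [hψ]
    have h2 : (Φ y : ℂ) = (FourierTransformInv.fourierInv ψ : SchwartzMap _ ℂ) y := by
      rw [h1]; rfl
    rw [h2, SchwartzMap.fourierInv_coe, Real.fourierInv_eq']
    refine integral_congr_ae (ae_of_all _ fun w => ?_)
    simp only [smul_eq_mul, inner_smul_left]
    simp [mul_comm]
  have hswap : ∀ n, ∫ x, (D n x : ℂ) * (Φ (Y n x) : ℂ) ∂P n = ∫ w, ψ w * ∫ x, (D n x : ℂ) *
      Complex.exp (((inner ℝ ((2 * Real.pi) • w) (Y n x) : ℝ) : ℂ) * Complex.I) ∂P n := by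
    intro n
    simp_rw [hinv, ← integral_const_mul]
    rw [integral_integral_swap]
    · refine integral_congr_ae (ae_of_all _ fun w => integral_congr_ae (ae_of_all _ fun x => ?_))
      simp only
      ring
    · have h1 : Integrable (fun z : S n × EuclideanSpace ℝ (Fin q) => (D n z.1 : ℂ) * ψ z.2)
          ((P n).prod volume) := ((hDi n).ofReal (𝕜 := ℂ)).mul_prod ψ.integrable
      have hY' := hY n
      refine (h1.bdd_mul (c := 1) (f := fun z => Complex.exp
        (((inner ℝ ((2 * Real.pi) • z.2) (Y n z.1) : ℝ) : ℂ) * Complex.I))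
        (Measurable.aestronglyMeasurable ?_) (ae_of_all _ fun z => ?_)).congr
        (ae_of_all _ fun z => ?_)
      · have : Measurable fun z : S n × EuclideanSpace ℝ (Fin q) =>
            inner ℝ ((2 * Real.pi) • z.2) (Y n z.1) :=
          (by fun_prop : Measurable fun z : S n × EuclideanSpace ℝ (Fin q) =>
            (2 * Real.pi) • z.2).inner (hY'.comp measurable_fst)
        fun_prop
      · rw [Complex.norm_exp_ofReal_mul_I]
      · simp only [Function.uncurry]
        ring
  obtain ⟨C, hC⟩ := hb 0
  have hlim : Tendsto (fun n => ∫ x, (D n x : ℂ) * (Φ (Y n x) : ℂ) ∂P n) atTop (𝓝 0) := by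
    simp_rw [hswap]
    rw [show (0 : ℂ) = ∫ w, ψ w * 0 by simp]
    refine tendsto_integral_filter_of_dominated_convergence (fun w => ‖ψ w‖ * C) ?_ ?_
      (ψ.integrable.norm.mul_const C) (ae_of_all _ fun w => (hcf _).const_mul _)
    · refine Eventually.of_forall fun n => ψ.continuous.aestronglyMeasurable.mul ?_
      refine Continuous.aestronglyMeasurable ?_
      refine continuous_of_dominated (bound := fun x => |D n x|) ?_ ?_ (hDi n).abs ?_
      · intro w
        refine ((hDi n).ofReal (𝕜 := ℂ)).aestronglyMeasurable.mul
          (Measurable.aestronglyMeasurable ?_)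
        have : Measurable fun x => inner ℝ ((2 * Real.pi) • w) (Y n x) :=
          (continuous_const.inner continuous_id).measurable.comp (hY n)
        fun_prop
      · intro w
        refine ae_of_all _ fun x => ?_
        rw [norm_mul, Complex.norm_exp_ofReal_mul_I, mul_one, Complex.norm_real, Real.norm_eq_abs]
      · refine ae_of_all _ fun x => ?_
        fun_prop
    · filter_upwards [hC] with n hn
      refine ae_of_all _ fun w => ?_
      rw [norm_mul]
      gcongr
      refine (norm_integral_le_integral_norm _).trans (le_trans (le_of_eq ?_) hn)
      refine integral_congr_ae (ae_of_all _ fun x => ?_)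
      simp only
      rw [norm_mul, Complex.norm_exp_ofReal_mul_I, mul_one, Complex.norm_real, Real.norm_eq_abs]
      simp
  have h2 := Complex.continuous_re.continuousAt.tendsto.comp hlim
  refine (h2.congr fun n => ?_).trans_eq (by simp)
  simp only [Function.comp]
  rw [show (fun x => (D n x : ℂ) * (Φ (Y n x) : ℂ)) = fun x => ((D n x * Φ (Y n x) : ℝ) : ℂ) by
    ext x; push_cast; rfl, integral_complex_ofReal, Complex.ofReal_re]

end Laplace

/-! ## Exponential moments of the approximating fields -/

/-- The test function attached to a mode in upper bounds: `1` in the trivial mode, the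
band-limited kernel in the oscillating mode. -/
def bandMode (θ : ℕ) (v : ℝ) : ℝ := if θ = 0 then 1 else bandKernel v

lemma bandMode_nonneg (θ : ℕ) (v : ℝ) : 0 ≤ bandMode θ v := by
  unfold bandMode
  split_ifs
  · exact zero_le_one
  · exact (bandKernel_pos v).le

lemma bandMode_le_two (θ : ℕ) (v : ℝ) : bandMode θ v ≤ 2 := by
  unfold bandMode
  split_ifs
  · norm_num
  · exact bandKernel_le_two v

lemma measurable_bandMode (θ : ℕ) : Measurable (bandMode θ) := by
  unfold bandMode
  split_ifs
  · exact measurable_const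
  · exact continuous_bandKernel.measurable

/-- Unmodulated kernels are real. Equality holds in the oscillating mode; in the trivial mode both
kernels are `1` and a factor `2` is lost. -/
lemma bandMode_le_waveKernel {θ : ℕ} (hθ : θ = 0 ∨ θ = 1) (v : ℝ) :
    bandMode θ v ≤ (waveKernel θ 0 0 v).re + (waveKernel θ 1 0 v).re := by
  rcases hθ with rfl | rfl
  · simp [bandMode, waveKernel_zero]
  · have := bandWave_eq 0 v
    rw [← Complex.add_re, ← this]
    simp [bandMode, bandWave]

/-- A Gaussian bound on the characteristic function at bounded frequencies bounds the expectation
of the band-limited kernels. -/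
lemma integral_bandMode_le {S : Type*} [MeasurableSpace S] {P : Measure S} [SFinite P] {W : S → ℝ}
    (hW : Integrable W P) (hW0 : ∀ x, 0 ≤ W x) {v₁ v₂ : S → ℝ} (hv₁ : Measurable v₁)
    (hv₂ : Measurable v₂) {θ₁ θ₂ : ℕ} (hθ₁ : θ₁ = 0 ∨ θ₁ = 1) (hθ₂ : θ₂ = 0 ∨ θ₂ = 1)
    {B c L : ℝ} (hc : 0 < c) (hL : 0 < L)
    (h : ∀ t₁ t₂ : ℝ, |t₁| ≤ 2 → |t₂| ≤ 2 → ‖weightedCharFun P W v₁ v₂ t₁ t₂‖ ≤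
      B * Real.exp (-(c * L * t₁ ^ 2 + c * L * t₂ ^ 2))) :
    (√L ^ θ₁ * √L ^ θ₂) * ∫ x, W x * (bandMode θ₁ (v₁ x) * bandMode θ₂ (v₂ x)) ∂P ≤
      B * (4 + 2 * √(Real.pi / c)) ^ 2 := by
  have hbase : ∀ b₁ b₂ : ℝ, (√L ^ θ₁ * √L ^ θ₂) * ‖∫ x, (W x : ℂ) *
      (waveKernel θ₁ b₁ 0 (v₁ x) * waveKernel θ₂ b₂ 0 (v₂ x)) ∂P‖ ≤
      1 / 16 * B * (4 + 2 * √(Real.pi / c)) ^ 2 := by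
    intro b₁ b₂
    have hB : 0 ≤ B := by
      have := (norm_nonneg _).trans (h 0 0 (by simp) (by simp))
      simpa using this
    rw [integral_waveKernel_mul_waveKernel hW hv₁ hv₂]
    have h1 : ‖∫ p, wavePhase θ₁ θ₂ b₁ b₂ p *
        weightedCharFun P W v₁ v₂ (θ₁ * (p.1.1 + p.1.2 + 0)) (θ₂ * (p.2.1 + p.2.2 + 0))
        ∂(squareMeasure.prod squareMeasure)‖ ≤ ∫ p, 1 / 16 * B *
          Real.exp (-(c * L * (θ₁ * (p.1.1 + p.1.2 + 0)) ^ 2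
            + c * L * (θ₂ * (p.2.1 + p.2.2 + 0)) ^ 2)) ∂(squareMeasure.prod squareMeasure) := by
      refine norm_integral_le_of_norm_le ?_ ?_
      · refine Integrable.const_mul ?_ _
        refine Integrable.of_bound (Continuous.aestronglyMeasurable (by fun_prop))
          1 (ae_of_all _ fun p => ?_)
        rw [Real.norm_eq_abs, Real.abs_exp]
        exact Real.exp_le_one_iff.2 (neg_nonpos.2 (by positivity))
      · filter_upwards [ae_prod_squareMeasure_abs_le hθ₁ hθ₂ 0 0] with p hp
        simp only [abs_zero, add_zero] at hp
        rw [norm_mul, norm_wavePhase, mul_assoc]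
        simp only [add_zero]
        gcongr
        exact h _ _ hp.1 hp.2
    rw [integral_const_mul] at h1
    have hJ := sq_sum_integral_square_le hθ₁ hθ₂ hc hL 0 0
    set J := ∫ p, Real.exp (-(c * L * (θ₁ * (p.1.1 + p.1.2 + 0)) ^ 2
            + c * L * (θ₂ * (p.2.1 + p.2.2 + 0)) ^ 2)) ∂(squareMeasure.prod squareMeasure)
    calc _ ≤ (√L ^ θ₁ * √L ^ θ₂) * (1 / 16 * B * J) := by gcongr
      _ = 1 / 16 * B * ((√L ^ θ₁ * √L ^ θ₂) * J) := by ring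
      _ ≤ _ := by gcongr
  have hint : ∀ b b', Integrable (fun x => (W x : ℂ) *
      (waveKernel θ₁ b 0 (v₁ x) * waveKernel θ₂ b' 0 (v₂ x))) P := by
    intro b b'
    refine (hW.ofReal (𝕜 := ℂ)).mul_bdd (c := 1) ?_ (ae_of_all _ fun x => ?_)
    · exact (((continuous_waveKernel _ _ _).measurable.comp hv₁).mul
        ((continuous_waveKernel _ _ _).measurable.comp hv₂)).aestronglyMeasurable
    · rw [norm_mul]
      exact mul_le_one₀ (norm_waveKernel_le _ _ _ _) (norm_nonneg _) (norm_waveKernel_le _ _ _ _)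
  set Z : ℝ → ℝ → ℂ := fun b b' => ∫ x, (W x : ℂ) *
      (waveKernel θ₁ b 0 (v₁ x) * waveKernel θ₂ b' 0 (v₂ x)) ∂P with hZ
  have hreal : ∀ (θ : ℕ) (b v : ℝ), ((waveKernel θ b 0 v).re : ℂ) = waveKernel θ b 0 v := by
    intro θ b v
    unfold waveKernel
    rw [mul_zero, zero_mul, Complex.ofReal_zero, zero_mul, Complex.exp_zero, mul_one,
      Complex.ofReal_re]
  have hle : ∫ x, W x * (bandMode θ₁ (v₁ x) * bandMode θ₂ (v₂ x)) ∂P ≤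
      ‖Z 0 0‖ + ‖Z 0 1‖ + (‖Z 1 0‖ + ‖Z 1 1‖) := by
    have h1 : ∫ x, W x * (bandMode θ₁ (v₁ x) * bandMode θ₂ (v₂ x)) ∂P ≤
        ((Z 0 0 + Z 0 1) + (Z 1 0 + Z 1 1)).re := by
      simp only [hZ]
      rw [integral_add_four (hint _ _) (hint _ _) (hint _ _) (hint _ _)]
      have h2 : ∀ x, ((W x : ℂ) * (waveKernel θ₁ 0 0 (v₁ x) * waveKernel θ₂ 0 0 (v₂ x)) +
          (W x : ℂ) * (waveKernel θ₁ 0 0 (v₁ x) * waveKernel θ₂ 1 0 (v₂ x)) +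
          ((W x : ℂ) * (waveKernel θ₁ 1 0 (v₁ x) * waveKernel θ₂ 0 0 (v₂ x)) +
          (W x : ℂ) * (waveKernel θ₁ 1 0 (v₁ x) * waveKernel θ₂ 1 0 (v₂ x)))) =
          ((W x * (((waveKernel θ₁ 0 0 (v₁ x)).re + (waveKernel θ₁ 1 0 (v₁ x)).re) *
            ((waveKernel θ₂ 0 0 (v₂ x)).re + (waveKernel θ₂ 1 0 (v₂ x)).re)) : ℝ) : ℂ) := by
        intro x
        push_cast
        simp only [hreal]
        ring
      have h3 := ((hint 0 0).add (hint 0 1)).add ((hint 1 0).add (hint 1 1))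
      have h4 := (h3.congr (ae_of_all _ h2)).re
      simp only [RCLike.re_to_complex, Complex.ofReal_re] at h4
      simp_rw [h2]
      rw [integral_complex_ofReal, Complex.ofReal_re]
      refine integral_mono_of_nonneg (ae_of_all _ fun x => mul_nonneg (hW0 x)
        (mul_nonneg (bandMode_nonneg _ _) (bandMode_nonneg _ _))) h4 (ae_of_all _ fun x => ?_)
      exact mul_le_mul_of_nonneg_left (mul_le_mul (bandMode_le_waveKernel hθ₁ _)
        (bandMode_le_waveKernel hθ₂ _) (bandMode_nonneg _ _)
        ((bandMode_nonneg _ _).trans (bandMode_le_waveKernel hθ₁ _))) (hW0 x)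
    refine h1.trans ((Complex.re_le_norm _).trans ((norm_add_le _ _).trans ?_))
    exact add_le_add (norm_add_le _ _) (norm_add_le _ _)
  have hK : 0 ≤ B * (4 + 2 * √(Real.pi / c)) ^ 2 := by
    have := (hbase 0 0).trans' (mul_nonneg (by positivity) (norm_nonneg _))
    nlinarith
  calc _ ≤ (√L ^ θ₁ * √L ^ θ₂) * (‖Z 0 0‖ + ‖Z 0 1‖ + (‖Z 1 0‖ + ‖Z 1 1‖)) := by gcongr
    _ = (√L ^ θ₁ * √L ^ θ₂) * ‖Z 0 0‖ + (√L ^ θ₁ * √L ^ θ₂) * ‖Z 0 1‖ +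
        ((√L ^ θ₁ * √L ^ θ₂) * ‖Z 1 0‖ + (√L ^ θ₁ * √L ^ θ₂) * ‖Z 1 1‖) := by ring
    _ ≤ _ := by linarith [hbase 0 0, hbase 0 1, hbase 1 0, hbase 1 1]

namespace FieldApproximation

variable {Ω : Type u} [MetricSpace Ω] [MeasurableSpace Ω] {vol : Measure Ω} {T : Set (Ω → ℝ)}
  {𝕏 : LogCorrelatedField.{u, w} Ω vol T} (A : FieldApproximation.{u, v, w} 𝕏)

/-- The real exponential weight `exp(γ₁ X(x₁) + γ₂ X(x₂) + ∑ ξ_j X_{δ_j}(z_j))`. -/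
def weight (N : ℕ) (γ₁ γ₂ : ℝ) (x₁ x₂ : Ω) {q : ℕ} (ξ δ : Fin q → ℝ) (z : Fin q → Ω)
    (s : A.Sample N) : ℝ :=
  Real.exp (γ₁ * A.X N s x₁ + γ₂ * A.X N s x₂ + ∑ j, ξ j * A.smoothed N (δ j) s (z j))

/-- `∫ C(x, u) f(u) du` for `f = ∑ ξ_j ρ_{δ_j,z_j}`. -/
def potential {q : ℕ} (ξ δ : Fin q → ℝ) (z : Fin q → Ω) (x : Ω) : ℝ :=
  ∫ y, 𝕏.cov x y * A.comb ξ δ z y ∂vol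

/-- `∫∫ C(u, v) f(u) f(v) du dv` for `f = ∑ ξ_j ρ_{δ_j,z_j}`. -/
def energy {q : ℕ} (ξ δ : Fin q → ℝ) (z : Fin q → Ω) : ℝ :=
  ∫ p : Ω × Ω, 𝕏.cov p.1 p.2 * A.comb ξ δ z p.1 * A.comb ξ δ z p.2 ∂(vol.prod vol)

/-- The exponent of the Gaussian interaction between two points and a smooth test function. -/
def interaction (γ₁ γ₂ : ℝ) (x₁ x₂ : Ω) {q : ℕ} (ξ δ : Fin q → ℝ) (z : Fin q → Ω) : ℝ :=
  γ₁ * γ₂ * 𝕏.cov x₁ x₂ + γ₁ * A.potential ξ δ z x₁ + γ₂ * A.potential ξ δ z x₂ +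
    A.energy ξ δ z / 2

lemma cov_symm (x y : Ω) : 𝕏.cov x y = 𝕏.cov y x := by
  simp only [LogCorrelatedField.cov, logKernel, dist_comm x y, 𝕏.symm_h x y]

@[simp] lemma potential_zero (ξ δ : Fin 0 → ℝ) (z : Fin 0 → Ω) (x : Ω) :
    A.potential ξ δ z x = 0 := by
  simp [potential, comb]

@[simp] lemma energy_zero (ξ δ : Fin 0 → ℝ) (z : Fin 0 → Ω) : A.energy ξ δ z = 0 := by
  simp [energy, comb]

lemma potential_one (ξ δ : ℝ) (z x : Ω) :
    A.potential (q := 1) (fun _ => ξ) (fun _ => δ) (fun _ => z) x = ξ * A.cov₁ δ z x := by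
  simp only [potential, comb, cov₁, Finset.univ_unique, Finset.sum_singleton]
  rw [← integral_const_mul]
  refine integral_congr_ae (ae_of_all _ fun y => ?_)
  simp only [cov_symm x y]
  ring

lemma energy_one (ξ δ : ℝ) (z : Ω) :
    A.energy (q := 1) (fun _ => ξ) (fun _ => δ) (fun _ => z) = ξ ^ 2 * A.cov₂ δ δ z z := by
  simp only [energy, comb, cov₂, Finset.univ_unique, Finset.sum_singleton]
  rw [← integral_const_mul]
  refine integral_congr_ae (ae_of_all _ fun y => ?_)
  simp only
  ring

lemma gaussianFactor_ne_zero (N : ℕ) (ζ₁ ζ₂ : ℂ) (x₁ x₂ : Ω) {q : ℕ} (ξ δ : Fin q → ℝ)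
    (z : Fin q → Ω) : A.gaussianFactor N ζ₁ ζ₂ x₁ x₂ ξ δ z ≠ 0 :=
  mul_ne_zero (Complex.exp_ne_zero _) (Complex.exp_ne_zero _)

lemma integral_expVar (N : ℕ) (ζ₁ ζ₂ : ℂ) (x₁ x₂ : Ω) {q : ℕ} (ξ δ : Fin q → ℝ)
    (z : Fin q → Ω) : ∫ s, A.expVar N ζ₁ ζ₂ x₁ x₂ ξ δ z s ∂A.P N =
      A.Psi N ζ₁ ζ₂ x₁ x₂ ξ δ z * A.gaussianFactor N ζ₁ ζ₂ x₁ x₂ ξ δ z := by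
  rw [Psi, div_mul_cancel₀ _ (A.gaussianFactor_ne_zero N ζ₁ ζ₂ x₁ x₂ ξ δ z)]

/-- The characteristic function of the recentred fields at two points under an exponential
weight. -/
lemma weightedCharFun_weight (N : ℕ) (γ₁ γ₂ : ℝ) (x₁ x₂ : Ω) {q : ℕ} (ξ δ : Fin q → ℝ)
    (z : Fin q → Ω) (t₁ t₂ : ℝ) :
    weightedCharFun (A.P N) (A.weight N γ₁ γ₂ x₁ x₂ ξ δ z)
      (fun s => A.X N s x₁ - γ₁ * Real.log N) (fun s => A.X N s x₂ - γ₂ * Real.log N) t₁ t₂ =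
    A.Psi N (γ₁ + t₁ * Complex.I) (γ₂ + t₂ * Complex.I) x₁ x₂ ξ δ z *
      (Real.exp ((γ₁ ^ 2 + γ₂ ^ 2) / 2 * Real.log N) *
        Real.exp (A.interaction γ₁ γ₂ x₁ x₂ ξ δ z) *
        Real.exp (-(Real.log N / 2 * t₁ ^ 2 + Real.log N / 2 * t₂ ^ 2)) : ℝ) *
      Complex.exp ((-(t₁ * t₂) * 𝕏.cov x₁ x₂ : ℝ) +
        ((t₁ * γ₂ + t₂ * γ₁) * 𝕏.cov x₁ x₂ + t₁ * A.potential ξ δ z x₁ +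
          t₂ * A.potential ξ δ z x₂ : ℝ) * Complex.I) := by
  have h1 : ∀ s, (A.weight N γ₁ γ₂ x₁ x₂ ξ δ z s : ℂ) * Complex.exp
      ((t₁ * (A.X N s x₁ - γ₁ * Real.log N) + t₂ * (A.X N s x₂ - γ₂ * Real.log N) : ℝ) *
        Complex.I) =
      A.expVar N (γ₁ + t₁ * Complex.I) (γ₂ + t₂ * Complex.I) x₁ x₂ ξ δ z s *
        Complex.exp (-(t₁ * γ₁ + t₂ * γ₂) * Real.log N * Complex.I) := by
    intro s
    unfold weight expVar
    rw [Complex.ofReal_exp, ← Complex.exp_add, ← Complex.exp_add]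
    congr 1
    push_cast
    ring
  unfold weightedCharFun
  simp_rw [h1]
  rw [integral_mul_const, integral_expVar, mul_assoc (A.Psi _ _ _ _ _ _ _ _),
    mul_assoc (A.Psi _ _ _ _ _ _ _ _)]
  congr 1
  unfold gaussianFactor
  push_cast
  rw [← Complex.exp_add, ← Complex.exp_add, ← Complex.exp_add, ← Complex.exp_add,
    ← Complex.exp_add]
  congr 1
  simp only [interaction]
  change _ + (_ + _ * ((A.potential ξ δ z x₁ : ℝ) : ℂ) + _ * ((A.potential ξ δ z x₂ : ℝ) : ℂ) +
    _ * ((A.energy ξ δ z : ℝ) : ℂ)) + _ = _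
  push_cast
  have hI : Complex.I ^ 2 = -1 := Complex.I_sq
  ring_nf
  rw [hI]
  ring

variable {A} {d : ℕ} {Ψ : ℂ → Ω → ℂ}

lemma mem_stripInf {d : ℕ} {γ : ℝ} (h0 : 0 ≤ γ) (h1 : γ ≤ √(2 * d)) (t : ℝ) :
    (γ + t * Complex.I : ℂ) ∈ stripInf d := by
  simpa [stripInf, h0] using h1

lemma mem_stripR {d : ℕ} {γ : ℝ} (h0 : 0 ≤ γ) (h1 : γ ≤ √(2 * d)) {t R : ℝ} (ht : |t| ≤ R) :
    (γ + t * Complex.I : ℂ) ∈ stripR d R := by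
  simpa [stripR, h0, ht] using h1

lemma isCompact_stripR (d : ℕ) (R : ℝ) : IsCompact (stripR d R) := by
  have h : stripR d R = (Icc 0 √(2 * d)) ×ℂ (Icc (-R) R) := by
    ext ζ
    simp [stripR, Complex.mem_reProdIm, abs_le, and_assoc]
  rw [h]
  exact isCompact_Icc.reProdIm isCompact_Icc

lemma MesoscopicAssumption.exists_bound (hM : A.MesoscopicAssumption d Ψ) {K : Set Ω}
    (hK : IsCompact K) (R : ℝ) : ∃ C > 0, ∀ ζ ∈ stripR d R, ∀ x ∈ K, ‖Ψ ζ x‖ ≤ C := by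
  have hc : ContinuousOn (Function.uncurry Ψ) (stripR d R ×ˢ K) :=
    hM.continuous_limit.mono (prod_mono (fun ζ hζ => ⟨hζ.1, hζ.2.1⟩) (subset_univ _))
  obtain ⟨C, hC⟩ := ((isCompact_stripR d R).prod hK).exists_bound_of_continuousOn hc
  exact ⟨max C 1, by positivity, fun ζ hζ x hx => (hC (ζ, x) ⟨hζ, hx⟩).trans (le_max_left _ _)⟩

lemma MesoscopicAssumption.exists_lower_bound (hM : A.MesoscopicAssumption d Ψ) {K : Set Ω}
    (hK : IsCompact K) {γ : ℝ} (h0 : 0 ≤ γ) (h1 : γ ≤ √(2 * d)) :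
    ∃ c > 0, ∀ x ∈ K, c ≤ (Ψ γ x).re := by
  rcases K.eq_empty_or_nonempty with rfl | hne
  · exact ⟨1, one_pos, by simp⟩
  have hc : ContinuousOn (fun x => (Ψ γ x).re) K := by
    have h2 : ContinuousOn (fun x : Ω => ((γ : ℂ), x)) K := by fun_prop
    have := hM.continuous_limit.comp h2 (fun x _ => ⟨by simpa using mem_stripInf h0 h1 0, trivial⟩)
    exact Complex.continuous_re.comp_continuousOn this
  obtain ⟨x₀, hx₀, hmin⟩ := hK.exists_isMinOn hne hc
  exact ⟨_, (hM.limit_pos γ h0 h1 x₀).1, fun x hx => hmin hx⟩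

lemma MesoscopicAssumption.ofReal_re (hM : A.MesoscopicAssumption d Ψ) {γ : ℝ} (h0 : 0 ≤ γ)
    (h1 : γ ≤ √(2 * d)) (x : Ω) : (((Ψ γ x).re : ℝ) : ℂ) = Ψ γ x :=
  Complex.ext rfl (by simp [(hM.limit_pos γ h0 h1 x).2])

lemma weight_pos (N : ℕ) (γ₁ γ₂ : ℝ) (x₁ x₂ : Ω) {q : ℕ} (ξ δ : Fin q → ℝ)
    (z : Fin q → Ω) (s : A.Sample N) : 0 < A.weight N γ₁ γ₂ x₁ x₂ ξ δ z s := Real.exp_pos _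

lemma MesoscopicAssumption.integrable_weight (hM : A.MesoscopicAssumption d Ψ) {N : ℕ}
    (hN : 1 ≤ N) {γ₁ γ₂ : ℝ} (h₁ : 0 ≤ γ₁) (h₁' : γ₁ ≤ √(2 * d)) (h₂ : 0 ≤ γ₂)
    (h₂' : γ₂ ≤ √(2 * d)) {x₁ x₂ : Ω} (hx : x₁ ≠ x₂) {q : ℕ} (ξ δ : Fin q → ℝ)
    (z : Fin q → Ω) (hδ : ∀ j, δ j ∈ Ioc (0 : ℝ) 1) :
    Integrable (A.weight N γ₁ γ₂ x₁ x₂ ξ δ z) (A.P N) := by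
  have h := (hM.integrable N hN x₁ x₂ hx γ₁ (by simpa using mem_stripInf h₁ h₁' 0) γ₂
    (by simpa using mem_stripInf h₂ h₂' 0) q ξ δ z hδ).re
  refine h.congr (ae_of_all _ fun s => ?_)
  simp only [expVar, weight]
  rw [← Complex.ofReal_mul, ← Complex.ofReal_mul, ← Complex.ofReal_add, ← Complex.ofReal_add,
    ← Complex.ofReal_exp]
  exact Complex.ofReal_re _

lemma measurable_X_apply (N : ℕ) (x : Ω) : Measurable fun s => A.X N s x :=
  (A.measurable_X N).comp (measurable_id.prodMk measurable_const)

/-- Bound on the covariance kernel at mesoscopic distances. -/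
lemma exists_abs_cov_le {K : Set Ω} (hK : IsCompact K) (η : ℝ) (hη : η ≤ 1) :
    ∃ B > 0, ∀ N : ℕ, 1 ≤ N → ∀ x₁ ∈ K, ∀ x₂ ∈ K, (N : ℝ) ^ (η - 1) ≤ dist x₁ x₂ →
      |𝕏.cov x₁ x₂| ≤ (1 - η) * Real.log N + B := by
  obtain ⟨D, hD⟩ := (hK.prod hK).exists_bound_of_continuousOn 𝕏.continuous_h.continuousOn
  obtain ⟨D', hD'⟩ := Metric.isBounded_iff.1 hK.isBounded
  refine ⟨|D| + |Real.log (max D' 1)| + 1, by positivity, fun N hN x₁ hx₁ x₂ hx₂ hr => ?_⟩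
  have hN0 : (0 : ℝ) < N := by exact_mod_cast hN
  have hL : 0 ≤ Real.log N := Real.log_nonneg (by exact_mod_cast hN)
  have hpos : 0 < dist x₁ x₂ := (Real.rpow_pos_of_pos hN0 _).trans_le hr
  have h1 : |𝕏.h x₁ x₂| ≤ |D| := (hD (x₁, x₂) ⟨hx₁, hx₂⟩).trans (le_abs_self D)
  have h2 : (η - 1) * Real.log N ≤ Real.log (dist x₁ x₂) := by
    rw [← Real.log_rpow hN0]
    exact Real.log_le_log (Real.rpow_pos_of_pos hN0 _) hr
  have h3 : Real.log (dist x₁ x₂) ≤ Real.log (max D' 1) :=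
    Real.log_le_log hpos ((hD' hx₁ hx₂).trans (le_max_left _ _))
  have h4 := le_abs_self (Real.log (max D' 1))
  have h5 : 0 ≤ (1 - η) * Real.log N := mul_nonneg (by linarith) hL
  have h6 := abs_le.1 h1
  simp only [LogCorrelatedField.cov, logKernel]
  rw [abs_le]
  have h7 := abs_nonneg D
  have h8 := abs_nonneg (Real.log (max D' 1))
  constructor <;> linarith

/-- Upper bound for two-point exponential moments, with a gain of `(log N)^{-1/2}` for each
localized variable. -/
lemma MesoscopicAssumption.upper_bound (hM : A.MesoscopicAssumption d Ψ) {K : Set Ω}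
    (hK : IsCompact K) {η : ℝ} (hη : 0 < η) (hη1 : η ≤ 1) {γ₁ γ₂ : ℝ} (h₁ : 0 ≤ γ₁)
    (h₁' : γ₁ ≤ √(2 * d)) (h₂ : 0 ≤ γ₂) (h₂' : γ₂ ≤ √(2 * d)) {θ₁ θ₂ : ℕ}
    (hθ₁ : θ₁ = 0 ∨ θ₁ = 1) (hθ₂ : θ₂ = 0 ∨ θ₂ = 1) {q : ℕ} (ξ : Fin q → ℝ) :
    ∃ C > 0, ∀ᶠ N : ℕ in atTop, ∀ x₁ ∈ K, ∀ x₂ ∈ K, (N : ℝ) ^ (η - 1) ≤ dist x₁ x₂ →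
      ∀ (z : Fin q → Ω) (δ : Fin q → ℝ), (∀ j, z j ∈ K) →
      (∀ j, (N : ℝ) ^ (η - 1) ≤ δ j ∧ δ j ≤ 1) →
      (√(Real.log N) ^ θ₁ * √(Real.log N) ^ θ₂) * ∫ s, A.weight N γ₁ γ₂ x₁ x₂ ξ δ z s *
        (bandMode θ₁ (A.X N s x₁ - γ₁ * Real.log N) * bandMode θ₂ (A.X N s x₂ - γ₂ * Real.log N))
        ∂A.P N ≤ C * Real.exp ((γ₁ ^ 2 + γ₂ ^ 2) / 2 * Real.log N +
          A.interaction γ₁ γ₂ x₁ x₂ ξ δ z) := by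
  obtain ⟨B, hB, hcov⟩ := exists_abs_cov_le (𝕏 := 𝕏) hK η hη1
  obtain ⟨C, hC, hΨ⟩ := hM.exists_bound hK 2
  -- `2 C²` bounds `Ψ_N`, whose relative error is at most `1`; `e^{4B}` bounds the effect of the
  -- bounded part of the covariance at frequencies up to `2`; `η / 2` is the Gaussian rate that
  -- survives.
  refine ⟨2 * (C * C) * Real.exp (4 * B) * (4 + 2 * √(Real.pi / (η / 2))) ^ 2, by positivity, ?_⟩
  filter_upwards [hM.limit K hK η hη 2 two_pos q ξ 1 one_pos, eventually_gt_atTop 1] with N hN hN1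
    x₁ hx₁ x₂ hx₂ hr z δ hz hδ
  have hN0 : (0 : ℝ) < N := by positivity
  have hL : 0 < Real.log N := Real.log_pos (by exact_mod_cast hN1)
  have hη0 : 0 < (N : ℝ) ^ (η - 1) := Real.rpow_pos_of_pos hN0 _
  have hx : x₁ ≠ x₂ := dist_pos.1 (hη0.trans_le hr)
  have hδ' : ∀ j, δ j ∈ Ioc (0 : ℝ) 1 := fun j => ⟨hη0.trans_le (hδ j).1, (hδ j).2⟩
  set L := Real.log N with hLdef
  set E := Real.exp ((γ₁ ^ 2 + γ₂ ^ 2) / 2 * L + A.interaction γ₁ γ₂ x₁ x₂ ξ δ z) with hE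
  have key := integral_bandMode_le (hM.integrable_weight hN1.le h₁ h₁' h₂ h₂' hx ξ δ z hδ')
    (fun s => (weight_pos N γ₁ γ₂ x₁ x₂ ξ δ z s).le)
    (v₁ := fun s => A.X N s x₁ - γ₁ * L) (v₂ := fun s => A.X N s x₂ - γ₂ * L)
    ((measurable_X_apply N x₁).sub_const _) ((measurable_X_apply N x₂).sub_const _) hθ₁ hθ₂
    (B := 2 * (C * C) * Real.exp (4 * B) * E) (c := η / 2) (L := L) (by positivity) hL ?_
  · refine key.trans (le_of_eq ?_)
    ring
  intro t₁ t₂ ht₁ ht₂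
  have hlim := hN _ (mem_stripR h₁ h₁' ht₁) _ (mem_stripR h₂ h₂' ht₂) x₁ hx₁ x₂ hx₂ hr z δ hz hδ
  have hPsi : ‖A.Psi N (γ₁ + t₁ * Complex.I) (γ₂ + t₂ * Complex.I) x₁ x₂ ξ δ z‖ ≤ 2 * (C * C) := by
    have h3 : ‖Ψ (γ₁ + t₁ * Complex.I) x₁ * Ψ (γ₂ + t₂ * Complex.I) x₂‖ ≤ C * C := by
      rw [norm_mul]
      exact mul_le_mul (hΨ _ (mem_stripR h₁ h₁' ht₁) _ hx₁) (hΨ _ (mem_stripR h₂ h₂' ht₂) _ hx₂)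
        (norm_nonneg _) hC.le
    have h4 := norm_le_norm_add_norm_sub' (A.Psi N (γ₁ + t₁ * Complex.I) (γ₂ + t₂ * Complex.I)
      x₁ x₂ ξ δ z) (Ψ (γ₁ + t₁ * Complex.I) x₁ * Ψ (γ₂ + t₂ * Complex.I) x₂)
    linarith
  rw [weightedCharFun_weight, norm_mul, norm_mul, Complex.norm_real, Real.norm_eq_abs,
    abs_of_pos (by positivity), Complex.norm_exp, ← Real.exp_add]
  have hre : (((-(t₁ * t₂) * 𝕏.cov x₁ x₂ : ℝ) : ℂ) +
        ((t₁ * γ₂ + t₂ * γ₁) * 𝕏.cov x₁ x₂ + t₁ * A.potential ξ δ z x₁ +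
          t₂ * A.potential ξ δ z x₂ : ℝ) * Complex.I).re = -(t₁ * t₂) * 𝕏.cov x₁ x₂ := by
    rw [Complex.add_re, Complex.re_ofReal_mul, Complex.I_re, mul_zero, add_zero,
      Complex.ofReal_re]
  rw [hre, mul_assoc, ← hE, mul_assoc E, ← Real.exp_add]
  -- At mesoscopic distances the covariance is at most `(1 - η) L + B`, so the cross term consumes
  -- at most the fraction `1 - η` of the Gaussian decay.
  have hq : -(L / 2 * t₁ ^ 2 + L / 2 * t₂ ^ 2) + -(t₁ * t₂) * 𝕏.cov x₁ x₂ ≤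
      4 * B + -(η / 2 * L * t₁ ^ 2 + η / 2 * L * t₂ ^ 2) := by
    have h3 := hcov N hN1.le x₁ hx₁ x₂ hx₂ hr
    have h4 : -(t₁ * t₂) * 𝕏.cov x₁ x₂ ≤ (t₁ ^ 2 + t₂ ^ 2) / 2 * ((1 - η) * L + B) := by
      have h5 : |t₁ * t₂| ≤ (t₁ ^ 2 + t₂ ^ 2) / 2 := by
        rw [abs_le]; constructor <;> nlinarith [sq_nonneg (t₁ + t₂), sq_nonneg (t₁ - t₂)]
      calc -(t₁ * t₂) * 𝕏.cov x₁ x₂ ≤ |-(t₁ * t₂) * 𝕏.cov x₁ x₂| := le_abs_self _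
        _ = |t₁ * t₂| * |𝕏.cov x₁ x₂| := by rw [abs_mul, abs_neg]
        _ ≤ _ := mul_le_mul h5 h3 (abs_nonneg _) (by positivity)
    have h6 : t₁ ^ 2 ≤ 4 := by nlinarith [sq_abs t₁, abs_nonneg t₁]
    have h7 : t₂ ^ 2 ≤ 4 := by nlinarith [sq_abs t₂, abs_nonneg t₂]
    have h8 : (t₁ ^ 2 + t₂ ^ 2) / 2 * B ≤ 4 * B := by nlinarith
    nlinarith
  calc _ ≤ 2 * (C * C) * (E * Real.exp (4 * B + -(η / 2 * L * t₁ ^ 2 + η / 2 * L * t₂ ^ 2))) := by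
        gcongr
    _ = _ := by rw [Real.exp_add]; ring

end FieldApproximation

/-! ### Gaussian frequencies of the tilted fields -/

namespace FieldApproximation

variable {Ω : Type u} [MetricSpace Ω] [MeasurableSpace Ω] {vol : Measure Ω} {T : Set (Ω → ℝ)}
  {𝕏 : LogCorrelatedField.{u, w} Ω vol T} {A : FieldApproximation.{u, v, w} 𝕏}
  {d : ℕ} {Ψ : ℂ → Ω → ℂ}

variable (A) in
/-- The asymptotic value of the expectation of `weight`. -/
def meanWeight (Ψ : ℂ → Ω → ℂ) (N : ℕ) (γ₁ γ₂ : ℝ) (x₁ x₂ : Ω) {q : ℕ} (ξ δ : Fin q → ℝ)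
    (z : Fin q → Ω) : ℝ :=
  Real.exp ((γ₁ ^ 2 + γ₂ ^ 2) / 2 * Real.log N) * Real.exp (A.interaction γ₁ γ₂ x₁ x₂ ξ δ z) *
    ((Ψ γ₁ x₁).re * (Ψ γ₂ x₂).re)

lemma MesoscopicAssumption.meanWeight_pos (hM : A.MesoscopicAssumption d Ψ) (N : ℕ) {γ₁ γ₂ : ℝ}
    (h₁ : 0 ≤ γ₁) (h₁' : γ₁ ≤ √(2 * d)) (h₂ : 0 ≤ γ₂) (h₂' : γ₂ ≤ √(2 * d)) (x₁ x₂ : Ω) {q : ℕ}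
    (ξ δ : Fin q → ℝ) (z : Fin q → Ω) : 0 < A.meanWeight Ψ N γ₁ γ₂ x₁ x₂ ξ δ z :=
  mul_pos (mul_pos (Real.exp_pos _) (Real.exp_pos _))
    (mul_pos (hM.limit_pos γ₁ h₁ h₁' x₁).1 (hM.limit_pos γ₂ h₂ h₂' x₂).1)

lemma measurable_smoothed [OpensMeasurableSpace Ω] [SFinite vol] (N : ℕ) {δ : ℝ}
    (hδ : δ ∈ Ioc (0 : ℝ) 1) (z : Ω) : Measurable fun s => A.smoothed N δ s z := by
  have hρ : Continuous fun y => A.ρ δ z y := by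
    have h : Continuous fun y : Ω => ((δ, z, y) : ℝ × Ω × Ω) := by fun_prop
    rw [← continuousOn_univ] at h ⊢
    exact A.continuousOn_ρ.comp h fun y _ => ⟨hδ, trivial⟩
  have h : Measurable fun p : A.Sample N × Ω => A.X N p.1 p.2 * A.ρ δ z p.2 :=
    (A.measurable_X N).mul (hρ.measurable.comp measurable_snd)
  exact (h.stronglyMeasurable.integral_prod_right').measurable

lemma measurable_weight [OpensMeasurableSpace Ω] [SFinite vol] (N : ℕ) (γ₁ γ₂ : ℝ) (x₁ x₂ : Ω)
    {q : ℕ} (ξ : Fin q → ℝ) {δ : Fin q → ℝ} (z : Fin q → Ω) (hδ : ∀ j, δ j ∈ Ioc (0 : ℝ) 1) :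
    Measurable (A.weight N γ₁ γ₂ x₁ x₂ ξ δ z) := by
  refine Real.measurable_exp.comp (((measurable_X_apply N x₁).const_mul _).add
    ((measurable_X_apply N x₂).const_mul _) |>.add (Finset.measurable_sum _ fun j _ => ?_))
  exact (measurable_smoothed N (hδ j) (z j)).const_mul _

/-- The covariance kernel is bounded away from the diagonal. -/
lemma exists_abs_cov_le_of_le_dist {K : Set Ω} (hK : IsCompact K) {c : ℝ} (hc : 0 < c) :
    ∃ B > 0, ∀ x₁ ∈ K, ∀ x₂ ∈ K, c ≤ dist x₁ x₂ → |𝕏.cov x₁ x₂| ≤ B := by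
  have hcl : IsClosed {p : Ω × Ω | c ≤ dist p.1 p.2} := isClosed_le continuous_const continuous_dist
  have hcont : ContinuousOn (fun p : Ω × Ω => 𝕏.cov p.1 p.2)
      ((K ×ˢ K) ∩ {p : Ω × Ω | c ≤ dist p.1 p.2}) := by
    refine ContinuousOn.add (ContinuousOn.neg (ContinuousOn.log continuous_dist.continuousOn ?_))
      𝕏.continuous_h.continuousOn
    exact fun p hp => (hc.trans_le hp.2).ne'
  obtain ⟨B, hB⟩ := ((hK.prod hK).inter_right hcl).exists_bound_of_continuousOn hcont
  exact ⟨max B 1, by positivity, fun x₁ h₁ x₂ h₂ h =>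
    (hB (x₁, x₂) ⟨⟨h₁, h₂⟩, h⟩).trans (le_max_left _ _)⟩

/-- Uniform continuity of `Ψ` on a compact part of the strip; the positive lower bound of `Ψ γ` on
`K` turns the absolute error into a relative one. -/
lemma MesoscopicAssumption.exists_norm_sub_le (hM : A.MesoscopicAssumption d Ψ) {K : Set Ω}
    (hK : IsCompact K) {γ : ℝ} (h0 : 0 ≤ γ) (h1 : γ ≤ √(2 * d)) {ε : ℝ} (hε : 0 < ε) :
    ∃ τ > 0, ∀ t : ℝ, |t| ≤ τ → ∀ x ∈ K,
      ‖Ψ (γ + t * Complex.I) x - Ψ γ x‖ ≤ ε * (Ψ γ x).re := by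
  obtain ⟨c, hc, hlow⟩ := hM.exists_lower_bound hK h0 h1
  have hcont : ContinuousOn (Function.uncurry Ψ) (stripR d 1 ×ˢ K) :=
    hM.continuous_limit.mono (prod_mono (fun ζ hζ => ⟨hζ.1, hζ.2.1⟩) (subset_univ _))
  have hu := ((isCompact_stripR d 1).prod hK).uniformContinuousOn_of_continuous hcont
  obtain ⟨r, hr, hru⟩ := Metric.uniformContinuousOn_iff_le.1 hu (ε * c) (by positivity)
  refine ⟨min r 1, by positivity, fun t ht x hx => ?_⟩
  have ha : ((γ + t * Complex.I : ℂ), x) ∈ stripR d 1 ×ˢ K :=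
    ⟨mem_stripR h0 h1 (ht.trans (min_le_right _ _)), hx⟩
  have hb : ((γ : ℂ), x) ∈ stripR d 1 ×ˢ K :=
    ⟨by simpa using mem_stripR h0 h1 (t := 0) (R := 1) (by simp), hx⟩
  have h2 := hru _ ha _ hb (by
    rw [Prod.dist_eq]
    simpa [dist_eq_norm] using ht.trans (min_le_left _ _))
  rw [dist_eq_norm] at h2
  exact h2.trans (mul_le_mul_of_nonneg_left (hlow x hx) hε.le)

lemma norm_mul_sub_one_le {a b : ℂ} {x y : ℝ} (ha : ‖a - 1‖ ≤ x) (hb : ‖b - 1‖ ≤ y) :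
    ‖a * b - 1‖ ≤ x + y + x * y := by
  have h : a * b - 1 = (a - 1) + (b - 1) + (a - 1) * (b - 1) := by ring
  rw [h]
  refine (norm_add_le _ _).trans (add_le_add ((norm_add_le _ _).trans (add_le_add ha hb)) ?_)
  rw [norm_mul]
  exact mul_le_mul ha hb (norm_nonneg _) ((norm_nonneg _).trans ha)

/-- Under the normalized exponential weights, the recentred fields at two macroscopically separated
points have nearly Gaussian characteristic functions. -/
lemma MesoscopicAssumption.gaussianFrequencies [OpensMeasurableSpace Ω] [SFinite vol]
    (hM : A.MesoscopicAssumption d Ψ) {K : Set Ω} (hK : IsCompact K) {γ₁ γ₂ : ℝ} (h₁ : 0 ≤ γ₁)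
    (h₁' : γ₁ ≤ √(2 * d)) (h₂ : 0 ≤ γ₂) (h₂' : γ₂ ≤ √(2 * d)) {c : ℝ} (hc : 0 < c) {q : ℕ}
    (ξ : Fin q → ℝ) {δ : Fin q → ℝ} (z : Fin q → Ω) (hδ : ∀ j, δ j ∈ Ioc (0 : ℝ) 1)
    {x₁ x₂ : ℕ → Ω} (hx₁ : ∀ n, x₁ n ∈ K) (hx₂ : ∀ n, x₂ n ∈ K)
    (hd : ∀ n, c ≤ dist (x₁ n) (x₂ n)) {B : ℝ} (hp₁ : ∀ n, |A.potential ξ δ z (x₁ n)| ≤ B)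
    (hp₂ : ∀ n, |A.potential ξ δ z (x₂ n)| ≤ B) :
    GaussianFrequencies (fun n => A.P (n + 1))
      (fun n s => (A.meanWeight Ψ (n + 1) γ₁ γ₂ (x₁ n) (x₂ n) ξ δ z)⁻¹ *
        A.weight (n + 1) γ₁ γ₂ (x₁ n) (x₂ n) ξ δ z s)
      (fun n s => A.X (n + 1) s (x₁ n) - γ₁ * Real.log ((n + 1 : ℕ) : ℝ))
      (fun n s => A.X (n + 1) s (x₂ n) - γ₂ * Real.log ((n + 1 : ℕ) : ℝ))
      (fun n => Real.log ((n + 1 : ℕ) : ℝ)) := by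
  obtain ⟨B₀, hB₀, hcov⟩ := exists_abs_cov_le_of_le_dist (𝕏 := 𝕏) hK hc
  have hBn : 0 ≤ B := (abs_nonneg _).trans (hp₁ 0)
  have hne : ∀ n, x₁ n ≠ x₂ n := fun n => dist_pos.1 (hc.trans_le (hd n))
  set K' : Set Ω := K ∪ range z with hK'
  have hKc : IsCompact K' := hK.union (finite_range z).isCompact
  -- Distances and smoothing scales are fixed, so any mesoscopic exponent would do; `η = 1 / 2` is
  -- used.
  have hscale : ∀ a > (0 : ℝ), ∀ᶠ N : ℕ in atTop, (N : ℝ) ^ ((1 / 2 : ℝ) - 1) ≤ a := by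
    intro a ha
    have h : Tendsto (fun N : ℕ => (N : ℝ) ^ (-(1 / 2) : ℝ)) atTop (𝓝 0) :=
      (tendsto_rpow_neg_atTop (by norm_num)).comp tendsto_natCast_atTop_atTop
    filter_upwards [h.eventually_le_const ha] with N hN
    norm_num at hN ⊢
    exact hN
  have hev : ∀ R > (0 : ℝ), ∀ e > (0 : ℝ), ∀ᶠ n : ℕ in atTop, ∀ t₁ t₂ : ℝ, |t₁| ≤ R → |t₂| ≤ R →
      ‖A.Psi (n + 1) (γ₁ + t₁ * Complex.I) (γ₂ + t₂ * Complex.I) (x₁ n) (x₂ n) ξ δ z -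
        Ψ (γ₁ + t₁ * Complex.I) (x₁ n) * Ψ (γ₂ + t₂ * Complex.I) (x₂ n)‖ ≤
      e * ‖Ψ (γ₁ + t₁ * Complex.I) (x₁ n) * Ψ (γ₂ + t₂ * Complex.I) (x₂ n)‖ := by
    intro R hR e he
    have h := (hM.limit K' hKc (1 / 2) (by norm_num) R hR q ξ e he).and
      ((hscale c hc).and (eventually_all.2 fun j => hscale (δ j) (hδ j).1))
    have h' := (tendsto_add_atTop_nat 1).eventually h
    filter_upwards [h'] with n hn t₁ t₂ ht₁ ht₂
    exact hn.1 _ (mem_stripR h₁ h₁' ht₁) _ (mem_stripR h₂ h₂' ht₂) _ (Or.inl (hx₁ n)) _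
      (Or.inl (hx₂ n)) (hn.2.1.trans (hd n)) z δ (fun j => Or.inr (mem_range_self j))
      fun j => ⟨hn.2.2 j, (hδ j).2⟩
  -- Normalization cancels the real prefactors. A ratio of values of `Ψ`, a factor that is bounded
  -- at bounded frequencies, and the Gaussian remain.
  have hchar : ∀ n t₁ t₂, weightedCharFun (A.P (n + 1))
      (fun s => (A.meanWeight Ψ (n + 1) γ₁ γ₂ (x₁ n) (x₂ n) ξ δ z)⁻¹ *
        A.weight (n + 1) γ₁ γ₂ (x₁ n) (x₂ n) ξ δ z s)
      (fun s => A.X (n + 1) s (x₁ n) - γ₁ * Real.log ((n + 1 : ℕ) : ℝ))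
      (fun s => A.X (n + 1) s (x₂ n) - γ₂ * Real.log ((n + 1 : ℕ) : ℝ)) t₁ t₂ =
      (A.Psi (n + 1) (γ₁ + t₁ * Complex.I) (γ₂ + t₂ * Complex.I) (x₁ n) (x₂ n) ξ δ z /
        (((Ψ γ₁ (x₁ n)).re * (Ψ γ₂ (x₂ n)).re : ℝ) : ℂ)) *
      Complex.exp ((-(t₁ * t₂) * 𝕏.cov (x₁ n) (x₂ n) : ℝ) +
        ((t₁ * γ₂ + t₂ * γ₁) * 𝕏.cov (x₁ n) (x₂ n) + t₁ * A.potential ξ δ z (x₁ n) +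
          t₂ * A.potential ξ δ z (x₂ n) : ℝ) * Complex.I) *
      (Real.exp (-(Real.log ((n + 1 : ℕ) : ℝ) / 2 * t₁ ^ 2 +
        Real.log ((n + 1 : ℕ) : ℝ) / 2 * t₂ ^ 2)) : ℝ) := by
    intro n t₁ t₂
    have hpos := (hM.meanWeight_pos (n + 1) h₁ h₁' h₂ h₂' (x₁ n) (x₂ n) ξ δ z).ne'
    have h := A.weightedCharFun_weight (n + 1) γ₁ γ₂ (x₁ n) (x₂ n) ξ δ z t₁ t₂
    have h' : weightedCharFun (A.P (n + 1))
      (fun s => (A.meanWeight Ψ (n + 1) γ₁ γ₂ (x₁ n) (x₂ n) ξ δ z)⁻¹ *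
        A.weight (n + 1) γ₁ γ₂ (x₁ n) (x₂ n) ξ δ z s)
      (fun s => A.X (n + 1) s (x₁ n) - γ₁ * Real.log ((n + 1 : ℕ) : ℝ))
      (fun s => A.X (n + 1) s (x₂ n) - γ₂ * Real.log ((n + 1 : ℕ) : ℝ)) t₁ t₂ =
      ((A.meanWeight Ψ (n + 1) γ₁ γ₂ (x₁ n) (x₂ n) ξ δ z)⁻¹ : ℝ) *
        weightedCharFun (A.P (n + 1)) (A.weight (n + 1) γ₁ γ₂ (x₁ n) (x₂ n) ξ δ z)
      (fun s => A.X (n + 1) s (x₁ n) - γ₁ * Real.log ((n + 1 : ℕ) : ℝ))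
      (fun s => A.X (n + 1) s (x₂ n) - γ₂ * Real.log ((n + 1 : ℕ) : ℝ)) t₁ t₂ := by
      unfold weightedCharFun
      rw [← integral_const_mul]
      refine integral_congr_ae (ae_of_all _ fun s => ?_)
      simp only [Complex.ofReal_mul, mul_assoc]
    rw [h', h]
    have hm : A.meanWeight Ψ (n + 1) γ₁ γ₂ (x₁ n) (x₂ n) ξ δ z = Real.exp ((γ₁ ^ 2 + γ₂ ^ 2) / 2 *
      Real.log ((n + 1 : ℕ) : ℝ)) * Real.exp (A.interaction γ₁ γ₂ (x₁ n) (x₂ n) ξ δ z) *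
      ((Ψ γ₁ (x₁ n)).re * (Ψ γ₂ (x₂ n)).re) := rfl
    have ha := Real.exp_ne_zero ((γ₁ ^ 2 + γ₂ ^ 2) / 2 * Real.log ((n + 1 : ℕ) : ℝ))
    have hb := Real.exp_ne_zero (A.interaction γ₁ γ₂ (x₁ n) (x₂ n) ξ δ z)
    have hcc := (mul_pos (hM.limit_pos γ₁ h₁ h₁' (x₁ n)).1 (hM.limit_pos γ₂ h₂ h₂' (x₂ n)).1).ne'
    rw [hm]
    generalize Real.exp ((γ₁ ^ 2 + γ₂ ^ 2) / 2 * Real.log ((n + 1 : ℕ) : ℝ)) = a at ha ⊢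
    generalize Real.exp (A.interaction γ₁ γ₂ (x₁ n) (x₂ n) ξ δ z) = b at hb ⊢
    generalize (Ψ γ₁ (x₁ n)).re * (Ψ γ₂ (x₂ n)).re = e at hcc ⊢
    have ha' : (a : ℂ) ≠ 0 := by exact_mod_cast ha
    have hb' : (b : ℂ) ≠ 0 := by exact_mod_cast hb
    have he' : (e : ℂ) ≠ 0 := by exact_mod_cast hcc
    simp only [Complex.ofReal_mul, Complex.ofReal_inv]
    field_simp
  have hphase : ∀ n (t₁ t₂ R : ℝ), |t₁| ≤ R → |t₂| ≤ R →
      ‖((-(t₁ * t₂) * 𝕏.cov (x₁ n) (x₂ n) : ℝ) : ℂ) +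
        ((t₁ * γ₂ + t₂ * γ₁) * 𝕏.cov (x₁ n) (x₂ n) + t₁ * A.potential ξ δ z (x₁ n) +
          t₂ * A.potential ξ δ z (x₂ n) : ℝ) * Complex.I‖ ≤
      R * (R * B₀ + (γ₁ + γ₂) * B₀ + 2 * B) := by
    intro n t₁ t₂ R ht₁ ht₂
    have hR := (abs_nonneg _).trans ht₁
    have hC := hcov _ (hx₁ n) _ (hx₂ n) (hd n)
    refine (norm_add_le _ _).trans ?_
    rw [norm_mul, Complex.norm_I, mul_one, Complex.norm_real, Complex.norm_real, Real.norm_eq_abs,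
      Real.norm_eq_abs]
    have e1 : |(-(t₁ * t₂) * 𝕏.cov (x₁ n) (x₂ n))| ≤ R * R * B₀ := by
      rw [abs_mul, abs_neg, abs_mul]; gcongr
    have e2 : |(t₁ * γ₂ + t₂ * γ₁) * 𝕏.cov (x₁ n) (x₂ n)| ≤ (R * γ₂ + R * γ₁) * B₀ := by
      rw [abs_mul]
      gcongr
      refine (abs_add_le _ _).trans ?_
      rw [abs_mul, abs_mul, abs_of_nonneg h₁, abs_of_nonneg h₂]
      gcongr
    have e3 : |t₁ * A.potential ξ δ z (x₁ n)| ≤ R * B := by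
      rw [abs_mul]; exact mul_le_mul ht₁ (hp₁ n) (abs_nonneg _) hR
    have e4 : |t₂ * A.potential ξ δ z (x₂ n)| ≤ R * B := by
      rw [abs_mul]; exact mul_le_mul ht₂ (hp₂ n) (abs_nonneg _) hR
    have e5 := abs_add_three ((t₁ * γ₂ + t₂ * γ₁) * 𝕏.cov (x₁ n) (x₂ n))
      (t₁ * A.potential ξ δ z (x₁ n)) (t₂ * A.potential ξ δ z (x₂ n))
    linarith
  refine ⟨Real.tendsto_log_atTop.comp (tendsto_natCast_atTop_atTop.comp (tendsto_add_atTop_nat 1)),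
    fun n => (measurable_weight (n + 1) γ₁ γ₂ (x₁ n) (x₂ n) ξ z hδ).const_mul _, fun n s =>
      mul_nonneg (inv_nonneg.2 (hM.meanWeight_pos (n + 1) h₁ h₁' h₂ h₂' _ _ ξ δ z).le)
        (weight_pos _ _ _ _ _ _ _ _ _).le, fun n =>
      (hM.integrable_weight n.succ_pos h₁ h₁' h₂ h₂' (hne n) ξ δ z hδ).const_mul _,
    fun n => (measurable_X_apply _ _).sub_const _, fun n => (measurable_X_apply _ _).sub_const _,
    fun R => ?_, fun ε hε => ?_⟩
  · set R' : ℝ := |R| + 1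
    have hR' : 0 < R' := by positivity
    obtain ⟨C, hC, hCb⟩ := hM.exists_bound hK R'
    obtain ⟨c₁, hc₁, hl₁⟩ := hM.exists_lower_bound hK h₁ h₁'
    obtain ⟨c₂, hc₂, hl₂⟩ := hM.exists_lower_bound hK h₂ h₂'
    refine ⟨2 * (C * C) / (c₁ * c₂) * Real.exp (R' * (R' * B₀ + (γ₁ + γ₂) * B₀ + 2 * B)), ?_⟩
    filter_upwards [hev R' hR' 1 one_pos] with n hn t₁ t₂ ht₁ ht₂
    have hRR : R ≤ R' := (le_abs_self R).trans (by simp [R'])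
    have ht₁' := ht₁.trans hRR
    have ht₂' := ht₂.trans hRR
    rw [hchar, norm_mul, norm_mul, norm_div, Complex.norm_real, Complex.norm_real,
      Real.norm_eq_abs, Real.norm_eq_abs, Real.abs_exp]
    have hb1 : ‖Ψ (γ₁ + t₁ * Complex.I) (x₁ n) * Ψ (γ₂ + t₂ * Complex.I) (x₂ n)‖ ≤ C * C := by
      rw [norm_mul]
      exact mul_le_mul (hCb _ (mem_stripR h₁ h₁' ht₁') _ (hx₁ n))
        (hCb _ (mem_stripR h₂ h₂' ht₂') _ (hx₂ n)) (norm_nonneg _) hC.le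
    have hb2 := hn t₁ t₂ ht₁' ht₂'
    have hb3 := norm_le_norm_add_norm_sub'
      (A.Psi (n + 1) (γ₁ + t₁ * Complex.I) (γ₂ + t₂ * Complex.I) (x₁ n) (x₂ n) ξ δ z)
      (Ψ (γ₁ + t₁ * Complex.I) (x₁ n) * Ψ (γ₂ + t₂ * Complex.I) (x₂ n))
    have hb4 : c₁ * c₂ ≤ |(Ψ γ₁ (x₁ n)).re * (Ψ γ₂ (x₂ n)).re| :=
      (mul_le_mul (hl₁ _ (hx₁ n)) (hl₂ _ (hx₂ n)) hc₂.le
        (hc₁.le.trans (hl₁ _ (hx₁ n)))).trans (le_abs_self _)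
    gcongr
    · linarith
    · rw [Complex.norm_exp]
      exact Real.exp_le_exp.2 ((Complex.re_le_norm _).trans (hphase n t₁ t₂ R' ht₁' ht₂'))
  -- `15 = 7 + 1 + 7`: the ratio of `Ψ` is within `7e` of `1`, the factor from the covariance within
  -- `e`, and the product of the two errors is at most `7e`.
  · set e : ℝ := min 1 (ε / 15)
    have he : 0 < e := by positivity
    have he1 : e ≤ 1 := min_le_left _ _
    have heε : 15 * e ≤ ε := by
      have : e ≤ ε / 15 := min_le_right _ _
      linarith
    obtain ⟨τ₁, hτ₁, hΨ₁⟩ := hM.exists_norm_sub_le hK h₁ h₁' he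
    obtain ⟨τ₂, hτ₂, hΨ₂⟩ := hM.exists_norm_sub_le hK h₂ h₂' he
    set D : ℝ := B₀ + (γ₁ + γ₂) * B₀ + 2 * B
    have hD : 0 < D := by positivity
    set τ : ℝ := min (min τ₁ τ₂) (min 1 (e / (2 * D)))
    have hτ : 0 < τ := by positivity
    have hτ1 : τ ≤ 1 := (min_le_right _ _).trans (min_le_left _ _)
    have hτD : τ * D ≤ e / 2 := by
      have : τ ≤ e / (2 * D) := (min_le_right _ _).trans (min_le_right _ _)
      calc τ * D ≤ e / (2 * D) * D := by gcongr
        _ = e / 2 := by field_simp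
    refine ⟨τ, hτ, ?_⟩
    filter_upwards [hev τ hτ e he] with n hn t₁ t₂ ht₁ ht₂
    rw [hchar, ← sub_one_mul, norm_mul, Complex.norm_real, Real.norm_eq_abs, Real.abs_exp]
    refine mul_le_mul_of_nonneg_right ?_ (Real.exp_pos _).le
    have hp₁ := (hM.limit_pos γ₁ h₁ h₁' (x₁ n)).1
    have hp₂ := (hM.limit_pos γ₂ h₂ h₂' (x₂ n)).1
    have ha := hΨ₁ t₁ (ht₁.trans ((min_le_left _ _).trans (min_le_left _ _))) _ (hx₁ n)
    have hb := hΨ₂ t₂ (ht₂.trans ((min_le_left _ _).trans (min_le_right _ _))) _ (hx₂ n)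
    have hn' := hn t₁ t₂ ht₁ ht₂
    rw [← hM.ofReal_re h₁ h₁'] at ha
    rw [← hM.ofReal_re h₂ h₂'] at hb
    have hph := hphase n t₁ t₂ τ ht₁ ht₂
    generalize (Ψ γ₁ (x₁ n)).re = m₁ at *
    generalize (Ψ γ₂ (x₂ n)).re = m₂ at *
    generalize Ψ (γ₁ + t₁ * Complex.I) (x₁ n) = Ψ₁ at *
    generalize Ψ (γ₂ + t₂ * Complex.I) (x₂ n) = Ψ₂ at *
    generalize A.Psi (n + 1) (γ₁ + t₁ * Complex.I) (γ₂ + t₂ * Complex.I) (x₁ n) (x₂ n) ξ δ z = Y at *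
    generalize ((-(t₁ * t₂) * 𝕏.cov (x₁ n) (x₂ n) : ℝ) : ℂ) +
        ((t₁ * γ₂ + t₂ * γ₁) * 𝕏.cov (x₁ n) (x₂ n) + t₁ * A.potential ξ δ z (x₁ n) +
          t₂ * A.potential ξ δ z (x₂ n) : ℝ) * Complex.I = p at *
    have hm₁ : (m₁ : ℂ) ≠ 0 := by exact_mod_cast hp₁.ne'
    have hm₂ : (m₂ : ℂ) ≠ 0 := by exact_mod_cast hp₂.ne'
    have ha' : ‖Ψ₁ / m₁ - 1‖ ≤ e := by
      rw [div_sub_one hm₁, norm_div, Complex.norm_real, Real.norm_eq_abs, abs_of_pos hp₁]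
      exact (div_le_iff₀ hp₁).2 ha
    have hb' : ‖Ψ₂ / m₂ - 1‖ ≤ e := by
      rw [div_sub_one hm₂, norm_div, Complex.norm_real, Real.norm_eq_abs, abs_of_pos hp₂]
      exact (div_le_iff₀ hp₂).2 hb
    have hab := norm_mul_sub_one_le ha' hb'
    have hY : ‖Y / ((m₁ * m₂ : ℝ) : ℂ) - 1‖ ≤ 7 * e := by
      have e1 : Y / ((m₁ * m₂ : ℝ) : ℂ) - 1 = (Y - Ψ₁ * Ψ₂) / ((m₁ * m₂ : ℝ) : ℂ) +
          (Ψ₁ / m₁ * (Ψ₂ / m₂) - 1) := by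
        push_cast; field_simp; ring
      have e2 : ‖(Y - Ψ₁ * Ψ₂) / ((m₁ * m₂ : ℝ) : ℂ)‖ ≤ e * ‖Ψ₁ / m₁ * (Ψ₂ / m₂)‖ := by
        rw [div_mul_div_comm, norm_div, norm_div, ← Complex.ofReal_mul, ← mul_div_assoc]
        gcongr
      have e3 : ‖Ψ₁ / m₁ * (Ψ₂ / m₂)‖ ≤ 4 := by
        have := norm_le_norm_add_norm_sub' (Ψ₁ / m₁ * (Ψ₂ / m₂)) 1
        rw [norm_one] at this
        nlinarith
      rw [e1]
      refine (norm_add_le _ _).trans ?_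
      nlinarith
    have hexp : ‖Complex.exp p - 1‖ ≤ e := by
      have e1 : ‖p‖ ≤ e / 2 := by
        refine hph.trans (le_trans ?_ hτD)
        simp only [D]
        gcongr
        exact mul_le_of_le_one_left hB₀.le hτ1
      refine (Complex.norm_exp_sub_one_le (by linarith)).trans (by linarith)
    have := norm_mul_sub_one_le hY hexp
    nlinarith

end FieldApproximation

/-! ### Normalizing constants and mixed moments of the two densities -/

namespace FieldApproximation

variable {Ω : Type u} [MetricSpace Ω] [MeasurableSpace Ω] {vol : Measure Ω} {T : Set (Ω → ℝ)}
  {𝕏 : LogCorrelatedField.{u, w} Ω vol T} {A : FieldApproximation.{u, v, w} 𝕏}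
  {d : ℕ} {Ψ : ℂ → Ω → ℂ}

variable (A) in
/-- The normalizing constant of a density: `𝔼 e^{γ X(x)}` in the trivial mode and
`e^{γ² log N} ℙ(X(x) ≥ γ log N)` in the oscillating mode. -/
def moment (θ : ℕ) (γ : ℝ) (N : ℕ) (x : Ω) : ℝ :=
  ∫ s, Real.exp (γ * A.X N s x) * modeFun θ γ 0 (A.X N s x - γ * Real.log N) ∂A.P N

variable (A) in
/-- The random density: `e^{-γ g(x)} e^{γ X(x)} / 𝔼 e^{γ X(x)}` in the trivial mode and
`1{X(x) ≥ γ log N + g(x)} / ℙ(X(x) ≥ γ log N)` in the oscillating mode. -/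
def density (θ : ℕ) (γ : ℝ) (g : Ω → ℝ) (N : ℕ) (x : Ω) (s : A.Sample N) : ℝ :=
  (if θ = 0 then Real.exp (-γ * g x) else 1) * (A.moment θ γ N x)⁻¹ *
    (Real.exp (γ * A.X N s x) * modeFun θ γ (g x) (A.X N s x - γ * Real.log N))

lemma moment_nonneg (θ : ℕ) (γ : ℝ) (N : ℕ) (x : Ω) : 0 ≤ A.moment θ γ N x :=
  integral_nonneg fun _ => mul_nonneg (Real.exp_pos _).le (modeFun_nonneg _ _ _ _)

lemma density_nonneg (θ : ℕ) (γ : ℝ) (g : Ω → ℝ) (N : ℕ) (x : Ω) (s : A.Sample N) :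
    0 ≤ A.density θ γ g N x s := by
  unfold density
  have h1 : (0 : ℝ) ≤ if θ = 0 then Real.exp (-γ * g x) else 1 := by split_ifs <;> positivity
  exact mul_nonneg (mul_nonneg h1 (inv_nonneg.2 (moment_nonneg _ _ _ _)))
    (mul_nonneg (Real.exp_pos _).le (modeFun_nonneg _ _ _ _))

lemma weight_point (N : ℕ) (γ : ℝ) (x y : Ω) (ξ δ : Fin 0 → ℝ) (z : Fin 0 → Ω) (s : A.Sample N) :
    A.weight N γ 0 x y ξ δ z s = Real.exp (γ * A.X N s x) := by
  simp [weight]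

lemma interaction_point (γ : ℝ) (x y : Ω) (ξ δ : Fin 0 → ℝ) (z : Fin 0 → Ω) :
    A.interaction γ 0 x y ξ δ z = 0 := by
  simp [interaction]

lemma modeFun_zero (γ b v : ℝ) : modeFun 0 γ b v = 1 := rfl

/-- One-point asymptotics along a sequence of points. -/
lemma MesoscopicAssumption.tendsto_moment_seq [OpensMeasurableSpace Ω] [SFinite vol] [Nontrivial Ω]
    (hM : A.MesoscopicAssumption d Ψ) {K : Set Ω} (hK : IsCompact K) {γ : ℝ} (hγ : 0 < γ)
    (hγd : γ ≤ √(2 * d)) {θ : ℕ} (hθ : θ = 0 ∨ θ = 1) {x : ℕ → Ω} (hx : ∀ n, x n ∈ K) :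
    Tendsto (fun n => √(Real.log ((n + 1 : ℕ) : ℝ)) ^ θ * (Real.exp (γ ^ 2 / 2 *
      Real.log ((n + 1 : ℕ) : ℝ)) * (Ψ γ (x n)).re)⁻¹ * A.moment θ γ (n + 1) (x n)) atTop
      (𝓝 (modeMass θ γ 0)) := by
  obtain ⟨p, p', hp⟩ := exists_pair_ne Ω
  set c : ℝ := dist p p' / 2
  have hc : 0 < c := half_pos (dist_pos.2 hp)
  classical
  -- A companion point at distance at least `c` turns the one-point moment into a two-point moment.
  -- It carries the exponent `0` and is invisible because `Ψ 0 = 1`.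
  set y : ℕ → Ω := fun n => if c ≤ dist (x n) p then p else p' with hy
  have hyd : ∀ n, c ≤ dist (x n) (y n) := by
    intro n
    simp only [hy]
    split_ifs with h
    · exact h
    · have := dist_triangle_left p p' (x n)
      simp only [c] at h ⊢
      linarith
  set K' : Set Ω := K ∪ {p, p'}
  have hK' : IsCompact K' := hK.union (toFinite _).isCompact
  have hyK : ∀ n, y n ∈ K' := fun n => by
    simp only [hy]
    split_ifs <;> simp [K']
  set ξ : Fin 0 → ℝ := Fin.elim0
  set z : Fin 0 → Ω := Fin.elim0
  have h := (hM.gaussianFrequencies hK' hγ.le hγd le_rfl (Real.sqrt_nonneg _) hc ξ (δ := ξ) z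
    (fun j => j.elim0) (fun n => Or.inl (hx n)) hyK hyd (B := 0) (by simp) (by simp)).tendsto_modeFun
    hθ (Or.inl rfl) hγ 0 0
  have hm : modeMass 0 γ 0 = 1 := rfl
  rw [hm, mul_one] at h
  refine h.congr fun n => ?_
  simp only [pow_zero, mul_one, modeFun_zero, weight_point, meanWeight, interaction_point,
    Real.exp_zero]
  have h0 : (Ψ ((0 : ℝ) : ℂ) (y n)).re = 1 := by simp [hM.limit_zero]
  rw [h0]
  simp only [mul_assoc, integral_const_mul, moment]
  simp

/-- One-point asymptotics, uniformly on compact sets. -/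
lemma MesoscopicAssumption.moment_approx [OpensMeasurableSpace Ω] [SFinite vol] [Nontrivial Ω]
    (hM : A.MesoscopicAssumption d Ψ) {K : Set Ω} (hK : IsCompact K) {γ : ℝ} (hγ : 0 < γ)
    (hγd : γ ≤ √(2 * d)) {θ : ℕ} (hθ : θ = 0 ∨ θ = 1) {ε : ℝ} (hε : 0 < ε) :
    ∀ᶠ N : ℕ in atTop, ∀ x ∈ K, |√(Real.log N) ^ θ * (Real.exp (γ ^ 2 / 2 *
      Real.log N) * (Ψ γ x).re)⁻¹ * A.moment θ γ N x - modeMass θ γ 0| < ε := by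
  rcases K.eq_empty_or_nonempty with rfl | ⟨x₀, hx₀⟩
  · simp
  classical
  -- Uniformity in `x` follows from convergence along arbitrary sequences, applied to a sequence
  -- that picks a violating point whenever there is one.
  set bad : ℕ → Ω → Prop := fun N x => x ∈ K ∧ ε ≤ |√(Real.log N) ^ θ * (Real.exp (γ ^ 2 / 2 *
      Real.log N) * (Ψ γ x).re)⁻¹ * A.moment θ γ N x - modeMass θ γ 0| with hbad
  set x : ℕ → Ω := fun n => if h : ∃ x, bad (n + 1) x then h.choose else x₀ with hxdef
  have hx : ∀ n, x n ∈ K := fun n => by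
    simp only [hxdef]
    split_ifs with h
    · exact h.choose_spec.1
    · exact hx₀
  have h := hM.tendsto_moment_seq hK hγ hγd hθ hx
  have h1 := (tendsto_iff_norm_sub_tendsto_zero.1 h).eventually_lt_const hε
  have h2 : ∀ᶠ n : ℕ in atTop, ∀ y ∈ K, |√(Real.log ((n + 1 : ℕ) : ℝ)) ^ θ * (Real.exp (γ ^ 2 / 2 *
      Real.log ((n + 1 : ℕ) : ℝ)) * (Ψ γ y).re)⁻¹ * A.moment θ γ (n + 1) y - modeMass θ γ 0| < ε := by
    filter_upwards [h1] with n hn y hy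
    by_contra hcon
    have hex : ∃ x, bad (n + 1) x := ⟨y, hy, not_lt.1 hcon⟩
    have hxn : x n = hex.choose := by simp only [hxdef]; rw [dif_pos hex]
    have h3 := hex.choose_spec.2
    rw [← hxn] at h3
    rw [Real.norm_eq_abs] at hn
    exact absurd hn (not_lt.2 h3)
  obtain ⟨n₀, hn₀⟩ := eventually_atTop.1 h2
  filter_upwards [eventually_ge_atTop (n₀ + 1)] with N hN
  obtain ⟨m, rfl⟩ : ∃ m, N = m + 1 := ⟨N - 1, by omega⟩
  exact hn₀ m (by omega)

lemma modeMass_pos (θ : ℕ) {γ : ℝ} (hγ : 0 < γ) (b : ℝ) : 0 < modeMass θ γ b := by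
  unfold modeMass
  split_ifs
  · exact one_pos
  · have := Real.exp_pos (-γ * b)
    positivity

/-- A uniform lower bound for the normalizing constants. -/
lemma MesoscopicAssumption.exists_le_moment [OpensMeasurableSpace Ω] [SFinite vol] [Nontrivial Ω]
    (hM : A.MesoscopicAssumption d Ψ) {K : Set Ω} (hK : IsCompact K) {γ : ℝ} (hγ : 0 < γ)
    (hγd : γ ≤ √(2 * d)) {θ : ℕ} (hθ : θ = 0 ∨ θ = 1) :
    ∃ c > 0, ∀ᶠ N : ℕ in atTop, ∀ x ∈ K,
      c * Real.exp (γ ^ 2 / 2 * Real.log N) ≤ √(Real.log N) ^ θ * A.moment θ γ N x := by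
  obtain ⟨m, hm, hlow⟩ := hM.exists_lower_bound hK hγ.le hγd
  have hmass := modeMass_pos θ hγ 0
  refine ⟨modeMass θ γ 0 / 2 * m, by positivity, ?_⟩
  filter_upwards [hM.moment_approx hK hγ hγd hθ (half_pos hmass)] with N hN x hx
  have h1 := (abs_lt.1 (hN x hx)).1
  have hpos := (hM.limit_pos γ hγ.le hγd x).1
  set E := Real.exp (γ ^ 2 / 2 * Real.log N)
  have hE : 0 < E := Real.exp_pos _
  have h2 : modeMass θ γ 0 / 2 ≤ √(Real.log N) ^ θ * (E * (Ψ γ x).re)⁻¹ * A.moment θ γ N x := by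
    linarith
  have h3 : √(Real.log N) ^ θ * A.moment θ γ N x =
      (√(Real.log N) ^ θ * (E * (Ψ γ x).re)⁻¹ * A.moment θ γ N x) * (E * (Ψ γ x).re) := by
    field_simp
  rw [h3]
  calc modeMass θ γ 0 / 2 * m * E ≤ modeMass θ γ 0 / 2 * (E * (Ψ γ x).re) := by
        rw [mul_assoc, mul_comm m]
        gcongr
        exact hlow x hx
    _ ≤ _ := by gcongr

/-- The mixed second moments of the densities all have the same limit. -/
lemma MesoscopicAssumption.tendsto_integral_density [OpensMeasurableSpace Ω] [SFinite vol]
    (hM : A.MesoscopicAssumption d Ψ) {γ : ℝ} (hγ : 0 < γ) (hγd : γ ≤ √(2 * d)) (g : Ω → ℝ)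
    {θ₁ θ₂ : ℕ} (hθ₁ : θ₁ = 0 ∨ θ₁ = 1) (hθ₂ : θ₂ = 0 ∨ θ₂ = 1) {x₁ x₂ : Ω} (hx : x₁ ≠ x₂) {q : ℕ}
    (ξ : Fin q → ℝ) {δ : Fin q → ℝ} (z : Fin q → Ω) (hδ : ∀ j, δ j ∈ Ioc (0 : ℝ) 1) :
    Tendsto (fun N => ∫ s, A.density θ₁ γ g N x₁ s * A.density θ₂ γ g N x₂ s *
      Real.exp (∑ j, ξ j * A.smoothed N (δ j) s (z j)) ∂A.P N) atTop
      (𝓝 (Real.exp (-γ * (g x₁ + g x₂)) * Real.exp (A.interaction γ γ x₁ x₂ ξ δ z))) := by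
  have : Nontrivial Ω := ⟨x₁, x₂, hx⟩
  have hK : IsCompact ({x₁, x₂} : Set Ω) := (toFinite _).isCompact
  rw [← tendsto_add_atTop_iff_nat 1]
  have h1 := hM.tendsto_moment_seq hK hγ hγd hθ₁ (x := fun _ => x₁) (by simp)
  have h2 := hM.tendsto_moment_seq hK hγ hγd hθ₂ (x := fun _ => x₂) (by simp)
  have h3 := (hM.gaussianFrequencies hK hγ.le hγd hγ.le hγd (dist_pos.2 hx) ξ z hδ
    (x₁ := fun _ => x₁) (x₂ := fun _ => x₂) (by simp) (by simp) (fun _ => le_rfl)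
    (B := max |A.potential ξ δ z x₁| |A.potential ξ δ z x₂|) (fun _ => le_max_left _ _)
    (fun _ => le_max_right _ _)).tendsto_modeFun hθ₁ hθ₂ hγ (g x₁) (g x₂)
  have hm₁ := (modeMass_pos θ₁ hγ 0).ne'
  have hm₂ := (modeMass_pos θ₂ hγ 0).ne'
  set a : ℕ → Ω → ℝ := fun θ x => if θ = 0 then Real.exp (-γ * g x) else 1 with ha
  -- This is where the two densities agree: in the trivial mode `e^{-γ g}` is put in by hand, in the
  -- oscillating mode it comes from the integral of the tail.
  have hmass : ∀ θ x, a θ x * modeMass θ γ (g x) = Real.exp (-γ * g x) * modeMass θ γ 0 := by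
    intro θ x
    simp only [ha, modeMass]
    split_ifs
    · rfl
    · simp; ring
  have h4 := (h3.div (h1.mul h2) (mul_ne_zero hm₁ hm₂)).const_mul
    (a θ₁ x₁ * a θ₂ x₂ * Real.exp (A.interaction γ γ x₁ x₂ ξ δ z))
  have hlim : a θ₁ x₁ * a θ₂ x₂ * Real.exp (A.interaction γ γ x₁ x₂ ξ δ z) *
      (modeMass θ₁ γ (g x₁) * modeMass θ₂ γ (g x₂) / (modeMass θ₁ γ 0 * modeMass θ₂ γ 0)) =
      Real.exp (-γ * (g x₁ + g x₂)) * Real.exp (A.interaction γ γ x₁ x₂ ξ δ z) := by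
    have e1 := hmass θ₁ x₁
    have e2 := hmass θ₂ x₂
    rw [mul_add, Real.exp_add]
    rw [← mul_div_assoc, div_eq_iff (mul_ne_zero hm₁ hm₂)]
    linear_combination (a θ₂ x₂ * modeMass θ₂ γ (g x₂) * Real.exp (A.interaction γ γ x₁ x₂ ξ δ z)) *
      e1 + (Real.exp (-γ * g x₁) * modeMass θ₁ γ 0 *
        Real.exp (A.interaction γ γ x₁ x₂ ξ δ z)) * e2
  rw [hlim] at h4
  refine h4.congr' ?_
  -- For `n > 0` the logarithm of `n + 1` is positive, and the powers of `√L` can be cancelled.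
  filter_upwards [eventually_gt_atTop 0] with n hn
  have hL : 0 < Real.log ((n + 1 : ℕ) : ℝ) := Real.log_pos (by exact_mod_cast Nat.succ_lt_succ hn)
  set L := Real.log ((n + 1 : ℕ) : ℝ) with hLdef
  have hs : √L ≠ 0 := (Real.sqrt_pos.2 hL).ne'
  set I := ∫ s, A.weight (n + 1) γ γ x₁ x₂ ξ δ z s * (modeFun θ₁ γ (g x₁) (A.X (n + 1) s x₁ - γ * L) *
    modeFun θ₂ γ (g x₂) (A.X (n + 1) s x₂ - γ * L)) ∂A.P (n + 1) with hI
  have e1 : ∫ s, A.density θ₁ γ g (n + 1) x₁ s * A.density θ₂ γ g (n + 1) x₂ s *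
      Real.exp (∑ j, ξ j * A.smoothed (n + 1) (δ j) s (z j)) ∂A.P (n + 1) =
      a θ₁ x₁ * a θ₂ x₂ * (A.moment θ₁ γ (n + 1) x₁)⁻¹ * (A.moment θ₂ γ (n + 1) x₂)⁻¹ * I := by
    rw [hI, ← integral_const_mul]
    refine integral_congr_ae (ae_of_all _ fun s => ?_)
    simp only [density, weight, ha, Real.exp_add, hLdef]
    ring
  have e2 : ∫ s, (A.meanWeight Ψ (n + 1) γ γ x₁ x₂ ξ δ z)⁻¹ * A.weight (n + 1) γ γ x₁ x₂ ξ δ z s *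
      (modeFun θ₁ γ (g x₁) (A.X (n + 1) s x₁ - γ * L) *
      modeFun θ₂ γ (g x₂) (A.X (n + 1) s x₂ - γ * L)) ∂A.P (n + 1) =
      (A.meanWeight Ψ (n + 1) γ γ x₁ x₂ ξ δ z)⁻¹ * I := by
    rw [hI, ← integral_const_mul]
    simp only [mul_assoc]
  simp only [Pi.div_apply, ← hLdef]
  rw [e1, e2]
  have e3 : A.meanWeight Ψ (n + 1) γ γ x₁ x₂ ξ δ z = Real.exp (γ ^ 2 / 2 * L) *
      Real.exp (γ ^ 2 / 2 * L) * Real.exp (A.interaction γ γ x₁ x₂ ξ δ z) *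
      ((Ψ γ x₁).re * (Ψ γ x₂).re) := by
    unfold meanWeight
    rw [← Real.exp_add (γ ^ 2 / 2 * L), ← hLdef]
    ring_nf
  rw [e3]
  have p1 := (hM.limit_pos γ hγ.le hγd x₁).1.ne'
  have p2 := (hM.limit_pos γ hγ.le hγd x₂).1.ne'
  have p3 := Real.exp_ne_zero (γ ^ 2 / 2 * L)
  have p4 := Real.exp_ne_zero (A.interaction γ γ x₁ x₂ ξ δ z)
  have p5 : √L ^ θ₁ ≠ 0 := pow_ne_zero _ hs
  have p6 : √L ^ θ₂ ≠ 0 := pow_ne_zero _ hs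
  field_simp

end FieldApproximation

/-! ## Upper bounds for truncated second moments -/

lemma eventually_rpow_sub_one_le {η : ℝ} (hη : η < 1) {a : ℝ} (ha : 0 < a) :
    ∀ᶠ N : ℕ in atTop, (N : ℝ) ^ (η - 1) ≤ a := by
  have h : Tendsto (fun N : ℕ => (N : ℝ) ^ (-(1 - η))) atTop (𝓝 0) :=
    (tendsto_rpow_neg_atTop (by linarith)).comp tendsto_natCast_atTop_atTop
  filter_upwards [h.eventually_le_const ha] with N hN
  rwa [neg_sub] at hN

/-- Supplies the companion points through which one-point bounds are read off two-point bounds with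
exponent `0`. A point cannot be close to both of two distinct points. -/
lemma exists_far_point (Ω : Type*) [MetricSpace Ω] [Nontrivial Ω] :
    ∃ K : Set Ω, IsCompact K ∧ ∃ c > 0, ∀ x : Ω, ∃ y ∈ K, c ≤ dist x y := by
  obtain ⟨p, p', hp⟩ := exists_pair_ne Ω
  have hc := dist_pos.2 hp
  refine ⟨{p, p'}, (toFinite _).isCompact, dist p p' / 2, half_pos hc, fun x => ?_⟩
  by_cases h : dist p p' / 2 ≤ dist x p
  · exact ⟨p, by simp, h⟩
  · refine ⟨p', by simp, ?_⟩
    have := dist_triangle_left p p' x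
    linarith

namespace FieldApproximation

variable {Ω : Type u} [MetricSpace Ω] [MeasurableSpace Ω] {vol : Measure Ω} {T : Set (Ω → ℝ)}
  {𝕏 : LogCorrelatedField.{u, w} Ω vol T} {A : FieldApproximation.{u, v, w} 𝕏}
  {d : ℕ} {Ψ : ℂ → Ω → ℂ}

variable (A) in
/-- The majorant of `density`. -/
def bandDensity (θ : ℕ) (γ : ℝ) (N : ℕ) (x : Ω) (s : A.Sample N) : ℝ :=
  √(Real.log N) ^ θ * Real.exp (γ * A.X N s x - γ ^ 2 / 2 * Real.log N) *
    bandMode θ (A.X N s x - γ * Real.log N)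

lemma bandDensity_nonneg (θ : ℕ) (γ : ℝ) (N : ℕ) (x : Ω) (s : A.Sample N) :
    0 ≤ A.bandDensity θ γ N x s :=
  mul_nonneg (mul_nonneg (pow_nonneg (Real.sqrt_nonneg _) _) (Real.exp_pos _).le)
    (bandMode_nonneg _ _)

lemma bandDensity_zero_zero (N : ℕ) (x : Ω) (s : A.Sample N) : A.bandDensity 0 0 N x s = 1 := by
  simp [bandDensity, bandMode]

lemma measurable_bandDensity (θ : ℕ) (γ : ℝ) (N : ℕ) :
    Measurable fun p : A.Sample N × Ω => A.bandDensity θ γ N p.2 p.1 := by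
  have h : Measurable fun p : A.Sample N × Ω => A.X N p.1 p.2 := A.measurable_X N
  have := (measurable_bandMode θ).comp (h.sub_const (γ * Real.log N))
  exact (by fun_prop : Measurable fun p : A.Sample N × Ω => √(Real.log N) ^ θ *
    Real.exp (γ * A.X N p.1 p.2 - γ ^ 2 / 2 * Real.log N)).mul this

lemma measurable_bandDensity_apply (θ : ℕ) (γ : ℝ) (N : ℕ) (x : Ω) :
    Measurable (A.bandDensity θ γ N x) :=
  (measurable_bandDensity θ γ N).comp (measurable_id.prodMk measurable_const)

/-- The lower bound on the normalizing constant accounts for the powers of `√L` and of `N` in the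
majorant; the tail is dominated by the kernel uniformly because `g` is bounded on `K`. Unlike the
tail, the majorant can be estimated from bounded frequencies. -/
lemma MesoscopicAssumption.density_le [OpensMeasurableSpace Ω] [SFinite vol] [Nontrivial Ω]
    (hM : A.MesoscopicAssumption d Ψ) {K : Set Ω} (hK : IsCompact K) {γ : ℝ} (hγ : 0 < γ)
    (hγd : γ ≤ √(2 * d)) {g : Ω → ℝ} (hg : Continuous g) {θ : ℕ} (hθ : θ = 0 ∨ θ = 1) :
    ∃ C > 0, ∀ᶠ N : ℕ in atTop, ∀ x ∈ K, ∀ s,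
      A.density θ γ g N x s ≤ C * A.bandDensity θ γ N x s := by
  obtain ⟨c, hc, hmom⟩ := hM.exists_le_moment hK hγ hγd hθ
  obtain ⟨G, hG⟩ := hK.exists_bound_of_continuousOn hg.continuousOn
  obtain ⟨C, hC, htail⟩ := exists_expTail_le hγ (-G)
  have hmode : ∀ x ∈ K, ∀ v, modeFun θ γ (g x) v ≤ (C + 1) * bandMode θ v := by
    intro x hx v
    rcases hθ with rfl | rfl
    · simp [modeFun, bandMode, hC.le]
    · simp only [modeFun, bandMode, one_ne_zero, if_false]
      refine (htail (g x) (abs_le.1 (hG x hx)).1 v).trans ?_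
      gcongr
      · exact (bandKernel_pos v).le
      · linarith
  have hcoef : ∀ x ∈ K, (if θ = 0 then Real.exp (-γ * g x) else 1) ≤ Real.exp (γ * |G|) := by
    intro x hx
    have h1 := abs_le.1 (hG x hx)
    have h2 := le_abs_self G
    split_ifs
    · exact Real.exp_le_exp.2 (by nlinarith)
    · exact Real.one_le_exp (by positivity)
  refine ⟨Real.exp (γ * |G|) * c⁻¹ * (C + 1), by positivity, ?_⟩
  filter_upwards [hmom, eventually_gt_atTop 1] with N hN hN1 x hx s
  have hL : 0 < Real.log N := Real.log_pos (by exact_mod_cast hN1)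
  set L := Real.log N
  set E := Real.exp (γ ^ 2 / 2 * L) with hE
  have hE0 : 0 < E := Real.exp_pos _
  have hs : 0 < √L ^ θ := pow_pos (Real.sqrt_pos.2 hL) _
  have h1 : (A.moment θ γ N x)⁻¹ ≤ c⁻¹ * (√L ^ θ * E⁻¹) := by
    have h2 := hN x hx
    have h3 : 0 < A.moment θ γ N x := by
      by_contra hcon
      have := mul_nonpos_of_nonneg_of_nonpos hs.le (not_lt.1 hcon)
      have : 0 < c * E := by positivity
      linarith
    rw [inv_le_comm₀ h3 (by positivity)]
    simp only [mul_inv, inv_inv]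
    rw [mul_left_comm, mul_comm (√L ^ θ)⁻¹, ← div_eq_mul_inv, div_le_iff₀ hs]
    linarith
  unfold density bandDensity
  rw [Real.exp_sub, ← hE]
  calc _ ≤ Real.exp (γ * |G|) * (c⁻¹ * (√L ^ θ * E⁻¹)) *
        (Real.exp (γ * A.X N s x) * ((C + 1) * bandMode θ (A.X N s x - γ * L))) := by
        have := hcoef x hx
        have := hmode x hx (A.X N s x - γ * L)
        have := moment_nonneg (A := A) θ γ N x
        have := modeFun_nonneg θ γ (g x) (A.X N s x - γ * L)
        gcongr
    _ = _ := by rw [div_eq_mul_inv]; ring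

/-- Upper bound for two-point exponential moments of the majorants. -/
lemma MesoscopicAssumption.lintegral_bandDensity_le (hM : A.MesoscopicAssumption d Ψ) {K : Set Ω}
    (hK : IsCompact K) {η : ℝ} (hη : 0 < η) (hη1 : η ≤ 1) {γ₁ γ₂ : ℝ} (h₁ : 0 ≤ γ₁)
    (h₁' : γ₁ ≤ √(2 * d)) (h₂ : 0 ≤ γ₂) (h₂' : γ₂ ≤ √(2 * d)) {θ₁ θ₂ : ℕ}
    (hθ₁ : θ₁ = 0 ∨ θ₁ = 1) (hθ₂ : θ₂ = 0 ∨ θ₂ = 1) {q : ℕ} (ξ : Fin q → ℝ) :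
    ∃ C > 0, ∀ᶠ N : ℕ in atTop, ∀ x₁ ∈ K, ∀ x₂ ∈ K, (N : ℝ) ^ (η - 1) ≤ dist x₁ x₂ →
      ∀ (z : Fin q → Ω) (δ : Fin q → ℝ), (∀ j, z j ∈ K) →
      (∀ j, (N : ℝ) ^ (η - 1) ≤ δ j ∧ δ j ≤ 1) →
      ∫⁻ s, ENNReal.ofReal (A.bandDensity θ₁ γ₁ N x₁ s * A.bandDensity θ₂ γ₂ N x₂ s *
        Real.exp (∑ j, ξ j * A.smoothed N (δ j) s (z j))) ∂A.P N ≤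
      ENNReal.ofReal (C * Real.exp (A.interaction γ₁ γ₂ x₁ x₂ ξ δ z)) := by
  obtain ⟨C, hC, h⟩ := hM.upper_bound hK hη hη1 h₁ h₁' h₂ h₂' hθ₁ hθ₂ ξ
  refine ⟨C, hC, ?_⟩
  filter_upwards [h, eventually_ge_atTop 1] with N hN hN1 x₁ hx₁ x₂ hx₂ hr z δ hz hδ
  have hN0 : (0 : ℝ) < N := by exact_mod_cast hN1
  have hη0 : 0 < (N : ℝ) ^ (η - 1) := Real.rpow_pos_of_pos hN0 _
  have hx : x₁ ≠ x₂ := dist_pos.1 (hη0.trans_le hr)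
  have hδ' : ∀ j, δ j ∈ Ioc (0 : ℝ) 1 := fun j => ⟨hη0.trans_le (hδ j).1, (hδ j).2⟩
  set L := Real.log N
  have hint : Integrable (fun s => A.weight N γ₁ γ₂ x₁ x₂ ξ δ z s *
      (bandMode θ₁ (A.X N s x₁ - γ₁ * L) * bandMode θ₂ (A.X N s x₂ - γ₂ * L))) (A.P N) := by
    refine (hM.integrable_weight hN1 h₁ h₁' h₂ h₂' hx ξ δ z hδ').mul_bdd (c := 4) ?_
      (ae_of_all _ fun s => ?_)
    · exact (((measurable_bandMode θ₁).comp ((measurable_X_apply N x₁).sub_const _)).mul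
        ((measurable_bandMode θ₂).comp ((measurable_X_apply N x₂).sub_const _))).aestronglyMeasurable
    · rw [Real.norm_eq_abs, abs_of_nonneg (mul_nonneg (bandMode_nonneg _ _) (bandMode_nonneg _ _))]
      have := mul_le_mul (bandMode_le_two θ₁ (A.X N s x₁ - γ₁ * L))
        (bandMode_le_two θ₂ (A.X N s x₂ - γ₂ * L)) (bandMode_nonneg _ _) zero_le_two
      linarith
  have heq : ∀ s, A.bandDensity θ₁ γ₁ N x₁ s * A.bandDensity θ₂ γ₂ N x₂ s *
        Real.exp (∑ j, ξ j * A.smoothed N (δ j) s (z j)) =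
      (√L ^ θ₁ * √L ^ θ₂ * Real.exp (-((γ₁ ^ 2 + γ₂ ^ 2) / 2 * L))) *
      (A.weight N γ₁ γ₂ x₁ x₂ ξ δ z s *
      (bandMode θ₁ (A.X N s x₁ - γ₁ * L) * bandMode θ₂ (A.X N s x₂ - γ₂ * L))) := by
    intro s
    have e : Real.exp (γ₁ * A.X N s x₁ - γ₁ ^ 2 / 2 * L) *
        Real.exp (γ₂ * A.X N s x₂ - γ₂ ^ 2 / 2 * L) *
        Real.exp (∑ j, ξ j * A.smoothed N (δ j) s (z j)) =
        Real.exp (-((γ₁ ^ 2 + γ₂ ^ 2) / 2 * L)) * A.weight N γ₁ γ₂ x₁ x₂ ξ δ z s := by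
      unfold weight
      rw [← Real.exp_add, ← Real.exp_add, ← Real.exp_add]
      congr 1
      ring
    unfold bandDensity
    linear_combination (√L ^ θ₁ * √L ^ θ₂ * bandMode θ₁ (A.X N s x₁ - γ₁ * L) *
      bandMode θ₂ (A.X N s x₂ - γ₂ * L)) * e
  simp_rw [heq]
  rw [← ofReal_integral_eq_lintegral_ofReal (hint.const_mul _) (ae_of_all _ fun s => ?_)]
  · refine ENNReal.ofReal_le_ofReal ?_
    rw [integral_const_mul]
    have h3 := hN x₁ hx₁ x₂ hx₂ hr z δ hz hδ
    rw [Real.exp_add] at h3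
    calc _ = Real.exp (-((γ₁ ^ 2 + γ₂ ^ 2) / 2 * L)) * (√L ^ θ₁ * √L ^ θ₂ *
          ∫ s, A.weight N γ₁ γ₂ x₁ x₂ ξ δ z s *
          (bandMode θ₁ (A.X N s x₁ - γ₁ * L) * bandMode θ₂ (A.X N s x₂ - γ₂ * L)) ∂A.P N) := by
            ring
      _ ≤ _ := mul_le_mul_of_nonneg_left h3 (Real.exp_pos _).le
      _ = _ := by
        rw [Real.exp_neg]
        field_simp
  · have := bandMode_nonneg θ₁ (A.X N s x₁ - γ₁ * L)
    have := bandMode_nonneg θ₂ (A.X N s x₂ - γ₂ * L)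
    have := weight_pos (A := A) N γ₁ γ₂ x₁ x₂ ξ δ z s
    simp only [Pi.zero_apply]
    positivity

lemma MesoscopicAssumption.lintegral_bandDensity_one_le [Nontrivial Ω]
    (hM : A.MesoscopicAssumption d Ψ) {K : Set Ω} (hK : IsCompact K) {γ : ℝ} (hγ : 0 ≤ γ)
    (hγd : γ ≤ √(2 * d)) {θ : ℕ} (hθ : θ = 0 ∨ θ = 1) :
    ∃ C > 0, ∀ᶠ N : ℕ in atTop, ∀ x ∈ K,
      ∫⁻ s, ENNReal.ofReal (A.bandDensity θ γ N x s) ∂A.P N ≤ ENNReal.ofReal C := by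
  obtain ⟨K₀, hK₀, c, hc, hfar⟩ := exists_far_point Ω
  obtain ⟨C, hC, h⟩ := hM.lintegral_bandDensity_le (hK.union hK₀) (η := 1 / 2) (by norm_num)
    (by norm_num) hγ hγd le_rfl (Real.sqrt_nonneg _) hθ (Or.inl rfl) (Fin.elim0 : Fin 0 → ℝ)
  refine ⟨C, hC, ?_⟩
  filter_upwards [h, eventually_rpow_sub_one_le (η := 1 / 2) (by norm_num) hc] with N hN hN2 x hx
  obtain ⟨y, hy, hxy⟩ := hfar x
  have := hN x (Or.inl hx) y (Or.inr hy) (hN2.trans hxy) Fin.elim0 Fin.elim0 (fun j => j.elim0)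
    (fun j => j.elim0)
  simpa [bandDensity_zero_zero, interaction_point] using this

end FieldApproximation

/-! ### Cutoffs and elementary inequalities for the truncation -/

/-- A smooth cutoff: `1` for `|y| ≤ a` and `0` for `|y| ≥ a + 1`. -/
def smoothCutoff (a y : ℝ) : ℝ := Real.smoothTransition (a ^ 2 + 1 - y ^ 2)

lemma smoothCutoff_nonneg (a y : ℝ) : 0 ≤ smoothCutoff a y := Real.smoothTransition.nonneg _

lemma smoothCutoff_le_one (a y : ℝ) : smoothCutoff a y ≤ 1 := Real.smoothTransition.le_one _

lemma smoothCutoff_eq_one {a y : ℝ} (h : |y| ≤ a) : smoothCutoff a y = 1 := by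
  refine Real.smoothTransition.one_of_one_le ?_
  nlinarith [sq_abs y, abs_nonneg y]

lemma abs_le_of_smoothCutoff_ne_zero {a y : ℝ} (ha : 0 ≤ a) (h : smoothCutoff a y ≠ 0) :
    |y| ≤ a + 1 := by
  by_contra hcon
  refine h (Real.smoothTransition.zero_of_nonpos ?_)
  nlinarith [sq_abs y, not_le.1 hcon]

lemma contDiff_smoothCutoff (a : ℝ) : ContDiff ℝ ∞ (smoothCutoff a) :=
  Real.smoothTransition.contDiff.comp (by fun_prop)

lemma one_sub_mul_le {a b : ℝ} (ha : a ≤ 1) (hb : b ≤ 1) :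
    1 - a * b ≤ (1 - a) + (1 - b) := by
  nlinarith [mul_nonneg (sub_nonneg.2 ha) (sub_nonneg.2 hb)]

lemma one_sub_prod_le {ι : Type*} (I : Finset ι) {b : ι → ℝ} (h0 : ∀ i, 0 ≤ b i)
    (h1 : ∀ i, b i ≤ 1) : 1 - ∏ i ∈ I, b i ≤ ∑ i ∈ I, (1 - b i) := by
  classical
  induction I using Finset.induction_on with
  | empty => simp
  | insert i I hi ih =>
    rw [Finset.prod_insert hi, Finset.sum_insert hi]
    exact (one_sub_mul_le (h1 i) (Finset.prod_le_one (fun j _ => h0 j) fun j _ => h1 j)).trans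
      (by linarith)

lemma exists_exp_neg_nat_le {c : ℝ} (hc : 0 < c) : ∃ k₀ : ℕ, ∀ k : ℕ, k₀ ≤ k →
    Real.exp (-k) ≤ c := by
  have h : Tendsto (fun k : ℕ => Real.exp (-(k : ℝ))) atTop (𝓝 0) :=
    Real.tendsto_exp_neg_atTop_nhds_zero.comp tendsto_natCast_atTop_atTop
  exact eventually_atTop.1 (h.eventually_le_const hc)

/-- A two-sided Chernoff bound. -/
lemma indicator_lt_abs_le (κ a y : ℝ) (hκ : 0 ≤ κ) : (if a < |y| then (1 : ℝ) else 0) ≤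
    Real.exp (-(κ * a)) * (Real.exp (κ * y) + Real.exp (-κ * y)) := by
  split_ifs with h
  · rw [mul_add, ← Real.exp_add, ← Real.exp_add]
    rcases abs_cases y with ⟨hy, _⟩ | ⟨hy, _⟩
    · have : 1 ≤ Real.exp (-(κ * a) + κ * y) := Real.one_le_exp (by nlinarith)
      linarith [Real.exp_pos (-(κ * a) + -κ * y)]
    · have : 1 ≤ Real.exp (-(κ * a) + -κ * y) := Real.one_le_exp (by nlinarith)
      linarith [Real.exp_pos (-(κ * a) + κ * y)]
  · positivity

/-- A geometric tail. The bound does not depend on the last scale `m`, which grows with `log N`. -/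
lemma sum_exp_neg_mul_le {a : ℝ} (ha : 0 < a) (k₁ m : ℕ) :
    ∑ k ∈ Finset.Icc k₁ m, Real.exp (-a * k) ≤ (1 - Real.exp (-a))⁻¹ * Real.exp (-a * k₁) := by
  have hr : Real.exp (-a) < 1 := Real.exp_lt_one_iff.2 (by linarith)
  have hpow : ∀ k : ℕ, Real.exp (-a * k) = Real.exp (-a) ^ k := fun k => by
    rw [← Real.exp_nat_mul]; ring_nf
  have hsub : Finset.Icc k₁ m ⊆ (Finset.range (m + 1)).image fun j => k₁ + j := by
    intro k hk
    rw [Finset.mem_Icc] at hk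
    exact Finset.mem_image.2 ⟨k - k₁, Finset.mem_range.2 (by omega), by omega⟩
  calc ∑ k ∈ Finset.Icc k₁ m, Real.exp (-a * k)
      ≤ ∑ k ∈ (Finset.range (m + 1)).image fun j => k₁ + j, Real.exp (-a * k) :=
        Finset.sum_le_sum_of_subset_of_nonneg hsub fun _ _ _ => (Real.exp_pos _).le
    _ = Real.exp (-a * k₁) * ∑ j ∈ Finset.range (m + 1), Real.exp (-a) ^ j := by
        rw [Finset.sum_image (by intro i _ j _ h; simpa using h), Finset.mul_sum]
        refine Finset.sum_congr rfl fun j _ => ?_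
        rw [hpow, hpow, pow_add]
    _ ≤ Real.exp (-a * k₁) * (1 - Real.exp (-a))⁻¹ := by
        gcongr
        rw [← tsum_geometric_of_lt_one (Real.exp_pos _).le hr]
        exact (summable_geometric_of_lt_one (Real.exp_pos _).le hr).sum_le_tsum _
          fun _ _ => pow_nonneg (Real.exp_pos _).le _
    _ = _ := mul_comm _ _

/-! ### Truncation at the scales `e^{-k}` -/

namespace FieldApproximation

variable {Ω : Type u} [MetricSpace Ω] [MeasurableSpace Ω] {vol : Measure Ω} {T : Set (Ω → ℝ)}
  {𝕏 : LogCorrelatedField.{u, w} Ω vol T} {A : FieldApproximation.{u, v, w} 𝕏}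
  {d : ℕ} {Ψ : ℂ → Ω → ℂ}

variable (A) in
/-- The smooth indicator that the smoothed fields at the scales `e^{-k}`, `k ∈ I`, are at most about
`l k`. -/
def scaleCutoff (l : ℝ) (N : ℕ) (I : Finset ℕ) (x : Ω) (s : A.Sample N) : ℝ :=
  ∏ k ∈ I, smoothCutoff (l * k) (A.smoothed N (Real.exp (-k)) s x)

variable (A) in
/-- The smooth indicator that neither the field nor the smoothed fields at the scales `e^{-k}`,
`k ∈ I`, are unusually large. -/
def truncation (l : ℝ) (N : ℕ) (I : Finset ℕ) (x : Ω) (s : A.Sample N) : ℝ :=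
  (if A.X N s x ≤ l * Real.log N then 1 else 0) * A.scaleCutoff l N I x s

variable (A) in
/-- The number of unusually large values among the field and its smoothed versions. -/
def excess (l : ℝ) (N : ℕ) (I : Finset ℕ) (x : Ω) (s : A.Sample N) : ℝ :=
  (if l * Real.log N < A.X N s x then 1 else 0) +
    ∑ k ∈ I, if l * k < |A.smoothed N (Real.exp (-k)) s x| then 1 else 0

lemma scaleCutoff_nonneg (l : ℝ) (N : ℕ) (I : Finset ℕ) (x : Ω) (s : A.Sample N) :
    0 ≤ A.scaleCutoff l N I x s := Finset.prod_nonneg fun _ _ => smoothCutoff_nonneg _ _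

lemma scaleCutoff_le_one (l : ℝ) (N : ℕ) (I : Finset ℕ) (x : Ω) (s : A.Sample N) :
    A.scaleCutoff l N I x s ≤ 1 :=
  Finset.prod_le_one (fun _ _ => smoothCutoff_nonneg _ _) fun _ _ => smoothCutoff_le_one _ _

lemma scaleCutoff_le {l : ℝ} {N : ℕ} {I : Finset ℕ} {k : ℕ} (hk : k ∈ I) (x : Ω)
    (s : A.Sample N) :
    A.scaleCutoff l N I x s ≤ smoothCutoff (l * k) (A.smoothed N (Real.exp (-k)) s x) := by
  classical
  unfold scaleCutoff
  rw [← Finset.mul_prod_erase I _ hk]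
  exact mul_le_of_le_one_right (smoothCutoff_nonneg _ _)
    (Finset.prod_le_one (fun _ _ => smoothCutoff_nonneg _ _) fun _ _ => smoothCutoff_le_one _ _)

lemma truncation_nonneg (l : ℝ) (N : ℕ) (I : Finset ℕ) (x : Ω) (s : A.Sample N) :
    0 ≤ A.truncation l N I x s :=
  mul_nonneg (by split_ifs <;> norm_num) (scaleCutoff_nonneg _ _ _ _ _)

lemma truncation_le_scaleCutoff (l : ℝ) (N : ℕ) (I : Finset ℕ) (x : Ω) (s : A.Sample N) :
    A.truncation l N I x s ≤ A.scaleCutoff l N I x s :=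
  mul_le_of_le_one_left (scaleCutoff_nonneg _ _ _ _ _) (by split_ifs <;> norm_num)

lemma truncation_le_one (l : ℝ) (N : ℕ) (I : Finset ℕ) (x : Ω) (s : A.Sample N) :
    A.truncation l N I x s ≤ 1 :=
  (truncation_le_scaleCutoff _ _ _ _ _).trans (scaleCutoff_le_one _ _ _ _ _)

lemma truncation_le_indicator (l : ℝ) (N : ℕ) (I : Finset ℕ) (x : Ω) (s : A.Sample N) :
    A.truncation l N I x s ≤ if A.X N s x ≤ l * Real.log N then 1 else 0 :=
  mul_le_of_le_one_right (by split_ifs <;> norm_num) (scaleCutoff_le_one _ _ _ _ _)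

lemma excess_nonneg (l : ℝ) (N : ℕ) (I : Finset ℕ) (x : Ω) (s : A.Sample N) :
    0 ≤ A.excess l N I x s :=
  add_nonneg (by split_ifs <;> norm_num)
    (Finset.sum_nonneg fun _ _ => by split_ifs <;> norm_num)

/-- A union bound: the defect of a product of numbers in `[0, 1]` is at most the sum of the defects,
and a cutoff is below `1` only when its value is too large. -/
lemma one_sub_truncation_le (l : ℝ) (N : ℕ) (I : Finset ℕ) (x : Ω) (s : A.Sample N) :
    1 - A.truncation l N I x s ≤ A.excess l N I x s := by
  unfold truncation excess
  refine (one_sub_mul_le (by split_ifs <;> norm_num) (scaleCutoff_le_one _ _ _ _ _)).trans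
    (add_le_add ?_ ?_)
  · split_ifs with h1 h2 h2
    · norm_num
    · norm_num
    · norm_num
    · exact absurd (not_le.1 h1) h2
  · refine (one_sub_prod_le I (fun _ => smoothCutoff_nonneg _ _)
      fun _ => smoothCutoff_le_one _ _).trans (Finset.sum_le_sum fun k _ => ?_)
    split_ifs with h
    · linarith [smoothCutoff_nonneg (l * k) (A.smoothed N (Real.exp (-k)) s x)]
    · rw [smoothCutoff_eq_one (not_lt.1 h), sub_self]

lemma exp_neg_nat_mem_Ioc (k : ℕ) : Real.exp (-k) ∈ Ioc (0 : ℝ) 1 :=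
  ⟨Real.exp_pos _, Real.exp_le_one_iff.2 (neg_nonpos.2 (Nat.cast_nonneg k))⟩

/-- Upper bound for the moments of the majorants weighted by the exponential of one smoothed
field. -/
lemma MesoscopicAssumption.lintegral_bandDensity_smoothed_le (hM : A.MesoscopicAssumption d Ψ)
    {K : Set Ω} (hK : IsCompact K) {η : ℝ} (hη : 0 < η) (hη1 : η ≤ 1) {γ₁ γ₂ : ℝ} (h₁ : 0 ≤ γ₁)
    (h₁' : γ₁ ≤ √(2 * d)) (h₂ : 0 ≤ γ₂) (h₂' : γ₂ ≤ √(2 * d)) {θ₁ θ₂ : ℕ}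
    (hθ₁ : θ₁ = 0 ∨ θ₁ = 1) (hθ₂ : θ₂ = 0 ∨ θ₂ = 1) (ξ : ℝ) :
    ∃ C > 0, ∀ᶠ N : ℕ in atTop, ∀ x₁ ∈ K, ∀ x₂ ∈ K, (N : ℝ) ^ (η - 1) ≤ dist x₁ x₂ →
      ∀ z ∈ K, ∀ δ : ℝ, (N : ℝ) ^ (η - 1) ≤ δ → δ ≤ 1 →
      ∫⁻ s, ENNReal.ofReal (A.bandDensity θ₁ γ₁ N x₁ s * A.bandDensity θ₂ γ₂ N x₂ s *
        Real.exp (ξ * A.smoothed N δ s z)) ∂A.P N ≤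
      ENNReal.ofReal (C * Real.exp (γ₁ * γ₂ * 𝕏.cov x₁ x₂ + γ₁ * (ξ * A.cov₁ δ z x₁) +
        γ₂ * (ξ * A.cov₁ δ z x₂) + ξ ^ 2 * A.cov₂ δ δ z z / 2)) := by
  obtain ⟨C, hC, h⟩ := hM.lintegral_bandDensity_le hK hη hη1 h₁ h₁' h₂ h₂' hθ₁ hθ₂
    (fun _ : Fin 1 => ξ)
  refine ⟨C, hC, ?_⟩
  filter_upwards [h] with N hN x₁ hx₁ x₂ hx₂ hr z hz δ hδ hδ1
  have := hN x₁ hx₁ x₂ hx₂ hr (fun _ => z) (fun _ => δ) (fun _ => hz) (fun _ => ⟨hδ, hδ1⟩)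
  simpa only [Finset.univ_unique, Finset.sum_singleton, interaction, potential_one,
    energy_one] using this

/-- Upper bound for the two-point moments of the majorants. -/
lemma MesoscopicAssumption.lintegral_bandDensity_two_le (hM : A.MesoscopicAssumption d Ψ)
    {K : Set Ω} (hK : IsCompact K) {η : ℝ} (hη : 0 < η) (hη1 : η ≤ 1) {γ₁ γ₂ : ℝ} (h₁ : 0 ≤ γ₁)
    (h₁' : γ₁ ≤ √(2 * d)) (h₂ : 0 ≤ γ₂) (h₂' : γ₂ ≤ √(2 * d)) {θ₁ θ₂ : ℕ}
    (hθ₁ : θ₁ = 0 ∨ θ₁ = 1) (hθ₂ : θ₂ = 0 ∨ θ₂ = 1) :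
    ∃ C > 0, ∀ᶠ N : ℕ in atTop, ∀ x₁ ∈ K, ∀ x₂ ∈ K, (N : ℝ) ^ (η - 1) ≤ dist x₁ x₂ →
      ∫⁻ s, ENNReal.ofReal (A.bandDensity θ₁ γ₁ N x₁ s * A.bandDensity θ₂ γ₂ N x₂ s) ∂A.P N ≤
      ENNReal.ofReal (C * Real.exp (γ₁ * γ₂ * 𝕏.cov x₁ x₂)) := by
  obtain ⟨C, hC, h⟩ := hM.lintegral_bandDensity_le hK hη hη1 h₁ h₁' h₂ h₂' hθ₁ hθ₂
    (Fin.elim0 : Fin 0 → ℝ)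
  refine ⟨C, hC, ?_⟩
  filter_upwards [h] with N hN x₁ hx₁ x₂ hx₂ hr
  have := hN x₁ hx₁ x₂ hx₂ hr Fin.elim0 Fin.elim0 (fun j => j.elim0) (fun j => j.elim0)
  simpa [interaction] using this

/-- The last scale of the truncation is chosen so that all its scales are mesoscopic, where the
moment asymptotics are available. -/
lemma rpow_sub_one_le_exp_neg {N k : ℕ} (hN : 1 ≤ N) {η : ℝ} (hη : η ≤ 1)
    (hk : k ≤ ⌊(1 - η) * Real.log N⌋₊) : (N : ℝ) ^ (η - 1) ≤ Real.exp (-k) := by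
  have hN0 : (0 : ℝ) < N := by exact_mod_cast hN
  have hL : 0 ≤ Real.log N := Real.log_nonneg (by exact_mod_cast hN)
  have h1 : (k : ℝ) ≤ (1 - η) * Real.log N :=
    (Nat.le_floor_iff (mul_nonneg (by linarith) hL)).1 hk
  rw [Real.rpow_def_of_pos hN0]
  exact Real.exp_le_exp.2 (by linarith)

end FieldApproximation

/-- The factors `√(log N)` of the majorants are absorbed by small powers of `N`. -/
lemma eventually_sqrt_log_pow_le {θ : ℕ} (hθ : θ = 0 ∨ θ = 1) {ε : ℝ} (hε : 0 < ε) :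
    ∀ᶠ N : ℕ in atTop, √(Real.log N) ^ θ ≤ Real.exp (ε * Real.log N) := by
  have h : Tendsto (fun N : ℕ => Real.log N) atTop atTop :=
    Real.tendsto_log_atTop.comp tendsto_natCast_atTop_atTop
  filter_upwards [h.eventually_ge_atTop (max 1 (4 / ε ^ 2))] with N hN
  set L := Real.log N
  have h1 : 1 ≤ L := (le_max_left _ _).trans hN
  have h2 : 4 / ε ^ 2 ≤ L := (le_max_right _ _).trans hN
  have h3 : 4 ≤ ε ^ 2 * L := by
    rw [div_le_iff₀ (by positivity)] at h2; linarith
  have h4 : √L ^ θ ≤ L := by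
    rcases hθ with rfl | rfl
    · simpa using h1
    · rw [pow_one]
      exact (Real.sqrt_le_left (by linarith)).2 (by nlinarith)
  have h5 : ε * L / 2 ≤ Real.exp (ε * L / 2) := by linarith [Real.add_one_le_exp (ε * L / 2)]
  have h6 : Real.exp (ε * L) = Real.exp (ε * L / 2) ^ 2 := by
    rw [← Real.exp_nat_mul]; congr 1; push_cast; ring
  have h7 : (ε * L / 2) ^ 2 ≤ Real.exp (ε * L / 2) ^ 2 := by gcongr
  nlinarith

lemma tendsto_exp_neg_mul_log {a : ℝ} (ha : 0 < a) :
    Tendsto (fun N : ℕ => Real.exp (-a * Real.log N)) atTop (𝓝 0) := by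
  have h : Tendsto (fun N : ℕ => a * Real.log N) atTop atTop :=
    (Real.tendsto_log_atTop.comp tendsto_natCast_atTop_atTop).const_mul_atTop ha
  simpa [Function.comp_def] using Real.tendsto_exp_neg_atTop_nhds_zero.comp h

/-! ### Cost of the truncation -/

namespace FieldApproximation

variable {Ω : Type u} [MetricSpace Ω] [MeasurableSpace Ω] {vol : Measure Ω} {T : Set (Ω → ℝ)}
  {𝕏 : LogCorrelatedField.{u, w} Ω vol T} {A : FieldApproximation.{u, v, w} 𝕏}
  {d : ℕ} {Ψ : ℂ → Ω → ℂ}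

/-- Exceedances of the field are rare, even under the measure weighted by the majorants. -/
lemma bandDensity_mul_indicator_lt_le {γ κ : ℝ} (hκ : 0 ≤ κ) (θ N : ℕ) (x : Ω) (s : A.Sample N) :
    A.bandDensity θ γ N x s * (if (γ + κ) * Real.log N < A.X N s x then 1 else 0) ≤
      2 * √(Real.log N) ^ θ * Real.exp (-(κ ^ 2 / 2) * Real.log N) *
        A.bandDensity 0 (γ + κ) N x s := by
  have hR : 0 ≤ 2 * √(Real.log N) ^ θ * Real.exp (-(κ ^ 2 / 2) * Real.log N) *
        A.bandDensity 0 (γ + κ) N x s :=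
    mul_nonneg (by positivity) (bandDensity_nonneg _ _ _ _ _)
  split_ifs with h
  · rw [mul_one]
    unfold bandDensity
    have h1 : bandMode 0 (A.X N s x - (γ + κ) * Real.log N) = 1 := rfl
    rw [h1, pow_zero, one_mul, mul_one, mul_assoc _ (Real.exp _) (Real.exp _), ← Real.exp_add]
    have h2 := bandMode_le_two θ (A.X N s x - γ * Real.log N)
    have h4 := bandMode_nonneg θ (A.X N s x - γ * Real.log N)
    -- Beyond the level `(γ + κ) L` the tilt can be raised from `γ` to `γ + κ`; completing the
    -- square leaves the gain `κ² L / 2`.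
    have h3 : Real.exp (γ * A.X N s x - γ ^ 2 / 2 * Real.log N) ≤ Real.exp (-(κ ^ 2 / 2) *
        Real.log N + ((γ + κ) * A.X N s x - (γ + κ) ^ 2 / 2 * Real.log N)) :=
      Real.exp_le_exp.2 (by nlinarith)
    calc _ ≤ √(Real.log N) ^ θ * Real.exp (-(κ ^ 2 / 2) *
        Real.log N + ((γ + κ) * A.X N s x - (γ + κ) ^ 2 / 2 * Real.log N)) * 2 := by
          gcongr
      _ = _ := by ring
  · simpa using hR

/-- Unusually large values at small scales are rare, under the measure weighted by the majorants at
one point or at two macroscopically separated points. -/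
lemma MesoscopicAssumption.lintegral_excess_le [OpensMeasurableSpace Ω] [SFinite vol]
    (hM : A.MesoscopicAssumption d Ψ) (hA : A.CovarianceAssumption) {K : Set Ω} (hK : IsCompact K)
    {η : ℝ} (hη : 0 < η) (hη1 : η < 1) {γ κ γ₂ : ℝ} (hγ : 0 ≤ γ) (hκ : 0 < κ)
    (hγκ : γ + κ ≤ √(2 * d)) (h₂ : 0 ≤ γ₂) (h₂' : γ₂ ≤ √(2 * d)) {θ₁ θ₂ : ℕ}
    (hθ₁ : θ₁ = 0 ∨ θ₁ = 1) (hθ₂ : θ₂ = 0 ∨ θ₂ = 1) {c : ℝ} (hc : 0 < c) :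
    ∃ C > 0, ∃ k₀ : ℕ, ∀ k₁ ≥ k₀, ∀ᶠ N : ℕ in atTop, ∀ x₁ ∈ K, ∀ x₂ ∈ K, c ≤ dist x₁ x₂ →
      ∫⁻ s, ENNReal.ofReal (A.bandDensity θ₁ γ N x₁ s * A.bandDensity θ₂ γ₂ N x₂ s *
        A.excess (γ + κ) N (Finset.Icc k₁ ⌊(1 - η) * Real.log N⌋₊) x₁ s) ∂A.P N ≤
      ENNReal.ofReal (C * Real.exp (-(κ ^ 2 / 2) * k₁)) := by
  have hγ' : γ ≤ √(2 * d) := by linarith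
  obtain ⟨H, hH, hcov⟩ := exists_abs_cov_le_of_le_dist (𝕏 := 𝕏) hK hc
  obtain ⟨a, ha, B, hB⟩ := hA.bound K hK
  obtain ⟨k₀, hk₀⟩ := exists_exp_neg_nat_le ha.1
  obtain ⟨D', hD'⟩ := Metric.isBounded_iff.1 hK.isBounded
  obtain ⟨C₁, hC₁, h1⟩ := hM.lintegral_bandDensity_smoothed_le hK hη hη1.le hγ hγ' h₂ h₂' hθ₁ hθ₂ κ
  obtain ⟨C₂, hC₂, h2⟩ := hM.lintegral_bandDensity_smoothed_le hK hη hη1.le hγ hγ' h₂ h₂' hθ₁ hθ₂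
    (-κ)
  obtain ⟨C₃, hC₃, h3⟩ := hM.lintegral_bandDensity_two_le hK hη hη1.le (γ₁ := γ + κ)
    (by linarith) hγκ h₂ h₂' (θ₁ := 0) (Or.inl rfl) hθ₂
  set B' : ℝ := |Real.log c| + |Real.log (max D' 1)| + |B|
  -- `E` collects the part of the Gaussian exponent that does not grow with the scale `k`: as the
  -- points are `c` apart, the smoothed field at `x₁` has bounded covariance with the field at `x₂`.
  set E : ℝ := γ * γ₂ * H + γ * κ * |B| + γ₂ * κ * B' + κ ^ 2 / 2 * |B| with hE
  set M : ℝ := (C₁ + C₂) * Real.exp E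
  have hq : 0 < 1 - Real.exp (-(κ ^ 2 / 2)) := by
    have : Real.exp (-(κ ^ 2 / 2)) < 1 := Real.exp_lt_one_iff.2 (by nlinarith)
    linarith
  refine ⟨1 + M * (1 - Real.exp (-(κ ^ 2 / 2)))⁻¹, by positivity, k₀, fun k₁ hk₁ => ?_⟩
  have hsmall : ∀ᶠ N : ℕ in atTop, 2 * √(Real.log N) ^ θ₁ * Real.exp (-(κ ^ 2 / 2) * Real.log N) *
      (C₃ * Real.exp ((γ + κ) * γ₂ * H)) ≤ Real.exp (-(κ ^ 2 / 2) * k₁) := by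
    have ht := (tendsto_exp_neg_mul_log (a := κ ^ 2 / 4) (by positivity)).const_mul
      (2 * (C₃ * Real.exp ((γ + κ) * γ₂ * H)))
    rw [mul_zero] at ht
    filter_upwards [ht.eventually_le_const (Real.exp_pos (-(κ ^ 2 / 2) * k₁)),
      eventually_sqrt_log_pow_le hθ₁ (ε := κ ^ 2 / 4) (by positivity)] with N hN1 hN2
    refine le_trans ?_ hN1
    calc _ ≤ 2 * Real.exp (κ ^ 2 / 4 * Real.log N) * Real.exp (-(κ ^ 2 / 2) * Real.log N) *
          (C₃ * Real.exp ((γ + κ) * γ₂ * H)) := by gcongr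
      _ = 2 * (C₃ * Real.exp ((γ + κ) * γ₂ * H)) * (Real.exp (κ ^ 2 / 4 * Real.log N) *
          Real.exp (-(κ ^ 2 / 2) * Real.log N)) := by ring
      _ = _ := by rw [← Real.exp_add]; ring_nf
  filter_upwards [h1, h2, h3, hsmall, eventually_rpow_sub_one_le hη1 hc, eventually_ge_atTop 1]
    with N hN1 hN2 hN3 hN4 hNc hNone x₁ hx₁ x₂ hx₂ hr
  have hmeso : (N : ℝ) ^ (η - 1) ≤ dist x₁ x₂ := hNc.trans hr
  set L := Real.log N
  set I := Finset.Icc k₁ ⌊(1 - η) * L⌋₊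
  have hC := hcov x₁ hx₁ x₂ hx₂ hr
  set U : A.Sample N → ℝ := fun s => A.bandDensity θ₁ γ N x₁ s * A.bandDensity θ₂ γ₂ N x₂ s with hU
  have hU0 : ∀ s, 0 ≤ U s := fun s =>
    mul_nonneg (bandDensity_nonneg _ _ _ _ _) (bandDensity_nonneg _ _ _ _ _)
  have hUm : Measurable U :=
    (measurable_bandDensity_apply _ _ _ _).mul (measurable_bandDensity_apply _ _ _ _)
  have hYm : ∀ k : ℕ, Measurable fun s => A.smoothed N (Real.exp (-k)) s x₁ := fun k =>
    measurable_smoothed N (exp_neg_nat_mem_Ioc k) x₁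
  -- the contribution of one scale
  have hscale : ∀ k ∈ I, ∀ ξ : ℝ, |ξ| = κ → γ * γ₂ * 𝕏.cov x₁ x₂ +
      γ * (ξ * A.cov₁ (Real.exp (-k)) x₁ x₁) + γ₂ * (ξ * A.cov₁ (Real.exp (-k)) x₁ x₂) +
      ξ ^ 2 * A.cov₂ (Real.exp (-k)) (Real.exp (-k)) x₁ x₁ / 2 ≤
      E + (γ * κ + κ ^ 2 / 2) * k := by
    intro k hk ξ hξ
    have hka : Real.exp (-k) ∈ Ioc (0 : ℝ) a :=
      ⟨Real.exp_pos _, hk₀ k (hk₁.le.trans (Finset.mem_Icc.1 hk).1)⟩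
    have b1 := hB x₁ hx₁ x₁ hx₁ _ hka _ hka le_rfl
    have b2 := (hB x₁ hx₁ x₂ hx₂ _ hka _ hka le_rfl).1
    rw [dist_self, max_eq_right (Real.exp_pos _).le, Real.log_exp] at b1
    have hk0 : (0 : ℝ) ≤ k := Nat.cast_nonneg k
    have c1 : |A.cov₁ (Real.exp (-k)) x₁ x₁| ≤ k + |B| := by
      have := abs_le.1 (b1.1.trans (le_abs_self B))
      rw [abs_le]; constructor <;> linarith
    have c2 : |A.cov₂ (Real.exp (-k)) (Real.exp (-k)) x₁ x₁| ≤ k + |B| := by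
      have := abs_le.1 (b1.2.trans (le_abs_self B))
      rw [abs_le]; constructor <;> linarith
    have c3 : |A.cov₁ (Real.exp (-k)) x₁ x₂| ≤ B' := by
      have e1 := abs_le.1 (b2.trans (le_abs_self B))
      have e2 : Real.log c ≤ Real.log (max (dist x₁ x₂) (Real.exp (-k))) :=
        Real.log_le_log hc (hr.trans (le_max_left _ _))
      have e3 : Real.log (max (dist x₁ x₂) (Real.exp (-k))) ≤ Real.log (max D' 1) :=
        Real.log_le_log (lt_max_of_lt_right (Real.exp_pos _))
          (max_le_max (hD' hx₁ hx₂) (exp_neg_nat_mem_Ioc k).2)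
      have e4 := neg_abs_le (Real.log c)
      have e5 := le_abs_self (Real.log (max D' 1))
      have e6 := abs_nonneg (Real.log c)
      have e7 := abs_nonneg (Real.log (max D' 1))
      simp only [B']
      rw [abs_le]; constructor <;> linarith
    have d1 : γ * γ₂ * 𝕏.cov x₁ x₂ ≤ γ * γ₂ * H := by
      have := (abs_le.1 hC).2; gcongr
    have dξ : ∀ y b : ℝ, |y| ≤ b → ξ * y ≤ κ * b := fun y b hyb => by
      calc ξ * y ≤ |ξ * y| := le_abs_self _
        _ = κ * |y| := by rw [abs_mul, hξ]
        _ ≤ κ * b := by gcongr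
    have d2 := mul_le_mul_of_nonneg_left (dξ _ _ c1) hγ
    have d3 := mul_le_mul_of_nonneg_left (dξ _ _ c3) h₂
    have d4 : ξ ^ 2 * A.cov₂ (Real.exp (-k)) (Real.exp (-k)) x₁ x₁ / 2 ≤
        κ ^ 2 * (k + |B|) / 2 := by
      rw [← hξ, sq_abs]
      have := (abs_le.1 c2).2
      gcongr
    rw [hE]
    nlinarith
  have hb1 : ∀ k ∈ I, ∫⁻ s, ENNReal.ofReal (U s * Real.exp (κ * A.smoothed N (Real.exp (-k)) s x₁))
      ∂A.P N ≤ ENNReal.ofReal (C₁ * Real.exp (E + (γ * κ + κ ^ 2 / 2) * k)) := by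
    intro k hk
    refine (hN1 x₁ hx₁ x₂ hx₂ hmeso x₁ hx₁ _ (rpow_sub_one_le_exp_neg hNone hη1.le
      (Finset.mem_Icc.1 hk).2) (exp_neg_nat_mem_Ioc k).2).trans (ENNReal.ofReal_le_ofReal ?_)
    exact mul_le_mul_of_nonneg_left (Real.exp_le_exp.2 (hscale k hk κ (abs_of_pos hκ))) hC₁.le
  have hb2 : ∀ k ∈ I, ∫⁻ s, ENNReal.ofReal (U s * Real.exp (-κ * A.smoothed N (Real.exp (-k)) s x₁))
      ∂A.P N ≤ ENNReal.ofReal (C₂ * Real.exp (E + (γ * κ + κ ^ 2 / 2) * k)) := by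
    intro k hk
    refine (hN2 x₁ hx₁ x₂ hx₂ hmeso x₁ hx₁ _ (rpow_sub_one_le_exp_neg hNone hη1.le
      (Finset.mem_Icc.1 hk).2) (exp_neg_nat_mem_Ioc k).2).trans (ENNReal.ofReal_le_ofReal ?_)
    exact mul_le_mul_of_nonneg_left
      (Real.exp_le_exp.2 (hscale k hk (-κ) (by rw [abs_neg, abs_of_pos hκ]))) hC₂.le
  have hb3 : ∫⁻ s, ENNReal.ofReal (A.bandDensity 0 (γ + κ) N x₁ s * A.bandDensity θ₂ γ₂ N x₂ s)
      ∂A.P N ≤ ENNReal.ofReal (C₃ * Real.exp ((γ + κ) * γ₂ * H)) := by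
    refine (hN3 x₁ hx₁ x₂ hx₂ hmeso).trans (ENNReal.ofReal_le_ofReal ?_)
    have := (abs_le.1 hC).2
    gcongr
  set aN : ℝ := 2 * √L ^ θ₁ * Real.exp (-(κ ^ 2 / 2) * L) with haN
  have haN0 : 0 ≤ aN := by positivity
  -- Chernoff's bound with parameter `κ` at each scale: the threshold gives `-κ (γ + κ) k`, the
  -- tilted exponential moment at most `(γ κ + κ² / 2) k`, so `-κ² k / 2` remains.
  have hpt : ∀ s, ENNReal.ofReal (U s * A.excess (γ + κ) N I x₁ s) ≤
      ENNReal.ofReal aN * ENNReal.ofReal (A.bandDensity 0 (γ + κ) N x₁ s *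
        A.bandDensity θ₂ γ₂ N x₂ s) + ∑ k ∈ I, ENNReal.ofReal (Real.exp (-(κ * ((γ + κ) * k)))) *
        (ENNReal.ofReal (U s * Real.exp (κ * A.smoothed N (Real.exp (-k)) s x₁)) +
        ENNReal.ofReal (U s * Real.exp (-κ * A.smoothed N (Real.exp (-k)) s x₁))) := by
    intro s
    have e0 : 0 ≤ A.bandDensity 0 (γ + κ) N x₁ s * A.bandDensity θ₂ γ₂ N x₂ s :=
      mul_nonneg (bandDensity_nonneg _ _ _ _ _) (bandDensity_nonneg _ _ _ _ _)
    have e1 : ∀ y, 0 ≤ U s * Real.exp y := fun y => mul_nonneg (hU0 s) (Real.exp_pos _).le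
    simp_rw [← ENNReal.ofReal_add (e1 _) (e1 _), ← ENNReal.ofReal_mul (Real.exp_pos _).le]
    rw [← ENNReal.ofReal_mul haN0, ← ENNReal.ofReal_sum_of_nonneg (fun k _ =>
      mul_nonneg (Real.exp_pos _).le (add_nonneg (e1 _) (e1 _))), ← ENNReal.ofReal_add
      (mul_nonneg haN0 e0) (Finset.sum_nonneg fun k _ =>
      mul_nonneg (Real.exp_pos _).le (add_nonneg (e1 _) (e1 _)))]
    refine ENNReal.ofReal_le_ofReal ?_
    unfold excess
    rw [mul_add, Finset.mul_sum]
    refine add_le_add ?_ (Finset.sum_le_sum fun k _ => ?_)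
    · have := mul_le_mul_of_nonneg_right (bandDensity_mul_indicator_lt_le (A := A) (γ := γ) hκ.le θ₁
        N x₁ s) (bandDensity_nonneg (A := A) θ₂ γ₂ N x₂ s)
      simp only [hU]
      calc _ = _ := by ring
        _ ≤ _ := this
        _ = _ := by ring
    · refine (mul_le_mul_of_nonneg_left (indicator_lt_abs_le κ _ _ hκ.le) (hU0 s)).trans_eq ?_
      ring
  have hm1 : ∀ ξ : ℝ, ∀ k : ℕ, Measurable fun s =>
      ENNReal.ofReal (U s * Real.exp (ξ * A.smoothed N (Real.exp (-k)) s x₁)) := fun ξ k => by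
    have := hYm k
    fun_prop
  have hm2 : Measurable fun s => ENNReal.ofReal (A.bandDensity 0 (γ + κ) N x₁ s *
        A.bandDensity θ₂ γ₂ N x₂ s) :=
    ((measurable_bandDensity_apply _ _ _ _).mul (measurable_bandDensity_apply _ _ _ _)).ennreal_ofReal
  calc _ ≤ _ := lintegral_mono hpt
    _ = ENNReal.ofReal aN * ∫⁻ s, ENNReal.ofReal (A.bandDensity 0 (γ + κ) N x₁ s *
        A.bandDensity θ₂ γ₂ N x₂ s) ∂A.P N + ∑ k ∈ I, ENNReal.ofReal (Real.exp (-(κ * ((γ + κ) * k))))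
        * ((∫⁻ s, ENNReal.ofReal (U s * Real.exp (κ * A.smoothed N (Real.exp (-k)) s x₁)) ∂A.P N) +
        ∫⁻ s, ENNReal.ofReal (U s * Real.exp (-κ * A.smoothed N (Real.exp (-k)) s x₁)) ∂A.P N) := by
      rw [lintegral_add_left (hm2.const_mul _), lintegral_const_mul _ hm2, lintegral_finsetSum]
      · congr 1
        refine Finset.sum_congr rfl fun k _ => ?_
        rw [lintegral_const_mul' _ _ ENNReal.ofReal_ne_top, lintegral_add_left (hm1 _ _)]
      · exact fun k _ => ((hm1 _ _).add (hm1 _ _)).const_mul _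
    _ ≤ ENNReal.ofReal aN * ENNReal.ofReal (C₃ * Real.exp ((γ + κ) * γ₂ * H)) +
        ∑ k ∈ I, ENNReal.ofReal (Real.exp (-(κ * ((γ + κ) * k)))) *
        (ENNReal.ofReal (C₁ * Real.exp (E + (γ * κ + κ ^ 2 / 2) * k)) +
        ENNReal.ofReal (C₂ * Real.exp (E + (γ * κ + κ ^ 2 / 2) * k))) := by
      gcongr with k hk k hk
      · exact hb1 k hk
      · exact hb2 k hk
    _ = ENNReal.ofReal (aN * (C₃ * Real.exp ((γ + κ) * γ₂ * H)) +
        ∑ k ∈ I, M * Real.exp (-(κ ^ 2 / 2) * k)) := by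
      rw [ENNReal.ofReal_add (by positivity) (Finset.sum_nonneg fun k _ => by positivity),
        ENNReal.ofReal_mul haN0, ENNReal.ofReal_sum_of_nonneg fun k _ => by positivity]
      congr 1
      refine Finset.sum_congr rfl fun k _ => ?_
      rw [← ENNReal.ofReal_add (by positivity) (by positivity),
        ← ENNReal.ofReal_mul (Real.exp_pos _).le]
      congr 1
      rw [← add_mul, mul_left_comm, ← Real.exp_add]
      simp only [M]
      rw [mul_assoc, ← Real.exp_add]
      ring_nf
    _ ≤ _ := by
      refine ENNReal.ofReal_le_ofReal ?_
      rw [← Finset.mul_sum, add_mul (1 : ℝ), one_mul, mul_assoc M]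
      exact add_le_add hN4 (mul_le_mul_of_nonneg_left
        (sum_exp_neg_mul_le (by positivity) k₁ _) (by positivity))

end FieldApproximation

/-! ### Truncated second moments -/

namespace FieldApproximation

variable {Ω : Type u} [MetricSpace Ω] [MeasurableSpace Ω] {vol : Measure Ω} {T : Set (Ω → ℝ)}
  {𝕏 : LogCorrelatedField.{u, w} Ω vol T} {A : FieldApproximation.{u, v, w} 𝕏}
  {d : ℕ} {Ψ : ℂ → Ω → ℂ}

/-- On the truncation event the majorant is bounded. -/
lemma bandDensity_mul_truncation_le {γ l : ℝ} (hγ : 0 ≤ γ) (θ N : ℕ) (I : Finset ℕ) (x : Ω)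
    (s : A.Sample N) : A.bandDensity θ γ N x s * A.truncation l N I x s ≤
      2 * √(Real.log N) ^ θ * Real.exp ((γ * l - γ ^ 2 / 2) * Real.log N) := by
  refine (mul_le_mul_of_nonneg_left (truncation_le_indicator l N I x s)
    (bandDensity_nonneg _ _ _ _ _)).trans ?_
  split_ifs with h
  · rw [mul_one]
    unfold bandDensity
    have h2 := bandMode_le_two θ (A.X N s x - γ * Real.log N)
    have h4 := bandMode_nonneg θ (A.X N s x - γ * Real.log N)
    have h3 : Real.exp (γ * A.X N s x - γ ^ 2 / 2 * Real.log N) ≤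
        Real.exp ((γ * l - γ ^ 2 / 2) * Real.log N) :=
      Real.exp_le_exp.2 (by nlinarith)
    calc _ ≤ √(Real.log N) ^ θ * Real.exp ((γ * l - γ ^ 2 / 2) * Real.log N) * 2 := by gcongr
      _ = _ := by ring
  · rw [mul_zero]; positivity

/-- The truncated second moments of the majorants have an integrable singularity on the
diagonal. -/
lemma MesoscopicAssumption.lintegral_truncation_le [Nontrivial Ω]
    (hM : A.MesoscopicAssumption d Ψ) (hA : A.CovarianceAssumption) {K : Set Ω} (hK : IsCompact K)
    {η : ℝ} (hη : 0 < η) (hη1 : η < 1) {γ κ β ε : ℝ} (hγ : 0 < γ) (hκ : 0 < κ)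
    (hγd : γ ≤ √(2 * d)) (hε : 0 < ε) (hβ : γ ^ 2 / 2 + γ * κ ≤ β)
    (hβ' : γ ^ 2 / 2 + γ * κ + ε ≤ (1 - η) * β) {θ₁ θ₂ : ℕ}
    (hθ₁ : θ₁ = 0 ∨ θ₁ = 1) (hθ₂ : θ₂ = 0 ∨ θ₂ = 1) :
    ∃ m : ℕ, ∀ k₀ ≥ m, ∃ C > 0, ∀ᶠ N : ℕ in atTop, ∀ x₁ ∈ K, ∀ x₂ ∈ K, x₁ ≠ x₂ →
      ∫⁻ s, ENNReal.ofReal (A.bandDensity θ₁ γ N x₁ s * A.bandDensity θ₂ γ N x₂ s *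
        (A.truncation (γ + κ) N (Finset.Icc k₀ ⌊(1 - η) * Real.log N⌋₊) x₁ s *
        A.truncation (γ + κ) N (Finset.Icc k₀ ⌊(1 - η) * Real.log N⌋₊) x₂ s)) ∂A.P N ≤
      ENNReal.ofReal (C * dist x₁ x₂ ^ (-β)) := by
  obtain ⟨H₀, hH₀⟩ := (hK.prod hK).exists_bound_of_continuousOn 𝕏.continuous_h.continuousOn
  obtain ⟨a, ha, B, hB⟩ := hA.bound K hK
  obtain ⟨m, hm⟩ := exists_exp_neg_nat_le ha.1
  obtain ⟨D', hD'⟩ := Metric.isBounded_iff.1 hK.isBounded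
  obtain ⟨C₁, hC₁, h1⟩ := hM.lintegral_bandDensity_smoothed_le hK hη hη1.le hγ.le hγd hγ.le hγd
    hθ₁ hθ₂ (-γ)
  obtain ⟨C₂, hC₂, h2⟩ := hM.lintegral_bandDensity_two_le hK hη hη1.le hγ.le hγd hγ.le hγd hθ₁ hθ₂
  obtain ⟨C₃, hC₃, h3⟩ := hM.lintegral_bandDensity_one_le hK hγ.le hγd hθ₁
  have hβ0 : 0 < β := by
    have : 0 < γ ^ 2 / 2 + γ * κ := by positivity
    linarith
  refine ⟨m, fun k₀ hk₀ => ?_⟩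
  set E : ℝ := γ + γ ^ 2 * (1 + |H₀|) + 2 * γ ^ 2 * |B| + γ ^ 2 * |B| / 2 with hE
  set D : ℝ := max D' 1
  have hD1 : 1 ≤ D := le_max_right _ _
  set Q₁ : ℝ := C₁ * Real.exp E
  set Q₂ : ℝ := C₂ * Real.exp (γ * γ * (k₀ + |H₀|)) * D ^ β
  set Q₃ : ℝ := 2 * C₃
  have hQ₁ : 0 < Q₁ := by positivity
  have hQ₂ : 0 < Q₂ := by positivity
  have hQ₃ : 0 < Q₃ := by positivity
  refine ⟨Q₁ + Q₂ + Q₃, by positivity, ?_⟩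
  filter_upwards [h1, h2, h3, eventually_sqrt_log_pow_le hθ₂ hε, eventually_gt_atTop 1]
    with N hN1 hN2 hN3 hN4 hNone x₁ hx₁ x₂ hx₂ hne
  have hN0 : (0 : ℝ) < N := by positivity
  set L := Real.log N with hLdef
  have hL : 0 < L := Real.log_pos (by exact_mod_cast hNone)
  set I := Finset.Icc k₀ ⌊(1 - η) * L⌋₊
  set r := dist x₁ x₂ with hr
  have hr0 : 0 < r := dist_pos.2 hne
  have hrD : r ≤ D := (hD' hx₁ hx₂).trans (le_max_left _ _)
  have hrpow : r ^ (-β) = Real.exp (β * -Real.log r) := by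
    rw [Real.rpow_def_of_pos hr0]; ring_nf
  have hr' : 0 < r ^ (-β) := Real.rpow_pos_of_pos hr0 _
  have hcov : 𝕏.cov x₁ x₂ ≤ -Real.log r + |H₀| := by
    have := (abs_le.1 ((hH₀ (x₁, x₂) ⟨hx₁, hx₂⟩).trans (le_abs_self H₀))).2
    simp only [LogCorrelatedField.cov, logKernel]
    simp only [Function.uncurry] at this
    linarith
  set U : A.Sample N → ℝ := fun s => A.bandDensity θ₁ γ N x₁ s * A.bandDensity θ₂ γ N x₂ s with hU
  have hU0 : ∀ s, 0 ≤ U s := fun s =>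
    mul_nonneg (bandDensity_nonneg _ _ _ _ _) (bandDensity_nonneg _ _ _ _ _)
  have hT0 := fun x s => truncation_nonneg (A := A) (γ + κ) N I x s
  have hT1 := fun x s => truncation_le_one (A := A) (γ + κ) N I x s
  have hfin : ∀ q ≤ Q₁ + Q₂ + Q₃, ENNReal.ofReal (q * r ^ (-β)) ≤
      ENNReal.ofReal ((Q₁ + Q₂ + Q₃) * r ^ (-β)) := fun q hq =>
    ENNReal.ofReal_le_ofReal (by gcongr)
  rcases le_or_gt ((N : ℝ) ^ (η - 1)) r with hfar | hnear
  · rcases le_or_gt r (Real.exp (-k₀)) with hsmall | hbig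
    · -- intermediate distances
      have hk₀ : (k₀ : ℝ) ≤ -Real.log r := by
        have := Real.log_le_log hr0 hsmall
        rw [Real.log_exp] at this
        linarith
      have hlog0 : 0 ≤ -Real.log r := (Nat.cast_nonneg k₀).trans hk₀
      -- The scale that matches the distance: `e^{-k-1} < r ≤ e^{-k}`.
      set k := ⌊-Real.log r⌋₊ with hk
      have hk1 : (k : ℝ) ≤ -Real.log r := Nat.floor_le hlog0
      have hk2 : -Real.log r < k + 1 := Nat.lt_floor_add_one _
      have hk3 : k₀ ≤ k := Nat.le_floor hk₀
      have hk4 : k ≤ ⌊(1 - η) * L⌋₊ := by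
        refine Nat.floor_mono ?_
        have := Real.log_le_log (Real.rpow_pos_of_pos hN0 _) hfar
        rw [Real.log_rpow hN0] at this
        linarith
      have hkI : k ∈ I := Finset.mem_Icc.2 ⟨hk3, hk4⟩
      have hka : Real.exp (-k) ∈ Ioc (0 : ℝ) a := ⟨Real.exp_pos _, hm k (by omega)⟩
      have hrk : r ≤ Real.exp (-k) := by
        rw [← Real.log_le_iff_le_exp hr0]; linarith
      have b1 := hB x₁ hx₁ x₁ hx₁ _ hka _ hka le_rfl
      have b2 := (hB x₁ hx₁ x₂ hx₂ _ hka _ hka le_rfl).1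
      rw [dist_self, max_eq_right (Real.exp_pos _).le, Real.log_exp] at b1
      rw [← hr, max_eq_right hrk, Real.log_exp] at b2
      have c1 := abs_le.1 (b1.1.trans (le_abs_self B))
      have c2 := abs_le.1 (b1.2.trans (le_abs_self B))
      have c3 := abs_le.1 (b2.trans (le_abs_self B))
      -- Coefficient of `γ² k`: `1` from the threshold, `1` from the covariance of the two points,
      -- `-1` from each point's covariance with the added term `-γ 𝕏_{N,e^{-k}}(x₁)`, and `1/2` from
      -- its variance. The sum is `1/2`, and the slack in the threshold adds `γ κ k`.
      have hexp : γ * ((γ + κ) * k + 1) + (γ * γ * 𝕏.cov x₁ x₂ +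
          γ * (-γ * A.cov₁ (Real.exp (-k)) x₁ x₁) + γ * (-γ * A.cov₁ (Real.exp (-k)) x₁ x₂) +
          (-γ) ^ 2 * A.cov₂ (Real.exp (-k)) (Real.exp (-k)) x₁ x₁ / 2) ≤ E + β * -Real.log r := by
        have g2 : 0 ≤ γ ^ 2 := sq_nonneg γ
        have e1 : γ ^ 2 * 𝕏.cov x₁ x₂ ≤ γ ^ 2 * (k + 1 + |H₀|) :=
          mul_le_mul_of_nonneg_left (by linarith) g2
        have e2 : γ ^ 2 * (k - |B|) ≤ γ ^ 2 * A.cov₁ (Real.exp (-k)) x₁ x₁ :=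
          mul_le_mul_of_nonneg_left (by linarith) g2
        have e3 : γ ^ 2 * (k - |B|) ≤ γ ^ 2 * A.cov₁ (Real.exp (-k)) x₁ x₂ :=
          mul_le_mul_of_nonneg_left (by linarith) g2
        have e4 : γ ^ 2 * A.cov₂ (Real.exp (-k)) (Real.exp (-k)) x₁ x₁ ≤ γ ^ 2 * (k + |B|) :=
          mul_le_mul_of_nonneg_left (by linarith) g2
        have e5 : (γ ^ 2 / 2 + γ * κ) * k ≤ β * k :=
          mul_le_mul_of_nonneg_right hβ (Nat.cast_nonneg k)
        have e6 : β * k ≤ β * -Real.log r := mul_le_mul_of_nonneg_left hk1 hβ0.le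
        rw [hE]
        linarith
      -- Of all cutoffs only the one at `x₁` and scale `k` is used. Where it is nonzero, the
      -- smoothed field is at most `(γ + κ) k + 1`, so the exponential on the right is at least `1`.
      have hpt : ∀ s, U s * (A.truncation (γ + κ) N I x₁ s * A.truncation (γ + κ) N I x₂ s) ≤
          Real.exp (γ * ((γ + κ) * k + 1)) *
            (U s * Real.exp (-γ * A.smoothed N (Real.exp (-k)) s x₁)) := by
        intro s
        have e1 : A.truncation (γ + κ) N I x₁ s * A.truncation (γ + κ) N I x₂ s ≤
            smoothCutoff ((γ + κ) * k) (A.smoothed N (Real.exp (-k)) s x₁) :=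
          (mul_le_of_le_one_right (hT0 _ _) (hT1 _ _)).trans
            ((truncation_le_scaleCutoff _ _ _ _ _).trans (scaleCutoff_le hkI _ _))
        have e2 : smoothCutoff ((γ + κ) * k) (A.smoothed N (Real.exp (-k)) s x₁) ≤
            Real.exp (γ * ((γ + κ) * k + 1)) *
              Real.exp (-γ * A.smoothed N (Real.exp (-k)) s x₁) := by
          rw [← Real.exp_add]
          by_cases h0 : smoothCutoff ((γ + κ) * k) (A.smoothed N (Real.exp (-k)) s x₁) = 0
          · rw [h0]; positivity
          · have h4 := abs_le_of_smoothCutoff_ne_zero (by positivity) h0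
            refine (smoothCutoff_le_one _ _).trans (Real.one_le_exp ?_)
            have h5 := mul_le_mul_of_nonneg_left ((le_abs_self _).trans h4) hγ.le
            linarith
        refine (mul_le_mul_of_nonneg_left (e1.trans e2) (hU0 s)).trans_eq ?_
        ring
      calc _ ≤ ∫⁻ s, ENNReal.ofReal (Real.exp (γ * ((γ + κ) * k + 1))) * ENNReal.ofReal
            (U s * Real.exp (-γ * A.smoothed N (Real.exp (-k)) s x₁)) ∂A.P N := by
            refine lintegral_mono fun s => ?_
            rw [← ENNReal.ofReal_mul (Real.exp_pos _).le]
            exact ENNReal.ofReal_le_ofReal (hpt s)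
        _ ≤ ENNReal.ofReal (Real.exp (γ * ((γ + κ) * k + 1))) * ENNReal.ofReal (C₁ * _) := by
            rw [lintegral_const_mul' _ _ ENNReal.ofReal_ne_top]
            gcongr
            exact hN1 x₁ hx₁ x₂ hx₂ hfar x₁ hx₁ _ (rpow_sub_one_le_exp_neg hNone.le hη1.le hk4)
              (exp_neg_nat_mem_Ioc k).2
        _ ≤ ENNReal.ofReal (Q₁ * r ^ (-β)) := by
            rw [← ENNReal.ofReal_mul (Real.exp_pos _).le, mul_left_comm, ← Real.exp_add, hrpow]
            refine ENNReal.ofReal_le_ofReal ?_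
            simp only [Q₁]
            rw [mul_assoc C₁ (Real.exp E), ← Real.exp_add]
            exact mul_le_mul_of_nonneg_left (Real.exp_le_exp.2 hexp) hC₁.le
        _ ≤ _ := hfin _ (by linarith)
    · -- macroscopic distances
      have hlog : -Real.log r ≤ k₀ := by
        have := Real.log_le_log (Real.exp_pos _) hbig.le
        rw [Real.log_exp] at this
        linarith
      calc _ ≤ ∫⁻ s, ENNReal.ofReal (U s) ∂A.P N := by
            refine lintegral_mono fun s => ENNReal.ofReal_le_ofReal ?_
            exact mul_le_of_le_one_right (hU0 s) (mul_le_one₀ (hT1 _ _) (hT0 _ _) (hT1 _ _))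
        _ ≤ ENNReal.ofReal (C₂ * Real.exp (γ * γ * 𝕏.cov x₁ x₂)) := hN2 x₁ hx₁ x₂ hx₂ hfar
        _ ≤ ENNReal.ofReal (Q₂ * r ^ (-β)) := by
            refine ENNReal.ofReal_le_ofReal ?_
            have e1 : 1 ≤ D ^ β * r ^ (-β) := by
              rw [Real.rpow_neg hr0.le, ← div_eq_mul_inv, one_le_div (Real.rpow_pos_of_pos hr0 _)]
              exact Real.rpow_le_rpow hr0.le hrD hβ0.le
            calc C₂ * Real.exp (γ * γ * 𝕏.cov x₁ x₂) ≤ C₂ * Real.exp (γ * γ * (k₀ + |H₀|)) := by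
                  gcongr; linarith
              _ ≤ C₂ * Real.exp (γ * γ * (k₀ + |H₀|)) * (D ^ β * r ^ (-β)) :=
                  le_mul_of_one_le_right (by positivity) e1
              _ = _ := by simp only [Q₂]; ring
        _ ≤ _ := hfin _ (by linarith)
  · -- microscopic distances
    have hlog : (1 - η) * L ≤ -Real.log r := by
      have := Real.log_le_log hr0 hnear.le
      rw [Real.log_rpow hN0] at this
      linarith
    -- At microscopic distances no two-point moment is available. The truncation of the field itself
    -- bounds the second majorant pointwise, up to `√L`, by `N^{γ²/2 + γκ}`, which is at most
    -- `r^{-β}` by the choice of `β` and `η`; `ε` pays for `√L`.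
    have hpt : ∀ s, U s * (A.truncation (γ + κ) N I x₁ s * A.truncation (γ + κ) N I x₂ s) ≤
        2 * r ^ (-β) * A.bandDensity θ₁ γ N x₁ s := by
      intro s
      have e1 := bandDensity_mul_truncation_le (A := A) (l := γ + κ) hγ.le θ₂ N I x₂ s
      have e2 : 2 * √L ^ θ₂ * Real.exp ((γ * (γ + κ) - γ ^ 2 / 2) * L) ≤ 2 * r ^ (-β) := by
        rw [mul_assoc]
        refine mul_le_mul_of_nonneg_left ?_ zero_le_two
        calc _ ≤ Real.exp (ε * L) * Real.exp ((γ * (γ + κ) - γ ^ 2 / 2) * L) := by gcongr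
          _ = Real.exp ((γ ^ 2 / 2 + γ * κ + ε) * L) := by rw [← Real.exp_add]; ring_nf
          _ ≤ Real.exp (β * -Real.log r) := by
            refine Real.exp_le_exp.2 ?_
            calc _ ≤ (1 - η) * β * L := by gcongr
              _ = β * ((1 - η) * L) := by ring
              _ ≤ _ := by gcongr
          _ = _ := hrpow.symm
      have e3 : A.truncation (γ + κ) N I x₁ s * A.truncation (γ + κ) N I x₂ s ≤
          A.truncation (γ + κ) N I x₂ s := mul_le_of_le_one_left (hT0 _ _) (hT1 _ _)
      calc _ ≤ U s * A.truncation (γ + κ) N I x₂ s := mul_le_mul_of_nonneg_left e3 (hU0 s)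
        _ = A.bandDensity θ₁ γ N x₁ s *
            (A.bandDensity θ₂ γ N x₂ s * A.truncation (γ + κ) N I x₂ s) := by simp only [hU]; ring
        _ ≤ A.bandDensity θ₁ γ N x₁ s * (2 * r ^ (-β)) :=
            mul_le_mul_of_nonneg_left (e1.trans e2) (bandDensity_nonneg _ _ _ _ _)
        _ = _ := mul_comm _ _
    calc _ ≤ ∫⁻ s, ENNReal.ofReal (2 * r ^ (-β)) * ENNReal.ofReal (A.bandDensity θ₁ γ N x₁ s)
            ∂A.P N := by
          refine lintegral_mono fun s => ?_
          rw [← ENNReal.ofReal_mul (by positivity)]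
          exact ENNReal.ofReal_le_ofReal (hpt s)
      _ ≤ ENNReal.ofReal (2 * r ^ (-β)) * ENNReal.ofReal C₃ := by
          rw [lintegral_const_mul' _ _ ENNReal.ofReal_ne_top]
          gcongr
          exact hN3 x₁ hx₁
      _ = ENNReal.ofReal (Q₃ * r ^ (-β)) := by
          rw [← ENNReal.ofReal_mul (by positivity)]
          congr 1
          simp only [Q₃]
          ring
      _ ≤ _ := hfin _ (by linarith)

end FieldApproximation

/-! ### Bounds for both densities at once -/

lemma fin_two_val (i : Fin 2) : (i : ℕ) = 0 ∨ (i : ℕ) = 1 := by omega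

lemma lintegral_ofReal_sum_sum_le {S : Type*} [MeasurableSpace S] {P : Measure S}
    {F : Fin 2 → Fin 2 → S → ℝ} (hF : ∀ i j, Measurable (F i j)) (hF0 : ∀ i j s, 0 ≤ F i j s)
    {B : Fin 2 → Fin 2 → ℝ} (hB0 : ∀ i j, 0 ≤ B i j)
    (h : ∀ i j, ∫⁻ s, ENNReal.ofReal (F i j s) ∂P ≤ ENNReal.ofReal (B i j)) :
    ∫⁻ s, ENNReal.ofReal (∑ i, ∑ j, F i j s) ∂P ≤ ENNReal.ofReal (∑ i, ∑ j, B i j) := by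
  have e1 : ∀ s, ENNReal.ofReal (∑ i, ∑ j, F i j s) = ∑ i, ∑ j, ENNReal.ofReal (F i j s) := by
    intro s
    rw [ENNReal.ofReal_sum_of_nonneg fun i _ => Finset.sum_nonneg fun j _ => hF0 i j s]
    exact Finset.sum_congr rfl fun i _ => ENNReal.ofReal_sum_of_nonneg fun j _ => hF0 i j s
  simp_rw [e1]
  rw [lintegral_finsetSum _ fun i _ => Finset.measurable_fun_sum _ fun j _ =>
    (hF i j).ennreal_ofReal,
    ENNReal.ofReal_sum_of_nonneg fun i _ => Finset.sum_nonneg fun j _ => hB0 i j]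
  refine Finset.sum_le_sum fun i _ => ?_
  rw [lintegral_finsetSum _ fun j _ => (hF i j).ennreal_ofReal,
    ENNReal.ofReal_sum_of_nonneg fun j _ => hB0 i j]
  exact Finset.sum_le_sum fun j _ => h i j

namespace FieldApproximation

variable {Ω : Type u} [MetricSpace Ω] [MeasurableSpace Ω] {vol : Measure Ω} {T : Set (Ω → ℝ)}
  {𝕏 : LogCorrelatedField.{u, w} Ω vol T} {A : FieldApproximation.{u, v, w} 𝕏}
  {d : ℕ} {Ψ : ℂ → Ω → ℂ}

variable (A) in
/-- A common majorant of the two densities. -/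
def domDensity (γ : ℝ) (N : ℕ) (x : Ω) (s : A.Sample N) : ℝ :=
  ∑ i : Fin 2, A.bandDensity i γ N x s

lemma domDensity_nonneg (γ : ℝ) (N : ℕ) (x : Ω) (s : A.Sample N) : 0 ≤ A.domDensity γ N x s :=
  Finset.sum_nonneg fun _ _ => bandDensity_nonneg _ _ _ _ _

lemma bandDensity_le_domDensity (i : Fin 2) (γ : ℝ) (N : ℕ) (x : Ω) (s : A.Sample N) :
    A.bandDensity i γ N x s ≤ A.domDensity γ N x s :=
  Finset.single_le_sum (f := fun i : Fin 2 => A.bandDensity i γ N x s)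
    (fun _ _ => bandDensity_nonneg _ _ _ _ _) (Finset.mem_univ i)

lemma measurable_domDensity (γ : ℝ) (N : ℕ) :
    Measurable fun p : A.Sample N × Ω => A.domDensity γ N p.2 p.1 :=
  Finset.measurable_fun_sum _ fun i _ => measurable_bandDensity i γ N

lemma measurable_domDensity_apply (γ : ℝ) (N : ℕ) (x : Ω) : Measurable (A.domDensity γ N x) :=
  Finset.measurable_fun_sum _ fun i _ => measurable_bandDensity_apply i γ N x

lemma domDensity_mul_mul (γ : ℝ) (N : ℕ) (x₁ x₂ : Ω) (s : A.Sample N) (c : ℝ) :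
    A.domDensity γ N x₁ s * A.domDensity γ N x₂ s * c = ∑ i : Fin 2, ∑ j : Fin 2,
      A.bandDensity i γ N x₁ s * A.bandDensity j γ N x₂ s * c := by
  simp only [domDensity]
  rw [Finset.sum_mul_sum, Finset.sum_mul]
  exact Finset.sum_congr rfl fun i _ => Finset.sum_mul _ _ _

lemma measurable_scaleCutoff_apply [OpensMeasurableSpace Ω] [SFinite vol] (l : ℝ) (N : ℕ)
    (I : Finset ℕ) (x : Ω) : Measurable (A.scaleCutoff l N I x) := by
  have h : ∀ k : ℕ, Measurable fun s => smoothCutoff (l * k) (A.smoothed N (Real.exp (-k)) s x) :=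
    fun k => (contDiff_smoothCutoff (l * k)).continuous.measurable.comp
      (measurable_smoothed N (exp_neg_nat_mem_Ioc k) x)
  exact Finset.measurable_fun_prod I fun k _ => h k

lemma measurable_truncation_apply [OpensMeasurableSpace Ω] [SFinite vol] (l : ℝ) (N : ℕ)
    (I : Finset ℕ) (x : Ω) : Measurable (A.truncation l N I x) :=
  (Measurable.ite (measurableSet_le (measurable_X_apply N x) measurable_const) measurable_const
    measurable_const).mul (measurable_scaleCutoff_apply l N I x)

lemma measurable_excess_apply [OpensMeasurableSpace Ω] [SFinite vol] (l : ℝ) (N : ℕ)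
    (I : Finset ℕ) (x : Ω) : Measurable (A.excess l N I x) := by
  refine (Measurable.ite (measurableSet_lt measurable_const (measurable_X_apply N x))
    measurable_const measurable_const).add (Finset.measurable_fun_sum _ fun k _ => ?_)
  exact Measurable.ite (measurableSet_lt measurable_const
    (continuous_abs.measurable.comp (measurable_smoothed N (exp_neg_nat_mem_Ioc k) x)))
    measurable_const measurable_const

lemma MesoscopicAssumption.density_le_domDensity [OpensMeasurableSpace Ω] [SFinite vol]
    [Nontrivial Ω] (hM : A.MesoscopicAssumption d Ψ) {K : Set Ω} (hK : IsCompact K) {γ : ℝ}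
    (hγ : 0 < γ) (hγd : γ ≤ √(2 * d)) {g : Ω → ℝ} (hg : Continuous g) :
    ∃ C > 0, ∀ᶠ N : ℕ in atTop, ∀ x ∈ K, ∀ s,
      A.density 1 γ g N x s + A.density 0 γ g N x s ≤ C * A.domDensity γ N x s := by
  obtain ⟨C₀, hC₀, h0⟩ := hM.density_le hK hγ hγd hg (Or.inl rfl)
  obtain ⟨C₁, hC₁, h1⟩ := hM.density_le hK hγ hγd hg (Or.inr rfl)
  refine ⟨C₀ + C₁, by positivity, ?_⟩
  filter_upwards [h0, h1] with N hN0 hN1 x hx s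
  have e0 := (hN0 x hx s).trans
    (mul_le_mul_of_nonneg_left (bandDensity_le_domDensity 0 γ N x s) hC₀.le)
  have e1 := (hN1 x hx s).trans
    (mul_le_mul_of_nonneg_left (bandDensity_le_domDensity 1 γ N x s) hC₁.le)
  linarith

lemma MesoscopicAssumption.lintegral_domDensity_excess_two_le [OpensMeasurableSpace Ω]
    [SFinite vol] (hM : A.MesoscopicAssumption d Ψ) (hA : A.CovarianceAssumption) {K : Set Ω}
    (hK : IsCompact K) {η : ℝ} (hη : 0 < η) (hη1 : η < 1) {γ κ : ℝ} (hγ : 0 ≤ γ) (hκ : 0 < κ)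
    (hγκ : γ + κ ≤ √(2 * d)) {c : ℝ} (hc : 0 < c) :
    ∃ C > 0, ∃ k₀ : ℕ, ∀ k₁ ≥ k₀, ∀ᶠ N : ℕ in atTop, ∀ x₁ ∈ K, ∀ x₂ ∈ K, c ≤ dist x₁ x₂ →
      ∫⁻ s, ENNReal.ofReal (A.domDensity γ N x₁ s * A.domDensity γ N x₂ s *
        A.excess (γ + κ) N (Finset.Icc k₁ ⌊(1 - η) * Real.log N⌋₊) x₁ s) ∂A.P N ≤
      ENNReal.ofReal (C * Real.exp (-(κ ^ 2 / 2) * k₁)) := by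
  have h := fun i j : Fin 2 => hM.lintegral_excess_le hA hK hη hη1 hγ hκ hγκ hγ
    (by linarith) (fin_two_val i) (fin_two_val j) hc
  choose C hC k₀ h using h
  refine ⟨∑ i, ∑ j, C i j, Finset.sum_pos (fun i _ => Finset.sum_pos (fun j _ => hC i j)
    Finset.univ_nonempty) Finset.univ_nonempty, ∑ i, ∑ j, k₀ i j, fun k₁ hk₁ => ?_⟩
  have hk : ∀ i j, k₀ i j ≤ k₁ := fun i j =>
    ((Finset.single_le_sum (f := fun j => k₀ i j) (fun _ _ => Nat.zero_le _)
      (Finset.mem_univ j)).trans (Finset.single_le_sum (f := fun i => ∑ j, k₀ i j)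
      (fun _ _ => Nat.zero_le _) (Finset.mem_univ i))).trans hk₁
  filter_upwards [eventually_all.2 fun i => eventually_all.2 fun j => h i j k₁ (hk i j)]
    with N hN x₁ hx₁ x₂ hx₂ hr
  have := lintegral_ofReal_sum_sum_le (P := A.P N) (F := fun i j s =>
    A.bandDensity i γ N x₁ s * A.bandDensity j γ N x₂ s *
        A.excess (γ + κ) N (Finset.Icc k₁ ⌊(1 - η) * Real.log N⌋₊) x₁ s)
    (fun i j => ((measurable_bandDensity_apply _ _ _ _).mul
      (measurable_bandDensity_apply _ _ _ _)).mul (measurable_excess_apply _ _ _ _))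
    (fun i j s => mul_nonneg (mul_nonneg (bandDensity_nonneg _ _ _ _ _)
      (bandDensity_nonneg _ _ _ _ _)) (excess_nonneg _ _ _ _ _))
    (B := fun i j => C i j * Real.exp (-(κ ^ 2 / 2) * k₁))
    (fun i j => mul_nonneg (hC i j).le (Real.exp_pos _).le) (fun i j => hN i j x₁ hx₁ x₂ hx₂ hr)
  simpa only [domDensity_mul_mul, Finset.sum_mul] using this

lemma MesoscopicAssumption.lintegral_domDensity_excess_one_le [OpensMeasurableSpace Ω]
    [SFinite vol] [Nontrivial Ω] (hM : A.MesoscopicAssumption d Ψ) (hA : A.CovarianceAssumption)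
    {K : Set Ω} (hK : IsCompact K) {η : ℝ} (hη : 0 < η) (hη1 : η < 1) {γ κ : ℝ} (hγ : 0 ≤ γ)
    (hκ : 0 < κ) (hγκ : γ + κ ≤ √(2 * d)) :
    ∃ C > 0, ∃ k₀ : ℕ, ∀ k₁ ≥ k₀, ∀ᶠ N : ℕ in atTop, ∀ x ∈ K,
      ∫⁻ s, ENNReal.ofReal (A.domDensity γ N x s *
        A.excess (γ + κ) N (Finset.Icc k₁ ⌊(1 - η) * Real.log N⌋₊) x s) ∂A.P N ≤
      ENNReal.ofReal (C * Real.exp (-(κ ^ 2 / 2) * k₁)) := by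
  obtain ⟨K₀, hK₀, c, hc, hfar⟩ := exists_far_point Ω
  -- The second point is a far companion with exponent `0`, where the majorant is `1`. The index
  -- `_j` is a dummy that brings the bound into the shape of `lintegral_ofReal_sum_sum_le`.
  have h := fun i _j : Fin 2 => hM.lintegral_excess_le hA (hK.union hK₀) hη hη1 hγ hκ hγκ le_rfl
    (Real.sqrt_nonneg _) (fin_two_val i) (Or.inl rfl) hc
  choose C hC k₀ h using h
  refine ⟨∑ i, ∑ j, C i j, Finset.sum_pos (fun i _ => Finset.sum_pos (fun j _ => hC i j)
    Finset.univ_nonempty) Finset.univ_nonempty, ∑ i, ∑ j, k₀ i j, fun k₁ hk₁ => ?_⟩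
  have hk : ∀ i j, k₀ i j ≤ k₁ := fun i j =>
    ((Finset.single_le_sum (f := fun j => k₀ i j) (fun _ _ => Nat.zero_le _)
      (Finset.mem_univ j)).trans (Finset.single_le_sum (f := fun i => ∑ j, k₀ i j)
      (fun _ _ => Nat.zero_le _) (Finset.mem_univ i))).trans hk₁
  filter_upwards [eventually_all.2 fun i => eventually_all.2 fun j => h i j k₁ (hk i j)]
    with N hN x hx
  obtain ⟨y, hy, hxy⟩ := hfar x
  have := lintegral_ofReal_sum_sum_le (P := A.P N) (F := fun i _ s =>
    A.bandDensity i γ N x s * A.bandDensity 0 0 N y s *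
        A.excess (γ + κ) N (Finset.Icc k₁ ⌊(1 - η) * Real.log N⌋₊) x s)
    (fun i j => ((measurable_bandDensity_apply _ _ _ _).mul
      (measurable_bandDensity_apply _ _ _ _)).mul (measurable_excess_apply _ _ _ _))
    (fun i j s => mul_nonneg (mul_nonneg (bandDensity_nonneg _ _ _ _ _)
      (bandDensity_nonneg _ _ _ _ _)) (excess_nonneg _ _ _ _ _))
    (B := fun i j => C i j * Real.exp (-(κ ^ 2 / 2) * k₁))
    (fun i j => mul_nonneg (hC i j).le (Real.exp_pos _).le)
    (fun i j => hN i j x (Or.inl hx) y (Or.inr hy) hxy)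
  refine le_trans (lintegral_mono fun s => ENNReal.ofReal_le_ofReal ?_)
    (this.trans_eq (by simp only [Finset.sum_mul]))
  simp only [bandDensity_zero_zero, mul_one]
  rw [domDensity, Finset.sum_mul]
  refine Finset.sum_le_sum fun i _ => ?_
  exact Finset.single_le_sum (f := fun _ : Fin 2 => A.bandDensity i γ N x s *
    A.excess (γ + κ) N (Finset.Icc k₁ ⌊(1 - η) * Real.log N⌋₊) x s)
    (fun _ _ => mul_nonneg (bandDensity_nonneg _ _ _ _ _) (excess_nonneg _ _ _ _ _))
    (Finset.mem_univ 0)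

lemma MesoscopicAssumption.lintegral_domDensity_truncation_le [OpensMeasurableSpace Ω]
    [SFinite vol] [Nontrivial Ω]
    (hM : A.MesoscopicAssumption d Ψ) (hA : A.CovarianceAssumption) {K : Set Ω} (hK : IsCompact K)
    {η : ℝ} (hη : 0 < η) (hη1 : η < 1) {γ κ β ε : ℝ} (hγ : 0 < γ) (hκ : 0 < κ)
    (hγd : γ ≤ √(2 * d)) (hε : 0 < ε) (hβ : γ ^ 2 / 2 + γ * κ ≤ β)
    (hβ' : γ ^ 2 / 2 + γ * κ + ε ≤ (1 - η) * β) :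
    ∃ m : ℕ, ∀ k₀ ≥ m, ∃ C > 0, ∀ᶠ N : ℕ in atTop, ∀ x₁ ∈ K, ∀ x₂ ∈ K, x₁ ≠ x₂ →
      ∫⁻ s, ENNReal.ofReal (A.domDensity γ N x₁ s * A.domDensity γ N x₂ s *
        (A.truncation (γ + κ) N (Finset.Icc k₀ ⌊(1 - η) * Real.log N⌋₊) x₁ s *
        A.truncation (γ + κ) N (Finset.Icc k₀ ⌊(1 - η) * Real.log N⌋₊) x₂ s)) ∂A.P N ≤
      ENNReal.ofReal (C * dist x₁ x₂ ^ (-β)) := by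
  have h := fun i j : Fin 2 => hM.lintegral_truncation_le hA hK hη hη1 hγ hκ hγd hε hβ hβ'
    (fin_two_val i) (fin_two_val j)
  choose m h using h
  refine ⟨∑ i, ∑ j, m i j, fun k₀ hk₀ => ?_⟩
  have hk : ∀ i j, m i j ≤ k₀ := fun i j =>
    ((Finset.single_le_sum (f := fun j => m i j) (fun _ _ => Nat.zero_le _)
      (Finset.mem_univ j)).trans (Finset.single_le_sum (f := fun i => ∑ j, m i j)
      (fun _ _ => Nat.zero_le _) (Finset.mem_univ i))).trans hk₀
  choose C hC h using fun i j => h i j k₀ (hk i j)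
  refine ⟨∑ i, ∑ j, C i j, Finset.sum_pos (fun i _ => Finset.sum_pos (fun j _ => hC i j)
    Finset.univ_nonempty) Finset.univ_nonempty, ?_⟩
  filter_upwards [eventually_all.2 fun i => eventually_all.2 fun j => h i j]
    with N hN x₁ hx₁ x₂ hx₂ hr
  have := lintegral_ofReal_sum_sum_le (P := A.P N) (F := fun i j s =>
    A.bandDensity i γ N x₁ s * A.bandDensity j γ N x₂ s *
        (A.truncation (γ + κ) N (Finset.Icc k₀ ⌊(1 - η) * Real.log N⌋₊) x₁ s *
        A.truncation (γ + κ) N (Finset.Icc k₀ ⌊(1 - η) * Real.log N⌋₊) x₂ s))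
    (fun i j => ((measurable_bandDensity_apply _ _ _ _).mul
      (measurable_bandDensity_apply _ _ _ _)).mul ((measurable_truncation_apply _ _ _ _).mul
      (measurable_truncation_apply _ _ _ _)))
    (fun i j s => mul_nonneg (mul_nonneg (bandDensity_nonneg _ _ _ _ _)
      (bandDensity_nonneg _ _ _ _ _)) (mul_nonneg (truncation_nonneg _ _ _ _ _)
      (truncation_nonneg _ _ _ _ _)))
    (B := fun i j => C i j * dist x₁ x₂ ^ (-β))
    (fun i j => mul_nonneg (hC i j).le (Real.rpow_nonneg dist_nonneg _))
    (fun i j => hN i j x₁ hx₁ x₂ hx₂ hr)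
  simpa only [domDensity_mul_mul, Finset.sum_mul] using this

lemma MesoscopicAssumption.lintegral_domDensity_le [Nontrivial Ω]
    (hM : A.MesoscopicAssumption d Ψ) {K : Set Ω} (hK : IsCompact K) {γ : ℝ} (hγ : 0 ≤ γ)
    (hγd : γ ≤ √(2 * d)) : ∃ C > 0, ∀ᶠ N : ℕ in atTop, ∀ x ∈ K,
      ∫⁻ s, ENNReal.ofReal (A.domDensity γ N x s) ∂A.P N ≤ ENNReal.ofReal C := by
  obtain ⟨C₀, hC₀, h0⟩ := hM.lintegral_bandDensity_one_le hK hγ hγd (θ := 0) (Or.inl rfl)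
  obtain ⟨C₁, hC₁, h1⟩ := hM.lintegral_bandDensity_one_le hK hγ hγd (θ := 1) (Or.inr rfl)
  refine ⟨C₀ + C₁, by positivity, ?_⟩
  filter_upwards [h0, h1] with N hN0 hN1 x hx
  simp only [domDensity, Fin.sum_univ_two, Fin.val_zero, Fin.val_one]
  simp_rw [ENNReal.ofReal_add (bandDensity_nonneg _ _ _ _ _) (bandDensity_nonneg _ _ _ _ _)]
  rw [lintegral_add_left (measurable_bandDensity_apply _ _ _ _).ennreal_ofReal,
    ENNReal.ofReal_add hC₀.le hC₁.le]
  exact add_le_add (hN0 x hx) (hN1 x hx)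

end FieldApproximation

lemma modeFun_le (θ : ℕ) {γ : ℝ} (hγ : 0 < γ) (b v : ℝ) :
    modeFun θ γ b v ≤ 1 + Real.exp (-γ * b) := by
  unfold modeFun
  split_ifs
  · linarith [Real.exp_pos (-γ * b)]
  · linarith [expTail_le hγ b v]

/-! ### Decorrelation of the difference of the densities -/

namespace FieldApproximation

variable {Ω : Type u} [MetricSpace Ω] [MeasurableSpace Ω] {vol : Measure Ω} {T : Set (Ω → ℝ)}
  {𝕏 : LogCorrelatedField.{u, w} Ω vol T} {A : FieldApproximation.{u, v, w} 𝕏}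
  {d : ℕ} {Ψ : ℂ → Ω → ℂ}

variable (A) in
/-- The difference of the two random densities. -/
def diffDensity (γ : ℝ) (g : Ω → ℝ) (N : ℕ) (x : Ω) (s : A.Sample N) : ℝ :=
  A.density 1 γ g N x s - A.density 0 γ g N x s

lemma abs_diffDensity_le (γ : ℝ) (g : Ω → ℝ) (N : ℕ) (x : Ω) (s : A.Sample N) :
    |A.diffDensity γ g N x s| ≤ A.density 1 γ g N x s + A.density 0 γ g N x s := by
  have h0 := density_nonneg (A := A) 0 γ g N x s
  have h1 := density_nonneg (A := A) 1 γ g N x s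
  unfold diffDensity
  rw [abs_le]
  constructor <;> linarith

lemma measurable_density_apply (θ : ℕ) (γ : ℝ) (g : Ω → ℝ) (N : ℕ) (x : Ω) :
    Measurable (A.density θ γ g N x) := by
  have h := measurable_X_apply (A := A) N x
  exact ((by fun_prop : Measurable fun s => Real.exp (γ * A.X N s x)).mul
    ((measurable_modeFun θ γ (g x)).comp (h.sub_const _))).const_mul _

lemma measurable_diffDensity_apply (γ : ℝ) (g : Ω → ℝ) (N : ℕ) (x : Ω) :
    Measurable (A.diffDensity γ g N x) :=
  (measurable_density_apply _ _ _ _ _).sub (measurable_density_apply _ _ _ _ _)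

lemma MesoscopicAssumption.integrable_density_mul (hM : A.MesoscopicAssumption d Ψ) {γ : ℝ}
    (hγ : 0 < γ) (hγd : γ ≤ √(2 * d)) (g : Ω → ℝ) (θ₁ θ₂ : ℕ) {x₁ x₂ : Ω} (hx : x₁ ≠ x₂) {q : ℕ}
    (ξ : Fin q → ℝ) {δ : Fin q → ℝ} (z : Fin q → Ω) (hδ : ∀ j, δ j ∈ Ioc (0 : ℝ) 1) {N : ℕ}
    (hN : 1 ≤ N) :
    Integrable (fun s => A.density θ₁ γ g N x₁ s * A.density θ₂ γ g N x₂ s *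
      Real.exp (∑ j, ξ j * A.smoothed N (δ j) s (z j))) (A.P N) := by
  have h := (hM.integrable_weight hN hγ.le hγd hγ.le hγd hx ξ δ z hδ).mul_bdd
    (c := (1 + Real.exp (-γ * g x₁)) * (1 + Real.exp (-γ * g x₂)))
    (g := fun s => modeFun θ₁ γ (g x₁) (A.X N s x₁ - γ * Real.log N) *
      modeFun θ₂ γ (g x₂) (A.X N s x₂ - γ * Real.log N))
    (((measurable_modeFun _ _ _).comp ((measurable_X_apply N x₁).sub_const _)).mul
    ((measurable_modeFun _ _ _).comp ((measurable_X_apply N x₂).sub_const _))).aestronglyMeasurable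
    (ae_of_all _ fun s => by
      rw [Real.norm_eq_abs, abs_of_nonneg (mul_nonneg (modeFun_nonneg _ _ _ _)
        (modeFun_nonneg _ _ _ _))]
      exact mul_le_mul (modeFun_le _ hγ _ _) (modeFun_le _ hγ _ _) (modeFun_nonneg _ _ _ _)
        (by positivity))
  refine (h.const_mul ((if θ₁ = 0 then Real.exp (-γ * g x₁) else 1) * (A.moment θ₁ γ N x₁)⁻¹ *
    ((if θ₂ = 0 then Real.exp (-γ * g x₂) else 1) * (A.moment θ₂ γ N x₂)⁻¹))).congr
    (ae_of_all _ fun s => ?_)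
  simp only [density, weight, Real.exp_add]
  ring

/-- The truncated differences at two points are asymptotically uncorrelated, when the truncation
concerns finitely many scales. -/
lemma MesoscopicAssumption.tendsto_integral_diffDensity_scaleCutoff [OpensMeasurableSpace Ω]
    [SFinite vol] (hM : A.MesoscopicAssumption d Ψ) {γ : ℝ} (hγ : 0 < γ) (hγd : γ ≤ √(2 * d))
    (g : Ω → ℝ) {x₁ x₂ : Ω} (hx : x₁ ≠ x₂) {l : ℝ} (hl : 0 ≤ l) (I : Finset ℕ) :
    Tendsto (fun N => ∫ s, A.diffDensity γ g N x₁ s * A.diffDensity γ g N x₂ s *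
      (A.scaleCutoff l N I x₁ s * A.scaleCutoff l N I x₂ s) ∂A.P N) atTop (𝓝 0) := by
  rw [← tendsto_add_atTop_iff_nat 1]
  -- One coordinate for each pair of a scale and a point: the cutoffs together form one smooth
  -- compactly supported function of a single random vector.
  set e := Fintype.equivFin (I × Bool) with he
  set q := Fintype.card (I × Bool)
  set δ : Fin q → ℝ := fun j => Real.exp (-(((e.symm j).1 : ℕ) : ℝ)) with hδ
  set z : Fin q → Ω := fun j => if (e.symm j).2 then x₁ else x₂ with hz
  have hδ1 : ∀ j, δ j ∈ Ioc (0 : ℝ) 1 := fun j => exp_neg_nat_mem_Ioc _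
  set Y : ∀ n, A.Sample (n + 1) → EuclideanSpace ℝ (Fin q) := fun n s =>
    WithLp.toLp 2 fun j => A.smoothed (n + 1) (δ j) s (z j) with hY
  set Φ : EuclideanSpace ℝ (Fin q) → ℝ := fun y =>
    ∏ j, smoothCutoff (l * ((e.symm j).1 : ℕ)) (y j) with hΦ
  have hYm : ∀ n, Measurable (Y n) := fun n => by
    have h : Measurable fun s => fun j => A.smoothed (n + 1) (δ j) s (z j) :=
      measurable_pi_lambda _ fun j => measurable_smoothed (n + 1) (hδ1 j) (z j)
    exact (WithLp.measurable_toLp 2 (Fin q → ℝ)).comp h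
  have hinner : ∀ n (ξ : EuclideanSpace ℝ (Fin q)) s, inner ℝ ξ (Y n s) =
      ∑ j, ξ j * A.smoothed (n + 1) (δ j) s (z j) := by
    intro n ξ s
    simp [PiLp.inner_apply, hY, mul_comm]
  have hterm := fun (θ₁ θ₂ : Fin 2) (ξ : EuclideanSpace ℝ (Fin q)) (n : ℕ) =>
    hM.integrable_density_mul hγ hγd g θ₁ θ₂ hx (fun j => ξ j) z hδ1 (N := n + 1) n.succ_pos
  have hlim := fun (θ₁ θ₂ : Fin 2) (ξ : EuclideanSpace ℝ (Fin q)) =>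
    (hM.tendsto_integral_density hγ hγd g (fin_two_val θ₁) (fin_two_val θ₂) hx (fun j => ξ j) z
      hδ1).comp (tendsto_add_atTop_nat 1)
  have hsum : ∀ (σ : Fin 2 → Fin 2 → ℝ) (ξ : EuclideanSpace ℝ (Fin q)) (n : ℕ),
      Integrable (fun s => ∑ i : Fin 2, ∑ j : Fin 2, σ i j *
        (A.density i γ g (n + 1) x₁ s * A.density j γ g (n + 1) x₂ s *
        Real.exp (∑ j, ξ j * A.smoothed (n + 1) (δ j) s (z j)))) (A.P (n + 1)) ∧
      ∫ s, ∑ i : Fin 2, ∑ j : Fin 2, σ i j *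
        (A.density i γ g (n + 1) x₁ s * A.density j γ g (n + 1) x₂ s *
        Real.exp (∑ j, ξ j * A.smoothed (n + 1) (δ j) s (z j))) ∂A.P (n + 1) =
      ∑ i : Fin 2, ∑ j : Fin 2, σ i j *
        ∫ s, A.density i γ g (n + 1) x₁ s * A.density j γ g (n + 1) x₂ s *
        Real.exp (∑ j, ξ j * A.smoothed (n + 1) (δ j) s (z j)) ∂A.P (n + 1) := by
    intro σ ξ n
    have h1 := fun i : Fin 2 => integrable_finsetSum Finset.univ
      fun j _ => (hterm i j ξ n).const_mul (σ i j)
    refine ⟨integrable_finsetSum _ fun i _ => h1 i, ?_⟩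
    rw [integral_finsetSum _ fun i _ => h1 i]
    refine Finset.sum_congr rfl fun i _ => ?_
    rw [integral_finsetSum _ fun j _ => (hterm i j ξ n).const_mul (σ i j)]
    exact Finset.sum_congr rfl fun j _ => integral_const_mul _ _
  have hsumlim : ∀ (σ : Fin 2 → Fin 2 → ℝ) (ξ : EuclideanSpace ℝ (Fin q)),
      Tendsto (fun n => ∫ s, ∑ i : Fin 2, ∑ j : Fin 2, σ i j *
        (A.density i γ g (n + 1) x₁ s * A.density j γ g (n + 1) x₂ s *
        Real.exp (∑ j, ξ j * A.smoothed (n + 1) (δ j) s (z j))) ∂A.P (n + 1)) atTop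
      (𝓝 (∑ i : Fin 2, ∑ j : Fin 2, σ i j * (Real.exp (-γ * (g x₁ + g x₂)) *
        Real.exp (A.interaction γ γ x₁ x₂ (fun j => ξ j) δ z)))) := by
    intro σ ξ
    simp_rw [fun n => (hsum σ ξ n).2]
    exact tendsto_finsetSum _ fun i _ => tendsto_finsetSum _ fun j _ => (hlim i j ξ).const_mul _
  -- The four mixed moments enter with signs `+ - - +`; as they have the same limit, the limits
  -- cancel.
  have hdiff : ∀ n (ξ : EuclideanSpace ℝ (Fin q)) s,
      A.diffDensity γ g (n + 1) x₁ s * A.diffDensity γ g (n + 1) x₂ s *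
      Real.exp (inner ℝ ξ (Y n s)) = ∑ i : Fin 2, ∑ j : Fin 2, (fun i j : Fin 2 =>
        (if i = j then (1 : ℝ) else -1)) i j *
        (A.density i γ g (n + 1) x₁ s * A.density j γ g (n + 1) x₂ s *
        Real.exp (∑ j, ξ j * A.smoothed (n + 1) (δ j) s (z j))) := by
    intro n ξ s
    rw [hinner]
    simp only [Fin.sum_univ_two, diffDensity, Fin.val_zero, Fin.val_one]
    simp
    ring
  have main := tendsto_integral_mul_of_tendsto_exp (P := fun n => A.P (n + 1))
    (D := fun n s => A.diffDensity γ g (n + 1) x₁ s * A.diffDensity γ g (n + 1) x₂ s) (Y := Y)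
    (fun n => ((measurable_diffDensity_apply _ _ _ _).mul
      (measurable_diffDensity_apply _ _ _ _)).aestronglyMeasurable) hYm
    (fun n ξ => by
      simp_rw [hdiff n ξ]
      exact (hsum _ ξ n).1)
    (fun ξ => by
      -- The absolute difference is at most the sum of the two densities, so the same four limits,
      -- all with sign `+`, bound the absolute moments.
      refine ⟨_, ((hsumlim (fun _ _ => 1) ξ).eventually_le_const (lt_add_one _)).mono
        fun n hn => le_trans (integral_mono_of_nonneg (ae_of_all _ fun s => by positivity)
          (hsum (fun _ _ => 1) ξ n).1 (ae_of_all _ fun s => ?_)) hn⟩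
      simp only [one_mul]
      rw [hinner, abs_mul]
      have h1 := mul_le_mul (abs_diffDensity_le (A := A) γ g (n + 1) x₁ s)
        (abs_diffDensity_le (A := A) γ g (n + 1) x₂ s) (abs_nonneg _)
        (add_nonneg (density_nonneg _ _ _ _ _ _) (density_nonneg _ _ _ _ _ _))
      refine (mul_le_mul_of_nonneg_right h1 (Real.exp_pos _).le).trans_eq ?_
      simp only [Fin.sum_univ_two, Fin.val_zero, Fin.val_one]
      ring)
    (fun ξ => by
      simp_rw [hdiff _ ξ]
      refine (hsumlim _ ξ).trans_eq ?_
      simp [Fin.sum_univ_two])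
    (Φ := Φ) ?_ ?_
  · refine main.congr fun n => integral_congr_ae (ae_of_all _ fun s => ?_)
    have hprod : Φ (Y n s) = A.scaleCutoff l (n + 1) I x₁ s * A.scaleCutoff l (n + 1) I x₂ s := by
      simp only [hΦ, hY, hδ, hz]
      rw [Equiv.prod_comp e.symm (fun p : I × Bool => smoothCutoff (l * ((p.1 : ℕ) : ℝ))
        (A.smoothed (n + 1) (Real.exp (-((p.1 : ℕ) : ℝ))) s (if p.2 then x₁ else x₂))),
        Fintype.prod_prod_type]
      simp only [Fintype.prod_bool, if_true]
      rw [Finset.prod_mul_distrib]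
      unfold scaleCutoff
      rw [← Finset.prod_coe_sort I, ← Finset.prod_coe_sort I]
      rfl
    simp only [hprod]
  · refine contDiff_prod fun j _ => (contDiff_smoothCutoff _).comp ?_
    fun_prop
  · refine HasCompactSupport.of_support_subset_isCompact (isCompact_closedBall (0 :
      EuclideanSpace ℝ (Fin q)) (√(∑ j : Fin q, (l * ((e.symm j).1 : ℕ) + 1) ^ 2))) fun y hy => ?_
    rw [Function.mem_support] at hy
    have hy' := Finset.prod_ne_zero_iff.1 hy
    rw [mem_closedBall_zero_iff, EuclideanSpace.norm_eq]
    refine Real.sqrt_le_sqrt (Finset.sum_le_sum fun j _ => ?_)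
    have := abs_le_of_smoothCutoff_ne_zero (by positivity) (hy' j (Finset.mem_univ j))
    rw [Real.norm_eq_abs]
    gcongr

end FieldApproximation

namespace FieldApproximation

variable {Ω : Type u} [MetricSpace Ω] [MeasurableSpace Ω] {vol : Measure Ω} {T : Set (Ω → ℝ)}
  {𝕏 : LogCorrelatedField.{u, w} Ω vol T} {A : FieldApproximation.{u, v, w} 𝕏}
  {d : ℕ} {Ψ : ℂ → Ω → ℂ}

lemma MesoscopicAssumption.integrable_diffDensity_mul (hM : A.MesoscopicAssumption d Ψ) {γ : ℝ}
    (hγ : 0 < γ) (hγd : γ ≤ √(2 * d)) (g : Ω → ℝ) {x₁ x₂ : Ω} (hx : x₁ ≠ x₂) {N : ℕ}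
    (hN : 1 ≤ N) :
    Integrable (fun s => A.diffDensity γ g N x₁ s * A.diffDensity γ g N x₂ s) (A.P N) := by
  have h := fun θ₁ θ₂ => hM.integrable_density_mul hγ hγd g θ₁ θ₂ hx (Fin.elim0 : Fin 0 → ℝ)
    (δ := Fin.elim0) Fin.elim0 (fun j => j.elim0) hN
  simp only [Finset.univ_eq_empty, Finset.sum_empty, Real.exp_zero, mul_one] at h
  refine (((h 1 1).sub (h 1 0)).sub ((h 0 1).sub (h 0 0))).congr (ae_of_all _ fun s => ?_)
  simp only [diffDensity, Pi.sub_apply]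
  ring

/-- Separates the coarse scales, whose number does not depend on `N` and to which Fourier inversion
applies, from the fine ones, whose effect is controlled by `excess`. -/
lemma truncation_eq_mul (l : ℝ) (N : ℕ) {k₀ k₁ m : ℕ} (h₀ : k₀ ≤ k₁) (h₁ : k₁ ≤ m) (x : Ω)
    (s : A.Sample N) : A.truncation l N (Finset.Icc k₀ m) x s =
      A.scaleCutoff l N (Finset.Ico k₀ k₁) x s * A.truncation l N (Finset.Icc k₁ m) x s := by
  have hu : Finset.Icc k₀ m = Finset.Ico k₀ k₁ ∪ Finset.Icc k₁ m := by
    ext k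
    simp only [Finset.mem_Icc, Finset.mem_union, Finset.mem_Ico]
    omega
  have hd : Disjoint (Finset.Ico k₀ k₁) (Finset.Icc k₁ m) := by
    rw [Finset.disjoint_left]
    intro k hk hk'
    simp only [Finset.mem_Icc, Finset.mem_Ico] at hk hk'
    omega
  unfold truncation scaleCutoff
  rw [hu, Finset.prod_union hd]
  ring

lemma tendsto_floor_mul_log {a : ℝ} (ha : 0 < a) :
    Tendsto (fun N : ℕ => ⌊a * Real.log N⌋₊) atTop atTop :=
  tendsto_nat_floor_atTop.comp
    ((Real.tendsto_log_atTop.comp tendsto_natCast_atTop_atTop).const_mul_atTop ha)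

/-- The truncated differences of the densities at two points are asymptotically uncorrelated. -/
lemma MesoscopicAssumption.tendsto_integral_diffDensity_truncation [OpensMeasurableSpace Ω]
    [SFinite vol] (hM : A.MesoscopicAssumption d Ψ) (hA : A.CovarianceAssumption) {η : ℝ}
    (hη : 0 < η) (hη1 : η < 1) {γ κ : ℝ} (hγ : 0 < γ) (hκ : 0 < κ) (hγκ : γ + κ ≤ √(2 * d))
    {g : Ω → ℝ} (hg : Continuous g) {x₁ x₂ : Ω} (hx : x₁ ≠ x₂) (k₀ : ℕ) :
    Tendsto (fun N => ∫ s, A.diffDensity γ g N x₁ s * A.diffDensity γ g N x₂ s *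
      (A.truncation (γ + κ) N (Finset.Icc k₀ ⌊(1 - η) * Real.log N⌋₊) x₁ s *
        A.truncation (γ + κ) N (Finset.Icc k₀ ⌊(1 - η) * Real.log N⌋₊) x₂ s) ∂A.P N)
      atTop (𝓝 0) := by
  have : Nontrivial Ω := ⟨x₁, x₂, hx⟩
  have hγd : γ ≤ √(2 * d) := by linarith
  have hK : IsCompact ({x₁, x₂} : Set Ω) := (toFinite _).isCompact
  have hm₁ : x₁ ∈ ({x₁, x₂} : Set Ω) := by simp
  have hm₂ : x₂ ∈ ({x₁, x₂} : Set Ω) := by simp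
  obtain ⟨C₁, hC₁, m, hexc⟩ := hM.lintegral_domDensity_excess_two_le hA hK hη hη1 hγ.le hκ hγκ
    (dist_pos.2 hx)
  obtain ⟨C₂, hC₂, hdens⟩ := hM.density_le_domDensity hK hγ hγd hg
  rw [Metric.tendsto_atTop']
  intro ε hε
  have hk : Tendsto (fun k : ℕ => 2 * (C₂ * C₂) * (C₁ * Real.exp (-(κ ^ 2 / 2) * k))) atTop
      (𝓝 0) := by
    have h1 : Tendsto (fun k : ℕ => κ ^ 2 / 2 * (k : ℝ)) atTop atTop :=
      tendsto_natCast_atTop_atTop.const_mul_atTop (by positivity)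
    have h2 := ((Real.tendsto_exp_neg_atTop_nhds_zero.comp h1).const_mul C₁).const_mul
      (2 * (C₂ * C₂))
    simpa [Function.comp_def] using h2
  -- `k₁` is fixed before `N`: the scales beyond it cost less than `ε / 2`, uniformly in large `N`.
  obtain ⟨k₁, hk₁ε, hk₁⟩ := ((hk.eventually_lt_const (half_pos hε)).and
    (eventually_ge_atTop (max m k₀))).exists
  have hk₁m : m ≤ k₁ := (le_max_left _ _).trans hk₁
  have hk₁k₀ : k₀ ≤ k₁ := (le_max_right _ _).trans hk₁
  have hcut := hM.tendsto_integral_diffDensity_scaleCutoff hγ hγd g hx (l := γ + κ)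
    (by positivity) (Finset.Ico k₀ k₁)
  have hev := (tendsto_zero_iff_norm_tendsto_zero.1 hcut).eventually_lt_const (half_pos hε)
  refine eventually_atTop.1 ?_ |>.imp fun a h n hn => h n hn.le
  filter_upwards [hev, hexc k₁ hk₁m, hdens, eventually_ge_atTop 1,
    (tendsto_floor_mul_log (a := 1 - η) (by linarith)).eventually_ge_atTop k₁]
    with N hN1 hN2 hN3 hN4 hN5
  set J := Finset.Icc k₁ ⌊(1 - η) * Real.log N⌋₊
  set Φ : A.Sample N → ℝ := fun s => A.scaleCutoff (γ + κ) N (Finset.Ico k₀ k₁) x₁ s *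
    A.scaleCutoff (γ + κ) N (Finset.Ico k₀ k₁) x₂ s with hΦ
  set Θ : A.Sample N → ℝ := fun s => A.truncation (γ + κ) N (Finset.Icc k₀
    ⌊(1 - η) * Real.log N⌋₊) x₁ s * A.truncation (γ + κ) N (Finset.Icc k₀
    ⌊(1 - η) * Real.log N⌋₊) x₂ s with hΘ
  set Δ : A.Sample N → ℝ := fun s => A.diffDensity γ g N x₁ s * A.diffDensity γ g N x₂ s with hΔ
  have hΔi : Integrable Δ (A.P N) := hM.integrable_diffDensity_mul hγ hγd g hx hN4
  have hΦ0 : ∀ s, 0 ≤ Φ s := fun s =>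
    mul_nonneg (scaleCutoff_nonneg _ _ _ _ _) (scaleCutoff_nonneg _ _ _ _ _)
  have hΦ1 : ∀ s, Φ s ≤ 1 := fun s => mul_le_one₀ (scaleCutoff_le_one _ _ _ _ _)
    (scaleCutoff_nonneg _ _ _ _ _) (scaleCutoff_le_one _ _ _ _ _)
  have hΘ0 : ∀ s, 0 ≤ Θ s := fun s =>
    mul_nonneg (truncation_nonneg _ _ _ _ _) (truncation_nonneg _ _ _ _ _)
  have hΘ1 : ∀ s, Θ s ≤ 1 := fun s => mul_le_one₀ (truncation_le_one _ _ _ _ _)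
    (truncation_nonneg _ _ _ _ _) (truncation_le_one _ _ _ _ _)
  have hΦm : Measurable Φ :=
    (measurable_scaleCutoff_apply _ _ _ _).mul (measurable_scaleCutoff_apply _ _ _ _)
  have hΘm : Measurable Θ :=
    (measurable_truncation_apply _ _ _ _).mul (measurable_truncation_apply _ _ _ _)
  have hi1 : Integrable (fun s => Δ s * Φ s) (A.P N) :=
    hΔi.mul_bdd (c := 1) hΦm.aestronglyMeasurable (ae_of_all _ fun s => by
      rw [Real.norm_eq_abs, abs_of_nonneg (hΦ0 s)]; exact hΦ1 s)
  have hi2 : Integrable (fun s => Δ s * Θ s) (A.P N) :=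
    hΔi.mul_bdd (c := 1) hΘm.aestronglyMeasurable (ae_of_all _ fun s => by
      rw [Real.norm_eq_abs, abs_of_nonneg (hΘ0 s)]; exact hΘ1 s)
  have hdiff : ∀ s, |Θ s - Φ s| ≤ A.excess (γ + κ) N J x₁ s + A.excess (γ + κ) N J x₂ s := by
    intro s
    have e1 : Θ s = Φ s * (A.truncation (γ + κ) N J x₁ s * A.truncation (γ + κ) N J x₂ s) := by
      simp only [hΘ, hΦ]
      rw [truncation_eq_mul _ _ hk₁k₀ hN5, truncation_eq_mul _ _ hk₁k₀ hN5]
      ring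
    have t1 := truncation_le_one (A := A) (γ + κ) N J x₁ s
    have t2 := truncation_le_one (A := A) (γ + κ) N J x₂ s
    have t3 := truncation_nonneg (A := A) (γ + κ) N J x₂ s
    have e2 := one_sub_mul_le t1 t2
    have e3 := one_sub_truncation_le (A := A) (γ + κ) N J x₁ s
    have e4 := one_sub_truncation_le (A := A) (γ + κ) N J x₂ s
    have e5 : A.truncation (γ + κ) N J x₁ s * A.truncation (γ + κ) N J x₂ s ≤ 1 :=
      mul_le_one₀ t1 t3 t2
    rw [e1, abs_sub_comm, ← mul_one_sub, abs_mul, abs_of_nonneg (hΦ0 s),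
      abs_of_nonneg (sub_nonneg.2 e5)]
    calc _ ≤ 1 * (1 - A.truncation (γ + κ) N J x₁ s * A.truncation (γ + κ) N J x₂ s) :=
          mul_le_mul_of_nonneg_right (hΦ1 s) (sub_nonneg.2 e5)
      _ ≤ _ := by linarith
  have hΔb : ∀ s, |Δ s| ≤ C₂ * C₂ * (A.domDensity γ N x₁ s * A.domDensity γ N x₂ s) := by
    intro s
    simp only [hΔ]
    rw [abs_mul]
    calc _ ≤ (C₂ * A.domDensity γ N x₁ s) * (C₂ * A.domDensity γ N x₂ s) :=
          mul_le_mul ((abs_diffDensity_le _ _ _ _ _).trans (hN3 x₁ hm₁ s))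
            ((abs_diffDensity_le _ _ _ _ _).trans (hN3 x₂ hm₂ s)) (abs_nonneg _)
            (mul_nonneg hC₂.le (domDensity_nonneg _ _ _ _))
      _ = _ := by ring
  have hbound : |∫ s, Δ s * Θ s ∂A.P N - ∫ s, Δ s * Φ s ∂A.P N| ≤
      2 * (C₂ * C₂) * (C₁ * Real.exp (-(κ ^ 2 / 2) * k₁)) := by
    rw [← integral_sub hi2 hi1, ← Real.norm_eq_abs, ← ENNReal.ofReal_le_ofReal_iff (by positivity),
      ofReal_norm]
    refine (enorm_integral_le_lintegral_enorm _).trans ?_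
    set F₁ : A.Sample N → ℝ := fun s => A.domDensity γ N x₁ s * A.domDensity γ N x₂ s *
      A.excess (γ + κ) N J x₁ s
    set F₂ : A.Sample N → ℝ := fun s => A.domDensity γ N x₂ s * A.domDensity γ N x₁ s *
      A.excess (γ + κ) N J x₂ s
    have hF₁ : ∀ s, 0 ≤ F₁ s := fun s => mul_nonneg (mul_nonneg (domDensity_nonneg _ _ _ _)
      (domDensity_nonneg _ _ _ _)) (excess_nonneg _ _ _ _ _)
    have hF₂ : ∀ s, 0 ≤ F₂ s := fun s => mul_nonneg (mul_nonneg (domDensity_nonneg _ _ _ _)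
      (domDensity_nonneg _ _ _ _)) (excess_nonneg _ _ _ _ _)
    have hF₁m : Measurable fun s => ENNReal.ofReal (F₁ s) :=
      (((measurable_domDensity_apply _ _ _).mul (measurable_domDensity_apply _ _ _)).mul
        (measurable_excess_apply _ _ _ _)).ennreal_ofReal
    calc _ ≤ ∫⁻ s, ENNReal.ofReal (C₂ * C₂) * (ENNReal.ofReal (F₁ s) + ENNReal.ofReal (F₂ s))
            ∂A.P N := by
          refine lintegral_mono fun s => ?_
          rw [← ENNReal.ofReal_add (hF₁ s) (hF₂ s), ← ENNReal.ofReal_mul (by positivity),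
            ← ofReal_norm]
          refine ENNReal.ofReal_le_ofReal ?_
          rw [Real.norm_eq_abs, ← mul_sub, abs_mul]
          refine (mul_le_mul (hΔb s) (hdiff s) (abs_nonneg _) (mul_nonneg (by positivity)
            (mul_nonneg (domDensity_nonneg _ _ _ _) (domDensity_nonneg _ _ _ _)))).trans_eq ?_
          simp only [F₁, F₂]
          ring
      _ ≤ ENNReal.ofReal (C₂ * C₂) * (ENNReal.ofReal (C₁ * Real.exp (-(κ ^ 2 / 2) * k₁)) +
            ENNReal.ofReal (C₁ * Real.exp (-(κ ^ 2 / 2) * k₁))) := by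
          rw [lintegral_const_mul' _ _ ENNReal.ofReal_ne_top, lintegral_add_left hF₁m]
          gcongr
          · exact hN2 x₁ hm₁ x₂ hm₂ le_rfl
          · exact hN2 x₂ hm₂ x₁ hm₁ (dist_comm x₁ x₂).le
      _ = _ := by
          rw [← ENNReal.ofReal_add (by positivity) (by positivity),
            ← ENNReal.ofReal_mul (by positivity)]
          congr 1
          ring
  rw [Real.dist_0_eq_abs]
  rw [Real.norm_eq_abs] at hN1
  have h6 := abs_sub_abs_le_abs_sub (∫ s, Δ s * Θ s ∂A.P N) (∫ s, Δ s * Φ s ∂A.P N)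
  have h7 : |∫ s, Δ s * Φ s ∂A.P N| < ε / 2 := hN1
  linarith

end FieldApproximation

/-! ### Second-moment method and choice of parameters -/

/-- Second-moment method: random integrals whose second moments are dominated and whose two-point
correlations tend to zero tend to zero in `L¹`. -/
lemma tendsto_lintegral_abs_integral_of_correlation {Ω : Type*} [MeasurableSpace Ω]
    {ν : Measure Ω} [SFinite ν] {S : ℕ → Type*} [∀ n, MeasurableSpace (S n)]
    {P : ∀ n, Measure (S n)} [∀ n, IsProbabilityMeasure (P n)] {G : ∀ n, S n → Ω → ℝ}
    (hG : ∀ n, Measurable (Function.uncurry (G n))) {R : Ω × Ω → ℝ}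
    (hR : Integrable R (ν.prod ν))
    (hdom : ∀ᶠ n in atTop, ∀ᵐ z ∂(ν.prod ν),
      ∫⁻ s, ENNReal.ofReal |G n s z.1 * G n s z.2| ∂P n ≤ ENNReal.ofReal (R z))
    (hlim : ∀ᵐ z ∂(ν.prod ν),
      Tendsto (fun n => ∫ s, G n s z.1 * G n s z.2 ∂P n) atTop (𝓝 0)) :
    Tendsto (fun n => ∫⁻ s, ENNReal.ofReal |∫ x, G n s x ∂ν| ∂P n) atTop (𝓝 0) := by
  have hHm : ∀ n, Measurable fun p : S n × (Ω × Ω) => G n p.1 p.2.1 * G n p.1 p.2.2 := fun n =>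
    ((hG n).comp (measurable_fst.prodMk (measurable_fst.comp measurable_snd))).mul
      ((hG n).comp (measurable_fst.prodMk (measurable_snd.comp measurable_snd)))
  have hHi : ∀ᶠ n in atTop, Integrable (fun p : S n × (Ω × Ω) => G n p.1 p.2.1 * G n p.1 p.2.2)
      ((P n).prod (ν.prod ν)) := by
    filter_upwards [hdom] with n hn
    refine ⟨(hHm n).aestronglyMeasurable, ?_⟩
    rw [hasFiniteIntegral_iff_enorm]
    have h1 : ∫⁻ p : S n × (Ω × Ω), ‖G n p.1 p.2.1 * G n p.1 p.2.2‖ₑ ∂((P n).prod (ν.prod ν)) =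
        ∫⁻ z, ∫⁻ s, ENNReal.ofReal |G n s z.1 * G n s z.2| ∂P n ∂(ν.prod ν) := by
      rw [lintegral_prod_symm _ (hHm n).enorm.aemeasurable]
      simp_rw [← Real.norm_eq_abs, ofReal_norm]
    rw [h1]
    exact (lintegral_mono_ae hn).trans_lt (by
      refine (lintegral_mono fun z => ENNReal.ofReal_le_ofReal (le_abs_self _)).trans_lt ?_
      simpa [hasFiniteIntegral_iff_norm] using hR.2)
  -- Valid for every sample, also where `G n s` fails to be integrable.
  have hsq : ∀ n s, (∫ x, G n s x ∂ν) ^ 2 = ∫ z : Ω × Ω, G n s z.1 * G n s z.2 ∂(ν.prod ν) := by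
    intro n s
    rw [integral_prod_mul (G n s) (G n s), sq]
  have hmain : Tendsto (fun n => ∫ z, ∫ s, G n s z.1 * G n s z.2 ∂P n ∂(ν.prod ν)) atTop (𝓝 0) := by
    rw [show (0 : ℝ) = ∫ _, (0 : ℝ) ∂(ν.prod ν) by simp]
    refine tendsto_integral_filter_of_dominated_convergence (fun z => |R z|) ?_ ?_ hR.abs hlim
    · filter_upwards [hHi] with n hn
      exact hn.integral_prod_right.aestronglyMeasurable
    · filter_upwards [hdom] with n hn
      filter_upwards [hn] with z hz
      have h1 := (enorm_integral_le_lintegral_enorm (μ := P n)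
        fun s => G n s z.1 * G n s z.2).trans
        (le_of_eq_of_le (by simp_rw [← Real.norm_eq_abs, ofReal_norm]) hz)
      rw [← ofReal_norm] at h1
      exact (ENNReal.ofReal_le_ofReal_iff (abs_nonneg _)).1
        (h1.trans (ENNReal.ofReal_le_ofReal (le_abs_self _)))
  rw [ENNReal.tendsto_atTop_zero]
  intro ε hε
  obtain ⟨τ, hτ, hτε⟩ : ∃ τ : ℝ, 0 < τ ∧ ENNReal.ofReal (2 * τ) ≤ ε := by
    rcases eq_or_ne ε ⊤ with rfl | htop
    · exact ⟨1, one_pos, le_top⟩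
    · refine ⟨ε.toReal / 2, half_pos (ENNReal.toReal_pos hε.ne' htop), ?_⟩
      rw [mul_div_cancel₀ _ two_ne_zero, ENNReal.ofReal_toReal htop]
  have hev := (tendsto_zero_iff_norm_tendsto_zero.1 hmain).eventually_lt_const
    (show (0 : ℝ) < τ ^ 2 by positivity)
  refine eventually_atTop.1 ?_
  filter_upwards [hev, hHi] with n hn hni
  refine le_trans ?_ hτε
  -- A linear substitute for Cauchy-Schwarz: a second moment below `τ²` bounds the first absolute
  -- moment by `2τ`.
  have h2 : ∀ s, |∫ x, G n s x ∂ν| ≤ τ + τ⁻¹ * (∫ x, G n s x ∂ν) ^ 2 := by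
    intro s
    have h3 : τ * |∫ x, G n s x ∂ν| ≤ τ * (τ + τ⁻¹ * (∫ x, G n s x ∂ν) ^ 2) := by
      rw [mul_add, mul_inv_cancel_left₀ hτ.ne', ← sq_abs (∫ x, G n s x ∂ν)]
      nlinarith [sq_nonneg (τ - |∫ x, G n s x ∂ν|), abs_nonneg (∫ x, G n s x ∂ν)]
    exact le_of_mul_le_mul_left h3 hτ
  have hint : Integrable (fun s => (∫ x, G n s x ∂ν) ^ 2) (P n) := by
    simp_rw [hsq]
    exact hni.integral_prod_left
  calc _ ≤ ∫⁻ s, ENNReal.ofReal (τ + τ⁻¹ * (∫ x, G n s x ∂ν) ^ 2) ∂P n :=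
        lintegral_mono fun s => ENNReal.ofReal_le_ofReal (h2 s)
    _ = ENNReal.ofReal (∫ s, (τ + τ⁻¹ * (∫ x, G n s x ∂ν) ^ 2) ∂P n) :=
        (ofReal_integral_eq_lintegral_ofReal ((integrable_const τ).add (hint.const_mul τ⁻¹))
          (ae_of_all _ fun s => add_nonneg hτ.le
            (mul_nonneg (inv_nonneg.2 hτ.le) (sq_nonneg _)))).symm
    _ ≤ ENNReal.ofReal (2 * τ) := by
        refine ENNReal.ofReal_le_ofReal ?_
        rw [integral_add (integrable_const τ) (hint.const_mul τ⁻¹), integral_const_mul,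
          integral_const]
        simp_rw [hsq]
        rw [integral_integral_swap hni]
        have h4 : ∫ z, ∫ s, G n s z.1 * G n s z.2 ∂P n ∂(ν.prod ν) ≤ τ ^ 2 :=
          (le_abs_self _).trans hn.le
        have h5 : τ⁻¹ * ∫ z, ∫ s, G n s z.1 * G n s z.2 ∂P n ∂(ν.prod ν) ≤ τ := by
          rw [inv_mul_le_iff₀ hτ]; nlinarith
        simp only [probReal_univ, one_smul]
        linarith

/-- Choice of the parameters of the truncation. -/
lemma exists_truncation_parameters {γ D : ℝ} (hγ : 0 < γ) (hD : γ < √(2 * D)) :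
    ∃ κ η ε β : ℝ, 0 < κ ∧ 0 < η ∧ η < 1 ∧ 0 < ε ∧ γ + κ ≤ √(2 * D) ∧ 0 < β ∧ β < D ∧
      γ ^ 2 / 2 + γ * κ ≤ β ∧ γ ^ 2 / 2 + γ * κ + ε ≤ (1 - η) * β := by
  have hsq : γ ^ 2 < 2 * D := (Real.lt_sqrt hγ.le).1 hD
  -- `β` is the midpoint of `γ² / 2` and `D`. Half of `a = β - γ² / 2` pays for `γ κ` and `ε`, the
  -- other half for `η β`.
  set a : ℝ := (D - γ ^ 2 / 2) / 2
  have ha : 0 < a := by simp only [a]; linarith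
  set β : ℝ := γ ^ 2 / 2 + a
  have hβ : 0 < β := by positivity
  have hκ1 : min (√(2 * D) - γ) (a / (4 * γ)) ≤ a / (4 * γ) := min_le_right _ _
  have hκ2 : γ * min (√(2 * D) - γ) (a / (4 * γ)) ≤ a / 4 := by
    calc _ ≤ γ * (a / (4 * γ)) := by gcongr
      _ = a / 4 := by field_simp
  have hη : (1 - a / (2 * β)) * β = β - a / 2 := by field_simp
  refine ⟨min (√(2 * D) - γ) (a / (4 * γ)), a / (2 * β), a / 4, β,
    lt_min (by linarith) (by positivity), by positivity, ?_, by positivity, ?_, hβ, ?_, ?_, ?_⟩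
  · rw [div_lt_one (by positivity)]
    simp only [β]
    nlinarith [sq_nonneg γ]
  · linarith [min_le_left (√(2 * D) - γ) (a / (4 * γ))]
  · simp only [β, a]; linarith
  · simp only [β]; linarith
  · rw [hη]; simp only [β]; linarith

/-! ### Volume growth and Riesz kernels -/

section Growth

variable {Ω : Type*} [MetricSpace Ω] [MeasurableSpace Ω]

/-- Locally, the measure of a ball of radius `r` is at most of order `r ^ d`. -/
def LocallyBoundedGrowth (vol : Measure Ω) (d : ℕ) : Prop :=
  ∀ K : Set Ω, IsCompact K → ∃ C : ℝ, ∀ x ∈ K, ∀ r > 0,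
    vol (K ∩ Metric.closedBall x r) ≤ ENNReal.ofReal (C * r ^ d)

variable {vol : Measure Ω} {d : ℕ}

lemma LocallyBoundedGrowth.measure_lt_top (h : LocallyBoundedGrowth vol d) {K : Set Ω}
    (hK : IsCompact K) : vol K < ⊤ := by
  rcases K.eq_empty_or_nonempty with rfl | ⟨x, hx⟩
  · simp
  obtain ⟨C, hC⟩ := h K hK
  obtain ⟨D, hD⟩ := Metric.isBounded_iff.1 hK.isBounded
  have hsub : K ⊆ K ∩ Metric.closedBall x (max D 1) := fun y hy =>
    ⟨hy, Metric.mem_closedBall.2 ((hD hy hx).trans (le_max_left _ _))⟩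
  exact (measure_mono hsub).trans_lt ((hC x hx _ (by positivity)).trans_lt ENNReal.ofReal_lt_top)

lemma LocallyBoundedGrowth.measure_singleton (h : LocallyBoundedGrowth vol d) (hd : d ≠ 0)
    (x : Ω) : vol {x} = 0 := by
  obtain ⟨C, hC⟩ := h {x} isCompact_singleton
  have h1 : Tendsto (fun n : ℕ => ENNReal.ofReal (C * (1 / ((n : ℝ) + 1)) ^ d)) atTop (𝓝 0) := by
    have h2 := ((tendsto_one_div_add_atTop_nhds_zero_nat (𝕜 := ℝ)).pow d).const_mul C
    rw [zero_pow hd, mul_zero] at h2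
    simpa [Function.comp_def] using (ENNReal.continuous_ofReal.tendsto 0).comp h2
  refine le_antisymm (ge_of_tendsto' h1 fun n => ?_) bot_le
  have hpos : (0 : ℝ) < 1 / ((n : ℝ) + 1) := by positivity
  refine le_trans (measure_mono ?_) (hC x rfl _ hpos)
  rintro y rfl
  exact ⟨rfl, Metric.mem_closedBall_self hpos.le⟩

/-- Decomposition into the layers `e^{-n-1} < r ≤ e^{-n}`: a single term of the series suffices for
`0 < r < 1`, and the summand `1` covers `r ≥ 1`. -/
lemma rpow_neg_le_tsum {β r : ℝ} (hβ : 0 < β) (hr : 0 ≤ r) : ENNReal.ofReal (r ^ (-β)) ≤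
    1 + ∑' n : ℕ, ENNReal.ofReal (Real.exp (β * (n + 1))) *
      (if r ≤ Real.exp (-n) then 1 else 0) := by
  -- In Lean `0 ^ (-β) = 0`, so the diagonal needs no care.
  rcases hr.eq_or_lt with rfl | hr0
  · rw [Real.zero_rpow (neg_ne_zero.2 hβ.ne'), ENNReal.ofReal_zero]
    exact bot_le
  rcases le_or_gt 1 r with h1 | h1
  · refine le_trans ?_ le_self_add
    rw [← ENNReal.ofReal_one]
    exact ENNReal.ofReal_le_ofReal (Real.rpow_le_one_of_one_le_of_nonpos h1 (by linarith))
  · have hlog : 0 ≤ -Real.log r := by linarith [Real.log_nonpos hr h1.le]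
    set n := ⌊-Real.log r⌋₊
    have hn1 : (n : ℝ) ≤ -Real.log r := Nat.floor_le hlog
    have hn2 : -Real.log r < n + 1 := Nat.lt_floor_add_one _
    refine le_trans ?_ (le_add_left (ENNReal.le_tsum n))
    rw [if_pos ((Real.log_le_iff_le_exp hr0).1 (by linarith)), mul_one, Real.rpow_def_of_pos hr0]
    refine ENNReal.ofReal_le_ofReal (Real.exp_le_exp.2 ?_)
    nlinarith

/-- Riesz potentials of order less than the dimension are bounded. -/
lemma LocallyBoundedGrowth.exists_lintegral_rpow_le [OpensMeasurableSpace Ω]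
    (h : LocallyBoundedGrowth vol d) {K : Set Ω} (hK : IsCompact K) {β : ℝ} (hβ : 0 < β)
    (hβd : β < d) : ∃ C : ℝ≥0∞, C < ⊤ ∧ ∀ x ∈ K,
      ∫⁻ y in K, ENNReal.ofReal (dist x y ^ (-β)) ∂vol ≤ C := by
  obtain ⟨C, hC⟩ := h K hK
  -- From one layer to the next the kernel grows by `e^β` and the volume bound shrinks by `e^{-d}`;
  -- the ratio is below `1` because `β < d`.
  set a : ℝ := Real.exp (-(d - β)) with ha
  have ha0 : 0 < a := Real.exp_pos _
  have ha1 : a < 1 := Real.exp_lt_one_iff.2 (by linarith)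
  refine ⟨vol K + ∑' n : ℕ, ENNReal.ofReal (Real.exp β * |C|) * ENNReal.ofReal a ^ n, ?_,
    fun x hx => ?_⟩
  · rw [ENNReal.tsum_mul_left, ENNReal.tsum_geometric]
    refine ENNReal.add_lt_top.2 ⟨h.measure_lt_top hK, ENNReal.mul_lt_top ENNReal.ofReal_lt_top ?_⟩
    rw [ENNReal.inv_lt_top, tsub_pos_iff_lt, ← ENNReal.ofReal_one]
    exact (ENNReal.ofReal_lt_ofReal_iff one_pos).2 ha1
  · have hm : ∀ n : ℕ, MeasurableSet {y | dist x y ≤ Real.exp (-n)} := fun n =>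
      (isClosed_le (continuous_const.dist continuous_id) continuous_const).measurableSet
    have hm' : ∀ n : ℕ, Measurable fun y => ENNReal.ofReal (Real.exp (β * (n + 1))) *
        (if dist x y ≤ Real.exp (-n) then (1 : ℝ≥0∞) else 0) := fun n =>
      (Measurable.ite (hm n) measurable_const measurable_const).const_mul _
    calc _ ≤ ∫⁻ y in K, (1 + ∑' n : ℕ, ENNReal.ofReal (Real.exp (β * (n + 1))) *
            (if dist x y ≤ Real.exp (-n) then 1 else 0)) ∂vol :=
          lintegral_mono fun y => rpow_neg_le_tsum hβ dist_nonneg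
      _ = vol K + ∑' n : ℕ, ENNReal.ofReal (Real.exp (β * (n + 1))) *
            vol (K ∩ Metric.closedBall x (Real.exp (-n))) := by
          rw [lintegral_add_left measurable_const, lintegral_const, one_mul,
            Measure.restrict_apply_univ, lintegral_tsum fun n => (hm' n).aemeasurable]
          congr 1
          refine tsum_congr fun n => ?_
          rw [lintegral_const_mul' _ _ ENNReal.ofReal_ne_top]
          congr 1
          have h1 : (fun y => if dist x y ≤ Real.exp (-n) then (1 : ℝ≥0∞) else 0) =
              {y | dist x y ≤ Real.exp (-n)}.indicator 1 := by
            ext y; simp [indicator]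
          rw [h1, lintegral_indicator_one (hm n), Measure.restrict_apply (hm n), inter_comm]
          congr 2
          ext y
          simp [dist_comm]
      _ ≤ _ := by
          refine add_le_add le_rfl (ENNReal.tsum_le_tsum fun n => ?_)
          refine (mul_le_mul' le_rfl (hC x hx _ (Real.exp_pos _))).trans ?_
          rw [← ENNReal.ofReal_pow ha0.le, ← ENNReal.ofReal_mul (Real.exp_pos _).le,
            ← ENNReal.ofReal_mul (by positivity)]
          refine ENNReal.ofReal_le_ofReal ?_
          have e1 : Real.exp (β * (n + 1)) * Real.exp (-n) ^ d = Real.exp β * a ^ n := by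
            rw [ha, ← Real.exp_nat_mul, ← Real.exp_nat_mul, ← Real.exp_add, ← Real.exp_add]
            ring_nf
          calc Real.exp (β * (n + 1)) * (C * Real.exp (-n) ^ d)
              = C * (Real.exp (β * (n + 1)) * Real.exp (-n) ^ d) := by ring
            _ ≤ |C| * (Real.exp (β * (n + 1)) * Real.exp (-n) ^ d) := by
                gcongr; exact le_abs_self C
            _ = _ := by rw [e1]; ring

end Growth

/-! ## Convergence in `L¹` on spaces of bounded growth -/

/-- The density has to be known only where the integrand lives. This matters for the thick points,
whose normalizing probability is known to be nonzero only on compact sets. -/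
lemma integral_withDensity_of_eqOn {Ω : Type*} [MeasurableSpace Ω] {μ : Measure Ω} {K : Set Ω}
    (hK : MeasurableSet K) {w : Ω → ℝ≥0∞} {D : Ω → ℝ} (hD : Measurable D) (hD0 : ∀ x, 0 ≤ D x)
    (hw : ∀ x ∈ K, w x = ENNReal.ofReal (D x)) {φ : Ω → ℝ} (hφ : ∀ x ∉ K, φ x = 0) :
    ∫ x, φ x ∂(μ.withDensity w) = ∫ x in K, φ x * D x ∂μ := by
  rw [← setIntegral_eq_integral_of_forall_compl_eq_zero hφ, restrict_withDensity hK,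
    withDensity_congr_ae ((ae_restrict_iff' hK).2 (ae_of_all _ hw)),
    integral_withDensity_eq_integral_toReal_smul hD.ennreal_ofReal
      (ae_of_all _ fun _ => ENNReal.ofReal_lt_top)]
  simp_rw [ENNReal.toReal_ofReal (hD0 _), smul_eq_mul, mul_comm]

lemma integrable_withDensity_of_eqOn {Ω : Type*} [MeasurableSpace Ω] {μ : Measure Ω} {K : Set Ω}
    (hK : MeasurableSet K) {w : Ω → ℝ≥0∞} {D : Ω → ℝ} (hD : Measurable D) (hD0 : ∀ x, 0 ≤ D x)
    (hw : ∀ x ∈ K, w x = ENNReal.ofReal (D x)) {φ : Ω → ℝ} (hφ : ∀ x ∉ K, φ x = 0)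
    (h : IntegrableOn (fun x => φ x * D x) K μ) : Integrable φ (μ.withDensity w) := by
  rw [← integrableOn_iff_integrable_of_support_subset (s := K)
    (fun x hx => by by_contra h; exact hx (hφ x h)), IntegrableOn, restrict_withDensity hK,
    withDensity_congr_ae ((ae_restrict_iff' hK).2 (ae_of_all _ hw)),
    integrable_withDensity_iff hD.ennreal_ofReal (ae_of_all _ fun _ => ENNReal.ofReal_lt_top)]
  simpa only [ENNReal.toReal_ofReal (hD0 _), IntegrableOn] using h

namespace FieldApproximation

variable {Ω : Type u} [MetricSpace Ω] [MeasurableSpace Ω] {vol : Measure Ω} {T : Set (Ω → ℝ)}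
  {𝕏 : LogCorrelatedField.{u, w} Ω vol T} {A : FieldApproximation.{u, v, w} 𝕏}
  {d : ℕ} {Ψ : ℂ → Ω → ℂ}

lemma measurable_uncurry_modeFun (θ : ℕ) (γ : ℝ) :
    Measurable fun p : ℝ × ℝ => modeFun θ γ p.1 p.2 := by
  unfold modeFun
  split_ifs
  · exact measurable_const
  · have h : (fun p : ℝ × ℝ => expTail γ p.1 p.2) =
        {p : ℝ × ℝ | p.1 ≤ p.2}.indicator fun p => Real.exp (-γ * p.2) := by
      ext p
      simp [expTail, indicator]
    rw [h]
    exact (by fun_prop : Measurable fun p : ℝ × ℝ => Real.exp (-γ * p.2)).indicator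
      (measurableSet_le measurable_fst measurable_snd)

lemma measurable_moment (θ : ℕ) (γ : ℝ) (N : ℕ) : Measurable (A.moment θ γ N) := by
  have hX : Measurable fun p : Ω × A.Sample N => A.X N p.2 p.1 :=
    (A.measurable_X N).comp measurable_swap
  have h : Measurable fun p : Ω × A.Sample N => Real.exp (γ * A.X N p.2 p.1) *
      modeFun θ γ 0 (A.X N p.2 p.1 - γ * Real.log N) :=
    (by fun_prop : Measurable fun p : Ω × A.Sample N => Real.exp (γ * A.X N p.2 p.1)).mul
      ((measurable_modeFun θ γ 0).comp (hX.sub_const _))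
  exact h.stronglyMeasurable.integral_prod_right'.measurable

lemma measurable_density (θ : ℕ) (γ : ℝ) {g : Ω → ℝ} (hg : Measurable g) (N : ℕ) :
    Measurable fun p : A.Sample N × Ω => A.density θ γ g N p.2 p.1 := by
  have hX : Measurable fun p : A.Sample N × Ω => A.X N p.1 p.2 := A.measurable_X N
  have h1 : Measurable fun p : A.Sample N × Ω =>
      modeFun θ γ (g p.2) (A.X N p.1 p.2 - γ * Real.log N) :=
    (measurable_uncurry_modeFun θ γ).comp ((hg.comp measurable_snd).prodMk (hX.sub_const _))
  have h2 : Measurable fun p : A.Sample N × Ω => Real.exp (γ * A.X N p.1 p.2) := by fun_prop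
  have h3 : Measurable fun p : A.Sample N × Ω => (A.moment θ γ N p.2)⁻¹ :=
    ((measurable_moment θ γ N).comp measurable_snd).inv
  have h4 : Measurable fun p : A.Sample N × Ω =>
      if θ = 0 then Real.exp (-γ * g p.2) else 1 := by
    split_ifs
    · have : Measurable fun p : A.Sample N × Ω => g p.2 := hg.comp measurable_snd
      exact Real.measurable_exp.comp (this.const_mul (-γ))
    · exact measurable_const
  exact (h4.mul h3).mul (h2.mul h1)

/-- Joint measurability rests on the continuity of the smoothing kernel in its centre and its
argument together. -/
lemma measurable_truncation [OpensMeasurableSpace Ω] [SecondCountableTopology Ω] [SFinite vol]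
    (l : ℝ) (N : ℕ) (I : Finset ℕ) :
    Measurable fun p : A.Sample N × Ω => A.truncation l N I p.2 p.1 := by
  have hX : Measurable fun p : A.Sample N × Ω => A.X N p.1 p.2 := A.measurable_X N
  have hs : ∀ k : ℕ, Measurable fun p : A.Sample N × Ω =>
      A.smoothed N (Real.exp (-k)) p.1 p.2 := by
    intro k
    have hρ : Continuous fun q : Ω × Ω => A.ρ (Real.exp (-k)) q.1 q.2 := by
      have h : Continuous fun q : Ω × Ω => ((Real.exp (-k), q.1, q.2) : ℝ × Ω × Ω) := by fun_prop
      rw [← continuousOn_univ] at h ⊢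
      exact A.continuousOn_ρ.comp h fun y _ => ⟨exp_neg_nat_mem_Ioc k, trivial⟩
    have h : Measurable fun p : (A.Sample N × Ω) × Ω =>
        A.X N p.1.1 p.2 * A.ρ (Real.exp (-k)) p.1.2 p.2 :=
      (hX.comp ((measurable_fst.comp measurable_fst).prodMk measurable_snd)).mul
        (hρ.measurable.comp ((measurable_snd.comp measurable_fst).prodMk measurable_snd))
    exact h.stronglyMeasurable.integral_prod_right'.measurable
  refine (Measurable.ite (measurableSet_le hX measurable_const) measurable_const
    measurable_const).mul (Finset.measurable_fun_prod I fun k _ => ?_)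
  exact (contDiff_smoothCutoff (l * k)).continuous.measurable.comp (hs k)

/-- The tail is built to cancel the tilt, up to a constant; this is how thick points enter the
tilted picture. -/
lemma exp_mul_expTail (γ b L v : ℝ) : Real.exp (γ * v) * expTail γ b (v - γ * L) =
    {v | γ * L + b ≤ v}.indicator (fun _ => Real.exp (γ ^ 2 * L)) v := by
  unfold expTail
  by_cases h : γ * L + b ≤ v
  · rw [indicator_of_mem (show v - γ * L ∈ Ici b from mem_Ici.2 (by linarith)),
      indicator_of_mem (by exact h), ← Real.exp_add]
    ring_nf
  · rw [indicator_of_notMem (show v - γ * L ∉ Ici b from fun h' => h (by linarith [mem_Ici.1 h'])),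
      indicator_of_notMem (by exact h), mul_zero]

lemma moment_one_eq (γ : ℝ) (N : ℕ) (x : Ω) : A.moment 1 γ N x =
    Real.exp (γ ^ 2 * Real.log N) * (A.P N).real {s | γ * Real.log N ≤ A.X N s x} := by
  have h : ∀ s, Real.exp (γ * A.X N s x) * modeFun 1 γ 0 (A.X N s x - γ * Real.log N) =
      {s | γ * Real.log N ≤ A.X N s x}.indicator (fun _ => Real.exp (γ ^ 2 * Real.log N)) s := by
    intro s
    have := exp_mul_expTail γ 0 (Real.log N) (A.X N s x)
    simpa [modeFun, indicator] using this
  unfold moment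
  simp_rw [h]
  rw [integral_indicator_const _ (measurableSet_le measurable_const (measurable_X_apply N x)),
    smul_eq_mul, mul_comm]

/-- The normalizing constant must not vanish: division by zero may give `∞` in the extended reals,
while it gives `0` in the reals. -/
lemma thick_density_eq (γ : ℝ) (g : Ω → ℝ) (N : ℕ) (x : Ω) (s : A.Sample N)
    (h : A.moment 1 γ N x ≠ 0) :
    {y | γ * Real.log N + g y ≤ A.X N s y}.indicator (1 : Ω → ℝ≥0∞) x /
      A.P N {s' | γ * Real.log N ≤ A.X N s' x} = ENNReal.ofReal (A.density 1 γ g N x s) := by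
  have hp : A.P N {s' | γ * Real.log N ≤ A.X N s' x} ≠ 0 := fun h0 => h <| by
    rw [moment_one_eq, measureReal_def, h0, ENNReal.toReal_zero, mul_zero]
  have hd : A.density 1 γ g N x s = {y | γ * Real.log N + g y ≤ A.X N s y}.indicator 1 x /
      (A.P N).real {s' | γ * Real.log N ≤ A.X N s' x} := by
    have h1 := exp_mul_expTail γ (g x) (Real.log N) (A.X N s x)
    have hp' : (A.P N).real {s' | γ * Real.log N ≤ A.X N s' x} ≠ 0 :=
      (ENNReal.toReal_pos hp (measure_ne_top _ _)).ne'
    unfold density modeFun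
    rw [if_neg one_ne_zero, if_neg one_ne_zero, h1, moment_one_eq]
    simp only [indicator, mem_ofPred_eq, Pi.one_apply]
    split_ifs
    · field_simp
    · simp
  rw [hd, measureReal_def, ENNReal.ofReal_div_of_pos (ENNReal.toReal_pos hp (measure_ne_top _ _)),
    ENNReal.ofReal_toReal (measure_ne_top _ _)]
  congr 1
  simp only [indicator, Pi.one_apply]
  split_ifs <;> simp

lemma density_zero_eq (γ : ℝ) (g : Ω → ℝ) (N : ℕ) (x : Ω) (s : A.Sample N) :
    A.density 0 γ g N x s = Real.exp (-γ * g x) *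
      (Real.exp (γ * A.X N s x) / ∫ s', Real.exp (γ * A.X N s' x) ∂A.P N) := by
  simp only [density, moment, modeFun, if_true, mul_one]
  rw [mul_assoc, inv_mul_eq_div]

/-- The two measures, tested against a function supported in a compact set, in terms of the
densities. -/
lemma MesoscopicAssumption.eventually_integral_eq [BorelSpace Ω] [SecondCountableTopology Ω]
    [SFinite vol] [Nontrivial Ω] (hM : A.MesoscopicAssumption d Ψ) {K : Set Ω} (hK : IsCompact K)
    (hvol : vol K < ⊤) {γ : ℝ} (hγ : 0 < γ) (hγd : γ ≤ √(2 * d)) {g : Ω → ℝ} (hg : Continuous g)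
    {f : Ω → ℝ} (hf : Continuous f) (hfK : ∀ x ∉ K, f x = 0) :
    ∀ᶠ N : ℕ in atTop, ∀ᵐ s ∂A.P N,
      Integrable f (A.thickMeasure γ g N s) ∧
      Integrable (fun x => Real.exp (-γ * g x) * f x) (A.expMeasure γ N s) ∧
      IntegrableOn (fun x => f x * A.diffDensity γ g N x s) K vol ∧
      ∫ x, f x ∂A.thickMeasure γ g N s - ∫ x, Real.exp (-γ * g x) * f x ∂A.expMeasure γ N s =
        ∫ x in K, f x * A.diffDensity γ g N x s ∂vol := by
  obtain ⟨c, hc, hmom⟩ := hM.exists_le_moment hK hγ hγd (Or.inr rfl)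
  obtain ⟨C, hC, hdom⟩ := hM.density_le_domDensity hK hγ hγd hg
  obtain ⟨B, hB, hint⟩ := hM.lintegral_domDensity_le hK hγ.le hγd
  obtain ⟨F, hF⟩ := hK.exists_bound_of_continuousOn hf.continuousOn
  filter_upwards [hmom, hdom, hint] with N hN1 hN2 hN3
  have hKm := hK.measurableSet
  -- Tonelli: the mean of the majorant is bounded on a compact set of finite volume, so almost every
  -- sample of it is integrable there. Both densities lie below it.
  have hae : ∀ᵐ s ∂A.P N, ∫⁻ x in K, ENNReal.ofReal (A.domDensity γ N x s) ∂vol < ⊤ := by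
    have hm : Measurable fun p : A.Sample N × Ω => ENNReal.ofReal (A.domDensity γ N p.2 p.1) :=
      (measurable_domDensity γ N).ennreal_ofReal
    refine ae_lt_top hm.lintegral_prod_right' ?_
    rw [lintegral_lintegral_swap hm.aemeasurable]
    refine ne_top_of_le_ne_top (ENNReal.mul_ne_top (ENNReal.ofReal_ne_top (r := B)) hvol.ne) ?_
    rw [← setLIntegral_const]
    exact setLIntegral_mono' hKm hN3
  filter_upwards [hae] with s hs
  have hdens : ∀ θ : ℕ, Measurable fun x => A.density θ γ g N x s := fun θ =>
    (measurable_density θ γ hg.measurable N).comp measurable_prodMk_left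
  have hdomint : IntegrableOn (fun x => A.domDensity γ N x s) K vol := by
    refine ⟨((measurable_domDensity γ N).comp measurable_prodMk_left).aestronglyMeasurable, ?_⟩
    rw [hasFiniteIntegral_iff_ofReal (ae_of_all _ fun x => domDensity_nonneg γ N x s)]
    exact hs
  have hfd : ∀ θ : ℕ, θ = 0 ∨ θ = 1 →
      IntegrableOn (fun x => f x * A.density θ γ g N x s) K vol := by
    intro θ hθ
    refine (hdomint.const_mul (F * C)).mono'
      (hf.measurable.mul (hdens θ)).aestronglyMeasurable ?_
    refine (ae_restrict_iff' hKm).2 (ae_of_all _ fun x hx => ?_)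
    have h0 := density_nonneg (A := A) 0 γ g N x s
    have h1 := density_nonneg (A := A) 1 γ g N x s
    rw [norm_mul, mul_assoc, Real.norm_of_nonneg (density_nonneg θ γ g N x s)]
    refine mul_le_mul (hF x hx) ?_ (density_nonneg θ γ g N x s) ((norm_nonneg _).trans (hF x hx))
    rcases hθ with rfl | rfl <;> linarith [hN2 x hx s]
  have hm1 : ∀ x ∈ K, A.moment 1 γ N x ≠ 0 := fun x hx h0 => by
    have := hN1 x hx
    rw [h0, mul_zero] at this
    exact absurd this (not_le.2 (by positivity))
  have hw1 := fun x hx => thick_density_eq γ g N x s (hm1 x hx)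
  have hD0 : Measurable fun x =>
      Real.exp (γ * A.X N s x) / ∫ s', Real.exp (γ * A.X N s' x) ∂A.P N := by
    have h1 : Measurable fun x => A.X N s x := (A.measurable_X N).comp measurable_prodMk_left
    have h2 : Measurable fun x => ∫ s', Real.exp (γ * A.X N s' x) ∂A.P N := by
      have e : ∀ x, A.moment 0 γ N x = ∫ s', Real.exp (γ * A.X N s' x) ∂A.P N := fun x => by
        simp [moment, modeFun]
      exact (funext e) ▸ measurable_moment 0 γ N
    exact (by fun_prop : Measurable fun x => Real.exp (γ * A.X N s x)).div h2
  have hD0' : ∀ x, 0 ≤ Real.exp (γ * A.X N s x) / ∫ s', Real.exp (γ * A.X N s' x) ∂A.P N :=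
    fun x => div_nonneg (Real.exp_pos _).le (integral_nonneg fun _ => (Real.exp_pos _).le)
  have hfK' : ∀ x ∉ K, Real.exp (-γ * g x) * f x = 0 := fun x hx => by rw [hfK x hx, mul_zero]
  have e0 : ∀ x, Real.exp (-γ * g x) * f x *
      (Real.exp (γ * A.X N s x) / ∫ s', Real.exp (γ * A.X N s' x) ∂A.P N) =
      f x * A.density 0 γ g N x s := fun x => by rw [density_zero_eq]; ring
  have hf0 := hfd 0 (Or.inl rfl)
  have hf1 := hfd 1 (Or.inr rfl)
  have ed : (fun x => f x * A.diffDensity γ g N x s) =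
      fun x => f x * A.density 1 γ g N x s - f x * A.density 0 γ g N x s := by
    ext x; simp only [diffDensity]; ring
  refine ⟨integrable_withDensity_of_eqOn hKm (hdens 1) (fun x => density_nonneg 1 γ g N x s)
    hw1 hfK hf1, integrable_withDensity_of_eqOn hKm hD0 hD0' (fun x _ => rfl) hfK' ?_, ?_, ?_⟩
  · exact hf0.congr (ae_of_all _ fun x => (e0 x).symm)
  · rw [ed]; exact hf1.sub hf0
  · rw [thickMeasure, expMeasure, integral_withDensity_of_eqOn hKm (hdens 1)
      (fun x => density_nonneg 1 γ g N x s) hw1 hfK,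
      integral_withDensity_of_eqOn hKm hD0 hD0' (fun x _ => rfl) hfK', ed, integral_sub hf1 hf0]
    exact congrArg _ (integral_congr_ae (ae_of_all _ fun x => e0 x))

end FieldApproximation

lemma lintegral_abs_integral_mul_le {Ω S : Type*} [MeasurableSpace Ω] [MeasurableSpace S]
    {μ : Measure Ω} [SFinite μ] {P : Measure S} [SFinite P] {K : Set Ω} (hK : MeasurableSet K)
    {G : S → Ω → ℝ} (hG : Measurable (Function.uncurry G)) {B : ℝ≥0∞}
    (h : ∀ x ∈ K, ∫⁻ s, ENNReal.ofReal |G s x| ∂P ≤ B) :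
    ∫⁻ s, ENNReal.ofReal |∫ x in K, G s x ∂μ| ∂P ≤ B * μ K := by
  have hm : Measurable fun p : S × Ω => ENNReal.ofReal |G p.1 p.2| :=
    (continuous_abs.measurable.comp hG).ennreal_ofReal
  calc _ ≤ ∫⁻ s, ∫⁻ x in K, ENNReal.ofReal |G s x| ∂μ ∂P := by
        refine lintegral_mono fun s => ?_
        have := enorm_integral_le_lintegral_enorm (μ := μ.restrict K) (G s)
        simpa only [← ofReal_norm, Real.norm_eq_abs] using this
    _ = ∫⁻ x in K, ∫⁻ s, ENNReal.ofReal |G s x| ∂P ∂μ :=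
        lintegral_lintegral_swap hm.aemeasurable
    _ ≤ B * μ K := by
        rw [← setLIntegral_const]
        exact setLIntegral_mono' hK h

lemma LocallyBoundedGrowth.integrable_rpow {Ω : Type*} [MetricSpace Ω] [MeasurableSpace Ω]
    [BorelSpace Ω] [SecondCountableTopology Ω] {vol : Measure Ω} [SFinite vol] {d : ℕ}
    (h : LocallyBoundedGrowth vol d) {K : Set Ω} (hK : IsCompact K) {β : ℝ} (hβ : 0 < β)
    (hβd : β < d) : Integrable (fun z : Ω × Ω => dist z.1 z.2 ^ (-β))
      ((vol.restrict K).prod (vol.restrict K)) := by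
  obtain ⟨C, hC, hint⟩ := h.exists_lintegral_rpow_le hK hβ hβd
  have hm : Measurable fun z : Ω × Ω => dist z.1 z.2 ^ (-β) := by fun_prop
  refine ⟨hm.aestronglyMeasurable, ?_⟩
  rw [hasFiniteIntegral_iff_ofReal (ae_of_all _ fun z => Real.rpow_nonneg dist_nonneg _),
    lintegral_prod _ hm.ennreal_ofReal.aemeasurable]
  refine (setLIntegral_mono' hK.measurableSet hint).trans_lt ?_
  rw [setLIntegral_const]
  exact ENNReal.mul_lt_top hC (h.measure_lt_top hK)

lemma LocallyBoundedGrowth.ae_ne {Ω : Type*} [MetricSpace Ω] [MeasurableSpace Ω]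
    [BorelSpace Ω] [SecondCountableTopology Ω] {vol : Measure Ω} [SFinite vol] {d : ℕ}
    (h : LocallyBoundedGrowth vol d) (hd : d ≠ 0) {K : Set Ω} (hK : MeasurableSet K) :
    ∀ᵐ z ∂((vol.restrict K).prod (vol.restrict K)), z.1 ∈ K ∧ z.2 ∈ K ∧ z.1 ≠ z.2 := by
  have h1 : ∀ᵐ z ∂((vol.restrict K).prod (vol.restrict K)), z ∈ K ×ˢ K := by
    rw [Measure.prod_restrict]
    exact ae_restrict_mem (hK.prod hK)
  have h2 : (vol.restrict K).prod (vol.restrict K) (diagonal Ω) = 0 := by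
    rw [Measure.measure_prod_null isClosed_diagonal.measurableSet]
    refine ae_of_all _ fun x => ?_
    have : Prod.mk x ⁻¹' diagonal Ω = {x} := by ext y; simp [eq_comm]
    simp only [this, Pi.zero_apply]
    exact le_antisymm ((Measure.restrict_apply_le _ _).trans (h.measure_singleton hd x).le) bot_le
  filter_upwards [h1, measure_eq_zero_iff_ae_notMem.1 h2] with z hz1 hz2
  exact ⟨hz1.1, hz1.2, hz2⟩

namespace FieldApproximation

variable {Ω : Type u} [MetricSpace Ω] [MeasurableSpace Ω] {vol : Measure Ω} {T : Set (Ω → ℝ)}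
  {𝕏 : LogCorrelatedField.{u, w} Ω vol T} {A : FieldApproximation.{u, v, w} 𝕏}
  {d : ℕ} {Ψ : ℂ → Ω → ℂ}

/-- The integrand is split by the truncation that starts at scale `k`. The discarded part has mean
`O(e^{-κ² k / 2})` uniformly in large `N`, and for each admissible `k` the kept part tends to zero
by the second-moment method; so `k` is chosen first, and then `N` large. -/
lemma MesoscopicAssumption.tendsto_lintegral_abs_integral_diffDensity [BorelSpace Ω]
    [SecondCountableTopology Ω] [SFinite vol] [Nontrivial Ω] (hM : A.MesoscopicAssumption d Ψ)
    (hA : A.CovarianceAssumption) (hvol : LocallyBoundedGrowth vol d) {K : Set Ω}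
    (hK : IsCompact K) {γ : ℝ} (hγ : 0 < γ) (hγd : γ < √(2 * d)) {g : Ω → ℝ} (hg : Continuous g)
    {f : Ω → ℝ} (hf : Continuous f)
    (hint : ∀ᶠ N : ℕ in atTop, ∀ᵐ s ∂A.P N,
      IntegrableOn (fun x => f x * A.diffDensity γ g N x s) K vol) :
    Tendsto (fun N : ℕ => ∫⁻ s, ENNReal.ofReal
      |∫ x in K, f x * A.diffDensity γ g N x s ∂vol| ∂A.P N) atTop (𝓝 0) := by
  have hd : d ≠ 0 := by
    rintro rfl
    simp at hγd
    linarith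
  obtain ⟨κ, η, ε, β, hκ, hη, hη1, hε, hγκ, hβ0, hβd, hβ, hβ'⟩ :=
    exists_truncation_parameters hγ hγd
  obtain ⟨C, hC, hdom⟩ := hM.density_le_domDensity hK hγ hγd.le hg
  obtain ⟨B₁, hB₁, k', hexc⟩ := hM.lintegral_domDensity_excess_one_le hA hK hη hη1 hγ.le hκ hγκ
  obtain ⟨m, htr⟩ := hM.lintegral_domDensity_truncation_le hA hK hη hη1 hγ hκ hγd.le hε hβ hβ'
  obtain ⟨F, hF⟩ := hK.exists_bound_of_continuousOn hf.continuousOn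
  have hF' : ∀ x ∈ K, |f x| ≤ max F 0 := fun x hx => (hF x hx).trans (le_max_left _ _)
  have hKm := hK.measurableSet
  have hdiff : ∀ᶠ N : ℕ in atTop, ∀ x ∈ K, ∀ s,
      |f x * A.diffDensity γ g N x s| ≤ max F 0 * C * A.domDensity γ N x s := by
    filter_upwards [hdom] with N hN x hx s
    rw [abs_mul, mul_assoc]
    exact mul_le_mul (hF' x hx) ((abs_diffDensity_le γ g N x s).trans (hN x hx s)) (abs_nonneg _)
      (le_max_right _ _)
  have hmeas : ∀ N, Measurable fun p : A.Sample N × Ω => f p.2 * A.diffDensity γ g N p.2 p.1 :=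
    fun N => (hf.measurable.comp measurable_snd).mul
      ((measurable_density 1 γ hg.measurable N).sub (measurable_density 0 γ hg.measurable N))
  set T : ℕ → ∀ N : ℕ, Ω → A.Sample N → ℝ := fun k N =>
    A.truncation (γ + κ) N (Finset.Icc k ⌊(1 - η) * Real.log N⌋₊) with hT
  have hTm : ∀ k N, Measurable fun p : A.Sample N × Ω => T k N p.2 p.1 := fun k N =>
    measurable_truncation _ _ _
  have hT0 : ∀ k N x s, 0 ≤ T k N x s := fun k N x s => truncation_nonneg _ _ _ _ _
  have hT1 : ∀ k N x s, T k N x s ≤ 1 := fun k N x s => truncation_le_one _ _ _ _ _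
  -- the truncated integrals tend to zero
  have hsecond : ∀ k ≥ m, Tendsto (fun N : ℕ => ∫⁻ s, ENNReal.ofReal
      |∫ x in K, f x * A.diffDensity γ g N x s * T k N x s ∂vol| ∂A.P N) atTop (𝓝 0) := by
    intro k hk
    obtain ⟨B₂, hB₂, hN₂⟩ := htr k hk
    refine tendsto_lintegral_abs_integral_of_correlation
      (G := fun N s x => f x * A.diffDensity γ g N x s * T k N x s)
      (R := fun z => (max F 0 * C) ^ 2 * B₂ * dist z.1 z.2 ^ (-β))
      (fun N => (hmeas N).mul (hTm k N)) ((hvol.integrable_rpow hK hβ0 hβd).const_mul _) ?_ ?_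
    · filter_upwards [hN₂, hdiff] with N h1 h2
      filter_upwards [hvol.ae_ne hd hKm] with z hz
      have hsq : (0 : ℝ) ≤ (max F 0 * C) ^ 2 := sq_nonneg _
      calc _ ≤ ∫⁻ s, ENNReal.ofReal ((max F 0 * C) ^ 2) * ENNReal.ofReal
              (A.domDensity γ N z.1 s * A.domDensity γ N z.2 s *
                (T k N z.1 s * T k N z.2 s)) ∂A.P N := by
            refine lintegral_mono fun s => ?_
            rw [← ENNReal.ofReal_mul hsq]
            refine ENNReal.ofReal_le_ofReal ?_
            rw [abs_mul, abs_mul, abs_mul _ (T k N z.2 s), abs_of_nonneg (hT0 k N z.1 s),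
              abs_of_nonneg (hT0 k N z.2 s)]
            calc _ ≤ max F 0 * C * A.domDensity γ N z.1 s * T k N z.1 s *
                  (max F 0 * C * A.domDensity γ N z.2 s * T k N z.2 s) := by
                  refine mul_le_mul
                    (mul_le_mul_of_nonneg_right (h2 z.1 hz.1 s) (hT0 k N z.1 s))
                    (mul_le_mul_of_nonneg_right (h2 z.2 hz.2.1 s) (hT0 k N z.2 s))
                    (mul_nonneg (abs_nonneg _) (hT0 k N z.2 s)) ?_
                  exact mul_nonneg ((abs_nonneg _).trans (h2 z.1 hz.1 s)) (hT0 k N z.1 s)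
              _ = _ := by ring
        _ ≤ ENNReal.ofReal ((max F 0 * C) ^ 2) * ENNReal.ofReal (B₂ * dist z.1 z.2 ^ (-β)) := by
            rw [lintegral_const_mul' _ _ ENNReal.ofReal_ne_top]
            exact mul_le_mul' le_rfl (h1 z.1 hz.1 z.2 hz.2.1 hz.2.2)
        _ = _ := by rw [← ENNReal.ofReal_mul hsq, mul_assoc]
    · filter_upwards [hvol.ae_ne hd hKm] with z hz
      have h1 := (hM.tendsto_integral_diffDensity_truncation hA hη hη1 hγ hκ hγκ hg hz.2.2
        k).const_mul (f z.1 * f z.2)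
      rw [mul_zero] at h1
      refine h1.congr fun N => ?_
      rw [← integral_const_mul]
      refine integral_congr_ae (ae_of_all _ fun s => ?_)
      simp only [hT]
      ring
  -- the error of the truncation is small
  have hfirst : ∀ k ≥ k', ∀ᶠ N : ℕ in atTop, ∫⁻ s, ENNReal.ofReal
      |∫ x in K, f x * A.diffDensity γ g N x s * (1 - T k N x s) ∂vol| ∂A.P N ≤
      ENNReal.ofReal (max F 0 * C) * ENNReal.ofReal (B₁ * Real.exp (-(κ ^ 2 / 2) * k)) *
        vol K := by
    intro k hk
    filter_upwards [hexc k hk, hdiff] with N h1 h2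
    refine lintegral_abs_integral_mul_le hKm
      (G := fun s x => f x * A.diffDensity γ g N x s * (1 - T k N x s))
      ((hmeas N).mul ((hTm k N).const_sub 1)) fun x hx => ?_
    have hFC : 0 ≤ max F 0 * C := mul_nonneg (le_max_right _ _) hC.le
    calc _ ≤ ∫⁻ s, ENNReal.ofReal (max F 0 * C) * ENNReal.ofReal (A.domDensity γ N x s *
            A.excess (γ + κ) N (Finset.Icc k ⌊(1 - η) * Real.log N⌋₊) x s) ∂A.P N := by
          refine lintegral_mono fun s => ?_
          rw [← ENNReal.ofReal_mul hFC, ← mul_assoc]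
          refine ENNReal.ofReal_le_ofReal ?_
          have h3 := one_sub_truncation_le (A := A) (γ + κ) N
            (Finset.Icc k ⌊(1 - η) * Real.log N⌋₊) x s
          rw [abs_mul, abs_of_nonneg (sub_nonneg.2 (hT1 k N x s))]
          exact mul_le_mul (h2 x hx s) h3 (sub_nonneg.2 (hT1 k N x s))
            ((abs_nonneg _).trans (h2 x hx s))
      _ ≤ _ := by
          rw [lintegral_const_mul' _ _ ENNReal.ofReal_ne_top]
          exact mul_le_mul' le_rfl (h1 x hx)
  have hsmall : Tendsto (fun k : ℕ => ENNReal.ofReal (max F 0 * C) *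
      ENNReal.ofReal (B₁ * Real.exp (-(κ ^ 2 / 2) * k)) * vol K) atTop (𝓝 0) := by
    have h1 : Tendsto (fun k : ℕ => B₁ * Real.exp (-(κ ^ 2 / 2) * k)) atTop (𝓝 0) := by
      have h2 : Tendsto (fun k : ℕ => -(κ ^ 2 / 2) * (k : ℝ)) atTop atBot :=
        tendsto_natCast_atTop_atTop.const_mul_atTop_of_neg (by nlinarith)
      simpa [Function.comp_def] using (Real.tendsto_exp_atBot.comp h2).const_mul B₁
    have h2 := (ENNReal.continuous_ofReal.tendsto 0).comp h1
    rw [ENNReal.ofReal_zero] at h2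
    have h3 := ENNReal.Tendsto.mul_const (ENNReal.Tendsto.const_mul
      (a := ENNReal.ofReal (max F 0 * C)) h2 (Or.inr ENNReal.ofReal_ne_top))
      (b := vol K) (Or.inr (hvol.measure_lt_top hK).ne)
    simpa [Function.comp_def] using h3
  rw [ENNReal.tendsto_nhds_zero]
  intro τ hτ
  have hτ2 : 0 < τ / 2 := ENNReal.half_pos hτ.ne'
  obtain ⟨k, hk1, hk2, hk3⟩ := ((eventually_ge_atTop m).and ((eventually_ge_atTop k').and
    (hsmall.eventually_le_const hτ2))).exists
  filter_upwards [hfirst k hk2, (hsecond k hk1).eventually_le_const hτ2, hint] with N h1 h2 h3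
  have hm2 : Measurable fun s => ENNReal.ofReal
      |∫ x in K, f x * A.diffDensity γ g N x s * (1 - T k N x s) ∂vol| := by
    have h := ((hmeas N).mul ((hTm k N).const_sub 1)).stronglyMeasurable.integral_prod_right'
      (ν := vol.restrict K)
    exact (continuous_abs.measurable.comp h.measurable).ennreal_ofReal
  calc _ ≤ ∫⁻ s, (ENNReal.ofReal
          |∫ x in K, f x * A.diffDensity γ g N x s * (1 - T k N x s) ∂vol| + ENNReal.ofReal
          |∫ x in K, f x * A.diffDensity γ g N x s * T k N x s ∂vol|) ∂A.P N := by
        refine lintegral_mono_ae ?_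
        filter_upwards [h3] with s hs
        have hTs : Measurable fun x => T k N x s := (hTm k N).comp measurable_prodMk_left
        have i1 : IntegrableOn (fun x => f x * A.diffDensity γ g N x s * T k N x s) K vol := by
          refine hs.mul_bdd (c := 1) hTs.aestronglyMeasurable (ae_of_all _ fun x => ?_)
          rw [Real.norm_of_nonneg (hT0 k N x s)]
          exact hT1 k N x s
        have i2 : IntegrableOn (fun x => f x * A.diffDensity γ g N x s * (1 - T k N x s)) K vol :=
          (hs.sub i1).congr (ae_of_all _ fun x => by simp only [Pi.sub_apply]; ring)
        rw [← ENNReal.ofReal_add (abs_nonneg _) (abs_nonneg _)]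
        refine ENNReal.ofReal_le_ofReal (le_trans (le_of_eq ?_) (abs_add_le _ _))
        rw [← integral_add i2 i1]
        congr 1
        refine integral_congr_ae (ae_of_all _ fun x => ?_)
        simp only
        ring
    _ ≤ τ / 2 + τ / 2 := by
        rw [lintegral_add_left hm2]
        exact add_le_add (h1.trans hk3) h2
    _ = τ := ENNReal.add_halves τ

/-- The main theorem for metric measure spaces of locally bounded growth. -/
theorem MesoscopicAssumption.thickPointsMatch [BorelSpace Ω] [SecondCountableTopology Ω]
    [LocallyCompactSpace Ω] (hM : A.MesoscopicAssumption d Ψ) (hA : A.CovarianceAssumption)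
    (hvol : LocallyBoundedGrowth vol d) {γ : ℝ} (hγ : 0 < γ) (hγd : γ < √(2 * d)) {g : Ω → ℝ}
    (hg : Continuous g) {f : Ω → ℝ} (hf : Continuous f) (hfc : HasCompactSupport f) :
    A.ThickPointsMatch γ g f := by
  have : IsFiniteMeasureOnCompacts vol := ⟨fun K hK => hvol.measure_lt_top hK⟩
  have hd : d ≠ 0 := by
    rintro rfl
    simp at hγd
    linarith
  -- A space with at most one point offers no companion point, but its volume is zero since points
  -- have no mass.
  rcases subsingleton_or_nontrivial Ω with hΩ | hΩ
  · have h0 : vol = 0 := by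
      rw [← Measure.measure_univ_eq_zero]
      rcases (univ : Set Ω).eq_empty_or_nonempty with h | ⟨x, -⟩
      · rw [h, measure_empty]
      · rw [(subsingleton_univ (α := Ω)).eq_singleton_of_mem (mem_univ x)]
        exact hvol.measure_singleton hd x
    subst h0
    refine ⟨Eventually.of_forall fun N => ae_of_all _ fun s => ?_, ?_⟩
    · simp [thickMeasure, expMeasure]
    · simp [thickMeasure, expMeasure]
  · have h := hM.eventually_integral_eq hfc hfc.measure_lt_top hγ hγd.le hg hf
      fun x hx => image_eq_zero_of_notMem_tsupport hx
    refine ⟨h.mono fun N hN => hN.mono fun s hs => ⟨hs.1, hs.2.1⟩, ?_⟩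
    refine (hM.tendsto_lintegral_abs_integral_diffDensity hA hvol hfc hγ hγd hg hf
      (h.mono fun N hN => hN.mono fun s hs => hs.2.2.1)).congr' ?_
    filter_upwards [h] with N hN
    refine lintegral_congr_ae ?_
    filter_upwards [hN] with s hs
    rw [hs.2.2.2]

end FieldApproximation

/-! ## Local geometry of Riemannian manifolds -/

section RiemannianCharts

open Manifold Bundle

variable {E : Type*} [NormedAddCommGroup E] [NormedSpace ℝ E] {H : Type*} [TopologicalSpace H]
  (I : ModelWithCorners ℝ E H) {M : Type*} [MetricSpace M] [ChartedSpace H M]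
  [RiemannianBundle (fun x : M => TangentSpace I x)] [IsManifold I 1 M]
  [IsContinuousRiemannianBundle E (fun x : M => TangentSpace I x)]

attribute [local instance] normedAddCommGroupTangentSpaceVectorSpace
  normedSpaceTangentSpaceVectorSpace

lemma eventually_enorm_mfderivWithin_extChartAt_symm_apply_le (x : M) :
    ∃ C : ℝ≥0, ∀ᶠ y in 𝓝[range I] (extChartAt I x x), ∀ v : E,
      ‖mfderiv[range I] (extChartAt I x).symm y v‖ₑ ≤ C * ‖v‖ₑ := by
  rcases eventually_enorm_mfderivWithin_symm_extChartAt_lt I x with ⟨C, -, hC⟩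
  refine ⟨C, hC.mono fun y hy v => ?_⟩
  with_unfolding_all exact (ContinuousLinearMap.le_opENorm _ _).trans (mul_le_mul' hy.le le_rfl)

lemma eventually_enorm_mfderiv_extChartAt_apply_le (x : M) :
    ∃ C : ℝ≥0, ∀ᶠ y in 𝓝 x, ∀ v : TangentSpace I y,
      enorm (E := E) (mfderiv% (extChartAt I x) y v) ≤ C * ‖v‖ₑ := by
  rcases eventually_enorm_mfderiv_extChartAt_lt I x with ⟨C, -, hC⟩
  refine ⟨C, hC.mono fun y hy v => ?_⟩
  with_unfolding_all exact (ContinuousLinearMap.le_opENorm _ _).trans (mul_le_mul' hy.le le_rfl)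

/-- The inverse of a chart is locally Lipschitz. -/
lemma exists_riemannianEDist_le_edist_extChartAt (x : M) :
    ∃ C : ℝ≥0, ∃ V ∈ 𝓝 x, V ⊆ (extChartAt I x).source ∧ ∀ y ∈ V, ∀ z ∈ V,
      riemannianEDist I y z ≤ C * edist (extChartAt I x y) (extChartAt I x z) := by
  obtain ⟨C, hC⟩ := eventually_enorm_mfderivWithin_extChartAt_symm_apply_le I x
  obtain ⟨r, r_pos, hr⟩ := Metric.mem_nhdsWithin_iff.1
    (inter_mem (extChartAt_target_mem_nhdsWithin (I := I) x) hC)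
  have A : (extChartAt I x) ⁻¹' (Metric.ball (extChartAt I x x) r ∩ range I) ∈ 𝓝 x := by
    apply extChartAt_preimage_mem_nhds_of_mem_nhdsWithin (by simp)
    rw [inter_comm]
    exact inter_mem_nhdsWithin _ (Metric.ball_mem_nhds _ r_pos)
  refine ⟨C, _, inter_mem A (extChartAt_source_mem_nhds (I := I) x), inter_subset_right,
    fun y hy z hz => ?_⟩
  let η := ContinuousAffineMap.lineMap (R := ℝ) (extChartAt I x y) (extChartAt I x z)
  set γ := (extChartAt I x).symm ∘ η with hγ
  -- The competing path is the image of a straight segment. Convexity of `range I` keeps the segment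
  -- inside the chart, also near the boundary.
  have hη : ∀ t ∈ Icc (0 : ℝ) 1, η t ∈ Metric.ball (extChartAt I x x) r ∩ range I := by
    intro t ht
    refine ((convex_ball _ _).inter I.convex_range).segment_subset hy.1 hz.1 ?_
    rw [segment_eq_image_lineMap]
    exact ⟨t, ht, by simp [η, ContinuousAffineMap.coe_lineMap_eq]⟩
  have hη1 : Icc (0 : ℝ) 1 ⊆ η ⁻¹' (extChartAt I x).target := fun t ht => (hr (hη t ht)).1
  have η_smooth : CMDiff[Icc 0 1] 1 η := by
    apply ContMDiff.contMDiffOn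
    rw [contMDiff_iff_contDiff]
    exact ContinuousAffineMap.contDiff _
  have : riemannianEDist I y z ≤ pathELength I γ 0 1 := by
    apply riemannianEDist_le_pathELength _ _ _ zero_le_one
    · exact (contMDiffOn_extChartAt_symm x).comp η_smooth hη1
    · simp only [γ, η, Function.comp_apply, ContinuousAffineMap.coe_lineMap_eq,
        AffineMap.lineMap_apply_zero]
      exact (extChartAt I x).left_inv hy.2
    · simp only [γ, η, Function.comp_apply, ContinuousAffineMap.coe_lineMap_eq,
        AffineMap.lineMap_apply_one]
      exact (extChartAt I x).left_inv hz.2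
  apply this.trans
  rw [← lintegral_fderiv_lineMap_eq_edist, pathELength_eq_lintegral_mfderivWithin_Icc,
    ← lintegral_const_mul' _ _ ENNReal.coe_ne_top]
  apply setLIntegral_mono' measurableSet_Icc (fun t ht ↦ ?_)
  have : mfderiv[Icc 0 1] γ t =
      (mfderiv[range I] (extChartAt I x).symm (η t)) ∘L (mfderiv[Icc 0 1] η t) := by
    apply mfderivWithin_comp
    · exact mdifferentiableWithinAt_extChartAt_symm (hη1 ht)
    · exact η_smooth.mdifferentiableOn one_ne_zero t ht
    · exact hη1.trans (preimage_mono (extChartAt_target_subset_range x))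
    · rw [uniqueMDiffWithinAt_iff_uniqueDiffWithinAt]
      exact uniqueDiffOn_Icc zero_lt_one t ht
  have : mfderiv[Icc 0 1] γ t 1 = (mfderiv[range I] (extChartAt I x).symm (η t))
      (fderivWithin ℝ η (Icc 0 1) t 1) := by
    rw [this, mfderivWithin_eq_fderivWithin]
    rfl
  rw [this]
  exact (hr (hη t ht)).2 _

/-- Charts are locally Lipschitz. -/
lemma exists_edist_extChartAt_le [IsRiemannianManifold I M] (x : M) :
    ∃ C : ℝ≥0, ∃ V ∈ 𝓝 x, ∀ y ∈ V, ∀ z ∈ V,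
      edist (extChartAt I x y) (extChartAt I x z) ≤ C * edist y z := by
  obtain ⟨C, hC⟩ := eventually_enorm_mfderiv_extChartAt_apply_le I x
  obtain ⟨ρ, ρ_pos, hρ⟩ := Metric.mem_nhds_iff.1
    (inter_mem hC (extChartAt_source_mem_nhds (I := I) x))
  -- Points of the ball of radius `ρ / 3` are less than `2ρ / 3` apart, and a path of length below
  -- `2ρ / 3` that starts there stays within `ρ / 3 + 2ρ / 3 = ρ` of `x`.
  refine ⟨C, _, Metric.ball_mem_nhds x (show 0 < ρ / 3 by positivity), fun y hy z hz => ?_⟩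
  have hyz : edist y z < ENNReal.ofReal (2 * ρ / 3) := by
    rw [edist_dist]
    refine (ENNReal.ofReal_lt_ofReal_iff (by positivity)).2 ?_
    have := dist_triangle_right y z x
    rw [Metric.mem_ball] at hy hz
    linarith
  -- short paths between points of the small ball stay in the large one
  have key : ∀ L, edist y z < L → L ≤ ENNReal.ofReal (2 * ρ / 3) →
      edist (extChartAt I x y) (extChartAt I x z) ≤ C * L := by
    intro L hL hL'
    rw [IsRiemannianManifold.out (I := I) y z] at hL
    obtain ⟨γ, hγy, hγz, γ_smooth, hγ, -⟩ :=
      exists_lt_locally_constant_of_riemannianEDist_lt hL zero_lt_one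
    have hmem : ∀ t ∈ Icc (0 : ℝ) 1, γ t ∈ Metric.ball x ρ := by
      intro t ht
      have h1 : edist y (γ t) < ENNReal.ofReal (2 * ρ / 3) := by
        rw [IsRiemannianManifold.out (I := I) y (γ t)]
        refine (riemannianEDist_le_pathELength γ_smooth.contMDiffOn hγy rfl ht.1).trans_lt ?_
        exact ((pathELength_mono le_rfl ht.2).trans_lt hγ).trans_le hL'
      rw [edist_dist, ENNReal.ofReal_lt_ofReal_iff (by positivity)] at h1
      rw [Metric.mem_ball] at hy ⊢
      have := dist_triangle_left (γ t) x y
      linarith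
    let γ' := extChartAt I x ∘ γ
    have hsm : CMDiff[Icc 0 1] 1 γ' :=
      contMDiffOn_extChartAt.comp (I' := I) (t := (chartAt H x).source)
        γ_smooth.contMDiffOn fun t ht => by
          have := (hρ (hmem t ht)).2
          rwa [extChartAt_source] at this
    calc edist (extChartAt I x y) (extChartAt I x z) = ‖γ' 1 - γ' 0‖ₑ := by
          rw [edist_comm, edist_eq_enorm_sub]
          simp only [γ', Function.comp_apply, hγy, hγz]
      _ ≤ ∫⁻ t in Icc 0 1, ‖derivWithin γ' (Icc 0 1) t‖ₑ := by
          apply enorm_sub_le_lintegral_derivWithin_Icc_of_contDiffOn_Icc _ zero_le_one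
          rwa [← contMDiffOn_iff_contDiffOn]
      _ ≤ ∫⁻ t in Icc 0 1, C * ‖mfderiv[Icc 0 1] γ t 1‖ₑ := by
          apply setLIntegral_mono' measurableSet_Icc (fun t ht ↦ ?_)
          have h1 : mfderiv[Icc 0 1] γ' t =
              (mfderiv% (extChartAt I x) (γ t)) ∘L (mfderiv[Icc 0 1] γ t) := by
            apply mfderiv_comp_mfderivWithin
            · refine mdifferentiableAt_extChartAt ?_
              have := (hρ (hmem t ht)).2
              rwa [extChartAt_source] at this
            · exact (γ_smooth.mdifferentiable one_ne_zero).mdifferentiableOn _ ht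
            · rw [uniqueMDiffWithinAt_iff_uniqueDiffWithinAt]
              exact uniqueDiffOn_Icc zero_lt_one _ ht
          have h2 : derivWithin γ' (Icc 0 1) t =
              (mfderiv% (extChartAt I x) (γ t)) (mfderiv[Icc 0 1] γ t 1) := by
            rw [← fderivWithin_derivWithin, ← mfderivWithin_eq_fderivWithin, h1]
            rfl
          rw [h2]
          exact (hρ (hmem t ht)).1 _
      _ = C * pathELength I γ 0 1 := by
          rw [lintegral_const_mul' _ _ ENNReal.coe_ne_top,
            pathELength_eq_lintegral_mfderivWithin_Icc]
      _ ≤ C * L := mul_le_mul' le_rfl hγ.le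
  -- The distance is an infimum of lengths that need not be attained, so the bound is proved for
  -- each `L` above it and passed to the limit.
  have htend : Tendsto (fun L : ℝ≥0∞ => (C : ℝ≥0∞) * L) (𝓝[>] edist y z) (𝓝 (C * edist y z)) :=
    (ENNReal.continuous_const_mul ENNReal.coe_ne_top).continuousWithinAt
  have : (𝓝[>] edist y z).NeBot := nhdsGT_neBot_of_exists_gt ⟨_, hyz⟩
  refine ge_of_tendsto htend ?_
  filter_upwards [Ioo_mem_nhdsGT hyz] with L hL using key L hL.1 hL.2.le

end RiemannianCharts

/-! ### Volume growth of open sets and of Riemannian manifolds -/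

section BoundedGrowth

lemma volume_closedBall_le_ofReal (d : ℕ) : ∃ C : ℝ, ∀ (x : EuclideanSpace ℝ (Fin d)) (r : ℝ),
    0 ≤ r → volume (Metric.closedBall x r) ≤ ENNReal.ofReal (C * r ^ d) := by
  refine ⟨(volume (Metric.ball (0 : EuclideanSpace ℝ (Fin d)) 1)).toReal, fun x r hr => ?_⟩
  rw [Measure.addHaar_closedBall _ _ hr, finrank_euclideanSpace_fin, mul_comm,
    ENNReal.ofReal_mul ENNReal.toReal_nonneg, ENNReal.ofReal_toReal measure_ball_lt_top.ne]

lemma locallyBoundedGrowth_comap_volume {d : ℕ} {U : Set (EuclideanSpace ℝ (Fin d))}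
    (hU : MeasurableSet U) :
    LocallyBoundedGrowth (volume.comap (Subtype.val : U → EuclideanSpace ℝ (Fin d))) d := by
  obtain ⟨C, hC⟩ := volume_closedBall_le_ofReal d
  refine fun K _ => ⟨C, fun x _ r hr => ?_⟩
  rw [comap_subtype_coe_apply hU]
  refine (measure_mono ?_).trans (hC x r hr.le)
  rintro - ⟨y, hy, rfl⟩
  exact hy.2

/-- The Euclidean normalization is the same factor on both sides, so the scaling of Hausdorff
measure under Lipschitz maps carries over. -/
lemma euclideanHausdorffMeasure_image_le {X Y : Type*} [MetricSpace X] [MeasurableSpace X]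
    [BorelSpace X] [MetricSpace Y] [MeasurableSpace Y] [BorelSpace Y] {C : ℝ≥0} {f : X → Y}
    {s : Set X} (h : LipschitzOnWith C f s) (d : ℕ) :
    Measure.euclideanHausdorffMeasure d (f '' s) ≤
      (C : ℝ≥0∞) ^ d * Measure.euclideanHausdorffMeasure d s := by
  simp_rw [Measure.euclideanHausdorffMeasure_def, Measure.smul_apply, ENNReal.smul_def,
    smul_eq_mul]
  rw [mul_left_comm, ← ENNReal.rpow_natCast]
  exact mul_le_mul' le_rfl (h.hausdorffMeasure_image_le (Nat.cast_nonneg d))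

/-- A space which is locally bi-Lipschitz to a subset of `ℝ^d` has locally bounded growth. -/
lemma locallyBoundedGrowth_euclideanHausdorffMeasure {d : ℕ} {M : Type*} [MetricSpace M]
    [MeasurableSpace M] [BorelSpace M]
    (h : ∀ p : M, ∃ C : ℝ≥0, ∃ V ∈ 𝓝 p, ∃ φ : M → EuclideanSpace ℝ (Fin d),
      ∀ y ∈ V, ∀ z ∈ V, edist (φ y) (φ z) ≤ C * edist y z ∧ edist y z ≤ C * edist (φ y) (φ z)) :
    LocallyBoundedGrowth (Measure.euclideanHausdorffMeasure d : Measure M) d := by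
  choose C V hV φ hφ using h
  obtain ⟨B, hB⟩ := volume_closedBall_le_ofReal d
  -- The part of the ball in `V p` is sent by `φ p` into a Euclidean ball of radius `2 C r` around
  -- the image of one of its points, and is recovered by the `C`-Lipschitz inverse.
  have hlocal : ∀ p x : M, ∀ r > 0, Measure.euclideanHausdorffMeasure d
      (V p ∩ Metric.closedBall x r) ≤ ENNReal.ofReal (C p ^ d * (|B| * (2 * C p) ^ d) * r ^ d) := by
    intro p x r hr
    rcases (V p ∩ Metric.closedBall x r).eq_empty_or_nonempty with h0 | ⟨y, hy⟩
    · rw [h0, measure_empty]; exact bot_le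
    set S := V p ∩ Metric.closedBall x r
    have hinj : InjOn (φ p) (V p) := fun a ha b hb hab => by
      have := (hφ p a ha b hb).2
      rwa [hab, edist_self, mul_zero, nonpos_iff_eq_zero, edist_eq_zero] at this
    have : Nonempty M := ⟨p⟩
    set ψ := Function.invFunOn (φ p) (V p)
    have hψ : ∀ a ∈ V p, ψ (φ p a) = a := fun a ha => hinj.leftInvOn_invFunOn ha
    have hlip : LipschitzOnWith (C p) ψ (φ p '' S) := by
      rintro - ⟨a, ha, rfl⟩ - ⟨b, hb, rfl⟩
      rw [hψ a ha.1, hψ b hb.1]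
      exact (hφ p a ha.1 b hb.1).2
    have himg : ψ '' (φ p '' S) = S := by
      rw [image_image]
      exact (image_congr fun a ha => hψ a ha.1).trans (image_id' S)
    have hsub : φ p '' S ⊆ Metric.closedBall (φ p y) (2 * C p * r) := by
      rintro - ⟨a, ha, rfl⟩
      have h1 := (hφ p a ha.1 y hy.1).1
      rw [edist_nndist, edist_nndist, ← ENNReal.coe_mul, ENNReal.coe_le_coe, ← NNReal.coe_le_coe,
        NNReal.coe_mul, coe_nndist, coe_nndist] at h1
      have h2 : dist a y ≤ 2 * r := by
        have := dist_triangle_right a y x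
        have := Metric.mem_closedBall.1 ha.2
        have := Metric.mem_closedBall.1 hy.2
        linarith
      refine Metric.mem_closedBall.2 (h1.trans ?_)
      calc (C p : ℝ) * dist a y ≤ C p * (2 * r) := by gcongr
        _ = _ := by ring
    calc Measure.euclideanHausdorffMeasure d S
        = Measure.euclideanHausdorffMeasure d (ψ '' (φ p '' S)) := by rw [himg]
      _ ≤ (C p : ℝ≥0∞) ^ d * Measure.euclideanHausdorffMeasure d (φ p '' S) :=
          euclideanHausdorffMeasure_image_le hlip d
      _ ≤ (C p : ℝ≥0∞) ^ d * ENNReal.ofReal (B * (2 * C p * r) ^ d) := by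
          rw [EuclideanSpace.euclideanHausdorffMeasure_eq_volume]
          exact mul_le_mul' le_rfl ((measure_mono hsub).trans (hB _ _ (by positivity)))
      _ ≤ _ := by
          rw [← ENNReal.ofReal_coe_nnreal, ← ENNReal.ofReal_pow (C p).coe_nonneg,
            ← ENNReal.ofReal_mul (by positivity)]
          refine ENNReal.ofReal_le_ofReal ?_
          calc (C p : ℝ) ^ d * (B * (2 * C p * r) ^ d) ≤ C p ^ d * (|B| * (2 * C p * r) ^ d) := by
                gcongr; exact le_abs_self B
            _ = _ := by rw [mul_pow (2 * (C p : ℝ)) r]; ring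
  intro K hK
  obtain ⟨t, -, ht⟩ := hK.elim_nhds_subcover V fun p _ => hV p
  refine ⟨∑ p ∈ t, C p ^ d * (|B| * (2 * C p) ^ d), fun x _ r hr => ?_⟩
  calc _ ≤ Measure.euclideanHausdorffMeasure d (⋃ p ∈ t, V p ∩ Metric.closedBall x r) := by
        refine measure_mono fun y hy => ?_
        obtain ⟨p, hp, hyp⟩ := mem_iUnion₂.1 (ht hy.1)
        exact mem_iUnion₂.2 ⟨p, hp, hyp, hy.2⟩
    _ ≤ ∑ p ∈ t, Measure.euclideanHausdorffMeasure d (V p ∩ Metric.closedBall x r) :=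
        measure_biUnion_finset_le _ _
    _ ≤ ∑ p ∈ t, ENNReal.ofReal (C p ^ d * (|B| * (2 * C p) ^ d) * r ^ d) :=
        Finset.sum_le_sum fun p _ => hlocal p x r hr
    _ = _ := by
        rw [← ENNReal.ofReal_sum_of_nonneg fun p _ => by positivity, Finset.sum_mul]

/-- Extended charts are bi-Lipschitz near each point for the intrinsic distance: paths are compared
with straight segments in one direction, and chart images of short paths with their end points in
the other. -/
lemma locallyBoundedGrowth_riemannian {d : ℕ} {H : Type*} [TopologicalSpace H]
    (I : ModelWithCorners ℝ (EuclideanSpace ℝ (Fin d)) H) (M : Type*) [MetricSpace M]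
    [MeasurableSpace M] [BorelSpace M] [ChartedSpace H M] [IsManifold I 1 M]
    [Bundle.RiemannianBundle (fun x : M => TangentSpace I x)]
    [IsContinuousRiemannianBundle (EuclideanSpace ℝ (Fin d)) (fun x : M => TangentSpace I x)]
    [IsRiemannianManifold I M] :
    LocallyBoundedGrowth (Measure.euclideanHausdorffMeasure d : Measure M) d := by
  refine locallyBoundedGrowth_euclideanHausdorffMeasure fun p => ?_
  obtain ⟨C₁, V₁, hV₁, -, h₁⟩ := exists_riemannianEDist_le_edist_extChartAt I p
  obtain ⟨C₂, V₂, hV₂, h₂⟩ := exists_edist_extChartAt_le I p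
  refine ⟨max C₁ C₂, V₁ ∩ V₂, inter_mem hV₁ hV₂, extChartAt I p, fun y hy z hz => ⟨?_, ?_⟩⟩
  · refine (h₂ y hy.2 z hz.2).trans (mul_le_mul' ?_ le_rfl)
    exact_mod_cast le_max_right C₁ C₂
  · rw [IsRiemannianManifold.out (I := I) y z]
    refine (h₁ y hy.1 z hz.1).trans (mul_le_mul' ?_ le_rfl)
    exact_mod_cast le_max_left C₁ C₂

/-- As the support of the extension lies inside `U`, its trace on the subspace `U` is still compact.
-/
lemma continuous_of_mem_testFunctionsOpen {d : ℕ} {U : Set (EuclideanSpace ℝ (Fin d))} {f : U → ℝ}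
    (hf : f ∈ testFunctionsOpen U) : Continuous f ∧ HasCompactSupport f := by
  obtain ⟨F, hF, hFc, hFU, hfF⟩ := hf
  have hf' : f = F ∘ Subtype.val := funext hfF
  have hK : IsCompact (Subtype.val ⁻¹' tsupport F : Set U) :=
    Topology.IsInducing.subtypeVal.isCompact_preimage_iff (by simpa using hFU) |>.2 hFc
  refine ⟨hf' ▸ hF.continuous.comp continuous_subtype_val, HasCompactSupport.intro hK fun x hx => ?_⟩
  rw [hfF]
  exact image_eq_zero_of_notMem_tsupport hx

end BoundedGrowth

/-! ### The theorem in both settings -/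

theorem theorem1p3 (d : ℕ) (γ : ℝ) (hγ : 0 < γ) (hγd : γ < √(2 * d)) :
    -- bounded open subsets of `ℝ^d`, with the Euclidean distance and Lebesgue measure
    (∀ U : Set (EuclideanSpace ℝ (Fin d)), IsOpen U → Bornology.IsBounded U →
      ∀ (𝕏 : LogCorrelatedField.{0, w} U (volume.comap Subtype.val) (testFunctionsOpen U))
        (A : FieldApproximation.{0, v, w} 𝕏) (Ψ : ℂ → U → ℂ),
        A.CovarianceAssumption → A.MesoscopicAssumption d Ψ → A.MacroscopicAssumption d Ψ →
        ∀ g : U → ℝ, Continuous g → ∀ f ∈ testFunctionsOpen U, A.ThickPointsMatch γ g f) ∧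
    -- `d`-dimensional smooth Riemannian manifolds, possibly with boundary, with the intrinsic
    -- distance and the Riemannian volume (the `d`-dimensional Hausdorff measure, normalized to
    -- be Lebesgue measure on `ℝ^d`)
    (∀ (H : Type t) [TopologicalSpace H] (I : ModelWithCorners ℝ (EuclideanSpace ℝ (Fin d)) H)
      (M : Type u) [MetricSpace M] [SecondCountableTopology M] [MeasurableSpace M] [BorelSpace M]
      [ChartedSpace H M] [IsManifold I ∞ M]
      [Bundle.RiemannianBundle (fun x : M => TangentSpace I x)]
      [IsContMDiffRiemannianBundle I ∞ (EuclideanSpace ℝ (Fin d))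
        (fun x : M => TangentSpace I x)]
      [IsRiemannianManifold I M],
      ∀ (𝕏 : LogCorrelatedField.{u, w} M (Measure.euclideanHausdorffMeasure d)
          (testFunctionsManifold I M))
        (A : FieldApproximation.{u, v, w} 𝕏) (Ψ : ℂ → M → ℂ),
        A.CovarianceAssumption → A.MesoscopicAssumption d Ψ → A.MacroscopicAssumption d Ψ →
        ∀ g : M → ℝ, Continuous g →
          ∀ f ∈ testFunctionsManifold I M, A.ThickPointsMatch γ g f) := by
  constructor
  · intro U hU _ 𝕏 A Ψ hA hM _ g hg f hf
    obtain ⟨hfc, hfs⟩ := continuous_of_mem_testFunctionsOpen hf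
    have : LocallyCompactSpace U := hU.locallyCompactSpace
    exact hM.thickPointsMatch hA (locallyBoundedGrowth_comap_volume hU.measurableSet) hγ hγd hg
      hfc hfs
  · intro H _ I M _ _ _ _ _ _ _ _ _ 𝕏 A Ψ hA hM _ g hg f hf
    have : LocallyCompactSpace M := Manifold.locallyCompact_of_finiteDimensional I
    -- The chart estimates only use a `C¹` structure and a continuous metric.
    have : IsManifold I 1 M := IsManifold.of_le (n := ∞) (by norm_num)
    have : IsContinuousRiemannianBundle (EuclideanSpace ℝ (Fin d))
        (fun x : M => TangentSpace I x) := by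
      obtain ⟨g, hg, hg'⟩ := IsContMDiffRiemannianBundle.exists_contMDiff (IB := I) (n := ∞)
        (F := EuclideanSpace ℝ (Fin d)) (E := fun x : M => TangentSpace I x)
      exact ⟨g, hg.continuous, hg'⟩
    exact hM.thickPointsMatch hA (locallyBoundedGrowth_riemannian I M) hγ hγd hg
      hf.1.continuous hf.2

end
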